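/- Let $d\ge1$, let $\mathfrak s=(\mathfrak s_j)_{j=1}^d$ be positive integers and let $N$ be an integer with $N>\max_j\mathfrak s_j$. Write $|\mathfrak s|=\sum_j\mathfrak s_j$, $|k|_{\mathfrak s}=\sum_j\mathfrak s_jk_j$ for $k\in\mathbb N^d$ (with $0\in\mathbb N$), $\|x\|_{\mathfrak s}=\sum_j|x_j|^{1/\mathfrak s_j}$ for $x\in\mathbb R^d$, and for $c,t>0$, $\zeta\in\mathbb R$, $$\mathsf G_t^{(c,\zeta)}(x)=t^{(\zeta-|\mathfrak s|)/N}\exp\Big\{-c\sum_{j=1}^d\Big(\frac{|x_j|^{N/\mathfrak s_j}}{t}\Big)^{\mathfrak s_j/(N-\mathfrak s_j)}\Big\}.$$ Consider $P(x,\partial_x)=\sum_{|k|_{\mathfrak s}\le N}a_k(x)\partial_x^k$ with coefficients $a_k:\mathbb R^d\to\mathbb C$. A function $Q_t(x,y)$ ($t>0$, $x,y\in\mathbb R^d$) is called a fundamental solution of $\partial_t-P(x,\partial_x)$ if (i) for each fixed $y$, $(t,x)\mapsto Q_t(x,y)$ is $C^1$ in $t$, its derivatives $\partial_x^kQ_t(x,y)$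 with $|k|_{\mathfrak s}\le N$ exist, are continuous in $(t,x)\in(0,\infty)\times\mathbb R^d$ and bounded in $x$ for each $t$, and $(\partial_t-P(x,\partial_x))Q_t(x,y)=0$; (ii) $Q_t(x,\cdot)$ is integrable and $\lim_{t\downarrow0}\int_{\mathbb R^d}Q_t(x,y)f(y)\,dy=f(x)$ for every bounded continuous $f$ on $\mathbb R^d$ and every $x$. Let $\delta>0$, $\alpha\in(0,1)$ and $A,H\in\mathbb R$. There are positive constants $C,c,\gamma$ for each $(k,n)\in\mathbb N^d\times\mathbb N$, and positive constants $C,c,\gamma$ for each $(k,\beta)\in\mathbb N^d\times(0,1)$, which depend only on $\mathfrak s,N,\delta,A,H,\alpha$ and on $(k,n)$, respectively $(k,\beta)$, such that the following holds. Assume that $$\operatorname{Re}P(x,i\xi)=\operatorname{Re}\sum_{|k|_{\mathfrak s}\le N}a_k(x)(i\xi)^k\le-\delta\|\xi\|_{\mathfrak s}^N\quad(x,\xi\in\mathbb R^d)$$ and that, for all $|k|_{\mathfrak s}\le N$ and $x,y\in\mathbb R^d$, $|a_k(x)|\le A$ and $|a_k(x)-a_k(y)|\le H\|x-y\|_{\mathfrak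 s}^\alpha$. Then $\partial_t-P(x,\partial_x)$ has a fundamental solution $Q$ with the following two properties. (1) For all $k\in\mathbb N^d$, $n\in\mathbb N$ with $|k|_{\mathfrak s}+Nn\le N$, with the constants of $(k,n)$, and all $t>0$, $x,y\in\mathbb R^d$, $$\big|\partial_t^n\partial_x^kQ_t(x,y)\big|\le Ce^{\gamma t}\,\mathsf G_t^{(c,-|k|_{\mathfrak s}-Nn)}(x-y).$$ (2) For all $k\in\mathbb N^d$ with $|k|_{\mathfrak s}\le N$ and all $\beta\in(0,1)$, with moreover $\beta<\alpha$ if $|k|_{\mathfrak s}=N$, with the constants of $(k,\beta)$, and all $t>0$, $x,x',y\in\mathbb R^d$, $$\big|\partial_x^kQ_t(x,y)-\partial_x^kQ_t(x',y)\big|\le Ce^{\gamma t}\|x-x'\|_{\mathfrak s}^\beta\Big(\mathsf G_t^{(c,-|k|_{\mathfrak s}-\beta)}(x-y)+\mathsf G_t^{(c,-|k|_{\mathfrak s}-\beta)}(x'-y)\Big).$$ -/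

import Mathlib

open Set Filter Topology MeasureTheory

noncomputable section

namespace AnisotropicParabolic

/-- `|𝔰| = ∑ 𝔰_j`. -/
def scalingSize {d : ℕ} (s : Fin d → ℕ) : ℕ := ∑ j, s j

/-- The scaled degree `|k|_𝔰 = ∑ 𝔰_j k_j` of a multi-index. -/
def sdeg {d : ℕ} (s k : Fin d → ℕ) : ℕ := ∑ j, s j * k j

/-- The anisotropic size `‖x‖_𝔰 = ∑ |x_j|^{1/𝔰_j}`. -/
def snorm {d : ℕ} (s : Fin d → ℕ) (x : Fin d → ℝ) : ℝ := ∑ j, |x j| ^ (1 / (s j : ℝ))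

/-- The multi-indices with `|k|_𝔰 ≤ N`; since `𝔰_j ≥ 1`, they all have entries at most `N`
(see `mem_multiIndices`). -/
def multiIndices {d : ℕ} (s : Fin d → ℕ) (N : ℕ) : Finset (Fin d → ℕ) :=
  (Fintype.piFinset fun _ => Finset.range (N + 1)).filter fun k => sdeg s k ≤ N

theorem mem_multiIndices {d : ℕ} {s : Fin d → ℕ} (hs : ∀ j, 0 < s j) {N : ℕ} {k : Fin d → ℕ} :
    k ∈ multiIndices s N ↔ sdeg s k ≤ N := by
  unfold multiIndices
  rw [Finset.mem_filter, Fintype.mem_piFinset]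
  refine ⟨fun h => h.2, fun h => ⟨fun j => ?_, h⟩⟩
  have h1 : s j * k j ≤ sdeg s k :=
    Finset.single_le_sum (f := fun i => s i * k i) (fun _ _ => Nat.zero_le _) (Finset.mem_univ j)
  have h2 : k j ≤ s j * k j := Nat.le_mul_of_pos_left _ (hs j)
  rw [Finset.mem_range]
  omega

/-- The partial derivative `∂_{x_j} f`. -/
def pderiv {d : ℕ} (j : Fin d) (f : (Fin d → ℝ) → ℂ) : (Fin d → ℝ) → ℂ :=
  fun x => lineDeriv ℝ f x (Pi.single j 1)

/-- `∂_x^k f = ∂_{x_1}^{k_1} (∂_{x_2}^{k_2} (… ∂_{x_d}^{k_d} f))`. -/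
def mderiv {d : ℕ} (k : Fin d → ℕ) (f : (Fin d → ℝ) → ℂ) : (Fin d → ℝ) → ℂ :=
  (List.finRange d).foldr (fun j g => (pderiv j)^[k j] g) f

/-- The class `𝒞_𝔰^N`: all the derivatives `∂_x^k f` with `|k|_𝔰 ≤ N` really exist (whatever the
order in which the partial derivatives are taken), and they are bounded and continuous. -/
structure IsCs {d : ℕ} (s : Fin d → ℕ) (N : ℕ) (f : (Fin d → ℝ) → ℂ) : Prop where
  hasDeriv : ∀ (k : Fin d → ℕ) (j : Fin d), sdeg s (k + Pi.single j 1) ≤ N → ∀ x,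
    HasLineDerivAt ℝ (mderiv k f) (mderiv (k + Pi.single j 1) f x) x (Pi.single j 1)
  continuous : ∀ k : Fin d → ℕ, sdeg s k ≤ N → Continuous (mderiv k f)
  bounded : ∀ k : Fin d → ℕ, sdeg s k ≤ N → ∃ M : ℝ, ∀ x, ‖mderiv k f x‖ ≤ M

/-- `P(x, ∂_x) f (x) = ∑_{|k|_𝔰 ≤ N} a_k(x) ∂_x^k f (x)`. -/
def diffOp {d : ℕ} (s : Fin d → ℕ) (N : ℕ) (a : (Fin d → ℕ) → (Fin d → ℝ) → ℂ)
    (f : (Fin d → ℝ) → ℂ) (x : Fin d → ℝ) : ℂ :=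
  ∑ k ∈ multiIndices s N, a k x * mderiv k f x

/-- `P(x, iξ) = ∑_{|k|_𝔰 ≤ N} a_k(x) (iξ)^k`. -/
def symbol {d : ℕ} (s : Fin d → ℕ) (N : ℕ) (a : (Fin d → ℕ) → (Fin d → ℝ) → ℂ)
    (x ξ : Fin d → ℝ) : ℂ :=
  ∑ k ∈ multiIndices s N, a k x * ∏ j, (Complex.I * (ξ j : ℂ)) ^ k j

/-- The kernel `G_t^{(c,ζ)}(x)`. -/
def gaussKernel {d : ℕ} (s : Fin d → ℕ) (N : ℕ) (c ζ t : ℝ) (x : Fin d → ℝ) : ℝ :=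
  t ^ ((ζ - (scalingSize s : ℝ)) / (N : ℝ)) *
    Real.exp (-c * ∑ j, (|x j| ^ ((N : ℝ) / (s j : ℝ)) / t) ^ ((s j : ℝ) / ((N : ℝ) - (s j : ℝ))))

/-- The structural assumptions on the coefficients: uniform Petrowski parabolicity with
constant `δ`, the bound `A`, and the `α`-Hölder bound `H` with respect to `‖·‖_𝔰`. -/
structure CoeffAssumptions {d : ℕ} (s : Fin d → ℕ) (N : ℕ) (δ A H α : ℝ)
    (a : (Fin d → ℕ) → (Fin d → ℝ) → ℂ) : Prop where
  petrowski : ∀ x ξ, (symbol s N a x ξ).re ≤ -δ * snorm s ξ ^ N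
  bound : ∀ k, sdeg s k ≤ N → ∀ x, ‖a k x‖ ≤ A
  holder : ∀ k, sdeg s k ≤ N → ∀ x y, ‖a k x - a k y‖ ≤ H * snorm s (x - y) ^ α

/-- `Q t x y`, `t > 0`, is a fundamental solution of `∂_t - P(x, ∂_x)`.  Only the values of `Q`
at times `t > 0` matter. -/
structure IsFundamentalSolution {d : ℕ} (s : Fin d → ℕ) (N : ℕ)
    (a : (Fin d → ℕ) → (Fin d → ℝ) → ℂ) (Q : ℝ → (Fin d → ℝ) → (Fin d → ℝ) → ℂ) : Prop where
  space_regular : ∀ y, ∀ t > 0, IsCs s N (fun x => Q t x y)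
  joint_continuous : ∀ y (k : Fin d → ℕ), sdeg s k ≤ N →
    ContinuousOn (fun p : ℝ × (Fin d → ℝ) => mderiv k (fun x => Q p.1 x y) p.2)
      (Ioi (0 : ℝ) ×ˢ univ)
  time_regular : ∀ y x, ContDiffOn ℝ 1 (fun t => Q t x y) (Ioi (0 : ℝ))
  equation : ∀ y, ∀ t > 0, ∀ x,
    deriv (fun τ => Q τ x y) t - diffOp s N a (fun x' => Q t x' y) x = 0
  integrable : ∀ t > 0, ∀ x, Integrable (fun y => Q t x y)
  initial : ∀ (f : BoundedContinuousFunction (Fin d → ℝ) ℂ) (x : Fin d → ℝ),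
    Tendsto (fun t => ∫ y, Q t x y * f y) (𝓝[>] (0 : ℝ)) (𝓝 (f x))

end AnisotropicParabolic

end

open AnisotropicParabolic

/-! The proof is Levi's parametrix method. Freezing the coefficients at a point `z` gives a
constant-coefficient operator whose kernel `Z(t, z, ·)` is the inverse Fourier transform of `exp (t
P(z, iξ))`. The fundamental solution is sought as `Q = Z + Z ⋆ Φ`, where `⋆` is convolution in
space-time. With `K = (P(x, ∂) - P(z, ∂)) Z` one has `(∂_t - P) Z = -K` and `(∂_t - P)(Z ⋆ Φ) = Φ -
K ⋆ Φ`, so the equation for `Q` becomes the Volterra equation `Φ = K + K ⋆ Φ`. Hölder continuity of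
the coefficients lowers the singularity of `K` from `t ^ (-1)` to the integrable `t ^ (-1 + α / N)`,
and `Φ` is the Neumann series.

Frozen kernels: the Petrowski condition survives the complex shift `ξ + iη` up to a term `C (1 + ‖η‖
^ N)` (`exists_re_csymb_le`). The contour of the Fourier integral may thus be moved
(`integral_shift_eq`), and the choice of `η` by a Legendre transform gives the exponential decay in
`x` (`norm_integral_mul_exp_le`). The difference of two symbols is treated in the same way, which
gives Lipschitz dependence on the frozen coefficients (`exists_norm_fundKer_le`).

Convolution: the exponent of the Gaussian-type kernel is subadditive in `(t, x)`, so exponentials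
with equal rate `c` compose, but they leave nothing to integrate with. Replacing the prefactor `t ^
(-|s| / N)` by a product of Cauchy kernels repairs this: the resulting majorant `maj` is integrable
and reproduces itself under convolution with the same `c` (`integral_maj_mul_maj_le`). Infinitely
many convolutions therefore cost nothing in `c`, and in a norm weighted by `exp (Λ t)` with `Λ`
large the Neumann series is geometric (`exists_resolvent_bound`).

Top-order derivatives: for `|k|_s = N` the kernel `∂^k Z` has the non-integrable singularity `(t -
r) ^ (-1)`. Two gains remedy it. The density `Φ` is Hölder of every order `θ < α` in its first
variable (`exists_leviDensity`), and `∂^k Z` has integral zero up to the error of freezing at a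
different point (`norm_integral_zker_le`). Subtracting `Φ(r, x, y)` inside the convolution then
improves the singularity by `(t - r) ^ (θ / N)` (`norm_slice_zker_le`). Hölder increments of order
`β` consume `β` of this gain, whence `β < α` at top order.

Time derivative: the singularity at the moving end point rules out naive differentiation of `∫₀ᵗ`.
Increments are computed by Fubini, and the resulting integrand equals an explicit continuous
function by the Volterra equation, so the fundamental theorem of calculus applies
(`hasDerivAt_setIntegral_Ioo`, `integral_timeDeriv`). -/

noncomputable section

namespace AnisotropicParabolic

/-! ### The Cauchy kernel on the line -/

/-- The Cauchy (Poisson) kernel on the line, without the factor `1/π`. -/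
def cauchyKer (a x : ℝ) : ℝ := a / (a ^ 2 + x ^ 2)

theorem cauchyKer_pos {a : ℝ} (ha : 0 < a) (x : ℝ) : 0 < cauchyKer a x := by
  unfold cauchyKer; positivity

theorem cauchyKer_neg (a x : ℝ) : cauchyKer a (-x) = cauchyKer a x := by
  simp [cauchyKer]

theorem cauchyKer_le_inv {a : ℝ} (ha : 0 < a) (x : ℝ) : cauchyKer a x ≤ a⁻¹ := by
  unfold cauchyKer
  rw [div_le_iff₀ (by positivity), inv_mul_eq_div, le_div_iff₀ ha]
  nlinarith [sq_nonneg x]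

/-- Since `r ≤ a + b`, the denominator of the kernel at `u + v` is at most twice the sum of the two
given denominators. Hence one of the two factors already decays like the kernel at `u + v`, and the
other is left over for integration. The self-reproduction of `maj` under convolution rests on this.
-/
theorem cauchyKer_mul_le {a b r : ℝ} (ha : 0 < a) (hb : 0 < b) (har : a ≤ r) (hbr : b ≤ r)
    (hr : r ≤ a + b) (u v : ℝ) :
    cauchyKer a u * cauchyKer b v ≤ 4 * cauchyKer r (u + v) * (cauchyKer a u + cauchyKer b v) := by
  have hr0 : 0 < r := ha.trans_le har
  unfold cauchyKer
  set A := a ^ 2 + u ^ 2 with hA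
  set B := b ^ 2 + v ^ 2 with hB
  set R := r ^ 2 + (u + v) ^ 2 with hR
  have hA0 : 0 < A := by positivity
  have hB0 : 0 < B := by positivity
  have hR0 : 0 < R := by positivity
  have h1 : R ≤ 2 * A + 2 * B := by
    nlinarith [sq_nonneg (u - v), sq_nonneg (a - b), mul_self_le_mul_self hr0.le hr]
  have h2 : a * b * R ≤ 4 * r * (a * B + b * A) := by
    have h3 : a * b * R ≤ a * b * (2 * A + 2 * B) :=
      mul_le_mul_of_nonneg_left h1 (by positivity)
    have h4 : b * (a * A) ≤ b * (r * A) := by gcongr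
    have h5 : a * (b * B) ≤ a * (r * B) := by gcongr
    have h6 : 0 ≤ a * (r * B) := by positivity
    have h7 : 0 ≤ b * (r * A) := by positivity
    nlinarith
  have e1 : a / A * (b / B) = (a * b * R) / (A * B * R) := by
    field_simp
  have e2 : 4 * (r / R) * (a / A + b / B) = (4 * r * (a * B + b * A)) / (A * B * R) := by
    field_simp
  rw [e1, e2]
  gcongr

theorem cauchyKer_eq_comp {a : ℝ} (ha : 0 < a) (x : ℝ) :
    cauchyKer a x = a⁻¹ * (1 + (a⁻¹ * x) ^ 2)⁻¹ := by
  unfold cauchyKer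
  field_simp

theorem integrable_cauchyKer {a : ℝ} (ha : 0 < a) : Integrable (cauchyKer a) := by
  have h := (integrable_inv_one_add_sq.comp_mul_left' (inv_ne_zero ha.ne')).const_mul a⁻¹
  exact h.congr (Eventually.of_forall fun x => (cauchyKer_eq_comp ha x).symm)

theorem integral_cauchyKer {a : ℝ} (ha : 0 < a) : ∫ x, cauchyKer a x = Real.pi := by
  simp_rw [cauchyKer_eq_comp ha, integral_const_mul]
  rw [Measure.integral_comp_mul_left (fun x : ℝ => (1 + x ^ 2)⁻¹) a⁻¹,
    integral_univ_inv_one_add_sq, inv_inv, abs_of_pos ha, smul_eq_mul]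
  field_simp

theorem cauchyKer_le_mul {a b : ℝ} (ha : 0 < a) (hab : a ≤ b) (hb : b ≤ 2 * a) (x : ℝ) :
    cauchyKer a x ≤ 4 * cauchyKer b x := by
  unfold cauchyKer
  have hb0 : 0 < b := ha.trans_le hab
  rw [← mul_div_assoc, div_le_div_iff₀ (by positivity) (by positivity)]
  have h1 : b ^ 2 ≤ 4 * a ^ 2 := by nlinarith
  have h2 : b ^ 2 + x ^ 2 ≤ 4 * (a ^ 2 + x ^ 2) := by nlinarith [sq_nonneg x]
  calc a * (b ^ 2 + x ^ 2) ≤ b * (4 * (a ^ 2 + x ^ 2)) := by gcongr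
    _ = _ := by ring

theorem cauchyKer_add_le {a h : ℝ} (ha : 0 < a) (hh : |h| ≤ a) (x : ℝ) :
    cauchyKer a (x + h) ≤ 3 * cauchyKer a x := by
  unfold cauchyKer
  rw [← mul_div_assoc, div_le_div_iff₀ (by positivity) (by positivity)]
  have h1 : h ^ 2 ≤ a ^ 2 := by rw [← sq_abs h]; gcongr
  have h2 : a ^ 2 + x ^ 2 ≤ 3 * (a ^ 2 + (x + h) ^ 2) := by nlinarith [sq_nonneg (x + 2 * h), sq_nonneg (2 * (x+h) - h)]
  calc a * (a ^ 2 + x ^ 2) ≤ a * (3 * (a ^ 2 + (x + h) ^ 2)) := by gcongr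
    _ = _ := by ring

/-! ### The exponent of the Gaussian-type kernel -/

/-- One coordinate of the exponent of `gaussKernel`. -/
def energy (s N : ℕ) (t x : ℝ) : ℝ := (|x| ^ ((N : ℝ) / s) / t) ^ ((s : ℝ) / ((N : ℝ) - s))

section energy

variable {s N : ℕ} (hs : 0 < s) (hN : s < N)

theorem energy_nonneg {t : ℝ} (ht : 0 < t) (x : ℝ) : 0 ≤ energy s N t x := by
  unfold energy; positivity

theorem energy_neg (t x : ℝ) : energy s N t (-x) = energy s N t x := by
  simp [energy]

include hs hN in
theorem energy_eq {t : ℝ} (ht : 0 < t) (x : ℝ) :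
    energy s N t x = (|x| / t ^ ((s : ℝ) / N)) ^ ((N : ℝ) / ((N : ℝ) - s)) := by
  have hs' : (0 : ℝ) < s := by exact_mod_cast hs
  have hN' : (s : ℝ) < N := by exact_mod_cast hN
  have h1 : (0 : ℝ) < N - s := by linarith
  have hN0 : (0 : ℝ) < N := by linarith
  unfold energy
  rw [Real.div_rpow (by positivity) ht.le, Real.div_rpow (abs_nonneg x) (by positivity),
    ← Real.rpow_mul (abs_nonneg x), ← Real.rpow_mul ht.le]
  congr 2 <;> field_simp

include hs hN in
-- This is the perspective `t φ(x / t)` of the convex function `φ(u) = |u| ^ p`, the form from which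
-- subadditivity is read off.
theorem energy_eq_mul {t : ℝ} (ht : 0 < t) (x : ℝ) :
    energy s N t x = t * (|x| / t) ^ ((N : ℝ) / ((N : ℝ) - s)) := by
  have hs' : (0 : ℝ) < s := by exact_mod_cast hs
  have hN' : (s : ℝ) < N := by exact_mod_cast hN
  have h1 : (0 : ℝ) < N - s := by linarith
  have hN0 : (0 : ℝ) < N := by linarith
  rw [energy_eq hs hN ht, Real.div_rpow (abs_nonneg x) (by positivity),
    Real.div_rpow (abs_nonneg x) ht.le, ← Real.rpow_mul ht.le]
  have : (N : ℝ) / ((N : ℝ) - s) = (s : ℝ) / N * ((N : ℝ) / ((N : ℝ) - s)) + 1 := by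
    field_simp; ring
  nth_rewrite 4 [this]
  rw [Real.rpow_add ht, Real.rpow_one]
  field_simp

include hs hN in
theorem one_le_exponent : 1 ≤ (N : ℝ) / ((N : ℝ) - s) := by
  have hs' : (0 : ℝ) < s := by exact_mod_cast hs
  have hN' : (s : ℝ) < N := by exact_mod_cast hN
  rw [le_div_iff₀ (by linarith)]; linarith

include hN in
theorem exponent_le : (N : ℝ) / ((N : ℝ) - s) ≤ N := by
  have hN' : (s : ℝ) + 1 ≤ N := by exact_mod_cast hN
  rw [div_le_iff₀ (by linarith)]
  nlinarith [Nat.cast_nonneg (α := ℝ) N]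

include hs hN in
-- The perspective of a convex function is jointly subadditive: `(x + y) / (t + r)` is the average
-- of `x / t` and `y / r` with weights `t / (t + r)` and `r / (t + r)`. Exponentials of `-c *
-- energy` therefore compose without loss in `c`.
theorem energy_add_le {t r : ℝ} (ht : 0 < t) (hr : 0 < r) (x y : ℝ) :
    energy s N (t + r) (x + y) ≤ energy s N t x + energy s N r y := by
  have hp := one_le_exponent hs hN
  rw [energy_eq_mul hs hN ht, energy_eq_mul hs hN hr, energy_eq_mul hs hN (add_pos ht hr)]
  set p := (N : ℝ) / ((N : ℝ) - s)
  have h0 : 0 < t + r := add_pos ht hr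
  have hc := (convexOn_rpow hp).2 (x := |x| / t) (y := |y| / r)
    (show (0 : ℝ) ≤ _ by positivity) (show (0 : ℝ) ≤ _ by positivity)
    (show 0 ≤ t / (t + r) by positivity) (show 0 ≤ r / (t + r) by positivity) (by field_simp)
  simp only [smul_eq_mul] at hc
  have h1 : |x + y| / (t + r) ≤ t / (t + r) * (|x| / t) + r / (t + r) * (|y| / r) := by
    have : t / (t + r) * (|x| / t) + r / (t + r) * (|y| / r) = (|x| + |y|) / (t + r) := by
      field_simp
    rw [this]
    gcongr
    exact abs_add_le x y
  have h2 := (Real.rpow_le_rpow (by positivity) h1 (by linarith : 0 ≤ p)).trans hc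
  calc (t + r) * (|x + y| / (t + r)) ^ p
      ≤ (t + r) * (t / (t + r) * (|x| / t) ^ p + r / (t + r) * (|y| / r) ^ p) := by gcongr
    _ = _ := by field_simp

include hs hN in
theorem energy_anti {t r : ℝ} (ht : 0 < t) (htr : t ≤ r) (x : ℝ) :
    energy s N r x ≤ energy s N t x := by
  have hs' : (0 : ℝ) < s := by exact_mod_cast hs
  have hN' : (s : ℝ) < N := by exact_mod_cast hN
  have h1 : (0 : ℝ) < N - s := by linarith
  have hr : 0 < r := ht.trans_le htr
  unfold energy
  gcongr

include hs hN in
-- In the variable scaled by `t ^ (s / N)` the shift is at most one, and `(u + 1) ^ p ≤ 2 ^ p (u ^ p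
-- + 1) / 2` by convexity. Since `N - s ≥ 1` for integers, `p ≤ N`, so the factor `2⁻¹ ^ N` serves
-- every coordinate at once.
theorem energy_shift {t h : ℝ} (ht : 0 < t) (hh : |h| ≤ t ^ ((s : ℝ) / N)) (x : ℝ) :
    (2 : ℝ)⁻¹ ^ N * energy s N t x ≤ energy s N t (x + h) + 1 := by
  have hp := one_le_exponent hs hN
  have hp' := exponent_le hN
  rw [energy_eq hs hN ht, energy_eq hs hN ht]
  set p := (N : ℝ) / ((N : ℝ) - s)
  set a := t ^ ((s : ℝ) / N)
  have ha : 0 < a := by positivity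
  set u := |x + h| / a
  have hu : 0 ≤ u := by positivity
  have hv : |x| / a ≤ u + 1 := by
    rw [show u + 1 = (|x + h| + a) / a by simp only [u]; field_simp]
    gcongr
    have : |x| ≤ |x + h| + |h| := by
      have := abs_add_le (x + h) (-h)
      simpa using this
    linarith
  have hc := (convexOn_rpow hp).2 (x := u) (y := 1) hu (show (0:ℝ) ≤ 1 by norm_num)
    (show (0 : ℝ) ≤ 1 / 2 by norm_num) (show (0 : ℝ) ≤ 1 / 2 by norm_num) (by norm_num)
  simp only [smul_eq_mul, Real.one_rpow] at hc
  have h1 : (|x| / a) ^ p ≤ (2 : ℝ) ^ N * (1 / 2 * u + 1 / 2 * 1) ^ p := by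
    calc (|x| / a) ^ p ≤ (2 * (1 / 2 * u + 1 / 2 * 1)) ^ p := by
          apply Real.rpow_le_rpow (by positivity) _ (by linarith)
          linarith
      _ = 2 ^ p * (1 / 2 * u + 1 / 2 * 1) ^ p := by
          rw [Real.mul_rpow (by norm_num) (by positivity)]
      _ ≤ (2 : ℝ) ^ N * (1 / 2 * u + 1 / 2 * 1) ^ p := by
          gcongr
          rw [← Real.rpow_natCast]
          exact Real.rpow_le_rpow_of_exponent_le (by norm_num) hp'
  have h2 : 0 ≤ u ^ p := by positivity
  calc (2 : ℝ)⁻¹ ^ N * (|x| / a) ^ p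
      ≤ (2 : ℝ)⁻¹ ^ N * ((2 : ℝ) ^ N * (1 / 2 * u + 1 / 2 * 1) ^ p) := by gcongr
    _ = (1 / 2 * u + 1 / 2 * 1) ^ p := by
        rw [← mul_assoc, ← mul_pow]; norm_num
    _ ≤ u ^ p + 1 := by linarith

end energy

/-! ### The majorant and its convolutions -/

/-- The integrable majorant, stable under convolution, which replaces `gaussKernel`. -/
def maj {d : ℕ} (s : Fin d → ℕ) (N : ℕ) (c t : ℝ) (x : Fin d → ℝ) : ℝ :=
  (∏ j, cauchyKer (t ^ ((s j : ℝ) / N)) (x j)) * Real.exp (-c * ∑ j, energy (s j) N t (x j))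

section maj

variable {d : ℕ} {s : Fin d → ℕ} {N : ℕ}

theorem maj_pos {t : ℝ} (ht : 0 < t) (c : ℝ) (x : Fin d → ℝ) : 0 < maj s N c t x :=
  mul_pos (Finset.prod_pos fun _ _ => cauchyKer_pos (by positivity) _) (Real.exp_pos _)

theorem maj_nonneg {t : ℝ} (ht : 0 < t) (c : ℝ) (x : Fin d → ℝ) : 0 ≤ maj s N c t x :=
  (maj_pos ht c x).le

theorem maj_sub_comm (c t : ℝ) (x y : Fin d → ℝ) : maj s N c t (x - y) = maj s N c t (y - x) := by
  unfold maj
  have h : ∀ j, (x - y) j = - (y - x) j := fun j => by simp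
  simp_rw [h, cauchyKer_neg, energy_neg]

theorem sum_energy_nonneg {t : ℝ} (ht : 0 < t) (x : Fin d → ℝ) :
    0 ≤ ∑ j, energy (s j) N t (x j) :=
  Finset.sum_nonneg fun _ _ => energy_nonneg ht _

theorem maj_mono {c c' t : ℝ} (hc : c' ≤ c) (ht : 0 < t) (x : Fin d → ℝ) :
    maj s N c t x ≤ maj s N c' t x := by
  unfold maj
  have := sum_energy_nonneg (s := s) (N := N) ht x
  gcongr
  exact Finset.prod_nonneg fun _ _ => (cauchyKer_pos (by positivity) _).le

theorem prod_rpow_scale {t : ℝ} (ht : 0 < t) :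
    ∏ j, t ^ ((s j : ℝ) / N) = t ^ ((scalingSize s : ℝ) / N) := by
  rw [← Real.rpow_sum_of_pos ht]
  congr 1
  rw [← Finset.sum_div, scalingSize]
  push_cast
  rfl

theorem maj_le_gaussKernel {c t : ℝ} (ht : 0 < t) (x : Fin d → ℝ) :
    maj s N c t x ≤ gaussKernel s N c 0 t x := by
  unfold maj gaussKernel
  refine mul_le_mul_of_nonneg_right ?_ (Real.exp_pos _).le
  calc ∏ j, cauchyKer (t ^ ((s j : ℝ) / N)) (x j) ≤ ∏ j, (t ^ ((s j : ℝ) / N))⁻¹ :=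
        Finset.prod_le_prod (fun _ _ => (cauchyKer_pos (by positivity) _).le)
          fun _ _ => cauchyKer_le_inv (by positivity) _
    _ = _ := by
        rw [Finset.prod_inv_distrib, prod_rpow_scale ht, ← Real.rpow_neg ht.le]
        congr 1; ring

/-- All estimates are carried out with `maj`; this is the passage back to the kernel of the theorem,
at the very end. -/
theorem rpow_mul_maj_le_gaussKernel {c t : ℝ} (ht : 0 < t) (ζ : ℝ) (x : Fin d → ℝ) :
    t ^ (ζ / N) * maj s N c t x ≤ gaussKernel s N c ζ t x := by
  calc t ^ (ζ / N) * maj s N c t x ≤ t ^ (ζ / N) * gaussKernel s N c 0 t x := by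
        gcongr; exact maj_le_gaussKernel ht x
    _ = _ := by
        unfold gaussKernel
        rw [← mul_assoc, ← Real.rpow_add ht]
        congr 2; ring

theorem maj_le_rpow {c t : ℝ} (hc : 0 ≤ c) (ht : 0 < t) (x : Fin d → ℝ) :
    maj s N c t x ≤ t ^ (-(scalingSize s : ℝ) / N) := by
  refine (maj_le_gaussKernel ht x).trans ?_
  unfold gaussKernel
  rw [zero_sub]
  refine mul_le_of_le_one_right (by positivity) ?_
  rw [Real.exp_le_one_iff]
  have := sum_energy_nonneg (s := s) (N := N) ht x
  unfold energy at this
  nlinarith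

variable (hs : ∀ j, 0 < s j) (hN : ∀ j, s j < N)

include hs hN in
theorem scale_mem (j : Fin d) : 0 < (s j : ℝ) / N ∧ (s j : ℝ) / N < 1 := by
  have h1 : (0 : ℝ) < s j := by exact_mod_cast hs j
  have h2 : (s j : ℝ) < N := by exact_mod_cast hN j
  exact ⟨by apply div_pos h1; linarith, (div_lt_one (by linarith)).2 h2⟩

include hs hN in
-- The Cauchy factors combine coordinatewise by `cauchyKer_mul_le`, whose conditions on the scales
-- hold because `t ↦ t ^ (s j / N)` is increasing and subadditive; the exponentials combine by
-- `energy_add_le`. The last product is what remains to be integrated.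
theorem maj_mul_le {c t r : ℝ} (hc : 0 ≤ c) (ht : 0 < t) (hr : 0 < r) (x y : Fin d → ℝ) :
    maj s N c t x * maj s N c r y ≤ 4 ^ d * maj s N c (t + r) (x + y) *
      ∏ j, (cauchyKer (t ^ ((s j : ℝ) / N)) (x j) + cauchyKer (r ^ ((s j : ℝ) / N)) (y j)) := by
  have hpos : ∀ (a : ℝ), 0 < a → ∀ (x : Fin d → ℝ) j, 0 < cauchyKer (a ^ ((s j : ℝ) / N)) (x j) :=
    fun a ha x j => cauchyKer_pos (by positivity) _
  have h1 : (∏ j, cauchyKer (t ^ ((s j : ℝ) / N)) (x j)) *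
      (∏ j, cauchyKer (r ^ ((s j : ℝ) / N)) (y j)) ≤
      4 ^ d * (∏ j, cauchyKer ((t + r) ^ ((s j : ℝ) / N)) ((x + y) j)) *
      ∏ j, (cauchyKer (t ^ ((s j : ℝ) / N)) (x j) + cauchyKer (r ^ ((s j : ℝ) / N)) (y j)) := by
    rw [← Finset.prod_mul_distrib]
    have : (4 : ℝ) ^ d = ∏ _j : Fin d, (4 : ℝ) := by simp
    rw [this, ← Finset.prod_mul_distrib, ← Finset.prod_mul_distrib]
    refine Finset.prod_le_prod (fun j _ => (mul_pos (hpos t ht x j) (hpos r hr y j)).le)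
      fun j _ => ?_
    obtain ⟨h0, h1⟩ := scale_mem hs hN j
    exact cauchyKer_mul_le (by positivity) (by positivity)
      (Real.rpow_le_rpow ht.le (by linarith) h0.le) (Real.rpow_le_rpow hr.le (by linarith) h0.le)
      (Real.rpow_add_le_add_rpow ht.le hr.le h0.le h1.le) _ _
  have h2 : Real.exp (-c * ∑ j, energy (s j) N t (x j)) *
      Real.exp (-c * ∑ j, energy (s j) N r (y j)) ≤
      Real.exp (-c * ∑ j, energy (s j) N (t + r) ((x + y) j)) := by
    rw [← Real.exp_add, Real.exp_le_exp]
    have : ∑ j, energy (s j) N (t + r) ((x + y) j) ≤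
        ∑ j, energy (s j) N t (x j) + ∑ j, energy (s j) N r (y j) := by
      rw [← Finset.sum_add_distrib]
      exact Finset.sum_le_sum fun j _ => energy_add_le (hs j) (hN j) ht hr _ _
    nlinarith
  unfold maj
  calc _ = ((∏ j, cauchyKer (t ^ ((s j : ℝ) / N)) (x j)) *
      (∏ j, cauchyKer (r ^ ((s j : ℝ) / N)) (y j))) *
      (Real.exp (-c * ∑ j, energy (s j) N t (x j)) *
      Real.exp (-c * ∑ j, energy (s j) N r (y j))) := by ring
    _ ≤ _ * _ := mul_le_mul h1 h2 (by positivity) (mul_nonneg (mul_nonneg (by positivity)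
          (Finset.prod_nonneg fun j _ => (hpos _ (by positivity) _ j).le))
          (Finset.prod_nonneg fun j _ => (add_pos (hpos t ht x j) (hpos r hr y j)).le))
    _ = _ := by ring

theorem continuous_cauchyKer {a : ℝ} (ha : 0 < a) : Continuous (cauchyKer a) := by
  unfold cauchyKer
  exact continuous_const.div (by fun_prop) fun x => by positivity

include hs hN in
theorem continuous_maj {c t : ℝ} (ht : 0 < t) : Continuous (maj s N c t) := by
  unfold maj
  refine Continuous.mul (continuous_finsetProd _ fun j _ =>
    (continuous_cauchyKer (by positivity)).comp (continuous_apply j)) ?_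
  refine Real.continuous_exp.comp (continuous_const.mul (continuous_finsetSum _ fun j _ => ?_))
  have h1 : (0 : ℝ) < s j := by exact_mod_cast hs j
  have h2 : (s j : ℝ) < N := by exact_mod_cast hN j
  have h3 : (0 : ℝ) < (N : ℝ) - s j := by linarith
  unfold energy
  refine Continuous.rpow_const ?_ fun _ => Or.inr (by positivity)
  refine Continuous.div_const (Continuous.rpow_const (by fun_prop) fun _ => Or.inr ?_) _
  have : (0 : ℝ) < N := by linarith
  positivity

theorem maj_le_prod {c t : ℝ} (hc : 0 ≤ c) (ht : 0 < t) (x : Fin d → ℝ) :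
    maj s N c t x ≤ ∏ j, cauchyKer (t ^ ((s j : ℝ) / N)) (x j) := by
  unfold maj
  refine mul_le_of_le_one_right
    (Finset.prod_nonneg fun j _ => (cauchyKer_pos (by positivity) _).le) ?_
  rw [Real.exp_le_one_iff]
  nlinarith [sum_energy_nonneg (s := s) (N := N) ht x]

include hs hN in
theorem integrable_maj {c t : ℝ} (hc : 0 ≤ c) (ht : 0 < t) : Integrable (maj s N c t) := by
  have h : Integrable (fun x : Fin d → ℝ => ∏ j, cauchyKer (t ^ ((s j : ℝ) / N)) (x j)) :=
    Integrable.fintype_prod fun j => integrable_cauchyKer (by positivity)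
  refine h.mono' (continuous_maj hs hN ht).aestronglyMeasurable (Eventually.of_forall fun x => ?_)
  rw [Real.norm_of_nonneg (maj_nonneg ht c x)]
  exact maj_le_prod hc ht x

theorem integral_maj_le {c t : ℝ} (hc : 0 ≤ c) (ht : 0 < t) :
    ∫ x, maj s N c t x ≤ Real.pi ^ d := by
  have h : Integrable (fun x : Fin d → ℝ => ∏ j, cauchyKer (t ^ ((s j : ℝ) / N)) (x j)) :=
    Integrable.fintype_prod fun j => integrable_cauchyKer (by positivity)
  calc ∫ x, maj s N c t x ≤ ∫ x : Fin d → ℝ, ∏ j, cauchyKer (t ^ ((s j : ℝ) / N)) (x j) :=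
        integral_mono_of_nonneg (Eventually.of_forall fun x => maj_nonneg ht c x) h
          (Eventually.of_forall fun x => maj_le_prod hc ht x)
    _ = ∏ j : Fin d, ∫ x, cauchyKer (t ^ ((s j : ℝ) / N)) x :=
        integral_fintype_prod_volume_eq_prod (fun j x => cauchyKer (t ^ ((s j : ℝ) / N)) x)
    _ = Real.pi ^ d := by
        rw [Finset.prod_congr rfl fun j _ => integral_cauchyKer (by positivity)]
        simp

include hs hN in
theorem integrable_maj_mul_maj {c t r : ℝ} (hc : 0 ≤ c) (ht : 0 < t) (hr : 0 < r)
    (x y : Fin d → ℝ) : Integrable fun z => maj s N c t (x - z) * maj s N c r (z - y) := by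
  have h1 : Integrable fun z => maj s N c r (z - y) :=
    (integrable_maj hs hN hc hr).comp_sub_right y
  refine h1.bdd_mul (c := t ^ (-(scalingSize s : ℝ) / N))
    ((continuous_maj hs hN ht).comp (by fun_prop)).aestronglyMeasurable
    (Eventually.of_forall fun z => ?_)
  rw [Real.norm_of_nonneg (maj_nonneg ht c _)]
  exact maj_le_rpow hc ht _

include hs hN in
-- The constant is `4 ^ d` from the pointwise bound times `(2 * π) ^ d`, the integral of two Cauchy
-- kernels in each coordinate. The rate `c` is the same on both sides, so the bound can be iterated
-- indefinitely.
theorem integral_maj_mul_maj_le {c t r : ℝ} (hc : 0 ≤ c) (ht : 0 < t) (hr : 0 < r)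
    (x y : Fin d → ℝ) :
    ∫ z, maj s N c t (x - z) * maj s N c r (z - y) ≤
      (8 * Real.pi) ^ d * maj s N c (t + r) (x - y) := by
  have hi : ∀ a : ℝ, 0 < a → ∀ u : ℝ, Integrable fun z => cauchyKer a (u - z) := fun a ha u =>
    (integrable_cauchyKer ha).comp_sub_left u
  have hi' : ∀ a : ℝ, 0 < a → ∀ u : ℝ, Integrable fun z => cauchyKer a (z - u) := fun a ha u =>
    (integrable_cauchyKer ha).comp_sub_right u
  have h : Integrable (fun z : Fin d → ℝ => ∏ j, (cauchyKer (t ^ ((s j : ℝ) / N)) (x j - z j) +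
      cauchyKer (r ^ ((s j : ℝ) / N)) (z j - y j))) :=
    Integrable.fintype_prod (f := fun j z => cauchyKer (t ^ ((s j : ℝ) / N)) (x j - z) +
      cauchyKer (r ^ ((s j : ℝ) / N)) (z - y j))
      fun j => (hi _ (by positivity) _).add (hi' _ (by positivity) _)
  calc ∫ z, maj s N c t (x - z) * maj s N c r (z - y)
      ≤ ∫ z : Fin d → ℝ, 4 ^ d * maj s N c (t + r) (x - y) *
        ∏ j, (cauchyKer (t ^ ((s j : ℝ) / N)) (x j - z j) +
          cauchyKer (r ^ ((s j : ℝ) / N)) (z j - y j)) := by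
        refine integral_mono_of_nonneg (Eventually.of_forall fun z =>
          mul_nonneg (maj_nonneg ht c _) (maj_nonneg hr c _)) (h.const_mul _)
          (Eventually.of_forall fun z => ?_)
        have := maj_mul_le hs hN hc ht hr (x - z) (z - y)
        rwa [sub_add_sub_cancel] at this
    _ = 4 ^ d * maj s N c (t + r) (x - y) * ∏ j : Fin d, ∫ z,
        (cauchyKer (t ^ ((s j : ℝ) / N)) (x j - z) +
          cauchyKer (r ^ ((s j : ℝ) / N)) (z - y j)) := by
        rw [integral_const_mul]
        congr 1
        exact integral_fintype_prod_volume_eq_prod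
          (fun j z => cauchyKer (t ^ ((s j : ℝ) / N)) (x j - z) +
          cauchyKer (r ^ ((s j : ℝ) / N)) (z - y j))
    _ = 4 ^ d * maj s N c (t + r) (x - y) * (2 * Real.pi) ^ d := by
        congr 1
        rw [Finset.prod_congr rfl (g := fun _ => 2 * Real.pi)]
        · simp
        intro j _
        rw [integral_add (hi _ (by positivity) _) (hi' _ (by positivity) _),
          integral_sub_left_eq_self (cauchyKer (t ^ ((s j : ℝ) / N))),
          integral_sub_right_eq_self (cauchyKer (r ^ ((s j : ℝ) / N))),
          integral_cauchyKer (by positivity), integral_cauchyKer (by positivity)]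
        ring
    _ = _ := by
        rw [show (8 : ℝ) = 4 * 2 by norm_num, mul_pow, mul_pow, mul_pow]; ring

include hs hN in
theorem maj_le_of_half {c t r : ℝ} (hc : 0 ≤ c) (ht : 0 < t) (htr : t ≤ r) (hr : r ≤ 2 * t)
    (x : Fin d → ℝ) : maj s N c t x ≤ 4 ^ d * maj s N c r x := by
  have hr0 : 0 < r := ht.trans_le htr
  have h1 : ∏ j, cauchyKer (t ^ ((s j : ℝ) / N)) (x j) ≤
      4 ^ d * ∏ j, cauchyKer (r ^ ((s j : ℝ) / N)) (x j) := by
    have : (4 : ℝ) ^ d = ∏ _j : Fin d, (4 : ℝ) := by simp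
    rw [this, ← Finset.prod_mul_distrib]
    refine Finset.prod_le_prod (fun j _ => (cauchyKer_pos (by positivity) _).le) fun j _ => ?_
    obtain ⟨h0, h1⟩ := scale_mem hs hN j
    refine cauchyKer_le_mul (by positivity) (Real.rpow_le_rpow ht.le htr h0.le) ?_ _
    calc r ^ ((s j : ℝ) / N) ≤ (2 * t) ^ ((s j : ℝ) / N) := Real.rpow_le_rpow hr0.le hr h0.le
      _ = 2 ^ ((s j : ℝ) / N) * t ^ ((s j : ℝ) / N) := Real.mul_rpow (by norm_num) ht.le
      _ ≤ 2 ^ (1 : ℝ) * t ^ ((s j : ℝ) / N) := by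
          gcongr
          · norm_num
      _ = _ := by rw [Real.rpow_one]
  have h2 : ∑ j, energy (s j) N r (x j) ≤ ∑ j, energy (s j) N t (x j) :=
    Finset.sum_le_sum fun j _ => energy_anti (hs j) (hN j) ht htr _
  unfold maj
  rw [← mul_assoc]
  refine mul_le_mul h1 (Real.exp_le_exp.2 (by nlinarith)) (Real.exp_pos _).le
    (mul_nonneg (by positivity) (Finset.prod_nonneg fun j _ => (cauchyKer_pos (by positivity) _).le))

include hs hN in
-- A displacement inside the anisotropic box of scale `t` only costs a factor `2⁻¹ ^ N` in the rate.
-- This transfers derivative bounds from intermediate points to an end point in the Hölder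
-- estimates.
theorem maj_add_le {c t : ℝ} (hc : 0 ≤ c) (ht : 0 < t) {h : Fin d → ℝ}
    (hh : ∀ j, |h j| ≤ t ^ ((s j : ℝ) / N)) (x : Fin d → ℝ) :
    maj s N c t (x + h) ≤ 3 ^ d * Real.exp (c * d) * maj s N (c * 2⁻¹ ^ N) t x := by
  have h1 : ∏ j, cauchyKer (t ^ ((s j : ℝ) / N)) ((x + h) j) ≤
      3 ^ d * ∏ j, cauchyKer (t ^ ((s j : ℝ) / N)) (x j) := by
    have : (3 : ℝ) ^ d = ∏ _j : Fin d, (3 : ℝ) := by simp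
    rw [this, ← Finset.prod_mul_distrib]
    exact Finset.prod_le_prod (fun j _ => (cauchyKer_pos (by positivity) _).le) fun j _ =>
      cauchyKer_add_le (by positivity) (hh j) _
  have h2 : 2⁻¹ ^ N * ∑ j, energy (s j) N t (x j) ≤ ∑ j, energy (s j) N t ((x + h) j) + d := by
    have : (d : ℝ) = ∑ _j : Fin d, (1 : ℝ) := by simp
    rw [this, ← Finset.sum_add_distrib, Finset.mul_sum]
    exact Finset.sum_le_sum fun j _ => energy_shift (hs j) (hN j) ht (hh j) _
  unfold maj
  calc _ ≤ (3 ^ d * ∏ j, cauchyKer (t ^ ((s j : ℝ) / N)) (x j)) *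
      Real.exp (c * d + -(c * 2⁻¹ ^ N) * ∑ j, energy (s j) N t (x j)) :=
      mul_le_mul h1 (Real.exp_le_exp.2 (by nlinarith)) (Real.exp_pos _).le
        (mul_nonneg (by positivity)
          (Finset.prod_nonneg fun j _ => (cauchyKer_pos (by positivity) _).le))
    _ = _ := by rw [Real.exp_add]; ring

end maj

/-! ### Increments controlled by partial derivatives -/

theorem hasDerivAt_line {d : ℕ} {f : (Fin d → ℝ) → ℂ} {f' : ℂ} {x v : Fin d → ℝ} {r : ℝ}
    (h : HasLineDerivAt ℝ f f' (x + r • v) v) : HasDerivAt (fun u : ℝ => f (x + u • v)) f' r := by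
  have h1 : HasDerivAt (fun u : ℝ => f (x + r • v + u • v)) f' (r - r) := by
    rw [sub_self]; exact h
  have h2 := h1.comp_sub_const r r
  refine h2.congr_of_eventuallyEq (Eventually.of_forall fun u => ?_)
  simp only
  congr 1
  module

section box

variable {d : ℕ}

/-- The path from `x'` to `x` changes one coordinate at a time, so partial derivatives suffice and
no total derivative is needed; it stays in the box spanned by the two points. The induction runs
over the set of coordinates already moved. -/
theorem norm_sub_le_of_lineDeriv {f : (Fin d → ℝ) → ℂ} {F : Fin d → (Fin d → ℝ) → ℂ}
    (hF : ∀ j z, HasLineDerivAt ℝ f (F j z) z (Pi.single j 1)) {x x' : Fin d → ℝ}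
    {B : Fin d → ℝ} (hB : ∀ j z, (∀ i, |z i - x' i| ≤ |x i - x' i|) → ‖F j z‖ ≤ B j) :
    ‖f x - f x'‖ ≤ ∑ j, B j * |x j - x' j| := by
  have key : ∀ S : Finset (Fin d),
      ‖f (S.piecewise x x') - f x'‖ ≤ ∑ j ∈ S, B j * |x j - x' j| := by
    intro S
    induction S using Finset.induction_on with
    | empty => simp
    | insert j S hj ih =>
      rw [Finset.sum_insert hj]
      set z := S.piecewise x x' with hz
      have hzj : z j = x' j := by simp [hz, hj]
      have hzi : ∀ i, |z i - x' i| ≤ |x i - x' i| := fun i => by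
        by_cases hi : i ∈ S <;> simp [hz, hi]
      have e : (insert j S).piecewise x x' = z + (x j - x' j) • Pi.single j (1 : ℝ) := by
        ext i
        by_cases hij : i = j
        · subst hij; simp [hzj]
        · by_cases hi : i ∈ S <;> simp [hz, hi, hij]
      have hmv : ‖f (z + (x j - x' j) • Pi.single j (1 : ℝ)) -
          f (z + (0 : ℝ) • Pi.single j (1 : ℝ))‖ ≤ B j * ‖(x j - x' j) - 0‖ := by
        refine Convex.norm_image_sub_le_of_norm_hasDerivWithin_le
          (f := fun u : ℝ => f (z + u • Pi.single j (1 : ℝ)))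
          (f' := fun u => F j (z + u • Pi.single j (1 : ℝ))) (s := uIcc 0 (x j - x' j))
          (fun u _ => (hasDerivAt_line (hF j _)).hasDerivWithinAt) (fun u hu => ?_)
          (convex_uIcc _ _) left_mem_uIcc right_mem_uIcc
        refine hB j _ fun i => ?_
        by_cases hij : i = j
        · subst hij
          have := abs_sub_left_of_mem_uIcc hu
          simpa [hzj] using this
        · simpa [hij] using hzi i
      rw [e]
      rw [zero_smul, add_zero, sub_zero, Real.norm_eq_abs] at hmv
      calc _ = ‖(f (z + (x j - x' j) • Pi.single j (1 : ℝ)) - f z) + (f z - f x')‖ := by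
            congr 1; ring
        _ ≤ _ := (norm_add_le _ _).trans (add_le_add hmv ih)
  have := key Finset.univ
  simpa using this

end box

/-! ### The anisotropic size, weights and Hölder bounds -/

section snorm

variable {d : ℕ} {s : Fin d → ℕ} {N : ℕ}

theorem snorm_nonneg (x : Fin d → ℝ) : 0 ≤ snorm s x :=
  Finset.sum_nonneg fun _ _ => by positivity

theorem snorm_sub_comm (x y : Fin d → ℝ) : snorm s (x - y) = snorm s (y - x) := by
  unfold snorm
  simp only [Pi.sub_apply, abs_sub_comm]

theorem continuous_snorm : Continuous (snorm s) := by
  unfold snorm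
  exact continuous_finsetSum _ fun j _ => Continuous.rpow_const (by fun_prop)
    fun _ => Or.inr (by positivity)

variable (hs : ∀ j, 0 < s j) (hN : ∀ j, s j < N)

include hs in
theorem snorm_zero : snorm s 0 = 0 := by
  unfold snorm
  refine Finset.sum_eq_zero fun j _ => ?_
  have : (0 : ℝ) < s j := by exact_mod_cast hs j
  rw [Pi.zero_apply, abs_zero, Real.zero_rpow (by positivity)]

include hs in
theorem snorm_add_le (x y : Fin d → ℝ) : snorm s (x + y) ≤ snorm s x + snorm s y := by
  unfold snorm
  rw [← Finset.sum_add_distrib]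
  refine Finset.sum_le_sum fun j _ => ?_
  have h1 : (1 : ℝ) ≤ s j := by exact_mod_cast hs j
  refine (Real.rpow_le_rpow (abs_nonneg _) (abs_add_le _ _) (by positivity)).trans ?_
  exact Real.rpow_add_le_add_rpow (abs_nonneg _) (abs_nonneg _) (by positivity)
    (by rw [div_le_one (by linarith)]; exact h1)

include hs in
theorem snorm_add_rpow_le {θ : ℝ} (h0 : 0 ≤ θ) (h1 : θ ≤ 1) (x y : Fin d → ℝ) :
    snorm s (x + y) ^ θ ≤ snorm s x ^ θ + snorm s y ^ θ :=
  (Real.rpow_le_rpow (snorm_nonneg _) (snorm_add_le hs x y) h0).trans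
    (Real.rpow_add_le_add_rpow (snorm_nonneg _) (snorm_nonneg _) h0 h1)

include hs in
theorem abs_le_snorm_pow (x : Fin d → ℝ) (j : Fin d) : |x j| ≤ snorm s x ^ s j := by
  have h : |x j| ^ (1 / (s j : ℝ)) ≤ snorm s x :=
    Finset.single_le_sum (f := fun i => |x i| ^ (1 / (s i : ℝ))) (fun _ _ => by positivity)
      (Finset.mem_univ j)
  calc |x j| = (|x j| ^ (1 / (s j : ℝ))) ^ s j := by
        rw [one_div, Real.rpow_inv_natCast_pow (abs_nonneg _) (hs j).ne']
    _ ≤ _ := by gcongr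

include hs hN in
-- Parabolic scaling: with `u = |x j| / t ^ (s j / N)` the `j`-th term is `t ^ (1 / N) * u ^ (1 / s
-- j)`, and `u ^ (1 / s j) ≤ 1 + u ^ p` because `1 / s j ≤ 1 ≤ p`.
theorem snorm_le_mul_energy {t : ℝ} (ht : 0 < t) (x : Fin d → ℝ) :
    snorm s x ≤ t ^ (1 / (N : ℝ)) * (d + ∑ j, energy (s j) N t (x j)) := by
  have hd : (d : ℝ) = ∑ _j : Fin d, (1 : ℝ) := by simp
  rw [hd, ← Finset.sum_add_distrib, Finset.mul_sum]
  refine Finset.sum_le_sum fun j _ => ?_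
  have h1 : (1 : ℝ) ≤ s j := by exact_mod_cast hs j
  have h2 : (s j : ℝ) < N := by exact_mod_cast hN j
  have hp := one_le_exponent (hs j) (hN j)
  rw [energy_eq (hs j) (hN j) ht]
  set p := (N : ℝ) / ((N : ℝ) - s j)
  set a := t ^ ((s j : ℝ) / N) with ha
  have ha0 : 0 < a := by positivity
  set u := |x j| / a with hu
  have hu0 : 0 ≤ u := by positivity
  have e : |x j| ^ (1 / (s j : ℝ)) = t ^ (1 / (N : ℝ)) * u ^ (1 / (s j : ℝ)) := by
    have : |x j| = a * u := by rw [hu]; field_simp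
    rw [this, Real.mul_rpow ha0.le hu0, ha, ← Real.rpow_mul ht.le]
    congr 2
    have : (0 : ℝ) < N := by linarith
    field_simp
  rw [e]
  gcongr
  rcases le_total u 1 with h | h
  · have := Real.rpow_le_one hu0 h (show 0 ≤ 1 / (s j : ℝ) by positivity)
    have : 0 ≤ u ^ p := by positivity
    linarith
  · have := Real.rpow_le_rpow_of_exponent_le h
      (show 1 / (s j : ℝ) ≤ p from le_trans (by rw [div_le_one (by linarith)]; exact h1) hp)
    linarith

include hs hN in
-- A weight of order `θ` buys the power `t ^ (θ / N)`. What is left is a factor linear in the total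
-- energy, absorbed by half of the exponential; this is the origin of `2 / c` and of the rate `c /
-- 2`.
theorem snorm_rpow_mul_maj_le {c t θ : ℝ} (hc : 0 < c) (ht : 0 < t) (h0 : 0 ≤ θ) (h1 : θ ≤ 1)
    (x : Fin d → ℝ) :
    snorm s x ^ θ * maj s N c t x ≤ (1 + d + 2 / c) * t ^ (θ / N) * maj s N (c / 2) t x := by
  have hE := sum_energy_nonneg (s := s) (N := N) ht x
  set E := ∑ j, energy (s j) N t (x j) with hEdef
  have h2 : snorm s x ^ θ ≤ t ^ (θ / N) * (1 + d + E) := by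
    calc snorm s x ^ θ ≤ (t ^ (1 / (N : ℝ)) * (1 + d + E)) ^ θ := by
          refine Real.rpow_le_rpow (snorm_nonneg _) ((snorm_le_mul_energy hs hN ht x).trans ?_) h0
          gcongr
          linarith
      _ = t ^ (θ / N) * (1 + d + E) ^ θ := by
          rw [Real.mul_rpow (by positivity) (by positivity), ← Real.rpow_mul ht.le]
          congr 2; ring
      _ ≤ t ^ (θ / N) * (1 + d + E) ^ (1 : ℝ) := by
          gcongr
          have : (0 : ℝ) ≤ d := by positivity
          linarith
      _ = _ := by rw [Real.rpow_one]
  have h3 : (1 + d + E) ≤ (1 + d + 2 / c) * Real.exp (c / 2 * E) := by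
    have h4 := Real.add_one_le_exp (c / 2 * E)
    have h5 : 0 ≤ c / 2 * E := by positivity
    have h6 : E ≤ 2 / c * Real.exp (c / 2 * E) := by
      rw [div_mul_eq_mul_div, le_div_iff₀ hc]; nlinarith
    have h7 : (1 + d : ℝ) ≤ (1 + d) * Real.exp (c / 2 * E) :=
      le_mul_of_one_le_right (by positivity) (by linarith)
    nlinarith
  unfold maj
  rw [← hEdef]
  have hpr : 0 ≤ ∏ j, cauchyKer (t ^ ((s j : ℝ) / N)) (x j) :=
    Finset.prod_nonneg fun j _ => (cauchyKer_pos (by positivity) _).le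
  calc _ ≤ (t ^ (θ / N) * ((1 + d + 2 / c) * Real.exp (c / 2 * E))) *
      ((∏ j, cauchyKer (t ^ ((s j : ℝ) / N)) (x j)) * Real.exp (-c * E)) := by
        refine mul_le_mul_of_nonneg_right (h2.trans ?_) (by positivity)
        gcongr
    _ = (1 + d + 2 / c) * t ^ (θ / N) * ((∏ j, cauchyKer (t ^ ((s j : ℝ) / N)) (x j)) *
      (Real.exp (c / 2 * E) * Real.exp (-c * E))) := by ring
    _ = _ := by rw [← Real.exp_add]; congr 3; ring_nf

include hs hN in
-- Half of the exponential pays for the decay of the Cauchy factors: in the scaled variable `u` one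
-- has `u - 1 ≤ u ^ p`, and `exp (c / 2 * u)` dominates `1 + u ^ 2` up to a constant.
theorem gaussKernel_le_maj {c t : ℝ} (hc : 0 < c) (ht : 0 < t) (x : Fin d → ℝ) :
    gaussKernel s N c 0 t x ≤ (Real.exp (c / 2) * (1 + 8 / c ^ 2)) ^ d * maj s N (c / 2) t x := by
  have h1 : ∀ j, (t ^ ((s j : ℝ) / N))⁻¹ * Real.exp (-(c / 2) * energy (s j) N t (x j)) ≤
      (Real.exp (c / 2) * (1 + 8 / c ^ 2)) * cauchyKer (t ^ ((s j : ℝ) / N)) (x j) := by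
    intro j
    have hp := one_le_exponent (hs j) (hN j)
    rw [energy_eq (hs j) (hN j) ht]
    set p := (N : ℝ) / ((N : ℝ) - s j)
    set a := t ^ ((s j : ℝ) / N) with ha
    have ha0 : 0 < a := by positivity
    rw [cauchyKer_eq_comp ha0]
    set u := |x j| / a with hu
    have hu0 : 0 ≤ u := by positivity
    have e : (a⁻¹ * x j) ^ 2 = u ^ 2 := by
      rw [hu, div_pow, sq_abs, mul_pow, inv_pow]; field_simp
    rw [e, mul_left_comm]
    gcongr
    rw [neg_mul, Real.exp_neg, ← div_eq_mul_inv, inv_eq_one_div, div_le_div_iff₀ (Real.exp_pos _) (by positivity),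
      one_mul]
    have h2 : u - 1 ≤ u ^ p := by
      rcases le_total u 1 with h | h
      · have : 0 ≤ u ^ p := by positivity
        linarith
      · have := Real.rpow_le_rpow_of_exponent_le h hp
        rw [Real.rpow_one] at this
        linarith
    have h3 : Real.exp (c / 2 * u) ≤ Real.exp (c / 2) * Real.exp (c / 2 * u ^ p) := by
      rw [← Real.exp_add, Real.exp_le_exp]; nlinarith
    have h4 := Real.quadratic_le_exp_of_nonneg (show 0 ≤ c / 2 * u by positivity)
    have h5 : 1 + u ^ 2 ≤ (1 + 8 / c ^ 2) * Real.exp (c / 2 * u) := by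
      have h6 : u ^ 2 ≤ 8 / c ^ 2 * Real.exp (c / 2 * u) := by
        rw [div_mul_eq_mul_div, le_div_iff₀ (by positivity)]
        have : 0 ≤ c / 2 * u := by positivity
        nlinarith
      have : 0 ≤ c / 2 * u := by positivity
      nlinarith [sq_nonneg (c / 2 * u)]
    calc 1 + u ^ 2 ≤ (1 + 8 / c ^ 2) * Real.exp (c / 2 * u) := h5
      _ ≤ (1 + 8 / c ^ 2) * (Real.exp (c / 2) * Real.exp (c / 2 * u ^ p)) := by gcongr
      _ = _ := by ring
  have h2 := Finset.prod_le_prod (s := Finset.univ) (fun j _ => by positivity) fun j _ => h1 j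
  rw [Finset.prod_mul_distrib, Finset.prod_mul_distrib, Finset.prod_inv_distrib,
    prod_rpow_scale ht, ← Real.exp_sum, ← Finset.mul_sum] at h2
  simp only [Finset.prod_const, Finset.card_univ, Fintype.card_fin] at h2
  have h3 : gaussKernel s N c 0 t x = (t ^ ((scalingSize s : ℝ) / N))⁻¹ *
      Real.exp (-(c / 2) * ∑ j, energy (s j) N t (x j)) *
      Real.exp (-(c / 2) * ∑ j, energy (s j) N t (x j)) := by
    rw [mul_assoc, ← Real.exp_add, ← Real.rpow_neg ht.le]
    unfold gaussKernel energy
    congr 2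
    · ring
    · ring
  rw [h3]
  unfold maj
  rw [← mul_assoc]
  gcongr

include hs hN in
/-- Hölder continuity from bounds on a function and on its partial derivatives. -/
theorem holder_of_lineDeriv {f : (Fin d → ℝ) → ℂ} {F : Fin d → (Fin d → ℝ) → ℂ}
    (hF : ∀ j z, HasLineDerivAt ℝ f (F j z) z (Pi.single j 1)) {c T τ B β : ℝ} (hc : 0 ≤ c)
    (hτ : 0 < τ) (hτT : τ ≤ T) (hB : 0 ≤ B) (hβ0 : 0 ≤ β) (hβ1 : β ≤ 1) {y : Fin d → ℝ}
    (hfb : ∀ z, ‖f z‖ ≤ B * maj s N c T (z - y))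
    (hFb : ∀ j z, ‖F j z‖ ≤ B * τ ^ (-(s j : ℝ) / N) * maj s N c T (z - y)) (x x' : Fin d → ℝ) :
    ‖f x - f x'‖ ≤ ((d + 1) * (3 ^ d * Real.exp (c * d))) * B * τ ^ (-β / N) *
      snorm s (x - x') ^ β *
      (maj s N (c * 2⁻¹ ^ N) T (x - y) + maj s N (c * 2⁻¹ ^ N) T (x' - y)) := by
  have hT : 0 < T := hτ.trans_le hτT
  set L := 3 ^ d * Real.exp (c * d) with hL
  have hL1 : 1 ≤ L := by
    have h1 : (1 : ℝ) ≤ 3 ^ d := one_le_pow₀ (by norm_num)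
    have h2 : 1 ≤ Real.exp (c * d) := Real.one_le_exp (by positivity)
    nlinarith
  set c' := c * 2⁻¹ ^ N with hc'
  have hcc : c' ≤ c := mul_le_of_le_one_right hc (pow_le_one₀ (by norm_num) (by norm_num))
  set r := snorm s (x - x') with hr
  have hr0 : 0 ≤ r := snorm_nonneg _
  have hM : ∀ z, 0 < maj s N c' T z := fun z => maj_pos hT _ _
  -- Beyond distance `τ ^ (1 / N)` the factor `τ ^ (-β / N) * r ^ β` is at least one and the
  -- triangle inequality suffices. Below it, the box between the points is within scale `τ ≤ T`, so
  -- decay at scale `T` survives the displacement although the derivatives are only controlled at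
  -- scale `τ`.
  rcases le_total (τ ^ (1 / (N : ℝ))) r with h | h
  · have h1 : 1 ≤ τ ^ (-β / N) * r ^ β := by
      calc (1 : ℝ) = τ ^ (-β / N) * (τ ^ (1 / (N : ℝ))) ^ β := by
            rw [← Real.rpow_mul hτ.le, ← Real.rpow_add hτ,
              show -β / (N : ℝ) + 1 / N * β = 0 by ring, Real.rpow_zero]
        _ ≤ _ := by gcongr
    have h2 : ∀ z, ‖f z‖ ≤ B * maj s N c' T (z - y) := fun z =>
      (hfb z).trans (mul_le_mul_of_nonneg_left (maj_mono hcc hT _) hB)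
    have h3 : ‖f x - f x'‖ ≤ B * (maj s N c' T (x - y) + maj s N c' T (x' - y)) := by
      rw [mul_add]
      exact (norm_sub_le _ _).trans (add_le_add (h2 x) (h2 x'))
    have h4 : 1 ≤ ((d + 1) * L) * (τ ^ (-β / N) * r ^ β) := by
      have : 1 ≤ (d + 1) * L := one_le_mul_of_one_le_of_one_le (by linarith [Nat.cast_nonneg (α := ℝ) d]) hL1
      exact one_le_mul_of_one_le_of_one_le this h1
    have h5 : 0 ≤ B * (maj s N c' T (x - y) + maj s N c' T (x' - y)) :=
      mul_nonneg hB (add_pos (hM _) (hM _)).le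
    calc _ ≤ _ := h3
      _ ≤ ((d + 1) * L) * (τ ^ (-β / N) * r ^ β) *
          (B * (maj s N c' T (x - y) + maj s N c' T (x' - y))) := le_mul_of_one_le_left h5 h4
      _ = _ := by ring
  · have hbox : ∀ j z, (∀ i, |z i - x' i| ≤ |x i - x' i|) →
        ‖F j z‖ ≤ B * τ ^ (-(s j : ℝ) / N) * (L * maj s N c' T (x' - y)) := by
      intro j z hz
      refine (hFb j z).trans ?_
      gcongr
      have h1 : ∀ i, |(z - x') i| ≤ T ^ ((s i : ℝ) / N) := fun i => by
        calc |(z - x') i| ≤ |(x - x') i| := hz i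
          _ ≤ r ^ s i := abs_le_snorm_pow hs _ i
          _ ≤ (τ ^ (1 / (N : ℝ))) ^ s i := by gcongr
          _ = τ ^ ((s i : ℝ) / N) := by
              rw [← Real.rpow_natCast, ← Real.rpow_mul hτ.le]; congr 1; ring
          _ ≤ _ := by gcongr
      have h2 := maj_add_le hs hN hc hT h1 (x' - y)
      rwa [show x' - y + (z - x') = z - y by abel] at h2
    refine (norm_sub_le_of_lineDeriv hF hbox).trans ?_
    have hterm : ∀ j, τ ^ (-(s j : ℝ) / N) * |x j - x' j| ≤ τ ^ (-β / N) * r ^ β := fun j => by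
      have h1 : (1 : ℝ) ≤ s j := by exact_mod_cast hs j
      calc τ ^ (-(s j : ℝ) / N) * |x j - x' j| ≤ τ ^ (-(s j : ℝ) / N) * r ^ ((s j : ℝ) - β + β) := by
            gcongr
            rw [sub_add_cancel, Real.rpow_natCast]
            exact abs_le_snorm_pow hs (x - x') j
        _ ≤ τ ^ (-(s j : ℝ) / N) * (r ^ ((s j : ℝ) - β) * r ^ β) := by
            gcongr
            exact (Real.rpow_add_of_nonneg hr0 (by linarith) hβ0).le
        _ ≤ τ ^ (-(s j : ℝ) / N) * ((τ ^ (1 / (N : ℝ))) ^ ((s j : ℝ) - β) * r ^ β) := by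
            gcongr
            linarith
        _ = _ := by
            rw [← mul_assoc, ← Real.rpow_mul hτ.le, ← Real.rpow_add hτ]
            congr 2; ring
    have hsum : ∑ j, B * τ ^ (-(s j : ℝ) / N) * (L * maj s N c' T (x' - y)) * |x j - x' j| ≤
        ∑ _j : Fin d, B * (L * maj s N c' T (x' - y)) * (τ ^ (-β / N) * r ^ β) :=
      Finset.sum_le_sum fun j _ => by
        calc _ = B * (L * maj s N c' T (x' - y)) * (τ ^ (-(s j : ℝ) / N) * |x j - x' j|) := by ring
          _ ≤ _ := mul_le_mul_of_nonneg_left (hterm j)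
            (mul_nonneg hB (mul_nonneg (by linarith) (hM _).le))
    refine hsum.trans ?_
    rw [Finset.sum_const, Finset.card_univ, Fintype.card_fin, nsmul_eq_mul]
    have hm := (hM (x - y)).le
    have hm' := (hM (x' - y)).le
    calc (d : ℝ) * (B * (L * maj s N c' T (x' - y)) * (τ ^ (-β / N) * r ^ β))
        ≤ (d + 1) * (B * (L * (maj s N c' T (x - y) + maj s N c' T (x' - y))) *
          (τ ^ (-β / N) * r ^ β)) := by gcongr <;> linarith
      _ = _ := by ring

end snorm

/-! ### Shifting the contour of a Fourier integral -/

section contour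

variable {d : ℕ}

/-- All coordinates are shifted at once by considering `F z = ∫ G(ξ + z η) dξ`. This is an entire
function of the single variable `z`, constant on the real axis by translation invariance of Lebesgue
measure, hence constant; the shift is its value at `I`. -/
theorem integral_shift_eq {G : (Fin d → ℂ) → ℂ} (hG : Differentiable ℂ G) {η : Fin d → ℝ}
    (hb : ∀ R : ℝ, ∃ g : (Fin d → ℝ) → ℝ, Integrable g ∧
      ∀ z : ℂ, ‖z‖ ≤ R → ∀ ξ : Fin d → ℝ, ‖G (fun j => (ξ j : ℂ) + z * (η j : ℂ))‖ ≤ g ξ) :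
    ∫ ξ : Fin d → ℝ, G (fun j => (ξ j : ℂ) + Complex.I * (η j : ℂ)) =
      ∫ ξ : Fin d → ℝ, G (fun j => (ξ j : ℂ)) := by
  set H : (Fin d → ℝ) → ℂ → ℂ := fun ξ z => G (fun j => (ξ j : ℂ) + z * (η j : ℂ)) with hH
  set F : ℂ → ℂ := fun z => ∫ ξ, H ξ z with hF
  have hHd : ∀ ξ, Differentiable ℂ (H ξ) := fun ξ => by
    refine hG.comp ?_
    fun_prop
  have hHc : Continuous (fun p : (Fin d → ℝ) × ℂ => H p.1 p.2) := by
    refine hG.continuous.comp ?_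
    fun_prop
  have hHm : ∀ z, AEStronglyMeasurable (fun ξ => H ξ z) := fun z =>
    (hHc.comp (by fun_prop : Continuous fun ξ : Fin d → ℝ => (ξ, z))).aestronglyMeasurable
  have hd : Differentiable ℂ F := by
    intro z₀
    -- One unit of radius for the neighbourhood of `z₀`, a second one for the circle in Cauchy's
    -- estimate of the derivative.
    obtain ⟨g, hgi, hg⟩ := hb (‖z₀‖ + 2)
    have h := hasDerivAt_integral_of_dominated_loc_of_deriv_le (μ := (volume : Measure (Fin d → ℝ)))
      (F := fun z ξ => H ξ z) (F' := fun z ξ => deriv (H ξ) z) (x₀ := z₀) (bound := g)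
      (Metric.ball_mem_nhds z₀ one_pos) (Eventually.of_forall hHm)
      (hgi.mono' (hHm z₀) (Eventually.of_forall fun ξ => hg z₀ (by linarith) ξ))
      ?_ ?_ hgi ?_
    · exact h.2.differentiableAt
    · have h1 : StronglyMeasurable fun p : (Fin d → ℝ) × ℂ => deriv (H p.1) p.2 :=
        stronglyMeasurable_deriv_with_param hHc
      exact (h1.comp_measurable (by fun_prop : Measurable fun ξ : Fin d → ℝ => (ξ, z₀)))
        |>.aestronglyMeasurable
    · refine Eventually.of_forall fun ξ z hz => ?_
      have := Complex.norm_deriv_le_of_forall_mem_sphere_norm_le (f := H ξ) (c := z) (C := g ξ)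
        one_pos (hHd ξ).diffContOnCl fun w hw => by
          refine hg w ?_ ξ
          have h1 : ‖w - z‖ = 1 := by simpa using hw
          have h2 : ‖z - z₀‖ < 1 := by simpa [dist_eq_norm] using hz
          calc ‖w‖ = ‖(w - z) + (z - z₀) + z₀‖ := by congr 1; ring
            _ ≤ ‖w - z‖ + ‖z - z₀‖ + ‖z₀‖ := norm_add₃_le
            _ ≤ _ := by linarith
      simpa using this
    · exact Eventually.of_forall fun ξ z _ => (hHd ξ z).hasDerivAt
  have hreal : ∀ u : ℝ, F u = F 0 := fun u => by
    have h1 : ∀ (v : ℝ), F v = ∫ ξ : Fin d → ℝ, G (fun j => ((ξ + v • η) j : ℂ)) := fun v => by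
      simp [hF, hH]
    have h2 : ∀ v : ℝ, F v = ∫ ξ : Fin d → ℝ, G (fun j => (ξ j : ℂ)) := fun v => by
      rw [h1]
      exact integral_add_right_eq_self (fun ξ : Fin d → ℝ => G (fun j => (ξ j : ℂ))) (v • η)
    rw [h2 u, ← h2 0, Complex.ofReal_zero]
  -- The real points `1 / (n + 1)` accumulate at zero, so the identity theorem extends the constancy
  -- from the real axis to the plane.
  have hconst : F = fun _ => F 0 := by
    refine AnalyticOnNhd.eq_of_frequently_eq (z₀ := 0) (fun z _ => hd.analyticAt z)
      (fun z _ => analyticAt_const) ?_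
    have h1 : Tendsto (fun n : ℕ => ((1 / ((n : ℝ) + 1) : ℝ) : ℂ)) atTop (𝓝[≠] 0) := by
      refine tendsto_nhdsWithin_iff.2 ⟨?_, Eventually.of_forall fun n => ?_⟩
      · exact (Complex.continuous_ofReal.tendsto' 0 0 (by simp)).comp
          (tendsto_one_div_add_atTop_nhds_zero_nat (𝕜 := ℝ))
      · have : (1 / ((n : ℝ) + 1) : ℝ) ≠ 0 := by positivity
        exact Complex.ofReal_ne_zero.2 this
    exact h1.frequently (Frequently.of_forall fun n => hreal _)
  have := congrFun hconst Complex.I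
  simpa [hF, hH] using this

end contour

/-! ### Exponentials of power sums and decay of oscillatory integrals -/

/-- `∑ |ξ_j|^{N/𝔰_j}`, which is comparable with `‖ξ‖_𝔰^N`. -/
def powSum {d : ℕ} (s : Fin d → ℕ) (N : ℕ) (ξ : Fin d → ℝ) : ℝ := ∑ j, |ξ j| ^ ((N : ℝ) / s j)

section powSum

variable {d : ℕ} {s : Fin d → ℕ} {N : ℕ}

theorem powSum_nonneg (ξ : Fin d → ℝ) : 0 ≤ powSum s N ξ :=
  Finset.sum_nonneg fun _ _ => by positivity

variable (hs : ∀ j, 0 < s j) (hN : ∀ j, s j < N)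

include hs hN in
theorem powSum_add_le (ξ h : Fin d → ℝ) :
    powSum s N (ξ + h) ≤ 2 ^ N * (powSum s N ξ + powSum s N h) := by
  unfold powSum
  rw [← Finset.sum_add_distrib, Finset.mul_sum]
  refine Finset.sum_le_sum fun j _ => ?_
  have h1 : (1 : ℝ) ≤ s j := by exact_mod_cast hs j
  have h2 : (s j : ℝ) < N := by exact_mod_cast hN j
  have hr : 1 ≤ (N : ℝ) / s j := by rw [le_div_iff₀ (by linarith)]; linarith
  have hr' : (N : ℝ) / s j ≤ N := div_le_self (by linarith) h1
  set r := (N : ℝ) / s j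
  set a := |ξ j|
  set b := |h j|
  have ha : 0 ≤ a := abs_nonneg _
  have hb : 0 ≤ b := abs_nonneg _
  have h3 : |(ξ + h) j| ≤ 2 * max a b := by
    have := abs_add_le (ξ j) (h j)
    have := le_max_left a b
    have := le_max_right a b
    simp only [Pi.add_apply]
    linarith
  have hm : 0 ≤ max a b := ha.trans (le_max_left _ _)
  calc |(ξ + h) j| ^ r ≤ (2 * max a b) ^ r := Real.rpow_le_rpow (abs_nonneg _) h3 (by linarith)
    _ = 2 ^ r * (max a b) ^ r := Real.mul_rpow (by norm_num) hm
    _ ≤ 2 ^ N * (a ^ r + b ^ r) := by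
        have h4 : (2 : ℝ) ^ r ≤ 2 ^ N := by
          rw [← Real.rpow_natCast]
          exact Real.rpow_le_rpow_of_exponent_le (by norm_num) hr'
        have h5 : (max a b) ^ r ≤ a ^ r + b ^ r := by
          have h6 : 0 ≤ a ^ r := by positivity
          have h7 : 0 ≤ b ^ r := by positivity
          rcases max_cases a b with h | h <;> rw [h.1] <;> linarith
        gcongr

theorem integral_exp_neg_mul_abs_rpow {r b : ℝ} (hr : 0 < r) (hb : 0 < b) :
    ∫ x : ℝ, Real.exp (-b * |x| ^ r) = 2 * (b ^ (-1 / r) * Real.Gamma (1 / r + 1)) := by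
  rw [integral_comp_abs (f := fun x => Real.exp (-b * x ^ r)), integral_exp_neg_mul_rpow hr hb]

theorem integrable_exp_neg_mul_abs_rpow {r b : ℝ} (hr : 0 < r) (hb : 0 < b) :
    Integrable fun x : ℝ => Real.exp (-b * |x| ^ r) := by
  refine Integrable.of_integral_ne_zero ?_
  rw [integral_exp_neg_mul_abs_rpow hr hb]
  have := Real.Gamma_pos_of_pos (show 0 < 1 / r + 1 by positivity)
  positivity

theorem exp_neg_powSum (b : ℝ) (ξ : Fin d → ℝ) :
    Real.exp (-b * powSum s N ξ) = ∏ j, Real.exp (-b * |ξ j| ^ ((N : ℝ) / s j)) := by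
  rw [powSum, Finset.mul_sum, Real.exp_sum]

include hs hN in
theorem integrable_exp_neg_powSum {b : ℝ} (hb : 0 < b) :
    Integrable fun ξ : Fin d → ℝ => Real.exp (-b * powSum s N ξ) := by
  simp_rw [exp_neg_powSum]
  refine Integrable.fintype_prod (f := fun j x => Real.exp (-b * |x| ^ ((N : ℝ) / s j))) fun j => ?_
  have h1 : (0 : ℝ) < s j := by exact_mod_cast hs j
  have h2 : (s j : ℝ) < N := by exact_mod_cast hN j
  exact integrable_exp_neg_mul_abs_rpow (div_pos (by linarith) h1) hb

include hs hN in
-- The integral factors into one-dimensional Gamma integrals; the scaling of the `j`-th one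
-- contributes `t ^ (-s j / N)`, and the exponents add up to `-|s| / N`.
theorem exists_integral_exp_neg_powSum {a : ℝ} (ha : 0 < a) : ∃ C : ℝ, 0 < C ∧ ∀ t : ℝ, 0 < t →
    ∫ ξ : Fin d → ℝ, Real.exp (-(a * t) * powSum s N ξ) = C * t ^ (-(scalingSize s : ℝ) / N) := by
  refine ⟨∏ j, 2 * (a ^ (-1 / ((N : ℝ) / s j)) * Real.Gamma (1 / ((N : ℝ) / s j) + 1)),
    Finset.prod_pos fun j _ => ?_, fun t ht => ?_⟩
  · have := Real.Gamma_pos_of_pos (show 0 < 1 / ((N : ℝ) / s j) + 1 by positivity)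
    positivity
  · simp_rw [exp_neg_powSum]
    rw [integral_fintype_prod_volume_eq_prod
      (fun j x => Real.exp (-(a * t) * |x| ^ ((N : ℝ) / s j))), neg_div,
      Real.rpow_neg ht.le, ← prod_rpow_scale ht, ← Finset.prod_inv_distrib,
      ← Finset.prod_mul_distrib]
    refine Finset.prod_congr rfl fun j _ => ?_
    have h1 : (0 : ℝ) < s j := by exact_mod_cast hs j
    have h2 : (s j : ℝ) < N := by exact_mod_cast hN j
    rw [integral_exp_neg_mul_abs_rpow (div_pos (by linarith) h1) (by positivity),
      Real.mul_rpow ha.le ht.le, ← Real.rpow_neg ht.le]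
    have : -1 / ((N : ℝ) / s j) = -((s j : ℝ) / N) := by field_simp
    rw [this]
    ring

/-- Decay of an oscillatory integral from growth bounds on the entire extension of its
amplitude. -/
theorem norm_integral_mul_exp_le (hs : ∀ j, 0 < s j) (hN : ∀ j, s j < N) {a b : ℝ} (ha : 0 < a)
    (hb : 0 < b) : ∃ C c γ : ℝ, 0 < C ∧ 0 < c ∧ 0 < γ ∧
      ∀ (t : ℝ), 0 < t → ∀ (g : (Fin d → ℂ) → ℂ), Differentiable ℂ g → ∀ B : ℝ, 0 ≤ B →
      (∀ ξ η : Fin d → ℝ, ‖g (fun j => (ξ j : ℂ) + Complex.I * (η j : ℂ))‖ ≤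
        B * Real.exp (-(a * t) * powSum s N ξ + b * t * (1 + powSum s N η))) →
      ∀ x : Fin d → ℝ, ‖∫ ξ : Fin d → ℝ, g (fun j => (ξ j : ℂ)) *
        Complex.exp (Complex.I * ∑ j, (x j : ℂ) * (ξ j : ℂ))‖ ≤
        C * B * Real.exp (γ * t) * maj s N c t x := by
  obtain ⟨C₀, hC₀, hint⟩ := exists_integral_exp_neg_powSum (s := s) (N := N) hs hN ha
  -- Since `N / s j ≥ 1 + 1 / N`, this choice gives `κ ^ (N / s j) ≤ κ * κ ^ (1 / N) = κ / (2 * (b +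
  -- 1))` for every `j`: the growth of the amplitude along the shift then costs at most half of the
  -- gain `κ * energy`.
  set κ : ℝ := (1 / (2 * (b + 1))) ^ N with hκ
  have hκ0 : 0 < κ := by positivity
  refine ⟨C₀ * (Real.exp (κ / 2 / 2) * (1 + 8 / (κ / 2) ^ 2)) ^ d, κ / 2 / 2, b, by positivity,
    by positivity, hb, fun t ht g hg B hB hgb x => ?_⟩
  -- Up to the factor `κ` this is the maximiser of the Legendre transform: `x j * η j` becomes `κ`
  -- times the `j`-th energy, and `t * |η j| ^ (N / s j)` is at most a multiple of the same energy.
  set η : Fin d → ℝ := fun j =>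
    κ * (SignType.sign (x j) : ℝ) * (|x j| / t) ^ ((s j : ℝ) / ((N : ℝ) - s j)) with hη
  set G : (Fin d → ℂ) → ℂ := fun ζ => g ζ * Complex.exp (Complex.I * ∑ j, (x j : ℂ) * ζ j) with hGdef
  have hGd : Differentiable ℂ G := by
    refine hg.mul (Differentiable.cexp ?_)
    fun_prop
  have hGn : ∀ ξ η : Fin d → ℝ, ‖G (fun j => (ξ j : ℂ) + Complex.I * (η j : ℂ))‖ ≤
      B * Real.exp (-(a * t) * powSum s N ξ + b * t * (1 + powSum s N η)) *
        Real.exp (-∑ j, x j * η j) := by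
    intro ξ η
    rw [hGdef, norm_mul, Complex.norm_exp]
    have : (Complex.I * ∑ j, (x j : ℂ) * ((ξ j : ℂ) + Complex.I * (η j : ℂ))).re =
        -∑ j, x j * η j := by
      simp [Complex.mul_re]
    rw [this]
    gcongr
    exact hgb ξ η
  -- For complex `z` the real part of `z` also displaces `ξ`. `powSum_add_le` undoes this
  -- displacement at the cost of a factor `2⁻¹ ^ N` in the decay, harmless since only integrability
  -- is at stake here.
  have hshift := integral_shift_eq hGd (η := η) (fun R => by
    refine ⟨fun ξ => B * Real.exp (a * t * powSum s N (R • η)) *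
      Real.exp (b * t * (1 + powSum s N (R • η))) * Real.exp (R * ∑ j, |x j * η j|) *
      Real.exp (-(a * t * 2⁻¹ ^ N) * powSum s N ξ),
      (integrable_exp_neg_powSum hs hN (by positivity)).const_mul _, fun z hz ξ => ?_⟩
    have e : (fun j => (ξ j : ℂ) + z * (η j : ℂ)) =
        fun j => (((ξ + z.re • η) j : ℝ) : ℂ) + Complex.I * (((z.im • η) j : ℝ) : ℂ) := by
      ext j
      conv_lhs => rw [← Complex.re_add_im z]
      simp only [Pi.add_apply, Pi.smul_apply, smul_eq_mul]
      push_cast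
      ring
    rw [e]
    refine (hGn _ _).trans ?_
    have hmono : ∀ u : ℝ, |u| ≤ R → powSum s N (u • η) ≤ powSum s N (R • η) := fun u hu => by
      refine Finset.sum_le_sum fun j _ => Real.rpow_le_rpow (abs_nonneg _) ?_ (by positivity)
      simp only [Pi.smul_apply, smul_eq_mul, abs_mul]
      have : |u| ≤ |R| := hu.trans (le_abs_self R)
      gcongr
    have hre := hmono z.re ((Complex.abs_re_le_norm z).trans hz)
    have him := hmono z.im ((Complex.abs_im_le_norm z).trans hz)
    have h1 : 2⁻¹ ^ N * powSum s N ξ ≤ powSum s N (ξ + z.re • η) + powSum s N (R • η) := by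
      have := powSum_add_le hs hN (ξ + z.re • η) ((-z.re) • η)
      rw [neg_smul, add_neg_cancel_right] at this
      have h2 := hmono (-z.re) (by rw [abs_neg]; exact (Complex.abs_re_le_norm z).trans hz)
      rw [neg_smul] at h2
      calc 2⁻¹ ^ N * powSum s N ξ ≤ 2⁻¹ ^ N * (2 ^ N * (powSum s N (ξ + z.re • η) +
          powSum s N (-(z.re • η)))) := by gcongr
        _ = powSum s N (ξ + z.re • η) + powSum s N (-(z.re • η)) := by
          rw [← mul_assoc, ← mul_pow]; norm_num
        _ ≤ _ := by linarith
    have h2 : -∑ j, x j * (z.im • η) j ≤ R * ∑ j, |x j * η j| := by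
      rw [← Finset.sum_neg_distrib, Finset.mul_sum]
      refine Finset.sum_le_sum fun j _ => ?_
      calc -(x j * (z.im • η) j) ≤ |x j * (z.im • η) j| := neg_le_abs _
        _ = |z.im| * |x j * η j| := by
          rw [Pi.smul_apply, smul_eq_mul, ← abs_mul]; congr 1; ring
        _ ≤ _ := by
          gcongr
          exact (Complex.abs_im_le_norm z).trans hz
    beta_reduce
    rw [mul_assoc B, mul_assoc B, mul_assoc B, mul_assoc B, ← Real.exp_add, ← Real.exp_add,
      ← Real.exp_add, ← Real.exp_add]
    refine mul_le_mul_of_nonneg_left (Real.exp_le_exp.2 ?_) hB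
    have h3 : a * t * (2⁻¹ ^ N * powSum s N ξ) ≤
        a * t * (powSum s N (ξ + z.re • η) + powSum s N (R • η)) := by gcongr
    have h4 : b * t * (1 + powSum s N (z.im • η)) ≤ b * t * (1 + powSum s N (R • η)) := by gcongr
    linarith)
  have hxη : ∀ j, x j * η j = κ * energy (s j) N t (x j) ∧
      b * t * |η j| ^ ((N : ℝ) / s j) ≤ κ / 2 * energy (s j) N t (x j) := by
    intro j
    have h1 : (1 : ℝ) ≤ s j := by exact_mod_cast hs j
    have h2 : (s j : ℝ) + 1 ≤ N := by exact_mod_cast hN j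
    have h3 : (0 : ℝ) < (N : ℝ) - s j := by linarith
    have h4 : (0 : ℝ) < N := by linarith
    rw [energy_eq_mul (hs j) (hN j) ht]
    set v := |x j| / t with hv
    have hv0 : 0 ≤ v := by positivity
    have hxv : |x j| = t * v := by rw [hv]; field_simp
    have hp : (N : ℝ) / ((N : ℝ) - s j) = 1 + (s j : ℝ) / ((N : ℝ) - s j) := by field_simp; ring
    constructor
    · have hsgn : x j * (SignType.sign (x j) : ℝ) = t * v := by
        rw [← hxv]; exact self_mul_sign (x j)
      rw [hp, Real.rpow_add' hv0 (by positivity), Real.rpow_one]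
      calc x j * η j = κ * (x j * (SignType.sign (x j) : ℝ)) *
            v ^ ((s j : ℝ) / ((N : ℝ) - s j)) := by rw [hη]; ring
        _ = _ := by rw [hsgn]; ring
    · have hsg : |(SignType.sign (x j) : ℝ)| ≤ 1 := by
        rcases lt_trichotomy (x j) 0 with h | h | h <;> simp [h]
      have h5 : |η j| ≤ κ * v ^ ((s j : ℝ) / ((N : ℝ) - s j)) := by
        have hvp : 0 ≤ v ^ ((s j : ℝ) / ((N : ℝ) - s j)) := by positivity
        simp only [hη, abs_mul, abs_of_pos hκ0, ← hv, abs_of_nonneg hvp]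
        gcongr
        exact mul_le_of_le_one_right hκ0.le hsg
      have h6 : |η j| ^ ((N : ℝ) / s j) ≤ κ ^ ((N : ℝ) / s j) * v ^ ((N : ℝ) / ((N : ℝ) - s j)) := by
        refine (Real.rpow_le_rpow (abs_nonneg _) h5 (by positivity)).trans ?_
        rw [Real.mul_rpow hκ0.le (by positivity), ← Real.rpow_mul hv0]
        refine le_of_eq ?_
        congr 2
        field_simp
      have hκ1 : κ ≤ 1 := by
        refine pow_le_one₀ (by positivity) ?_
        rw [div_le_one (by positivity)]; linarith
      have h7 : κ ^ ((N : ℝ) / s j) ≤ κ * (1 / (2 * (b + 1))) := by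
        have h8 : 1 + 1 / (N : ℝ) ≤ (N : ℝ) / s j := by
          rw [le_div_iff₀ (by linarith)]
          have : 1 / (N : ℝ) * s j ≤ 1 := by
            rw [div_mul_eq_mul_div, div_le_one h4]; linarith
          nlinarith
        calc κ ^ ((N : ℝ) / s j) ≤ κ ^ (1 + 1 / (N : ℝ)) :=
              Real.rpow_le_rpow_of_exponent_ge hκ0 hκ1 h8
          _ = κ * κ ^ (1 / (N : ℝ)) := by rw [Real.rpow_add hκ0, Real.rpow_one]
          _ = _ := by
              congr 1
              rw [hκ, one_div (N : ℝ), Real.pow_rpow_inv_natCast (by positivity)]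
              have : 0 < N := by exact_mod_cast h4
              exact this.ne'
      have h8 : b * (1 / (2 * (b + 1))) ≤ 1 / 2 := by
        rw [mul_one_div, div_le_div_iff₀ (by positivity) (by norm_num)]; linarith
      calc b * t * |η j| ^ ((N : ℝ) / s j)
          ≤ b * t * (κ * (1 / (2 * (b + 1))) * v ^ ((N : ℝ) / ((N : ℝ) - s j))) := by
            have := h6.trans (mul_le_mul_of_nonneg_right h7 (by positivity))
            gcongr
        _ = κ * (b * (1 / (2 * (b + 1)))) * (t * v ^ ((N : ℝ) / ((N : ℝ) - s j))) := by ring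
        _ ≤ κ * (1 / 2) * (t * v ^ ((N : ℝ) / ((N : ℝ) - s j))) := by gcongr
        _ = _ := by ring
  have hexp : b * t * (1 + powSum s N η) - ∑ j, x j * η j ≤
      b * t + -(κ / 2) * ∑ j, energy (s j) N t (x j) := by
    have h1 : b * t * powSum s N η - ∑ j, x j * η j ≤
        -(κ / 2) * ∑ j, energy (s j) N t (x j) := by
      rw [powSum, Finset.mul_sum, Finset.mul_sum, ← Finset.sum_sub_distrib]
      refine Finset.sum_le_sum fun j _ => ?_
      have := hxη j
      rw [this.1]
      linarith [this.2]
    linarith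
  change ‖∫ ξ : Fin d → ℝ, G (fun j => (ξ j : ℂ))‖ ≤ _
  rw [← hshift]
  calc ‖∫ ξ : Fin d → ℝ, G (fun j => (ξ j : ℂ) + Complex.I * (η j : ℂ))‖
      ≤ ∫ ξ : Fin d → ℝ, B * Real.exp (b * t) *
          Real.exp (-(κ / 2) * ∑ j, energy (s j) N t (x j)) *
          Real.exp (-(a * t) * powSum s N ξ) := by
        refine norm_integral_le_of_norm_le
          ((integrable_exp_neg_powSum hs hN (by positivity)).const_mul _)
          (Eventually.of_forall fun ξ => (hGn ξ η).trans ?_)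
        rw [mul_assoc B, mul_assoc B, mul_assoc B, ← Real.exp_add, ← Real.exp_add, ← Real.exp_add]
        refine mul_le_mul_of_nonneg_left (Real.exp_le_exp.2 ?_) hB
        linarith
    _ = C₀ * B * Real.exp (b * t) * gaussKernel s N (κ / 2) 0 t x := by
        rw [integral_const_mul, hint t ht, gaussKernel, zero_sub]
        unfold energy
        ring
    _ ≤ C₀ * B * Real.exp (b * t) * ((Real.exp (κ / 2 / 2) * (1 + 8 / (κ / 2) ^ 2)) ^ d *
          maj s N (κ / 2 / 2) t x) := by
        gcongr
        exact gaussKernel_le_maj hs hN (by positivity) ht x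
    _ = _ := by ring

end powSum

/-! ### Parabolic symbols and constant-coefficient kernels -/

section symbols

variable {d : ℕ} {s : Fin d → ℕ} {N : ℕ}

/-- `∏ (iζ_j)^{k_j}`. -/
def cmono {d : ℕ} (k : Fin d → ℕ) (ζ : Fin d → ℂ) : ℂ := ∏ j, (Complex.I * ζ j) ^ k j

/-- The constant-coefficient symbol `∑ p_k (iζ)^k`. -/
def csymb {d : ℕ} (s : Fin d → ℕ) (N : ℕ) (p : (Fin d → ℕ) → ℂ) (ζ : Fin d → ℂ) : ℂ :=
  ∑ k ∈ multiIndices s N, p k * cmono k ζ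

/-- Parabolicity and boundedness of a constant-coefficient symbol. -/
structure ParabolicSymbol {d : ℕ} (s : Fin d → ℕ) (N : ℕ) (δ A : ℝ) (p : (Fin d → ℕ) → ℂ) :
    Prop where
  petrowski : ∀ ξ : Fin d → ℝ, (csymb s N p fun j => (ξ j : ℂ)).re ≤ -δ * snorm s ξ ^ N
  bound : ∀ k ∈ multiIndices s N, ‖p k‖ ≤ A

/-- The Fourier multiplier `(iζ)^k e^{tP(iζ)}`. -/
def amp {d : ℕ} (s : Fin d → ℕ) (N : ℕ) (p : (Fin d → ℕ) → ℂ) (k : Fin d → ℕ) (t : ℝ)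
    (ζ : Fin d → ℂ) : ℂ := cmono k ζ * Complex.exp (t * csymb s N p ζ)

/-- The derivative `∂^k` of the fundamental solution of the constant-coefficient equation. -/
def fundKer {d : ℕ} (s : Fin d → ℕ) (N : ℕ) (p : (Fin d → ℕ) → ℂ) (k : Fin d → ℕ) (t : ℝ)
    (x : Fin d → ℝ) : ℂ :=
  ((2 * Real.pi : ℝ) ^ d : ℝ)⁻¹ * ∫ ξ : Fin d → ℝ, amp s N p k t (fun j => (ξ j : ℂ)) *
    Complex.exp (Complex.I * ∑ j, (x j : ℂ) * (ξ j : ℂ))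

theorem differentiable_cmono (k : Fin d → ℕ) : Differentiable ℂ (cmono k) := by
  unfold cmono
  fun_prop

theorem differentiable_csymb (p : (Fin d → ℕ) → ℂ) : Differentiable ℂ (csymb s N p) := by
  unfold csymb
  have := differentiable_cmono (d := d)
  fun_prop

theorem differentiable_amp (p : (Fin d → ℕ) → ℂ) (k : Fin d → ℕ) (t : ℝ) :
    Differentiable ℂ (amp s N p k t) := by
  unfold amp
  have h1 := differentiable_cmono k
  have h2 := differentiable_csymb (s := s) (N := N) p
  fun_prop

theorem prod_pow_sdeg (X : ℝ) (k : Fin d → ℕ) : ∏ j, (X ^ s j) ^ k j = X ^ sdeg s k := by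
  simp_rw [← pow_mul]
  rw [Finset.prod_pow_eq_pow_sum, sdeg]

/-- The pair of bounds `‖a‖ ≤ α`, `‖b - a‖ ≤ β - α` is stable under products. Iterated over the
factors of a monomial, it bounds complex increments by the increment of a real monomial, with no
binomial expansion. -/
theorem norm_mul_sub_le {a b a' b' : ℂ} {α β α' β' : ℝ} (h1 : ‖a‖ ≤ α) (h2 : ‖b - a‖ ≤ β - α)
    (h1' : ‖a'‖ ≤ α') (h2' : ‖b' - a'‖ ≤ β' - α') :
    ‖a * a'‖ ≤ α * α' ∧ ‖b * b' - a * a'‖ ≤ β * β' - α * α' := by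
  have hα : 0 ≤ α := (norm_nonneg _).trans h1
  have hα' : 0 ≤ α' := (norm_nonneg _).trans h1'
  have hβ' : ‖b'‖ ≤ β' := by
    calc ‖b'‖ = ‖a' + (b' - a')‖ := by congr 1; ring
      _ ≤ ‖a'‖ + ‖b' - a'‖ := norm_add_le _ _
      _ ≤ _ := by linarith
  constructor
  · rw [norm_mul]; gcongr
  · calc ‖b * b' - a * a'‖ = ‖(b - a) * b' + a * (b' - a')‖ := by congr 1; ring
      _ ≤ ‖b - a‖ * ‖b'‖ + ‖a‖ * ‖b' - a'‖ := by
        rw [← norm_mul, ← norm_mul]; exact norm_add_le _ _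
      _ ≤ (β - α) * β' + α * (β' - α') := by
        have : 0 ≤ β - α := (norm_nonneg _).trans h2
        gcongr
      _ = _ := by ring

theorem norm_pow_sub_le {a b : ℂ} {α β : ℝ} (h1 : ‖a‖ ≤ α) (h2 : ‖b - a‖ ≤ β - α) (n : ℕ) :
    ‖a ^ n‖ ≤ α ^ n ∧ ‖b ^ n - a ^ n‖ ≤ β ^ n - α ^ n := by
  induction n with
  | zero => simp
  | succ n ih => simp only [pow_succ]; exact norm_mul_sub_le ih.1 ih.2 h1 h2

theorem norm_prod_sub_le {ι : Type*} (S : Finset ι) {a b : ι → ℂ} {α β : ι → ℝ}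
    (h1 : ∀ i, ‖a i‖ ≤ α i) (h2 : ∀ i, ‖b i - a i‖ ≤ β i - α i) :
    ‖∏ i ∈ S, a i‖ ≤ ∏ i ∈ S, α i ∧
      ‖∏ i ∈ S, b i - ∏ i ∈ S, a i‖ ≤ ∏ i ∈ S, β i - ∏ i ∈ S, α i := by
  classical
  induction S using Finset.induction_on with
  | empty => simp
  | insert i S hi ih =>
    simp only [Finset.prod_insert hi]
    exact norm_mul_sub_le (h1 i) (h2 i) ih.1 ih.2

variable (hs : ∀ j, 0 < s j) (hN : ∀ j, s j < N)

include hs in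
-- Coordinatewise `|ξ j| ≤ X ^ s j` and `|η j| ≤ Y ^ s j ≤ (X + Y) ^ s j - X ^ s j`, with `X` and
-- `Y` the anisotropic sizes of `ξ` and `η`; the stability of such pairs under products yields the
-- scaled degree as exponent.
theorem norm_cmono_sub_le (k : Fin d → ℕ) (ξ η : Fin d → ℝ) :
    ‖cmono k (fun j => (ξ j : ℂ))‖ ≤ snorm s ξ ^ sdeg s k ∧
    ‖cmono k (fun j => (ξ j : ℂ) + Complex.I * (η j : ℂ)) - cmono k (fun j => (ξ j : ℂ))‖ ≤
      (snorm s ξ + snorm s η) ^ sdeg s k - snorm s ξ ^ sdeg s k := by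
  have hX := snorm_nonneg (s := s) ξ
  have hY := snorm_nonneg (s := s) η
  have h : ∀ j, ‖(Complex.I * (ξ j : ℂ)) ^ k j‖ ≤ (snorm s ξ ^ s j) ^ k j ∧
      ‖(Complex.I * ((ξ j : ℂ) + Complex.I * (η j : ℂ))) ^ k j - (Complex.I * (ξ j : ℂ)) ^ k j‖ ≤
        ((snorm s ξ + snorm s η) ^ s j) ^ k j - (snorm s ξ ^ s j) ^ k j := fun j => by
    refine norm_pow_sub_le ?_ ?_ _
    · simpa using abs_le_snorm_pow hs ξ j
    · have h1 : snorm s ξ ^ s j + snorm s η ^ s j ≤ (snorm s ξ + snorm s η) ^ s j :=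
        pow_add_pow_le hX hY (hs j).ne'
      have h2 : ‖Complex.I * ((ξ j : ℂ) + Complex.I * (η j : ℂ)) - Complex.I * (ξ j : ℂ)‖ = |η j| := by
        rw [mul_add, add_sub_cancel_left]; simp
      rw [h2]
      linarith [abs_le_snorm_pow hs η j]
  have := norm_prod_sub_le Finset.univ (fun j => (h j).1) (fun j => (h j).2)
  rw [prod_pow_sdeg, prod_pow_sdeg] at this
  exact this

include hs in
theorem norm_cmono_le (k : Fin d → ℕ) (ξ η : Fin d → ℝ) :
    ‖cmono k (fun j => (ξ j : ℂ) + Complex.I * (η j : ℂ))‖ ≤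
      (snorm s ξ + snorm s η) ^ sdeg s k := by
  have h := norm_cmono_sub_le hs k ξ η
  calc _ = ‖cmono k (fun j => (ξ j : ℂ)) + (cmono k (fun j => (ξ j : ℂ) +
        Complex.I * (η j : ℂ)) - cmono k (fun j => (ξ j : ℂ)))‖ := by congr 1; ring
    _ ≤ _ := norm_add_le _ _
    _ ≤ _ := by linarith [h.1, h.2]

theorem abs_rpow_div_eq (N : ℕ) (n : ℕ) (u : ℝ) :
    |u| ^ ((N : ℝ) / n) = (|u| ^ (1 / (n : ℝ))) ^ N := by
  rw [← Real.rpow_natCast, ← Real.rpow_mul (abs_nonneg u)]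
  congr 1; ring

theorem powSum_le_snorm_pow (hN0 : 0 < N) (ξ : Fin d → ℝ) : powSum s N ξ ≤ snorm s ξ ^ N := by
  obtain ⟨n, rfl⟩ := Nat.exists_eq_succ_of_ne_zero hN0.ne'
  unfold powSum
  simp_rw [abs_rpow_div_eq, pow_succ]
  have h : ∀ j, |ξ j| ^ (1 / (s j : ℝ)) ≤ snorm s ξ := fun j =>
    Finset.single_le_sum (f := fun i => |ξ i| ^ (1 / (s i : ℝ))) (fun _ _ => by positivity)
      (Finset.mem_univ j)
  calc _ ≤ ∑ j, snorm s ξ ^ n * |ξ j| ^ (1 / (s j : ℝ)) :=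
        Finset.sum_le_sum fun j _ => mul_le_mul_of_nonneg_right
          (pow_le_pow_left₀ (by positivity) (h j) n) (by positivity)
    _ = _ := by rw [← Finset.mul_sum, ← snorm]

theorem snorm_pow_le_powSum (hN0 : 0 < N) (ξ : Fin d → ℝ) :
    snorm s ξ ^ N ≤ d ^ N * powSum s N ξ := by
  rcases Nat.eq_zero_or_pos d with rfl | hd
  · simp [snorm, powSum, hN0.ne']
  obtain ⟨n, rfl⟩ := Nat.exists_eq_succ_of_ne_zero hN0.ne'
  unfold powSum
  simp_rw [abs_rpow_div_eq]
  have h := pow_sum_div_card_le_sum_pow (s := Finset.univ)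
    (f := fun j => |ξ j| ^ (1 / (s j : ℝ))) (n := n) fun _ _ => by positivity
  rw [div_le_iff₀ (by simpa using pow_pos (show (0 : ℝ) < d by exact_mod_cast hd) n)] at h
  simp only [Finset.card_univ, Fintype.card_fin] at h
  rw [snorm]
  refine h.trans ?_
  rw [mul_comm]
  refine mul_le_mul_of_nonneg_right ?_ (Finset.sum_nonneg fun _ _ => by positivity)
  exact pow_le_pow_right₀ (by exact_mod_cast hd) (Nat.le_succ n)

/-- A mean value estimate. The extra factor `1 + X + Y` avoids the exponent `m - 1`, and since it is
at least one, lower degrees can later be raised to `N`. -/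
theorem add_pow_sub_le {X Y : ℝ} (hX : 0 ≤ X) (hY : 0 ≤ Y) (m : ℕ) :
    (1 + X + Y) * ((X + Y) ^ m - X ^ m) ≤ m * Y * (1 + X + Y) ^ m := by
  induction m with
  | zero => simp
  | succ m ih =>
    have h1 : X ^ m ≤ (1 + X + Y) ^ m := by gcongr; linarith
    have h2 : 0 ≤ m * Y * (1 + X + Y) ^ m := by positivity
    calc (1 + X + Y) * ((X + Y) ^ (m + 1) - X ^ (m + 1))
        = (X + Y) * ((1 + X + Y) * ((X + Y) ^ m - X ^ m)) + (1 + X + Y) * Y * X ^ m := by ring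
      _ ≤ (X + Y) * (m * Y * (1 + X + Y) ^ m) + (1 + X + Y) * Y * (1 + X + Y) ^ m := by gcongr
      _ ≤ (1 + X + Y) * (m * Y * (1 + X + Y) ^ m) + (1 + X + Y) * Y * (1 + X + Y) ^ m := by
          gcongr; linarith
      _ = _ := by push_cast; ring

/-- After the mean value bound `N * Y * S ^ (N - 1)` with `S = 1 + X + Y`, either `Y ≤ ε * S` or `S
≤ Y / ε`; this dichotomy takes the place of Young's inequality. -/
theorem add_pow_sub_le_young {X Y ε : ℝ} (hX : 0 ≤ X) (hY : 0 ≤ Y) (hε : 0 < ε) {m N : ℕ}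
    (hN0 : 0 < N) (hm : m ≤ N) :
    (X + Y) ^ m - X ^ m ≤ N * (ε * (1 + X + Y) ^ N + ε * (Y / ε) ^ N) := by
  obtain ⟨n, rfl⟩ := Nat.exists_eq_succ_of_ne_zero hN0.ne'
  set S := 1 + X + Y with hS
  have hS1 : 1 ≤ S := by linarith
  have h1 : S * ((X + Y) ^ m - X ^ m) ≤ S * ((n.succ : ℕ) * (Y * S ^ n)) := by
    refine (add_pow_sub_le hX hY m).trans ?_
    rw [← hS]
    calc (m : ℝ) * Y * S ^ m ≤ (n.succ : ℕ) * Y * S ^ n.succ := by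
          gcongr
      _ = _ := by rw [pow_succ]; ring
  have h2 := le_of_mul_le_mul_left h1 (by linarith)
  refine h2.trans (mul_le_mul_of_nonneg_left ?_ (by positivity))
  rcases le_total Y (ε * S) with h | h
  · have : 0 ≤ ε * (Y / ε) ^ n.succ := by positivity
    calc Y * S ^ n ≤ ε * S * S ^ n := by gcongr
      _ = ε * S ^ n.succ := by rw [pow_succ]; ring
      _ ≤ _ := by linarith
  · have h3 : S ≤ Y / ε := by rw [le_div_iff₀ hε]; linarith
    have : 0 ≤ ε * S ^ n.succ := by positivity
    calc Y * S ^ n ≤ Y * (Y / ε) ^ n := by gcongr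
      _ = ε * (Y / ε) ^ n.succ := by rw [pow_succ]; field_simp
      _ ≤ _ := by linarith

theorem one_add_add_pow_le {X Y : ℝ} (hX : 0 ≤ X) (hY : 0 ≤ Y) (N : ℕ) :
    (1 + X + Y) ^ N ≤ 3 ^ N * (1 + X ^ N + Y ^ N) := by
  have h : ∀ Z : ℝ, 1 ≤ Z → X ≤ Z → Y ≤ Z → (1 + X + Y) ^ N ≤ 3 ^ N * Z ^ N := fun Z h1 h2 h3 => by
    rw [← mul_pow]; gcongr; linarith
  have hXN : 0 ≤ X ^ N := by positivity
  have hYN : 0 ≤ Y ^ N := by positivity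
  rcases le_total X Y with h1 | h1
  · rcases le_total Y 1 with h2 | h2
    · refine (h 1 le_rfl (h1.trans h2) h2).trans ?_
      gcongr; rw [one_pow]; linarith
    · refine (h Y h2 h1 le_rfl).trans ?_
      gcongr; linarith
  · rcases le_total X 1 with h2 | h2
    · refine (h 1 le_rfl h2 (h1.trans h2)).trans ?_
      gcongr; rw [one_pow]; linarith
    · refine (h X h2 le_rfl h1).trans ?_
      gcongr; linarith

include hs in
-- Parabolicity is stable under imaginary shifts. The symbol at `ξ + iη` differs from its value at
-- `ξ` by a small multiple of `‖ξ‖ ^ N` and a large multiple of `1 + ‖η‖ ^ N`; half of `δ` absorbs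
-- the former. The parameter `ε` is tuned to the number of monomials, to `A` and to `N`, so `C`
-- serves all symbols of the class.
theorem exists_re_csymb_le (hN0 : 0 < N) {δ A : ℝ} (hδ : 0 < δ) (hA : 0 ≤ A) :
    ∃ C : ℝ, 0 < C ∧ ∀ p : (Fin d → ℕ) → ℂ, ParabolicSymbol s N δ A p → ∀ ξ η : Fin d → ℝ,
      (csymb s N p fun j => (ξ j : ℂ) + Complex.I * (η j : ℂ)).re ≤
        -(δ / 2) * powSum s N ξ + C * (1 + powSum s N η) := by
  set n : ℝ := ((multiIndices s N).card : ℝ) with hn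
  have hn0 : 0 ≤ n := by positivity
  set W : ℝ := n * A * N with hW
  have hW0 : 0 ≤ W := by positivity
  set ε : ℝ := δ / (2 * 3 ^ N * (W + 1)) with hε
  have hε0 : 0 < ε := by positivity
  refine ⟨δ / 2 + (δ / 2 + W * ε * (1 / ε) ^ N) * d ^ N, by positivity, fun p hp ξ η => ?_⟩
  set X := snorm s ξ with hX
  set Y := snorm s η with hY
  have hX0 : 0 ≤ X := snorm_nonneg _
  have hY0 : 0 ≤ Y := snorm_nonneg _
  set ζ : Fin d → ℂ := fun j => (ξ j : ℂ) + Complex.I * (η j : ℂ)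
  have h1 : ‖csymb s N p ζ - csymb s N p (fun j => (ξ j : ℂ))‖ ≤
      W * (ε * (1 + X + Y) ^ N + ε * (Y / ε) ^ N) := by
    unfold csymb
    rw [← Finset.sum_sub_distrib]
    calc _ ≤ ∑ k ∈ multiIndices s N, A * (N * (ε * (1 + X + Y) ^ N + ε * (Y / ε) ^ N)) := by
          refine norm_sum_le_of_le _ fun k hk => ?_
          rw [← mul_sub, norm_mul]
          refine mul_le_mul (hp.bound k hk) ((norm_cmono_sub_le hs k ξ η).2.trans
            (add_pow_sub_le_young hX0 hY0 hε0 hN0 ((mem_multiIndices hs).1 hk))) (norm_nonneg _) hA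
      _ = _ := by rw [Finset.sum_const, nsmul_eq_mul, ← hn]; ring
  have h2 : (csymb s N p ζ).re ≤ -δ * X ^ N + W * (ε * (1 + X + Y) ^ N + ε * (Y / ε) ^ N) := by
    have h3 := (Complex.re_le_norm (csymb s N p ζ - csymb s N p (fun j => (ξ j : ℂ)))).trans h1
    rw [Complex.sub_re] at h3
    linarith [hp.petrowski ξ]
  have h3 : W * (ε * (1 + X + Y) ^ N) ≤ δ / 2 * (1 + X ^ N + Y ^ N) := by
    have h4 : W * ε * 3 ^ N ≤ δ / 2 := by
      rw [hε, mul_div_assoc', div_mul_eq_mul_div, div_le_div_iff₀ (by positivity) (by norm_num)]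
      have : 0 ≤ δ * 3 ^ N := by positivity
      nlinarith
    calc W * (ε * (1 + X + Y) ^ N) ≤ W * (ε * (3 ^ N * (1 + X ^ N + Y ^ N))) := by
          gcongr; exact one_add_add_pow_le hX0 hY0 N
      _ = W * ε * 3 ^ N * (1 + X ^ N + Y ^ N) := by ring
      _ ≤ _ := by gcongr
  have h4 : W * (ε * (Y / ε) ^ N) = W * ε * (1 / ε) ^ N * Y ^ N := by
    rw [div_pow, div_pow]; ring
  have h5 := powSum_le_snorm_pow (s := s) hN0 ξ
  have h6 := snorm_pow_le_powSum (s := s) hN0 η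
  have h7 := powSum_nonneg (s := s) (N := N) η
  have h8 : 0 ≤ W * ε * (1 / ε) ^ N := by positivity
  calc (csymb s N p ζ).re ≤ -(δ / 2) * X ^ N + δ / 2 + (δ / 2 + W * ε * (1 / ε) ^ N) * Y ^ N := by
        rw [mul_add] at h2; linarith
    _ ≤ -(δ / 2) * powSum s N ξ + δ / 2 + (δ / 2 + W * ε * (1 / ε) ^ N) *
        (d ^ N * powSum s N η) := by
        have : -(δ / 2) * X ^ N ≤ -(δ / 2) * powSum s N ξ := by nlinarith
        gcongr
    _ ≤ _ := by
        have h9 : 0 ≤ (δ / 2 + W * ε * (1 / ε) ^ N) * d ^ N := by positivity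
        nlinarith

/-- In the scaled variable `u = t ^ (1 / N) * Z` a power is dominated by the exponential of a small
multiple of `1 + u`, hence of `u ^ N`, and `u ^ N` is controlled by `t` times the power sums.
Undoing the scaling produces `t ^ (-m / N)`. -/
theorem exists_rpow_mul_pow_le (hN0 : 0 < N) (M : ℕ) {ε : ℝ} (hε : 0 < ε) :
    ∃ C : ℝ, 0 < C ∧ ∀ m ≤ M, ∀ t : ℝ, 0 < t → ∀ ξ η : Fin d → ℝ,
      (snorm s ξ + snorm s η) ^ m ≤ C * t ^ (-(m : ℝ) / N) *
        Real.exp (ε * t * (powSum s N ξ + powSum s N η)) := by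
  set ε' : ℝ := ε / (2 ^ N * (d ^ N + 1)) with hε'
  have hε0 : 0 < ε' := by positivity
  refine ⟨(M.factorial / ε' ^ M) * Real.exp (2 * ε'), by positivity, fun m hm t ht ξ η => ?_⟩
  set Z := snorm s ξ + snorm s η with hZ
  have hX0 : 0 ≤ snorm s ξ := snorm_nonneg _
  have hY0 : 0 ≤ snorm s η := snorm_nonneg _
  have hZ0 : 0 ≤ Z := add_nonneg hX0 hY0
  set u := t ^ (1 / (N : ℝ)) * Z with hu
  have hu0 : 0 ≤ u := by positivity
  have hN' : (N : ℝ) ≠ 0 := by exact_mod_cast hN0.ne'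
  have huN : u ^ N ≤ t * (2 ^ N * (d ^ N + 1) * (powSum s N ξ + powSum s N η)) := by
    rw [hu, mul_pow, ← Real.rpow_natCast (t ^ (1 / (N : ℝ))), ← Real.rpow_mul ht.le,
      one_div_mul_cancel hN', Real.rpow_one]
    gcongr
    have h1 : Z ^ N ≤ 2 ^ N * (snorm s ξ ^ N + snorm s η ^ N) := by
      have hXN : 0 ≤ snorm s ξ ^ N := by positivity
      have hYN : 0 ≤ snorm s η ^ N := by positivity
      have h3 : Z ^ N ≤ (2 * max (snorm s ξ) (snorm s η)) ^ N := by
        gcongr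
        linarith [le_max_left (snorm s ξ) (snorm s η), le_max_right (snorm s ξ) (snorm s η)]
      refine h3.trans ?_
      rw [mul_pow]
      gcongr
      rcases max_cases (snorm s ξ) (snorm s η) with h | h <;> rw [h.1] <;> linarith
    have h2 : snorm s ξ ^ N + snorm s η ^ N ≤ (d ^ N + 1) * (powSum s N ξ + powSum s N η) := by
      have := snorm_pow_le_powSum (s := s) hN0 ξ
      have := snorm_pow_le_powSum (s := s) hN0 η
      have := powSum_nonneg (s := s) (N := N) ξ
      have := powSum_nonneg (s := s) (N := N) η
      linarith
    calc _ ≤ _ := h1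
      _ ≤ 2 ^ N * ((d ^ N + 1) * (powSum s N ξ + powSum s N η)) := by gcongr
      _ = _ := by ring
  have h1 : u ^ m ≤ (M.factorial / ε' ^ M) * Real.exp (ε' * (1 + u)) := by
    calc u ^ m ≤ (1 + u) ^ m := by gcongr; linarith
      _ ≤ (1 + u) ^ M := pow_le_pow_right₀ (by linarith) hm
      _ = (M.factorial / ε' ^ M) * ((ε' * (1 + u)) ^ M / M.factorial) := by
          rw [mul_pow]; field_simp
      _ ≤ _ := by
          gcongr
          exact Real.pow_div_factorial_le_exp _ (by positivity) _
  have h2 : u ≤ 1 + u ^ N := by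
    rcases le_total u 1 with h | h
    · have : 0 ≤ u ^ N := by positivity
      linarith
    · have := le_self_pow₀ h hN0.ne'
      linarith
  have h3 : ε' * (1 + u) ≤ 2 * ε' + ε * t * (powSum s N ξ + powSum s N η) := by
    calc ε' * (1 + u) ≤ ε' * (2 + t * (2 ^ N * (d ^ N + 1) * (powSum s N ξ + powSum s N η))) :=
          mul_le_mul_of_nonneg_left (by linarith) hε0.le
      _ = _ := by rw [hε']; field_simp
  have h4 : Z ^ m = t ^ (-(m : ℝ) / N) * u ^ m := by
    rw [hu, mul_pow, ← Real.rpow_natCast (t ^ (1 / (N : ℝ))), ← Real.rpow_mul ht.le, ← mul_assoc,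
      ← Real.rpow_add ht, show -(m : ℝ) / N + 1 / N * m = 0 by ring, Real.rpow_zero, one_mul]
  rw [h4]
  calc t ^ (-(m : ℝ) / N) * u ^ m ≤ t ^ (-(m : ℝ) / N) * ((M.factorial / ε' ^ M) *
        Real.exp (2 * ε' + ε * t * (powSum s N ξ + powSum s N η))) := by
        gcongr; exact h1.trans (by gcongr)
    _ = _ := by rw [Real.exp_add]; ring

theorem norm_exp_sub_exp_le {a b : ℂ} {M : ℝ} (ha : a.re ≤ M) (hb : b.re ≤ M) :
    ‖Complex.exp a - Complex.exp b‖ ≤ Real.exp M * ‖a - b‖ := by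
  refine Convex.norm_image_sub_le_of_norm_deriv_le (s := {z : ℂ | z.re ≤ M})
    (fun z _ => Complex.differentiable_exp z) (fun z hz => ?_) ?_ hb ha
  · rw [Complex.deriv_exp, Complex.norm_exp]
    exact Real.exp_le_exp.2 hz
  · exact convex_halfSpace_re_le M

include hs in
-- The decay budget: parabolicity supplies `δ / 2`; the monomial uses `δ / 8`, and the factor `t *
-- (1 + powSum ξ + powSum η)` from the difference of two exponentials uses another `δ / 8`, so `δ /
-- 4` remains in both bounds.
theorem exists_norm_amp_le (hN0 : 0 < N) {δ A : ℝ} (hδ : 0 < δ) (hA : 0 ≤ A) (M : ℕ) :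
    ∃ C b : ℝ, 0 < C ∧ 0 < b ∧ ∀ p : (Fin d → ℕ) → ℂ, ParabolicSymbol s N δ A p →
      ∀ k : Fin d → ℕ, sdeg s k ≤ M → ∀ t : ℝ, 0 < t → ∀ ξ η : Fin d → ℝ,
      ‖amp s N p k t (fun j => (ξ j : ℂ) + Complex.I * (η j : ℂ))‖ ≤
        C * t ^ (-(sdeg s k : ℝ) / N) *
          Real.exp (-(δ / 4 * t) * powSum s N ξ + b * t * (1 + powSum s N η)) ∧
      ∀ p' : (Fin d → ℕ) → ℂ, ParabolicSymbol s N δ A p' → ∀ h : ℝ,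
        (∀ l ∈ multiIndices s N, ‖p l - p' l‖ ≤ h) →
        ‖amp s N p k t (fun j => (ξ j : ℂ) + Complex.I * (η j : ℂ)) -
          amp s N p' k t (fun j => (ξ j : ℂ) + Complex.I * (η j : ℂ))‖ ≤
        C * h * t ^ (-(sdeg s k : ℝ) / N) *
          Real.exp (-(δ / 4 * t) * powSum s N ξ + b * t * (1 + powSum s N η)) := by
  obtain ⟨C₁, hC₁, hre⟩ := exists_re_csymb_le (s := s) hs hN0 hδ hA
  obtain ⟨C₂, hC₂, hpw⟩ := exists_rpow_mul_pow_le (s := s) hN0 M (show 0 < δ / 8 by positivity)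
  set n : ℝ := ((multiIndices s N).card : ℝ) with hn
  have hn0 : 0 ≤ n := by positivity
  set D : ℝ := 3 ^ N * (d ^ N + 1) * (8 / δ) with hD
  have hD0 : 0 ≤ D := by positivity
  refine ⟨C₂ * (1 + n * D), C₁ + δ, by positivity, by positivity, fun p hp k hk t ht ξ η => ?_⟩
  set ζ : Fin d → ℂ := fun j => (ξ j : ℂ) + Complex.I * (η j : ℂ) with hζ
  set q := powSum s N ξ
  set r := powSum s N η
  have hq : 0 ≤ q := powSum_nonneg _
  have hr : 0 ≤ r := powSum_nonneg _
  have hm : ‖cmono k ζ‖ ≤ C₂ * t ^ (-(sdeg s k : ℝ) / N) * Real.exp (δ / 8 * t * (q + r)) :=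
    (norm_cmono_le hs k ξ η).trans (hpw _ hk t ht ξ η)
  have hre' : ∀ p : (Fin d → ℕ) → ℂ, ParabolicSymbol s N δ A p →
      (t * csymb s N p ζ).re ≤ t * (-(δ / 2) * q + C₁ * (1 + r)) := fun p hp => by
    rw [Complex.re_ofReal_mul]
    exact mul_le_mul_of_nonneg_left (hre p hp ξ η) ht.le
  have hT : 0 ≤ C₂ * t ^ (-(sdeg s k : ℝ) / N) := by positivity
  have hδt : 0 < δ * t := by positivity
  constructor
  · unfold amp
    rw [norm_mul, Complex.norm_exp]
    calc _ ≤ (C₂ * t ^ (-(sdeg s k : ℝ) / N) * Real.exp (δ / 8 * t * (q + r))) *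
          Real.exp (t * (-(δ / 2) * q + C₁ * (1 + r))) := by
          gcongr
          exact hre' p hp
      _ = C₂ * t ^ (-(sdeg s k : ℝ) / N) * Real.exp (δ / 8 * t * (q + r) +
          t * (-(δ / 2) * q + C₁ * (1 + r))) := by rw [Real.exp_add]; ring
      _ ≤ C₂ * t ^ (-(sdeg s k : ℝ) / N) *
          Real.exp (-(δ / 4 * t) * q + (C₁ + δ) * t * (1 + r)) := by
          refine mul_le_mul_of_nonneg_left (Real.exp_le_exp.2 ?_) hT
          nlinarith [mul_nonneg hδt.le hq, mul_nonneg hδt.le hr]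
      _ ≤ _ := by
          gcongr
          exact le_mul_of_one_le_right hC₂.le (by nlinarith)
  · intro p' hp' h hh
    have h0 : n * h = 0 ∨ 0 ≤ h := by
      rcases (multiIndices s N).eq_empty_or_nonempty with he | ⟨l, hl⟩
      · left; simp [hn, he]
      · right; exact (norm_nonneg _).trans (hh l hl)
    have hnh : 0 ≤ n * h := by rcases h0 with h0 | h0 <;> [exact h0.ge; positivity]
    have hh0 : 0 ≤ h := by
      refine (norm_nonneg _).trans (hh 0 ((mem_multiIndices hs).2 ?_))
      simp [sdeg]
    have h1 : ‖t * csymb s N p ζ - t * csymb s N p' ζ‖ ≤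
        n * h * (D * Real.exp (δ / 8 * t * (1 + q + r))) := by
      rw [← mul_sub, norm_mul, Complex.norm_real, Real.norm_of_nonneg ht.le]
      have h2 : ‖csymb s N p ζ - csymb s N p' ζ‖ ≤ n * h * (1 + snorm s ξ + snorm s η) ^ N := by
        unfold csymb
        rw [← Finset.sum_sub_distrib]
        calc _ ≤ ∑ l ∈ multiIndices s N, h * (1 + snorm s ξ + snorm s η) ^ N := by
              refine norm_sum_le_of_le _ fun l hl => ?_
              rw [← sub_mul, norm_mul]
              have hX0 : 0 ≤ snorm s ξ := snorm_nonneg _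
              have hY0 : 0 ≤ snorm s η := snorm_nonneg _
              refine mul_le_mul (hh l hl) ((norm_cmono_le hs l ξ η).trans ?_) (norm_nonneg _) hh0
              calc (snorm s ξ + snorm s η) ^ sdeg s l ≤ (1 + snorm s ξ + snorm s η) ^ sdeg s l := by
                    gcongr; linarith
                _ ≤ _ := pow_le_pow_right₀ (by linarith) ((mem_multiIndices hs).1 hl)
          _ = _ := by rw [Finset.sum_const, nsmul_eq_mul, ← hn]; ring
      have h3 : (1 + snorm s ξ + snorm s η) ^ N ≤ 3 ^ N * (d ^ N + 1) * (1 + q + r) := by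
        refine (one_add_add_pow_le (snorm_nonneg _) (snorm_nonneg _) N).trans ?_
        rw [mul_assoc]
        gcongr
        have h5 := snorm_pow_le_powSum (s := s) hN0 ξ
        have h6 := snorm_pow_le_powSum (s := s) hN0 η
        have h7 : (0 : ℝ) ≤ d ^ N := by positivity
        change _ ≤ _ * q at h5
        change _ ≤ _ * r at h6
        nlinarith
      have h4 : t * (1 + q + r) ≤ 8 / δ * Real.exp (δ / 8 * t * (1 + q + r)) := by
        have := Real.add_one_le_exp (δ / 8 * t * (1 + q + r))
        rw [div_mul_eq_mul_div, le_div_iff₀ hδ]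
        nlinarith
      calc t * ‖csymb s N p ζ - csymb s N p' ζ‖
          ≤ t * (n * h * (3 ^ N * (d ^ N + 1) * (1 + q + r))) := by
            gcongr; exact h2.trans (by gcongr)
        _ = n * h * (3 ^ N * (d ^ N + 1) * (t * (1 + q + r))) := by ring
        _ ≤ n * h * (3 ^ N * (d ^ N + 1) * (8 / δ * Real.exp (δ / 8 * t * (1 + q + r)))) := by
            gcongr
        _ = _ := by rw [hD]; ring
    have h2 := (norm_exp_sub_exp_le (hre' p hp) (hre' p' hp')).trans
      (mul_le_mul_of_nonneg_left h1 (Real.exp_pos _).le)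
    unfold amp
    rw [← mul_sub, norm_mul]
    calc _ ≤ (C₂ * t ^ (-(sdeg s k : ℝ) / N) * Real.exp (δ / 8 * t * (q + r))) *
          (Real.exp (t * (-(δ / 2) * q + C₁ * (1 + r))) *
            (n * h * (D * Real.exp (δ / 8 * t * (1 + q + r))))) := by gcongr
      _ = C₂ * t ^ (-(sdeg s k : ℝ) / N) * (n * h * D) * Real.exp (δ / 8 * t * (q + r) +
          (t * (-(δ / 2) * q + C₁ * (1 + r)) + δ / 8 * t * (1 + q + r))) := by
          rw [Real.exp_add, Real.exp_add]; ring
      _ ≤ C₂ * t ^ (-(sdeg s k : ℝ) / N) * (n * h * D) *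
          Real.exp (-(δ / 4 * t) * q + (C₁ + δ) * t * (1 + r)) := by
          refine mul_le_mul_of_nonneg_left (Real.exp_le_exp.2 ?_) (by positivity)
          nlinarith [mul_nonneg hδt.le hq, mul_nonneg hδt.le hr]
      _ ≤ C₂ * t ^ (-(sdeg s k : ℝ) / N) * (h + n * h * D) *
          Real.exp (-(δ / 4 * t) * q + (C₁ + δ) * t * (1 + r)) := by
          gcongr
          linarith
      _ = _ := by ring

/-- Gaussian-type bounds for the constant-coefficient kernels, and their dependence on the
coefficients. -/
theorem exists_norm_fundKer_le (hs : ∀ j, 0 < s j) (hN : ∀ j, s j < N) (hN0 : 0 < N) {δ A : ℝ}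
    (hδ : 0 < δ) (hA : 0 ≤ A) (M : ℕ) :
    ∃ C c γ : ℝ, 0 < C ∧ 0 < c ∧ 0 < γ ∧ ∀ p : (Fin d → ℕ) → ℂ, ParabolicSymbol s N δ A p →
      ∀ k : Fin d → ℕ, sdeg s k ≤ M → ∀ t : ℝ, 0 < t → ∀ x : Fin d → ℝ,
      ‖fundKer s N p k t x‖ ≤
        C * Real.exp (γ * t) * t ^ (-(sdeg s k : ℝ) / N) * maj s N c t x ∧
      ∀ p' : (Fin d → ℕ) → ℂ, ParabolicSymbol s N δ A p' → ∀ h : ℝ,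
        (∀ l ∈ multiIndices s N, ‖p l - p' l‖ ≤ h) →
        ‖fundKer s N p k t x - fundKer s N p' k t x‖ ≤
          C * h * Real.exp (γ * t) * t ^ (-(sdeg s k : ℝ) / N) * maj s N c t x := by
  obtain ⟨C₁, b, hC₁, hb, hamp⟩ := exists_norm_amp_le (s := s) hs hN0 hδ hA M
  obtain ⟨C₂, c, γ, hC₂, hc, hγ, hint⟩ := norm_integral_mul_exp_le (s := s) (N := N) hs hN
    (show 0 < δ / 4 by positivity) hb
  set w : ℝ := ((2 * Real.pi : ℝ) ^ d)⁻¹ with hw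
  have hw0 : 0 < w := by have := Real.pi_pos; positivity
  have hwn : ‖((((2 * Real.pi : ℝ) ^ d)⁻¹ : ℝ) : ℂ)‖ = w := by
    rw [Complex.norm_real, Real.norm_of_nonneg hw0.le]
  refine ⟨w * C₂ * C₁, c, γ, by positivity, hc, hγ, fun p hp k hk t ht x => ⟨?_, ?_⟩⟩
  · have h1 := hint t ht (amp s N p k t) (differentiable_amp p k t)
      (C₁ * t ^ (-(sdeg s k : ℝ) / N)) (by positivity) (fun ξ η => (hamp p hp k hk t ht ξ η).1) x
    unfold fundKer
    rw [norm_mul, hwn]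
    calc _ ≤ w * _ := mul_le_mul_of_nonneg_left h1 hw0.le
      _ = _ := by ring
  · intro p' hp' h hh
    have hh0 : 0 ≤ h := by
      refine (norm_nonneg _).trans (hh 0 ((mem_multiIndices hs).2 ?_))
      simp [sdeg]
    -- The difference of two amplitudes is again entire and carries the factor `h`, so the same
    -- contour estimate gives Lipschitz dependence on the coefficients with the full decay in `x`.
    have h1 := hint t ht (fun ζ => amp s N p k t ζ - amp s N p' k t ζ)
      ((differentiable_amp p k t).sub (differentiable_amp p' k t))
      (C₁ * h * t ^ (-(sdeg s k : ℝ) / N)) (by positivity)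
      (fun ξ η => (hamp p hp k hk t ht ξ η).2 p' hp' h hh) x
    have hi : ∀ p : (Fin d → ℕ) → ℂ, ParabolicSymbol s N δ A p →
        Integrable fun ξ : Fin d → ℝ => amp s N p k t (fun j => (ξ j : ℂ)) *
          Complex.exp (Complex.I * ∑ j, (x j : ℂ) * (ξ j : ℂ)) := fun p hp => by
      refine Integrable.mono' ((integrable_exp_neg_powSum hs hN
        (show 0 < δ / 4 * t by positivity)).const_mul
        (C₁ * t ^ (-(sdeg s k : ℝ) / N) * Real.exp (b * t))) ?_ (Eventually.of_forall fun ξ => ?_)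
      · refine Continuous.aestronglyMeasurable ?_
        refine ((differentiable_amp p k t).continuous.comp (by fun_prop)).mul ?_
        fun_prop
      · have h2 := (hamp p hp k hk t ht ξ 0).1
        have h3 : powSum s N (0 : Fin d → ℝ) = 0 := by
          unfold powSum
          refine Finset.sum_eq_zero fun j _ => ?_
          have h4 : (0 : ℝ) < s j := by exact_mod_cast hs j
          have h5 : (0 : ℝ) < N := by exact_mod_cast hN0
          rw [Pi.zero_apply, abs_zero, Real.zero_rpow (by positivity)]
        rw [norm_mul, Complex.norm_exp]
        simp only [Pi.zero_apply, Complex.ofReal_zero, mul_zero, add_zero, h3, mul_one] at h2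
        have h4 : (Complex.I * ∑ j, (x j : ℂ) * (ξ j : ℂ)).re = 0 := by
          simp [Complex.mul_re]
        rw [h4, Real.exp_zero, mul_one]
        refine h2.trans (le_of_eq ?_)
        rw [Real.exp_add]; ring
    unfold fundKer
    rw [← mul_sub, ← integral_sub (hi p hp) (hi p' hp'), norm_mul, hwn]
    simp_rw [← sub_mul]
    calc _ ≤ w * _ := mul_le_mul_of_nonneg_left h1 hw0.le
      _ = _ := by ring

end symbols

/-! ### Derivatives, continuity and mass of the constant-coefficient kernels -/

section regularity

variable {d : ℕ} {s : Fin d → ℕ} {N : ℕ}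

/-- The integrand in the definition of `fundKer`. -/
def fundInt {d : ℕ} (s : Fin d → ℕ) (N : ℕ) (p : (Fin d → ℕ) → ℂ) (k : Fin d → ℕ) (t : ℝ)
    (x ξ : Fin d → ℝ) : ℂ :=
  amp s N p k t (fun j => (ξ j : ℂ)) * Complex.exp (Complex.I * ∑ j, (x j : ℂ) * (ξ j : ℂ))

/-- At real frequencies the modulus does not depend on `x`, so the integrand at one point dominates
the integrands at all points. -/
theorem norm_fundInt (p : (Fin d → ℕ) → ℂ) (k : Fin d → ℕ) (t : ℝ) (x ξ : Fin d → ℝ) :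
    ‖fundInt s N p k t x ξ‖ = ‖amp s N p k t (fun j => (ξ j : ℂ))‖ := by
  have h : (Complex.I * ∑ j, (x j : ℂ) * (ξ j : ℂ)).re = 0 := by simp [Complex.mul_re]
  rw [fundInt, norm_mul, Complex.norm_exp, h, Real.exp_zero, mul_one]

theorem cmono_add (k l : Fin d → ℕ) (ζ : Fin d → ℂ) :
    cmono (k + l) ζ = cmono k ζ * cmono l ζ := by
  simp [cmono, pow_add, Finset.prod_mul_distrib]

theorem cmono_single (j : Fin d) (ζ : Fin d → ℂ) :
    cmono (Pi.single j 1) ζ = Complex.I * ζ j := by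
  unfold cmono
  rw [Finset.prod_eq_single j]
  · simp
  · intro i _ hi; simp [hi]
  · simp

theorem cmono_zero_right {k : Fin d → ℕ} (hk : k ≠ 0) : cmono k (0 : Fin d → ℂ) = 0 := by
  obtain ⟨j, hj⟩ := Function.ne_iff.1 hk
  exact Finset.prod_eq_zero (Finset.mem_univ j) (by simpa using hj)

theorem continuous_fundInt (p : (Fin d → ℕ) → ℂ) (k : Fin d → ℕ) (ξ : Fin d → ℝ) :
    Continuous fun q : ℝ × (Fin d → ℝ) => fundInt s N p k q.1 q.2 ξ := by
  unfold fundInt amp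
  fun_prop

theorem continuous_fundInt_right (p : (Fin d → ℕ) → ℂ) (k : Fin d → ℕ) (t : ℝ) (x : Fin d → ℝ) :
    Continuous (fundInt s N p k t x) := by
  unfold fundInt
  refine ((differentiable_amp p k t).continuous.comp (by fun_prop)).mul ?_
  fun_prop

theorem powSum_zero (hs : ∀ j, 0 < s j) (hN0 : 0 < N) : powSum s N (0 : Fin d → ℝ) = 0 := by
  unfold powSum
  refine Finset.sum_eq_zero fun j _ => ?_
  have h4 : (0 : ℝ) < s j := by exact_mod_cast hs j
  have h5 : (0 : ℝ) < N := by exact_mod_cast hN0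
  rw [Pi.zero_apply, abs_zero, Real.zero_rpow (by positivity)]

variable (hs : ∀ j, 0 < s j) (hN : ∀ j, s j < N) (hN0 : 0 < N) {δ A : ℝ} (hδ : 0 < δ)
  (hA : 0 ≤ A) {p : (Fin d → ℕ) → ℂ} (hp : ParabolicSymbol s N δ A p)

include hs hN0 hδ hA hp in
theorem exists_norm_fundInt_le (k : Fin d → ℕ) : ∃ C b : ℝ, 0 < C ∧ 0 < b ∧
    ∀ t : ℝ, 0 < t → ∀ x ξ : Fin d → ℝ, ‖fundInt s N p k t x ξ‖ ≤
      C * t ^ (-(sdeg s k : ℝ) / N) * Real.exp (b * t) *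
        Real.exp (-(δ / 4 * t) * powSum s N ξ) := by
  obtain ⟨C, b, hC, hb, h⟩ := exists_norm_amp_le (s := s) hs hN0 hδ hA (sdeg s k)
  refine ⟨C, b, hC, hb, fun t ht x ξ => ?_⟩
  have h2 := (h p hp k le_rfl t ht ξ 0).1
  simp only [Pi.zero_apply, Complex.ofReal_zero, mul_zero, add_zero, powSum_zero hs hN0,
    mul_one] at h2
  rw [norm_fundInt]
  refine h2.trans (le_of_eq ?_)
  rw [Real.exp_add]; ring

include hs hN hN0 hδ hA hp in
theorem integrable_fundInt (k : Fin d → ℕ) {t : ℝ} (ht : 0 < t) (x : Fin d → ℝ) :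
    Integrable (fundInt s N p k t x) := by
  obtain ⟨C, b, hC, hb, h⟩ := exists_norm_fundInt_le hs hN0 hδ hA hp k
  exact ((integrable_exp_neg_powSum hs hN (show 0 < δ / 4 * t by positivity)).const_mul _).mono'
    (continuous_fundInt_right p k t x).aestronglyMeasurable (Eventually.of_forall fun ξ => h t ht x ξ)

include hs hN0 hδ hA hp in
theorem exists_norm_fundInt_le_of_mem (k : Fin d → ℕ) {t₀ : ℝ} (ht₀ : 0 < t₀) : ∃ C : ℝ,
    ∀ t ∈ Ioo (t₀ / 2) (2 * t₀), ∀ x ξ : Fin d → ℝ, ‖fundInt s N p k t x ξ‖ ≤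
      C * Real.exp (-(δ / 8 * t₀) * powSum s N ξ) := by
  obtain ⟨C, b, hC, hb, h⟩ := exists_norm_fundInt_le hs hN0 hδ hA hp k
  refine ⟨C * (t₀ / 2) ^ (-(sdeg s k : ℝ) / N) * Real.exp (b * (2 * t₀)), fun t ht x ξ => ?_⟩
  have ht0 : 0 < t := lt_trans (by positivity) ht.1
  refine (h t ht0 x ξ).trans ?_
  have hq := powSum_nonneg (s := s) (N := N) ξ
  have h1 : t ^ (-(sdeg s k : ℝ) / N) ≤ (t₀ / 2) ^ (-(sdeg s k : ℝ) / N) :=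
    Real.rpow_le_rpow_of_nonpos (by positivity) ht.1.le
      (div_nonpos_of_nonpos_of_nonneg (by simp) (by positivity))
  have h2 : Real.exp (b * t) ≤ Real.exp (b * (2 * t₀)) :=
    Real.exp_le_exp.2 (mul_le_mul_of_nonneg_left ht.2.le hb.le)
  have h3 : Real.exp (-(δ / 4 * t) * powSum s N ξ) ≤ Real.exp (-(δ / 8 * t₀) * powSum s N ξ) := by
    refine Real.exp_le_exp.2 ?_
    have : δ / 8 * t₀ ≤ δ / 4 * t := by nlinarith [ht.1]
    nlinarith
  gcongr

theorem fundKer_eq (p : (Fin d → ℕ) → ℂ) (k : Fin d → ℕ) (t : ℝ) (x : Fin d → ℝ) :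
    fundKer s N p k t x =
      (((2 * Real.pi : ℝ) ^ d)⁻¹ : ℝ) * ∫ ξ : Fin d → ℝ, fundInt s N p k t x ξ := rfl

theorem sum_add_smul_single_mul (x ξ : Fin d → ℝ) (j : Fin d) (u : ℝ) :
    ∑ i, (((x + u • (Pi.single j 1 : Fin d → ℝ)) i : ℝ) : ℂ) * (ξ i : ℂ) =
      ∑ i, (x i : ℂ) * (ξ i : ℂ) + u * (ξ j : ℂ) := by
  simp only [Pi.add_apply, Pi.smul_apply, smul_eq_mul, Complex.ofReal_add, add_mul,
    Finset.sum_add_distrib]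
  congr 1
  rw [Finset.sum_eq_single j]
  · simp
  · intro i _ hi; simp [hi]
  · simp

theorem hasDerivAt_fundInt (p : (Fin d → ℕ) → ℂ) (k : Fin d → ℕ) (j : Fin d) (t : ℝ)
    (x ξ : Fin d → ℝ) (u : ℝ) : HasDerivAt
      (fun u : ℝ => fundInt s N p k t (x + u • (Pi.single j 1 : Fin d → ℝ)) ξ)
      (fundInt s N p (k + Pi.single j 1) t (x + u • (Pi.single j 1 : Fin d → ℝ)) ξ) u := by
  unfold fundInt
  simp_rw [sum_add_smul_single_mul]
  have h1 : HasDerivAt (fun u : ℝ => Complex.I * (∑ i, (x i : ℂ) * (ξ i : ℂ) + u * (ξ j : ℂ)))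
      (Complex.I * (ξ j : ℂ)) u := by
    have := ((Complex.ofRealCLM.hasDerivAt (x := u)).mul_const (ξ j : ℂ)).const_add
      (∑ i, (x i : ℂ) * (ξ i : ℂ))
    have := this.const_mul Complex.I
    simpa using this
  refine (h1.cexp.const_mul _).congr_deriv ?_
  rw [amp, amp, cmono_add, cmono_single]
  ring

include hs hN hN0 hδ hA hp in
theorem hasLineDerivAt_fundKer (k : Fin d → ℕ) (j : Fin d) {t : ℝ} (ht : 0 < t)
    (x : Fin d → ℝ) : HasLineDerivAt ℝ (fundKer s N p k t)
      (fundKer s N p (k + Pi.single j 1) t x) x (Pi.single j 1) := by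
  have h := hasDerivAt_integral_of_dominated_loc_of_deriv_le
    (μ := (volume : Measure (Fin d → ℝ)))
    (F := fun (u : ℝ) ξ => fundInt s N p k t (x + u • (Pi.single j 1 : Fin d → ℝ)) ξ)
    (F' := fun (u : ℝ) ξ =>
      fundInt s N p (k + Pi.single j 1) t (x + u • (Pi.single j 1 : Fin d → ℝ)) ξ)
    (x₀ := 0) (bound := fun ξ => ‖fundInt s N p (k + Pi.single j 1) t x ξ‖) univ_mem
    (Eventually.of_forall fun u => (continuous_fundInt_right _ _ _ _).aestronglyMeasurable)
    (integrable_fundInt hs hN hN0 hδ hA hp k ht _)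
    (continuous_fundInt_right p (k + Pi.single j 1) t
      (x + (0 : ℝ) • (Pi.single j 1 : Fin d → ℝ))).aestronglyMeasurable
    (Eventually.of_forall fun ξ u _ => (norm_fundInt p (k + Pi.single j 1) t _ ξ).trans_le
      (norm_fundInt p (k + Pi.single j 1) t x ξ).ge)
    (integrable_fundInt hs hN hN0 hδ hA hp (k + Pi.single j 1) ht x).norm
    (Eventually.of_forall fun ξ u _ => hasDerivAt_fundInt p k j t x ξ u)
  have h' := h.2
  rw [zero_smul, add_zero] at h'
  exact h'.const_mul _

include hs hN hN0 hδ hA hp in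
-- A time derivative multiplies the amplitude by the symbol, and each monomial of the symbol shifts
-- the multi-index: this is the constant-coefficient equation, differentiated `k` times.
theorem hasDerivAt_fundKer (k : Fin d → ℕ) {t : ℝ} (ht : 0 < t) (x : Fin d → ℝ) :
    HasDerivAt (fun t => fundKer s N p k t x)
      (∑ l ∈ multiIndices s N, p l * fundKer s N p (k + l) t x) t := by
  have hsum : ∀ t ξ, fundInt s N p k t x ξ * csymb s N p (fun j => (ξ j : ℂ)) =
      ∑ l ∈ multiIndices s N, p l * fundInt s N p (k + l) t x ξ := fun t ξ => by
    unfold fundInt amp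
    simp only [cmono_add]
    rw [csymb, Finset.mul_sum]
    refine Finset.sum_congr rfl fun l _ => ?_
    ring
  choose C hC using fun l => exists_norm_fundInt_le_of_mem hs hN0 hδ hA hp (k + l) ht
  have hint := integrable_exp_neg_powSum hs hN (show 0 < δ / 8 * t by positivity)
  have h := hasDerivAt_integral_of_dominated_loc_of_deriv_le
    (μ := (volume : Measure (Fin d → ℝ)))
    (F := fun t ξ => fundInt s N p k t x ξ)
    (F' := fun t ξ => ∑ l ∈ multiIndices s N, p l * fundInt s N p (k + l) t x ξ)
    (x₀ := t) (bound := fun ξ => ∑ l ∈ multiIndices s N, ‖p l‖ *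
      (C l * Real.exp (-(δ / 8 * t) * powSum s N ξ)))
    (Ioo_mem_nhds (show t / 2 < t by linarith) (show t < 2 * t by linarith))
    (Eventually.of_forall fun u => (continuous_fundInt_right _ _ _ _).aestronglyMeasurable)
    (integrable_fundInt hs hN hN0 hδ hA hp k ht _)
    (continuous_finsetSum _ fun l _ =>
      continuous_const.mul (continuous_fundInt_right _ _ _ _)).aestronglyMeasurable
    (Eventually.of_forall fun ξ u hu => norm_sum_le_of_le _ fun l _ => by
      rw [norm_mul]; exact mul_le_mul_of_nonneg_left (hC l u hu x ξ) (norm_nonneg _))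
    (integrable_finsetSum _ fun l _ => (hint.const_mul _).const_mul _)
    (Eventually.of_forall fun ξ u _ => by
      have h1 : HasDerivAt (fun u : ℝ => (u : ℂ) * csymb s N p (fun j => (ξ j : ℂ)))
          (csymb s N p (fun j => (ξ j : ℂ))) u := by
        simpa using (Complex.ofRealCLM.hasDerivAt (x := u)).mul_const
          (csymb s N p (fun j => (ξ j : ℂ)))
      rw [← hsum]
      unfold fundInt amp
      refine ((h1.cexp.const_mul (cmono k fun j => (ξ j : ℂ))).mul_const
        (Complex.exp (Complex.I * ∑ j, (x j : ℂ) * (ξ j : ℂ)))).congr_deriv ?_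
      ring)
  simp_rw [fundKer_eq]
  refine (h.2.const_mul _).congr_deriv ?_
  rw [integral_finsetSum _ fun l _ =>
    (integrable_fundInt hs hN hN0 hδ hA hp _ ht _).const_mul _, Finset.mul_sum]
  refine Finset.sum_congr rfl fun l _ => ?_
  rw [integral_const_mul]; ring

include hs hN hN0 hδ hA hp in
theorem continuousAt_fundKer (k : Fin d → ℕ) {t : ℝ} (ht : 0 < t) (x : Fin d → ℝ) :
    ContinuousAt (fun q : ℝ × (Fin d → ℝ) => fundKer s N p k q.1 q.2) (t, x) := by
  obtain ⟨C, hC⟩ := exists_norm_fundInt_le_of_mem hs hN0 hδ hA hp k ht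
  simp_rw [fundKer_eq]
  refine continuousAt_const.mul ?_
  refine continuousAt_of_dominated
    (bound := fun ξ => C * Real.exp (-(δ / 8 * t) * powSum s N ξ))
    (Eventually.of_forall fun q => (continuous_fundInt_right _ _ _ _).aestronglyMeasurable) ?_
    ((integrable_exp_neg_powSum hs hN (show 0 < δ / 8 * t by positivity)).const_mul _)
    (Eventually.of_forall fun ξ => (continuous_fundInt p k ξ).continuousAt)
  have : ∀ᶠ q : ℝ × (Fin d → ℝ) in 𝓝 (t, x), q.1 ∈ Ioo (t / 2) (2 * t) :=
    continuousAt_fst.preimage_mem_nhds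
      (Ioo_mem_nhds (show t / 2 < t by linarith) (show t < 2 * t by linarith))
  filter_upwards [this] with q hq
  exact Eventually.of_forall fun ξ => hC _ hq _ _

include hs hN hN0 hδ hA hp in
theorem continuous_fundKer (k : Fin d → ℕ) {t : ℝ} (ht : 0 < t) :
    Continuous (fundKer s N p k t) :=
  continuous_iff_continuousAt.2 fun x => (continuousAt_fundKer hs hN hN0 hδ hA hp k ht x).comp
    (f := fun x => (t, x)) (by fun_prop)

/-- Joint measurability includes the freezing point, which enters only through the coefficients. In
the convolutions the freezing point is the variable of integration. -/
theorem measurable_fundKer {a : (Fin d → ℕ) → (Fin d → ℝ) → ℂ}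
    (ha : ∀ l ∈ multiIndices s N, Measurable (a l)) (k : Fin d → ℕ) :
    Measurable fun q : ℝ × (Fin d → ℝ) × (Fin d → ℝ) =>
      fundKer s N (fun l => a l q.2.1) k q.1 q.2.2 := by
  simp_rw [fundKer_eq]
  refine Measurable.const_mul ?_ _
  refine StronglyMeasurable.measurable ?_
  refine StronglyMeasurable.integral_prod_right (f := fun (q : ℝ × (Fin d → ℝ) × (Fin d → ℝ)) ξ =>
    fundInt s N (fun l => a l q.2.1) k q.1 q.2.2 ξ) ?_
  refine Measurable.stronglyMeasurable ?_
  simp only [Function.uncurry_def]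
  unfold fundInt amp
  have hm : ∀ l : Fin d → ℕ, Measurable fun q : (ℝ × (Fin d → ℝ) × (Fin d → ℝ)) × (Fin d → ℝ) =>
      cmono l (fun j => (q.2 j : ℂ)) := fun l =>
    ((differentiable_cmono l).continuous.comp (by fun_prop)).measurable
  have hc : Measurable fun q : (ℝ × (Fin d → ℝ) × (Fin d → ℝ)) × (Fin d → ℝ) =>
      csymb s N (fun l => a l q.1.2.1) (fun j => (q.2 j : ℂ)) := by
    unfold csymb
    refine Finset.measurable_fun_sum _ fun l hl => ?_
    exact ((ha l hl).comp (by fun_prop)).mul (hm l)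
  refine ((hm k).mul (Complex.measurable_exp.comp (Measurable.mul (by fun_prop) hc))).mul ?_
  fun_prop

open FourierTransform in
-- Fourier inversion at frequency zero, transported to Euclidean space; the change of variables by
-- `2 * π` produces the prefactor. It identifies the total mass of a kernel with the value of its
-- amplitude at zero.
theorem integral_fourier_eq {f : (Fin d → ℝ) → ℂ} (hf : Continuous f) (hfi : Integrable f)
    (hFi : Integrable fun x : Fin d → ℝ => ∫ ξ : Fin d → ℝ, f ξ *
      Complex.exp (Complex.I * ∑ j, (x j : ℂ) * (ξ j : ℂ))) :
    (((2 * Real.pi : ℝ) ^ d)⁻¹ : ℝ) * ∫ x : Fin d → ℝ, ∫ ξ : Fin d → ℝ, f ξ *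
      Complex.exp (Complex.I * ∑ j, (x j : ℂ) * (ξ j : ℂ)) = f 0 := by
  set F : (Fin d → ℝ) → ℂ := fun x => ∫ ξ : Fin d → ℝ, f ξ *
      Complex.exp (Complex.I * ∑ j, (x j : ℂ) * (ξ j : ℂ)) with hF
  have hπ : (2 * Real.pi : ℝ) ≠ 0 := by have := Real.pi_pos; positivity
  have hmp := PiLp.volume_preserving_ofLp (Fin d)
  have hemb := (MeasurableEquiv.toLp 2 (Fin d → ℝ)).symm.measurableEmbedding
  set f' : EuclideanSpace ℝ (Fin d) → ℂ := fun v => f (WithLp.ofLp v) with hf'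
  have h1 : 𝓕⁻ f' = fun v => F ((2 * Real.pi) • WithLp.ofLp v) := by
    ext v
    rw [Real.fourierInv_eq', hF]
    beta_reduce
    rw [← hmp.integral_comp hemb]
    refine integral_congr_ae (Eventually.of_forall fun w => ?_)
    simp only [hf', smul_eq_mul, Pi.smul_apply]
    rw [mul_comm]
    congr 2
    rw [PiLp.inner_apply]
    push_cast
    rw [Finset.mul_sum, Finset.mul_sum, Finset.sum_mul]
    refine Finset.sum_congr rfl fun j _ => ?_
    simp
    ring
  have hf'i : Integrable f' := (hmp.integrable_comp_emb hemb).2 hfi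
  have h2 : Integrable (𝓕⁻ f') := by
    rw [h1]
    exact (hmp.integrable_comp_emb (g := fun x => F ((2 * Real.pi) • x)) hemb).2
      (hFi.comp_smul hπ)
  have h2' : Integrable (𝓕 f') := by
    have : 𝓕 f' = fun v => 𝓕⁻ f' (-v) := by
      ext v
      rw [Real.fourierInv_eq_fourier_neg, neg_neg]
    rw [this]
    exact h2.comp_neg
  have h3 := hf'i.fourier_fourierInv_eq h2' (v := 0)
    (hf.comp (PiLp.continuous_ofLp 2 _)).continuousAt
  rw [Real.fourier_eq', h1] at h3
  simp only [inner_zero_right, mul_zero, Complex.ofReal_zero, zero_mul, Complex.exp_zero,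
    one_smul] at h3
  rw [hmp.integral_comp hemb (fun x => F ((2 * Real.pi) • x)), Measure.integral_comp_smul] at h3
  simp only [Module.finrank_fin_fun, Complex.real_smul] at h3
  rw [abs_of_pos (by have := Real.pi_pos; positivity)] at h3
  exact h3

include hs hN hN0 hδ hA hp in
theorem integrable_fundKer (k : Fin d → ℕ) {t : ℝ} (ht : 0 < t) :
    Integrable (fundKer s N p k t) := by
  obtain ⟨C, c, γ, hC, hc, hγ, h⟩ := exists_norm_fundKer_le hs hN hN0 hδ hA (sdeg s k)
  exact ((integrable_maj hs hN hc.le ht).const_mul _).mono'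
    (continuous_fundKer hs hN hN0 hδ hA hp k ht).aestronglyMeasurable
    (Eventually.of_forall fun x => (h p hp k le_rfl t ht x).1)

include hs hN hN0 hδ hA hp in
theorem integral_fundKer (k : Fin d → ℕ) {t : ℝ} (ht : 0 < t) :
    ∫ x, fundKer s N p k t x = amp s N p k t 0 := by
  have hi := integrable_fundKer hs hN hN0 hδ hA hp k ht
  have hπ : (((2 * Real.pi : ℝ) ^ d)⁻¹ : ℝ) ≠ 0 := by have := Real.pi_pos; positivity
  have hi' : Integrable fun x : Fin d → ℝ => ∫ ξ : Fin d → ℝ, fundInt s N p k t x ξ := by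
    have := hi.const_mul ((((2 * Real.pi : ℝ) ^ d)⁻¹ : ℝ) : ℂ)⁻¹
    refine this.congr (Eventually.of_forall fun x => ?_)
    simp only [fundKer_eq]
    rw [inv_mul_cancel_left₀]
    exact_mod_cast hπ
  have h := integral_fourier_eq (f := fun ξ => amp s N p k t (fun j => (ξ j : ℂ)))
    ((differentiable_amp p k t).continuous.comp (by fun_prop)) ?_ hi'
  · simp_rw [fundKer_eq, integral_const_mul]
    refine h.trans ?_
    congr 1
  · have := integrable_fundInt hs hN hN0 hδ hA hp k ht 0
    refine this.congr (Eventually.of_forall fun ξ => ?_)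
    simp [fundInt]

include hs hN hN0 hδ hA hp in
-- This cancellation makes the convolutions with top-order kernels converge.
theorem integral_fundKer_of_ne_zero {k : Fin d → ℕ} (hk : k ≠ 0) {t : ℝ} (ht : 0 < t) :
    ∫ x, fundKer s N p k t x = 0 := by
  rw [integral_fundKer hs hN hN0 hδ hA hp k ht, amp, cmono_zero_right hk, zero_mul]

include hs hN hN0 hδ hA hp in
theorem integral_fundKer_zero {t : ℝ} (ht : 0 < t) :
    ∫ x, fundKer s N p 0 t x = Complex.exp (t * csymb s N p 0) := by
  rw [integral_fundKer hs hN hN0 hδ hA hp 0 ht, amp]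
  simp [cmono]

end regularity

/-- Surplus positive powers of `t` are traded for exponential growth. This is why the growth rate
`γ` rises by one or two in many of the bounds. -/
theorem rpow_le_exp {t a : ℝ} (ht : 0 < t) (h0 : 0 ≤ a) (h1 : a ≤ 1) : t ^ a ≤ Real.exp t := by
  have h := Real.add_one_le_exp t
  rcases le_total t 1 with h2 | h2
  · exact (Real.rpow_le_one ht.le h2 h0).trans (by linarith)
  · calc t ^ a ≤ t ^ (1 : ℝ) := Real.rpow_le_rpow_of_exponent_le h2 h1
      _ = t := Real.rpow_one t
      _ ≤ _ := by linarith

/-! ### Kernels with frozen coefficients and Levi's kernel -/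

/-- The kernel `∂^k Z` of the equation with coefficients frozen at `w`. -/
def frz {d : ℕ} (s : Fin d → ℕ) (N : ℕ) (a : (Fin d → ℕ) → (Fin d → ℝ) → ℂ) (k : Fin d → ℕ)
    (t : ℝ) (w x : Fin d → ℝ) : ℂ := fundKer s N (fun l => a l w) k t x

/-- Levi's kernel `(P(x,∂_x) - P(z,∂_x)) Z(t, z, x - z)`. -/
def leviKer {d : ℕ} (s : Fin d → ℕ) (N : ℕ) (a : (Fin d → ℕ) → (Fin d → ℝ) → ℂ)
    (t : ℝ) (x z : Fin d → ℝ) : ℂ :=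
  ∑ l ∈ multiIndices s N, (a l x - a l z) * frz s N a l t z (x - z)

/-- The quantitative properties of the frozen kernels on which Levi's method relies. -/
structure FrozenBounds {d : ℕ} (s : Fin d → ℕ) (N : ℕ) (α C c γ : ℝ)
    (a : (Fin d → ℕ) → (Fin d → ℝ) → ℂ) : Prop where
  coeff : ∀ k ∈ multiIndices s N, ∀ x, ‖a k x‖ ≤ C
  weight : ∀ k : Fin d → ℕ, sdeg s k ≤ 2 * N → ∀ θ : ℝ, 0 ≤ θ → θ ≤ 1 → ∀ t : ℝ, 0 < t →
    ∀ w x, snorm s x ^ θ * ‖frz s N a k t w x‖ ≤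
      C * Real.exp (γ * t) * t ^ ((θ - sdeg s k) / N) * maj s N c t x
  diff : ∀ k : Fin d → ℕ, sdeg s k ≤ 2 * N → ∀ t : ℝ, 0 < t → ∀ x z,
    ‖frz s N a k t z (x - z) - frz s N a k t x (x - z)‖ ≤
      C * Real.exp (γ * t) * t ^ ((α - sdeg s k) / N) * maj s N c t (x - z)
  holder : ∀ k : Fin d → ℕ, sdeg s k ≤ N → ∀ β : ℝ, 0 ≤ β → β ≤ 1 → ∀ t : ℝ, 0 < t →
    ∀ w x x', ‖frz s N a k t w x - frz s N a k t w x'‖ ≤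
      C * Real.exp (γ * t) * t ^ ((-β - sdeg s k) / N) * snorm s (x - x') ^ β *
        (maj s N c t x + maj s N c t x')
  levi : ∀ t : ℝ, 0 < t → ∀ x z, ‖leviKer s N a t x z‖ ≤
      C * Real.exp (γ * t) * t ^ (-1 + α / N) * maj s N c t (x - z)
  levi_holder : ∀ β : ℝ, 0 ≤ β → β ≤ α → ∀ t : ℝ, 0 < t → ∀ x x' z,
    ‖leviKer s N a t x z - leviKer s N a t x' z‖ ≤
      C * Real.exp (γ * t) * t ^ (-1 + (α - β) / N) * snorm s (x - x') ^ β *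
        (maj s N c t (x - z) + maj s N c t (x' - z))

section coeff

variable {d : ℕ} {s : Fin d → ℕ} {N : ℕ} {δ A H α : ℝ}
  {a : (Fin d → ℕ) → (Fin d → ℝ) → ℂ}

/-- The numbers `A` and `H` carry no sign condition, and the constants must exist before any
coefficients are given; hence the absolute values. -/
theorem CoeffAssumptions.parabolicSymbol (hs : ∀ j, 0 < s j)
    (ha : CoeffAssumptions s N δ A H α a) (w : Fin d → ℝ) :
    ParabolicSymbol s N δ |A| (fun k => a k w) :=
  ⟨fun ξ => ha.petrowski w ξ,
    fun k hk => (ha.bound k ((mem_multiIndices hs).1 hk) w).trans (le_abs_self A)⟩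

theorem CoeffAssumptions.holder_abs (ha : CoeffAssumptions s N δ A H α a) {k : Fin d → ℕ}
    (hk : sdeg s k ≤ N) (x y : Fin d → ℝ) : ‖a k x - a k y‖ ≤ |H| * snorm s (x - y) ^ α :=
  (ha.holder k hk x y).trans (mul_le_mul_of_nonneg_right (le_abs_self H)
    (Real.rpow_nonneg (snorm_nonneg _) _))

theorem CoeffAssumptions.continuous (hs : ∀ j, 0 < s j) (hα : 0 < α)
    (ha : CoeffAssumptions s N δ A H α a) {k : Fin d → ℕ} (hk : sdeg s k ≤ N) :
    Continuous (a k) := by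
  refine continuous_iff_continuousAt.2 fun x => ?_
  rw [ContinuousAt, tendsto_iff_norm_sub_tendsto_zero]
  have h1 : Tendsto (fun y => |H| * snorm s (y - x) ^ α) (𝓝 x) (𝓝 0) := by
    have h2 : Continuous fun y => |H| * snorm s (y - x) ^ α :=
      continuous_const.mul (Continuous.rpow_const (continuous_snorm.comp (by fun_prop))
        fun _ => Or.inr hα.le)
    have := h2.tendsto x
    rwa [sub_self, snorm_zero hs, Real.zero_rpow hα.ne', mul_zero] at this
  exact squeeze_zero (fun y => norm_nonneg _) (fun y => ha.holder_abs hk y x) h1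

theorem sdeg_add_single (k : Fin d → ℕ) (j : Fin d) :
    sdeg s (k + Pi.single j 1) = sdeg s k + s j := by
  unfold sdeg
  simp only [Pi.add_apply, mul_add, Finset.sum_add_distrib]
  congr 1
  rw [Finset.sum_eq_single j]
  · simp
  · intro i _ hi; simp [hi]
  · simp

theorem rpow_sub_div_le {t u m : ℝ} (hN0 : 0 < N) (ht : 0 < t) (h0 : 0 ≤ m) (h1 : m ≤ N) :
    t ^ ((u - m) / N) ≤ Real.exp t * t ^ (-1 + u / N) := by
  have hN' : (0 : ℝ) < N := by exact_mod_cast hN0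
  have e : (u - m) / N = ((N - m) / N) + (-1 + u / N) := by field_simp; ring
  rw [e, Real.rpow_add ht]
  gcongr
  refine rpow_le_exp ht (div_nonneg (by linarith) hN'.le) ?_
  rw [div_le_one hN']; linarith

theorem snorm_rpow_mul_norm_le (hs : ∀ j, 0 < s j) (hN : ∀ j, s j < N) {c t θ C m : ℝ}
    (hc : 0 < c) (ht : 0 < t) (h0 : 0 ≤ θ) (h1 : θ ≤ 1) (hC : 0 ≤ C) {v : ℂ} {x : Fin d → ℝ}
    (hv : ‖v‖ ≤ C * t ^ (-m / N) * maj s N c t x) :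
    snorm s x ^ θ * ‖v‖ ≤ (1 + d + 2 / c) * C * t ^ ((θ - m) / N) * maj s N (c / 2) t x := by
  calc snorm s x ^ θ * ‖v‖ ≤ snorm s x ^ θ * (C * t ^ (-m / N) * maj s N c t x) :=
        mul_le_mul_of_nonneg_left hv (Real.rpow_nonneg (snorm_nonneg _) _)
    _ = C * t ^ (-m / N) * (snorm s x ^ θ * maj s N c t x) := by ring
    _ ≤ C * t ^ (-m / N) * ((1 + d + 2 / c) * t ^ (θ / N) * maj s N (c / 2) t x) :=
        mul_le_mul_of_nonneg_left (snorm_rpow_mul_maj_le hs hN hc ht h0 h1 x) (by positivity)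
    _ = (1 + d + 2 / c) * C * (t ^ (θ / N) * t ^ (-m / N)) * maj s N (c / 2) t x := by ring
    _ = _ := by rw [← Real.rpow_add ht]; congr 3; ring

theorem exp_mul_exp_self (γ t : ℝ) : Real.exp (γ * t) * Real.exp t = Real.exp ((γ + 1) * t) := by
  rw [← Real.exp_add]; congr 1; ring

theorem exists_norm_frz_le (hs : ∀ j, 0 < s j) (hN : ∀ j, s j < N) (hN0 : 0 < N) (A H : ℝ)
    (hδ : 0 < δ) : ∃ C c γ : ℝ, 0 < C ∧ 0 < c ∧ 0 < γ ∧ ∀ a, CoeffAssumptions s N δ A H α a →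
      ∀ k : Fin d → ℕ, sdeg s k ≤ 2 * N → ∀ t : ℝ, 0 < t → ∀ w x,
        ‖frz s N a k t w x‖ ≤ C * Real.exp (γ * t) * t ^ (-(sdeg s k : ℝ) / N) * maj s N c t x ∧
        ∀ w', ‖frz s N a k t w x - frz s N a k t w' x‖ ≤ snorm s (w - w') ^ α *
          (C * Real.exp (γ * t) * t ^ (-(sdeg s k : ℝ) / N) * maj s N c t x) := by
  obtain ⟨C₀, c₀, γ₀, hC₀, hc₀, hγ₀, hfund⟩ :=
    exists_norm_fundKer_le (s := s) (N := N) hs hN hN0 hδ (abs_nonneg A) (2 * N)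
  have hH := abs_nonneg H
  refine ⟨C₀ * (1 + |H|), c₀, γ₀, by positivity, hc₀, hγ₀, fun a ha k hk t ht w x => ?_⟩
  have hp := ha.parabolicSymbol hs
  have hm := maj_nonneg (s := s) (N := N) ht c₀ x
  refine ⟨((hfund _ (hp w) k hk t ht x).1).trans ?_, fun w' => ?_⟩
  · gcongr
    exact le_mul_of_one_le_right hC₀.le (by linarith)
  · have h := (hfund _ (hp w) k hk t ht x).2 _ (hp w') (|H| * snorm s (w - w') ^ α)
      (fun l hl => ha.holder_abs ((mem_multiIndices hs).1 hl) w w')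
    have hr : 0 ≤ snorm s (w - w') ^ α := Real.rpow_nonneg (snorm_nonneg _) _
    refine h.trans ?_
    calc _ = snorm s (w - w') ^ α * (C₀ * |H| * Real.exp (γ₀ * t) *
          t ^ (-(sdeg s k : ℝ) / N) * maj s N c₀ t x) := by ring
      _ ≤ _ := by
          gcongr
          linarith

/-- Hölder continuity is interpolated between the kernel and one further derivative in each
direction. For degree at most `N` this leads to degrees up to `2 * N`, the range in which the kernel
bounds are stated. -/
theorem norm_frz_sub_le (hs : ∀ j, 0 < s j) (hN : ∀ j, s j < N) (hN0 : 0 < N) (hδ : 0 < δ)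
    (ha : CoeffAssumptions s N δ A H α a) {C c γ : ℝ} (hC : 0 < C) (hc : 0 < c)
    (hb : ∀ k : Fin d → ℕ, sdeg s k ≤ 2 * N → ∀ t : ℝ, 0 < t → ∀ w x,
      ‖frz s N a k t w x‖ ≤ C * Real.exp (γ * t) * t ^ (-(sdeg s k : ℝ) / N) * maj s N c t x)
    {k : Fin d → ℕ} (hk : sdeg s k ≤ N) {β : ℝ} (h0 : 0 ≤ β) (h1 : β ≤ 1) {t : ℝ} (ht : 0 < t)
    (w x x' : Fin d → ℝ) : ‖frz s N a k t w x - frz s N a k t w x'‖ ≤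
      ((d + 1) * (3 ^ d * Real.exp (c * d)) * C) * Real.exp (γ * t) *
        t ^ ((-β - sdeg s k) / N) * snorm s (x - x') ^ β *
        (maj s N (c * 2⁻¹ ^ N) t x + maj s N (c * 2⁻¹ ^ N) t x') := by
  have h := holder_of_lineDeriv hs hN (f := frz s N a k t w)
    (F := fun j => frz s N a (k + Pi.single j 1) t w)
    (fun j z => hasLineDerivAt_fundKer hs hN hN0 hδ (abs_nonneg A) (ha.parabolicSymbol hs w) k j
      ht z)
    (c := c) (T := t) (τ := t) (B := C * Real.exp (γ * t) * t ^ (-(sdeg s k : ℝ) / N))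
    (β := β) hc.le ht le_rfl (by positivity) h0 h1 (y := 0)
    (fun z => by
      rw [sub_zero]
      exact hb k (by omega) t ht w z)
    (fun j z => by
      have hj : sdeg s (k + Pi.single j 1) ≤ 2 * N := by
        rw [sdeg_add_single]; have := hN j; omega
      rw [sub_zero]
      refine (hb _ hj t ht w z).trans (le_of_eq ?_)
      have e : t ^ (-(sdeg s (k + Pi.single j 1) : ℝ) / N) =
          t ^ (-(sdeg s k : ℝ) / N) * t ^ (-(s j : ℝ) / N) := by
        rw [← Real.rpow_add ht, sdeg_add_single]
        congr 1
        push_cast; ring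
      rw [e]; ring) x x'
  rw [sub_zero, sub_zero] at h
  refine h.trans (le_of_eq ?_)
  have e : t ^ ((-β - sdeg s k) / N) = t ^ (-(sdeg s k : ℝ) / N) * t ^ (-β / N) := by
    rw [← Real.rpow_add ht]; congr 1; ring
  rw [e]; ring

/-- The coefficient difference vanishes to order `α` on the diagonal, and this weight turns the
worst singularity `t ^ (-1)`, from degree `N`, into `t ^ (-1 + α / N)`. Terms of lower degree have
powers to spare, which go into the exponential. -/
theorem norm_leviKer_le (hs : ∀ j, 0 < s j) (hN0 : 0 < N)
    (ha : CoeffAssumptions s N δ A H α a) {B c γ : ℝ} (hB : 0 ≤ B)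
    (hw : ∀ l ∈ multiIndices s N, ∀ t : ℝ, 0 < t → ∀ w x, snorm s x ^ α * ‖frz s N a l t w x‖ ≤
      B * Real.exp (γ * t) * t ^ ((α - sdeg s l) / N) * maj s N c t x)
    {t : ℝ} (ht : 0 < t) (x z : Fin d → ℝ) : ‖leviKer s N a t x z‖ ≤
      (multiIndices s N).card * (|H| * B) * Real.exp ((γ + 1) * t) * t ^ (-1 + α / N) *
        maj s N c t (x - z) := by
  have hm := maj_nonneg (s := s) (N := N) ht c (x - z)
  have hH := abs_nonneg H
  unfold leviKer
  calc _ ≤ ∑ l ∈ multiIndices s N, |H| * B * Real.exp ((γ + 1) * t) * t ^ (-1 + α / N) *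
        maj s N c t (x - z) := by
        refine norm_sum_le_of_le _ fun l hl => ?_
        have hl' := (mem_multiIndices hs).1 hl
        rw [norm_mul]
        calc _ ≤ |H| * snorm s (x - z) ^ α * ‖frz s N a l t z (x - z)‖ :=
              mul_le_mul_of_nonneg_right (ha.holder_abs hl' x z) (norm_nonneg _)
          _ = |H| * (snorm s (x - z) ^ α * ‖frz s N a l t z (x - z)‖) := by ring
          _ ≤ |H| * (B * Real.exp (γ * t) * t ^ ((α - sdeg s l) / N) * maj s N c t (x - z)) :=
              mul_le_mul_of_nonneg_left (hw l hl t ht z (x - z)) hH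
          _ ≤ |H| * (B * Real.exp (γ * t) * (Real.exp t * t ^ (-1 + α / N)) *
              maj s N c t (x - z)) := by
              have := rpow_sub_div_le (u := α) hN0 ht (Nat.cast_nonneg (sdeg s l))
                (by exact_mod_cast hl')
              gcongr
          _ = _ := by rw [← exp_mul_exp_self]; ring
    _ = _ := by rw [Finset.sum_const, nsmul_eq_mul]; ring

theorem one_le_rpow_mul_of_le {t r β : ℝ} (ht : 0 < t) (hβ : 0 ≤ β)
    (h : t ^ (1 / (N : ℝ)) ≤ r) : 1 ≤ t ^ (-β / N) * r ^ β := by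
  calc (1 : ℝ) = t ^ (-β / N) * (t ^ (1 / (N : ℝ))) ^ β := by
        rw [← Real.rpow_mul ht.le, ← Real.rpow_add ht,
          show -β / (N : ℝ) + 1 / N * β = 0 by ring, Real.rpow_zero]
    _ ≤ _ := by gcongr

/-- One summand of `leviKer`, at two points at distance at most `t^{1/N}`. -/
theorem norm_levi_summand_sub_le (hs : ∀ j, 0 < s j) (hN : ∀ j, s j < N) (hα1 : α < 1)
    (ha : CoeffAssumptions s N δ A H α a) {B c β : ℝ} (hc : 0 < c) (hB : 0 ≤ B)
    (h0 : 0 ≤ β) (h1 : β ≤ α) {t : ℝ} (ht : 0 < t) {l : Fin d → ℕ} (hl : sdeg s l ≤ N)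
    (x x' z : Fin d → ℝ) (hr : snorm s (x - x') ≤ t ^ (1 / (N : ℝ)))
    (hb : ‖frz s N a l t z (x - z)‖ ≤ B * t ^ (-(sdeg s l : ℝ) / N) * maj s N (c / 2) t (x - z))
    (hd : ‖frz s N a l t z (x - z) - frz s N a l t z (x' - z)‖ ≤
      B * t ^ ((-β - sdeg s l) / N) * snorm s (x - x') ^ β *
        (maj s N c t (x - z) + maj s N c t (x' - z))) :
    ‖(a l x - a l z) * frz s N a l t z (x - z) - (a l x' - a l z) * frz s N a l t z (x' - z)‖ ≤
      |H| * B * (1 + 2 * (1 + d + 2 / c)) * (t ^ ((α - β - sdeg s l) / N) *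
        snorm s (x - x') ^ β * (maj s N (c / 2) t (x - z) + maj s N (c / 2) t (x' - z))) := by
  have hH := abs_nonneg H
  have hα0 : 0 ≤ α := h0.trans h1
  set r := snorm s (x - x') with hrdef
  have hr0 : 0 ≤ r := snorm_nonneg _
  have hrβ : 0 ≤ r ^ β := Real.rpow_nonneg hr0 _
  have hrα : r ^ α ≤ t ^ ((α - β) / N) * r ^ β := by
    calc r ^ α = r ^ (α - β + β) := by rw [sub_add_cancel]
      _ = r ^ (α - β) * r ^ β := Real.rpow_add_of_nonneg hr0 (by linarith) h0
      _ ≤ (t ^ (1 / (N : ℝ))) ^ (α - β) * r ^ β :=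
          mul_le_mul_of_nonneg_right (Real.rpow_le_rpow hr0 hr (by linarith)) hrβ
      _ = _ := by rw [← Real.rpow_mul ht.le]; congr 2; ring
  have hrt : r ^ α ≤ t ^ (α / N) := by
    calc r ^ α ≤ (t ^ (1 / (N : ℝ))) ^ α := Real.rpow_le_rpow hr0 hr hα0
      _ = _ := by rw [← Real.rpow_mul ht.le]; congr 1; ring
  have hwx := snorm_rpow_mul_maj_le hs hN hc ht hα0 hα1.le (x - z)
  have hwx' := snorm_rpow_mul_maj_le hs hN hc ht hα0 hα1.le (x' - z)
  have hm0 := maj_nonneg (s := s) (N := N) ht (c / 2) (x - z)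
  have hm0' := maj_nonneg (s := s) (N := N) ht (c / 2) (x' - z)
  have hM0 := maj_nonneg (s := s) (N := N) ht c (x - z)
  have hM0' := maj_nonneg (s := s) (N := N) ht c (x' - z)
  have hMm : maj s N c t (x - z) ≤ maj s N (c / 2) t (x - z) := maj_mono (by linarith) ht _
  set W : ℝ := 1 + d + 2 / c with hW
  have hW1 : 1 ≤ W := by
    have h1 : 0 ≤ 2 / c := by positivity
    have h2 : (0 : ℝ) ≤ d := Nat.cast_nonneg d
    linarith
  generalize maj s N (c / 2) t (x - z) = m at *
  generalize maj s N (c / 2) t (x' - z) = m' at *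
  generalize maj s N c t (x - z) = M at *
  generalize maj s N c t (x' - z) = M' at *
  -- The increment falls either on the coefficient or on the kernel. In the first case `r ^ α` is
  -- traded for `t ^ ((α - β) / N) * r ^ β`. In the second the weight sits at `x' - z`, and it must
  -- be moved to `x - z` before the majorant centred there can absorb it.
  have e : (a l x - a l z) * frz s N a l t z (x - z) -
      (a l x' - a l z) * frz s N a l t z (x' - z) =
      (a l x - a l x') * frz s N a l t z (x - z) +
      (a l x' - a l z) * (frz s N a l t z (x - z) - frz s N a l t z (x' - z)) := by ring
  have h2 : ‖(a l x - a l x') * frz s N a l t z (x - z)‖ ≤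
      |H| * B * (t ^ ((α - β - sdeg s l) / N) * r ^ β * (m + m')) := by
    rw [norm_mul]
    calc _ ≤ (|H| * (t ^ ((α - β) / N) * r ^ β)) * (B * t ^ (-(sdeg s l : ℝ) / N) * m) :=
          mul_le_mul ((ha.holder_abs hl x x').trans (mul_le_mul_of_nonneg_left hrα hH)) hb
            (norm_nonneg _) (by positivity)
      _ = |H| * B * ((t ^ ((α - β) / N) * t ^ (-(sdeg s l : ℝ) / N)) * r ^ β * m) := by ring
      _ = |H| * B * (t ^ ((α - β - sdeg s l) / N) * r ^ β * m) := by
          rw [← Real.rpow_add ht]; congr 4; ring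
      _ ≤ _ := by
          refine mul_le_mul_of_nonneg_left (mul_le_mul_of_nonneg_left ?_ ?_) ?_
          · linarith
          · positivity
          · positivity
  have h3 : ‖(a l x' - a l z) * (frz s N a l t z (x - z) - frz s N a l t z (x' - z))‖ ≤
      |H| * B * (2 * W) * (t ^ ((α - β - sdeg s l) / N) * r ^ β * (m + m')) := by
    rw [norm_mul]
    have h5 : snorm s (x' - z) ^ α ≤ t ^ (α / N) + snorm s (x - z) ^ α := by
      have := snorm_add_rpow_le hs hα0 hα1.le (x' - x) (x - z)
      rw [sub_add_sub_cancel, snorm_sub_comm x' x, ← hrdef] at this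
      linarith
    have ht0 : 0 ≤ t ^ (α / N) := by positivity
    have h7 : snorm s (x' - z) ^ α * (M + M') ≤ (2 * W) * (t ^ (α / N) * (m + m')) := by
      have h8 : snorm s (x' - z) ^ α * M ≤ (1 + W) * (t ^ (α / N) * m) := by
        calc _ ≤ (t ^ (α / N) + snorm s (x - z) ^ α) * M := mul_le_mul_of_nonneg_right h5 hM0
          _ = t ^ (α / N) * M + snorm s (x - z) ^ α * M := by ring
          _ ≤ t ^ (α / N) * m + W * t ^ (α / N) * m :=
              add_le_add (mul_le_mul_of_nonneg_left hMm ht0) hwx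
          _ = _ := by ring
      have h9 : 0 ≤ t ^ (α / N) * m := mul_nonneg ht0 hm0
      have h10 : 0 ≤ t ^ (α / N) * m' := mul_nonneg ht0 hm0'
      nlinarith
    calc _ ≤ (|H| * snorm s (x' - z) ^ α) * (B * t ^ ((-β - sdeg s l) / N) * r ^ β *
          (M + M')) := by
          refine mul_le_mul (ha.holder_abs hl x' z) hd (norm_nonneg _) ?_
          exact mul_nonneg hH (Real.rpow_nonneg (snorm_nonneg _) _)
      _ = |H| * (B * t ^ ((-β - sdeg s l) / N) * r ^ β) *
          (snorm s (x' - z) ^ α * (M + M')) := by ring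
      _ ≤ |H| * (B * t ^ ((-β - sdeg s l) / N) * r ^ β) *
          ((2 * W) * (t ^ (α / N) * (m + m'))) := mul_le_mul_of_nonneg_left h7 (by positivity)
      _ = |H| * B * (2 * W) * ((t ^ (α / N) * t ^ ((-β - sdeg s l) / N)) * r ^ β *
          (m + m')) := by ring
      _ = _ := by rw [← Real.rpow_add ht]; congr 4; ring
  rw [e]
  refine (norm_add_le _ _).trans ((add_le_add h2 h3).trans (le_of_eq ?_))
  ring

theorem norm_leviKer_sub_le (hs : ∀ j, 0 < s j) (hN : ∀ j, s j < N) (hN0 : 0 < N) (hα1 : α < 1)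
    (ha : CoeffAssumptions s N δ A H α a) {B c γ : ℝ} (hB : 0 ≤ B) (hc : 0 < c)
    (hb : ∀ l : Fin d → ℕ, sdeg s l ≤ N → ∀ t : ℝ, 0 < t → ∀ w x, ‖frz s N a l t w x‖ ≤
      B * Real.exp (γ * t) * t ^ (-(sdeg s l : ℝ) / N) * maj s N (c / 2) t x)
    (hd : ∀ l : Fin d → ℕ, sdeg s l ≤ N → ∀ β : ℝ, 0 ≤ β → β ≤ 1 → ∀ t : ℝ, 0 < t → ∀ w x x',
      ‖frz s N a l t w x - frz s N a l t w x'‖ ≤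
        B * Real.exp (γ * t) * t ^ ((-β - sdeg s l) / N) * snorm s (x - x') ^ β *
        (maj s N c t x + maj s N c t x'))
    (hK : ∀ t : ℝ, 0 < t → ∀ x z, ‖leviKer s N a t x z‖ ≤
      B * Real.exp ((γ + 1) * t) * t ^ (-1 + α / N) * maj s N (c / 2) t (x - z))
    {β : ℝ} (h0 : 0 ≤ β) (h1 : β ≤ α) {t : ℝ} (ht : 0 < t) (x x' z : Fin d → ℝ) :
    ‖leviKer s N a t x z - leviKer s N a t x' z‖ ≤
      (B + (multiIndices s N).card * (|H| * B * (1 + 2 * (1 + d + 2 / c)))) *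
        Real.exp ((γ + 1) * t) * t ^ (-1 + (α - β) / N) *
        snorm s (x - x') ^ β * (maj s N (c / 2) t (x - z) + maj s N (c / 2) t (x' - z)) := by
  have hH := abs_nonneg H
  have hm := maj_nonneg (s := s) (N := N) ht (c / 2) (x - z)
  have hm' := maj_nonneg (s := s) (N := N) ht (c / 2) (x' - z)
  have hr0 : 0 ≤ snorm s (x - x') := snorm_nonneg _
  have hrβ : 0 ≤ snorm s (x - x') ^ β := Real.rpow_nonneg hr0 _
  set R : ℝ := Real.exp ((γ + 1) * t) * t ^ (-1 + (α - β) / N) * snorm s (x - x') ^ β *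
    (maj s N (c / 2) t (x - z) + maj s N (c / 2) t (x' - z)) with hR
  have hR0 : 0 ≤ R := by positivity
  set n : ℝ := ((multiIndices s N).card : ℝ) with hn
  have hn0 : 0 ≤ n := Nat.cast_nonneg _
  set V : ℝ := |H| * B * (1 + 2 * (1 + d + 2 / c)) with hV
  have hV0 : 0 ≤ V := by positivity
  suffices h : ‖leviKer s N a t x z - leviKer s N a t x' z‖ ≤ (B + n * V) * R by
    refine h.trans (le_of_eq ?_)
    rw [hR]; ring
  rcases le_total (t ^ (1 / (N : ℝ))) (snorm s (x - x')) with h | h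
  · have h2 := one_le_rpow_mul_of_le ht h0 h
    calc _ ≤ ‖leviKer s N a t x z‖ + ‖leviKer s N a t x' z‖ := norm_sub_le _ _
      _ ≤ _ := add_le_add (hK t ht x z) (hK t ht x' z)
      _ = B * Real.exp ((γ + 1) * t) * t ^ (-1 + α / N) *
          (maj s N (c / 2) t (x - z) + maj s N (c / 2) t (x' - z)) := by ring
      _ ≤ (B * Real.exp ((γ + 1) * t) * t ^ (-1 + α / N) *
          (maj s N (c / 2) t (x - z) + maj s N (c / 2) t (x' - z))) *
          (t ^ (-β / N) * snorm s (x - x') ^ β) := le_mul_of_one_le_right (by positivity) h2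
      _ = B * (Real.exp ((γ + 1) * t) * (t ^ (-1 + α / N) * t ^ (-β / N)) *
          snorm s (x - x') ^ β *
          (maj s N (c / 2) t (x - z) + maj s N (c / 2) t (x' - z))) := by ring
      _ = B * R := by rw [hR, ← Real.rpow_add ht]; congr 5; ring
      _ ≤ _ := mul_le_mul_of_nonneg_right (by nlinarith) hR0
  · unfold leviKer
    rw [← Finset.sum_sub_distrib]
    calc _ ≤ ∑ l ∈ multiIndices s N, V * R := by
          refine norm_sum_le_of_le _ fun l hl => ?_
          have hl' := (mem_multiIndices hs).1 hl
          have hd' := hd l hl' β h0 (by linarith) t ht z (x - z) (x' - z)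
          rw [sub_sub_sub_cancel_right] at hd'
          refine (norm_levi_summand_sub_le hs hN hα1 ha (B := B * Real.exp (γ * t)) hc
            (by positivity) h0 h1 ht hl' x x' z h (hb l hl' t ht z _) hd').trans ?_
          have hpow := rpow_sub_div_le (u := α - β) hN0 ht (Nat.cast_nonneg (sdeg s l))
            (by exact_mod_cast hl')
          calc _ = V * Real.exp (γ * t) * (t ^ ((α - β - sdeg s l) / N) *
                (snorm s (x - x') ^ β *
                (maj s N (c / 2) t (x - z) + maj s N (c / 2) t (x' - z)))) := by rw [hV]; ring
            _ ≤ V * Real.exp (γ * t) * (Real.exp t * t ^ (-1 + (α - β) / N) *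
                (snorm s (x - x') ^ β *
                (maj s N (c / 2) t (x - z) + maj s N (c / 2) t (x' - z)))) :=
                mul_le_mul_of_nonneg_left (mul_le_mul_of_nonneg_right hpow (by positivity))
                  (by positivity)
            _ = _ := by rw [hR, ← exp_mul_exp_self]; ring
      _ = n * V * R := by rw [Finset.sum_const, nsmul_eq_mul, ← hn]; ring
      _ ≤ _ := mul_le_mul_of_nonneg_right (by linarith) hR0

/-- The rate shrinks twice: by `2⁻¹ ^ N` for displacements and by one half for weights. Afterwards a
single rate is kept through the whole Neumann series. -/
theorem exists_frozenBounds (hs : ∀ j, 0 < s j) (hN : ∀ j, s j < N) (hN0 : 0 < N) (A H : ℝ)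
    (hδ : 0 < δ) (hα0 : 0 < α) (hα1 : α < 1) : ∃ C c γ : ℝ, 0 < C ∧ 0 < c ∧ 0 < γ ∧
      ∀ a, CoeffAssumptions s N δ A H α a → FrozenBounds s N α C c γ a := by
  obtain ⟨C₀, c₀, γ₀, hC₀, hc₀, hγ₀, hfrz⟩ :=
    exists_norm_frz_le (s := s) (N := N) (α := α) hs hN hN0 A H hδ
  set c₁ : ℝ := c₀ * 2⁻¹ ^ N with hc₁
  have hc₁0 : 0 < c₁ := by positivity
  have hc₁₀ : c₁ ≤ c₀ := mul_le_of_le_one_right hc₀.le (pow_le_one₀ (by norm_num) (by norm_num))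
  obtain ⟨L, hL⟩ : ∃ L : ℝ, L = (d + 1) * (3 ^ d * Real.exp (c₀ * d)) * C₀ := ⟨_, rfl⟩
  have hL0 : 0 < L := by rw [hL]; positivity
  obtain ⟨W, hW⟩ : ∃ W : ℝ, W = (1 + d + 2 / c₁) * C₀ := ⟨_, rfl⟩
  have hW0 : 0 < W := by rw [hW]; positivity
  obtain ⟨K, hK⟩ : ∃ K : ℝ, K = (multiIndices s N).card * (|H| * W) := ⟨_, rfl⟩
  have hK0 : 0 ≤ K := by rw [hK]; positivity
  obtain ⟨B, hB⟩ : ∃ B : ℝ, B = C₀ + L + W + K := ⟨_, rfl⟩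
  have hB0 : 0 < B := by rw [hB]; positivity
  obtain ⟨V, hV⟩ : ∃ V : ℝ, V = B + (multiIndices s N).card *
    (|H| * B * (1 + 2 * (1 + d + 2 / c₁))) := ⟨_, rfl⟩
  have hVB : B ≤ V := by
    rw [hV]
    have : 0 ≤ (multiIndices s N).card * (|H| * B * (1 + 2 * (1 + d + 2 / c₁))) := by positivity
    linarith
  have hA := abs_nonneg A
  refine ⟨V + |A|, c₁ / 2, γ₀ + 1, by linarith, by positivity, by positivity, fun a ha => ?_⟩
  have hexp : ∀ t : ℝ, 0 < t → Real.exp (γ₀ * t) ≤ Real.exp ((γ₀ + 1) * t) := fun t ht =>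
    Real.exp_le_exp.2 (by nlinarith)
  have hmono : ∀ t : ℝ, 0 < t → ∀ x, maj s N c₀ t x ≤ maj s N c₁ t x := fun t ht x =>
    maj_mono hc₁₀ ht x
  have hmono' : ∀ t : ℝ, 0 < t → ∀ x, maj s N c₁ t x ≤ maj s N (c₁ / 2) t x := fun t ht x =>
    maj_mono (by linarith) ht x
  have hb : ∀ k : Fin d → ℕ, sdeg s k ≤ 2 * N → ∀ t : ℝ, 0 < t → ∀ w x, ‖frz s N a k t w x‖ ≤
      C₀ * Real.exp (γ₀ * t) * t ^ (-(sdeg s k : ℝ) / N) * maj s N c₁ t x :=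
    fun k hk t ht w x => ((hfrz a ha k hk t ht w x).1).trans
      (mul_le_mul_of_nonneg_left (hmono t ht x) (by positivity))
  have hweight : ∀ k : Fin d → ℕ, sdeg s k ≤ 2 * N → ∀ θ : ℝ, 0 ≤ θ → θ ≤ 1 → ∀ t : ℝ, 0 < t →
      ∀ w x, snorm s x ^ θ * ‖frz s N a k t w x‖ ≤
        W * Real.exp (γ₀ * t) * t ^ ((θ - sdeg s k) / N) * maj s N (c₁ / 2) t x := by
    intro k hk θ h0 h1 t ht w x
    refine (snorm_rpow_mul_norm_le hs hN hc₁0 ht h0 h1 (by positivity)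
      (hb k hk t ht w x)).trans (le_of_eq ?_)
    rw [hW]; ring
  have hhol : ∀ l : Fin d → ℕ, sdeg s l ≤ N → ∀ β : ℝ, 0 ≤ β → β ≤ 1 → ∀ t : ℝ, 0 < t →
      ∀ w x x', ‖frz s N a l t w x - frz s N a l t w x'‖ ≤
        B * Real.exp (γ₀ * t) * t ^ ((-β - sdeg s l) / N) * snorm s (x - x') ^ β *
        (maj s N c₁ t x + maj s N c₁ t x') := by
    intro l hl β h0 h1 t ht w x x'
    refine (norm_frz_sub_le hs hN hN0 hδ ha hC₀ hc₀
      (fun k hk t ht w x => (hfrz a ha k hk t ht w x).1) hl h0 h1 ht w x x').trans ?_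
    rw [← hL, ← hc₁]
    have hr := Real.rpow_nonneg (snorm_nonneg (s := s) (x - x')) β
    have hm := maj_nonneg (s := s) (N := N) ht c₁ x
    have hm' := maj_nonneg (s := s) (N := N) ht c₁ x'
    have hLB : L ≤ B := by linarith
    gcongr
  have hlevi : ∀ t : ℝ, 0 < t → ∀ x z, ‖leviKer s N a t x z‖ ≤
      B * Real.exp ((γ₀ + 1) * t) * t ^ (-1 + α / N) * maj s N (c₁ / 2) t (x - z) := by
    intro t ht x z
    refine (norm_leviKer_le hs hN0 ha hW0.le (fun l hl t ht w x => hweight l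
      (by have := (mem_multiIndices hs).1 hl; omega) α hα0.le hα1.le t ht w x) ht x z).trans ?_
    rw [← hK]
    have hm := maj_nonneg (s := s) (N := N) ht (c₁ / 2) (x - z)
    have hKB : K ≤ B := by linarith
    gcongr
  have hBV : B ≤ V + |A| := by linarith
  refine ⟨fun k hk x => ?_, fun k hk θ h0 h1 t ht w x => ?_, fun k hk t ht x z => ?_,
    fun k hk β h0 h1 t ht w x x' => ?_, fun t ht x z => ?_, fun β h0 h1 t ht x x' z => ?_⟩
  · refine ((ha.parabolicSymbol hs x).bound k hk).trans ?_
    linarith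
  · have hm := maj_nonneg (s := s) (N := N) ht (c₁ / 2) x
    refine (hweight k hk θ h0 h1 t ht w x).trans ?_
    have h2 := hexp t ht
    have h3 : W ≤ V + |A| := by linarith
    have h4 : 0 ≤ V + |A| := by linarith
    exact mul_le_mul_of_nonneg_right (mul_le_mul_of_nonneg_right
      (mul_le_mul h3 h2 (Real.exp_pos _).le h4) (by positivity)) hm
  · have hm := maj_nonneg (s := s) (N := N) ht (c₁ / 2) (x - z)
    have h := (hfrz a ha k hk t ht z (x - z)).2 x
    rw [snorm_sub_comm] at h
    refine h.trans ?_
    have hpos : 0 ≤ C₀ * Real.exp (γ₀ * t) * t ^ (-(sdeg s k : ℝ) / N) * maj s N c₀ t (x - z) :=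
      mul_nonneg (by positivity) (maj_nonneg ht _ _)
    -- The scalar bound itself is inserted as the value `v`: here the weight `‖x - z‖ ^ α` comes
    -- from the distance of the two freezing points and is absorbed by the decay of that bound.
    have h2 := snorm_rpow_mul_norm_le hs hN hc₁0 ht hα0.le hα1.le
      (C := C₀ * Real.exp (γ₀ * t)) (m := sdeg s k) (by positivity) (x := x - z)
      (v := ((C₀ * Real.exp (γ₀ * t) * t ^ (-(sdeg s k : ℝ) / N) * maj s N c₀ t (x - z) : ℝ) : ℂ))
      (by
        rw [Complex.norm_real, Real.norm_of_nonneg hpos]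
        exact mul_le_mul_of_nonneg_left (hmono t ht _) (by positivity))
    rw [Complex.norm_real, Real.norm_of_nonneg hpos] at h2
    refine h2.trans ?_
    have h3 := hexp t ht
    have h4 : W ≤ V + |A| := by linarith
    have h5 : 0 ≤ V + |A| := by linarith
    rw [← mul_assoc (1 + (d : ℝ) + 2 / c₁), ← hW]
    exact mul_le_mul_of_nonneg_right (mul_le_mul_of_nonneg_right
      (mul_le_mul h4 h3 (Real.exp_pos _).le h5) (by positivity)) hm
  · have hr := Real.rpow_nonneg (snorm_nonneg (s := s) (x - x')) β
    refine (hhol k hk β h0 h1 t ht w x x').trans ?_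
    have h5 := hexp t ht
    have h6 := hmono' t ht x
    have h7 := hmono' t ht x'
    have hm := maj_nonneg (s := s) (N := N) ht c₁ x
    have hm' := maj_nonneg (s := s) (N := N) ht c₁ x'
    have h8 : 0 ≤ V + |A| := by linarith
    exact mul_le_mul (mul_le_mul_of_nonneg_right (mul_le_mul_of_nonneg_right
      (mul_le_mul hBV h5 (Real.exp_pos _).le h8) (by positivity)) hr) (add_le_add h6 h7)
      (by positivity) (by positivity)
  · have hm := maj_nonneg (s := s) (N := N) ht (c₁ / 2) (x - z)
    refine (hlevi t ht x z).trans ?_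
    gcongr
  · have hm := maj_nonneg (s := s) (N := N) ht (c₁ / 2) (x - z)
    have hm' := maj_nonneg (s := s) (N := N) ht (c₁ / 2) (x' - z)
    have hr := Real.rpow_nonneg (snorm_nonneg (s := s) (x - x')) β
    refine (norm_leviKer_sub_le hs hN hN0 hα1 ha hB0.le hc₁0 (fun l hl t ht w x => ?_)
      hhol hlevi h0 h1 ht x x' z).trans ?_
    · refine (hb l (by omega) t ht w x).trans ?_
      have h2 := hmono' t ht x
      have hm := maj_nonneg (s := s) (N := N) ht c₁ x
      have h3 : C₀ ≤ B := by linarith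
      gcongr
    · rw [← hV]
      gcongr
      linarith

end coeff

/-! ### Time integrals with two end-point singularities -/

section timeIntegrals

theorem integrableOn_rpow_Ioo {b t : ℝ} (hb : 0 < b) (ht : 0 < t) :
    IntegrableOn (fun r : ℝ => r ^ (b - 1)) (Ioo 0 t) ∧
      ∫ r in Ioo 0 t, r ^ (b - 1) = t ^ b / b := by
  have h1 : IntervalIntegrable (fun r : ℝ => r ^ (b - 1)) volume 0 t :=
    intervalIntegral.intervalIntegrable_rpow' (by linarith)
  refine ⟨((intervalIntegrable_iff_integrableOn_Ioo_of_le ht.le).1 h1), ?_⟩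
  rw [← integral_Ioc_eq_integral_Ioo, ← intervalIntegral.integral_of_le ht.le,
    integral_rpow (Or.inl (by linarith)), sub_add_cancel, Real.zero_rpow hb.ne', sub_zero]

theorem integrableOn_comp_sub_Ioo {f : ℝ → ℝ} {t : ℝ} (ht : 0 < t)
    (hf : IntegrableOn f (Ioo 0 t)) : IntegrableOn (fun r => f (t - r)) (Ioo 0 t) ∧
      ∫ r in Ioo 0 t, f (t - r) = ∫ r in Ioo 0 t, f r := by
  have h1 : IntervalIntegrable f volume 0 t :=
    (intervalIntegrable_iff_integrableOn_Ioo_of_le ht.le).2 hf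
  have h2 := h1.comp_sub_left t
  rw [sub_zero, sub_self] at h2
  refine ⟨(intervalIntegrable_iff_integrableOn_Ioo_of_le ht.le).1 h2.symm, ?_⟩
  rw [← integral_Ioc_eq_integral_Ioo, ← integral_Ioc_eq_integral_Ioo,
    ← intervalIntegral.integral_of_le ht.le, ← intervalIntegral.integral_of_le ht.le,
    intervalIntegral.integral_comp_sub_left f t, sub_self, sub_zero]

/-- At every `r` one of the two factors is at least `t / 2` away from its singularity. Decoupling
them in this way replaces the exact Beta integral by elementary ones. -/
theorem rpow_mul_rpow_le {a b t r : ℝ} (ha : a ≤ 1) (hb : b ≤ 1) (hr : r ∈ Ioo 0 t) :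
    (t - r) ^ (a - 1) * r ^ (b - 1) ≤
      (t / 2) ^ (b - 1) * (t - r) ^ (a - 1) + (t / 2) ^ (a - 1) * r ^ (b - 1) := by
  have h1 : 0 < r := hr.1
  have h2 : 0 < t - r := sub_pos.2 hr.2
  have ht : 0 < t := h1.trans hr.2
  rcases le_total (t / 2) r with h | h
  · have h3 : r ^ (b - 1) ≤ (t / 2) ^ (b - 1) :=
      Real.rpow_le_rpow_of_nonpos (by positivity) h (by linarith)
    have h4 : 0 ≤ (t / 2) ^ (a - 1) * r ^ (b - 1) := by positivity
    have h5 : 0 ≤ (t - r) ^ (a - 1) := by positivity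
    nlinarith
  · have h3 : (t - r) ^ (a - 1) ≤ (t / 2) ^ (a - 1) :=
      Real.rpow_le_rpow_of_nonpos (by positivity) (by linarith) (by linarith)
    have h4 : 0 ≤ (t / 2) ^ (b - 1) * (t - r) ^ (a - 1) := by positivity
    have h5 : 0 ≤ r ^ (b - 1) := by positivity
    nlinarith

theorem aestronglyMeasurable_rpow_mul_rpow (a b t : ℝ) (μ : Measure ℝ) :
    AEStronglyMeasurable (fun r : ℝ => (t - r) ^ (a - 1) * r ^ (b - 1)) μ :=
  Measurable.aestronglyMeasurable (by fun_prop)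

theorem integrableOn_rpow_mul_rpow {a b t : ℝ} (ha0 : 0 < a) (ha : a ≤ 1) (hb0 : 0 < b)
    (hb : b ≤ 1) (ht : 0 < t) :
    IntegrableOn (fun r : ℝ => (t - r) ^ (a - 1) * r ^ (b - 1)) (Ioo 0 t) ∧
      ∫ r in Ioo 0 t, (t - r) ^ (a - 1) * r ^ (b - 1) ≤
        2 * (1 / a + 1 / b) * t ^ (a + b - 1) := by
  have hA := integrableOn_rpow_Ioo ha0 ht
  have hA' := integrableOn_comp_sub_Ioo ht hA.1
  have hB := integrableOn_rpow_Ioo hb0 ht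
  have hi : IntegrableOn (fun r => (t / 2) ^ (b - 1) * (t - r) ^ (a - 1) +
      (t / 2) ^ (a - 1) * r ^ (b - 1)) (Ioo 0 t) :=
    (hA'.1.const_mul _).add (hB.1.const_mul _)
  have hnn : ∀ r ∈ Ioo 0 t, 0 ≤ (t - r) ^ (a - 1) * r ^ (b - 1) := fun r hr =>
    mul_nonneg (Real.rpow_nonneg (sub_pos.2 hr.2).le _) (Real.rpow_nonneg hr.1.le _)
  have hint : IntegrableOn (fun r : ℝ => (t - r) ^ (a - 1) * r ^ (b - 1)) (Ioo 0 t) := by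
    refine Integrable.mono' hi (aestronglyMeasurable_rpow_mul_rpow a b t _) ?_
    filter_upwards [ae_restrict_mem measurableSet_Ioo] with r hr
    rw [Real.norm_of_nonneg (hnn r hr)]
    exact rpow_mul_rpow_le ha hb hr
  refine ⟨hint, ?_⟩
  have h2 : ∀ u : ℝ, u ≤ 1 → 0 < u → (t / 2) ^ (u - 1) ≤ 2 * t ^ (u - 1) := fun u hu hu0 => by
    rw [Real.div_rpow ht.le (by norm_num), div_le_iff₀ (by positivity)]
    have h3 : (1 : ℝ) ≤ 2 * 2 ^ (u - 1) := by
      rw [mul_comm, ← Real.rpow_add_one (by norm_num), sub_add_cancel]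
      exact Real.one_le_rpow (by norm_num) hu0.le
    have : 0 ≤ t ^ (u - 1) := by positivity
    nlinarith
  calc _ ≤ ∫ r in Ioo 0 t, ((t / 2) ^ (b - 1) * (t - r) ^ (a - 1) +
        (t / 2) ^ (a - 1) * r ^ (b - 1)) :=
        setIntegral_mono_on hint hi measurableSet_Ioo fun r hr => rpow_mul_rpow_le ha hb hr
    _ = (t / 2) ^ (b - 1) * (t ^ a / a) + (t / 2) ^ (a - 1) * (t ^ b / b) := by
        rw [integral_add (hA'.1.const_mul _) (hB.1.const_mul _), integral_const_mul,
          integral_const_mul, hA'.2, hA.2, hB.2]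
    _ ≤ (2 * t ^ (b - 1)) * (t ^ a / a) + (2 * t ^ (a - 1)) * (t ^ b / b) := by
        have h3 := h2 a ha ha0
        have h4 := h2 b hb hb0
        gcongr
    _ = 2 * ((t ^ (b - 1) * t ^ a) / a + (t ^ (a - 1) * t ^ b) / b) := by ring
    _ = _ := by
        rw [← Real.rpow_add ht, ← Real.rpow_add ht, show b - 1 + a = a + b - 1 by ring,
          show a - 1 + b = a + b - 1 by ring]
        ring

theorem exp_neg_le_rpow {v ε : ℝ} (hv : 0 < v) (h0 : 0 ≤ ε) (h1 : ε ≤ 1) :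
    Real.exp (-v) ≤ v ^ (-ε) := by
  rw [Real.rpow_neg hv.le, Real.exp_neg]
  exact inv_anti₀ (by positivity) (rpow_le_exp hv h0 h1)

/-- Smallness of the Volterra kernel in an exponentially weighted norm. -/
theorem integral_exp_neg_mul_rpow_mul_rpow_le {ε t Λ : ℝ} (hε0 : 0 < ε) (hε : ε ≤ 1)
    (ht : 0 < t) (hΛ : 0 < Λ) :
    IntegrableOn (fun r : ℝ => Real.exp (-(Λ * (t - r))) * ((t - r) ^ (ε - 1) * r ^ (ε - 1)))
      (Ioo 0 t) ∧
    ∫ r in Ioo 0 t, Real.exp (-(Λ * (t - r))) * ((t - r) ^ (ε - 1) * r ^ (ε - 1)) ≤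
      (2 / ε + 2 * Real.Gamma ε) * Λ ^ (-ε) * t ^ (ε - 1) := by
  have hnn : ∀ r ∈ Ioo 0 t,
      0 ≤ Real.exp (-(Λ * (t - r))) * ((t - r) ^ (ε - 1) * r ^ (ε - 1)) := fun r hr =>
    mul_nonneg (Real.exp_pos _).le
      (mul_nonneg (Real.rpow_nonneg (sub_pos.2 hr.2).le _) (Real.rpow_nonneg hr.1.le _))
  have hint : IntegrableOn (fun r : ℝ => Real.exp (-(Λ * (t - r))) *
      ((t - r) ^ (ε - 1) * r ^ (ε - 1))) (Ioo 0 t) := by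
    refine Integrable.mono' (integrableOn_rpow_mul_rpow hε0 hε hε0 hε ht).1
      (Measurable.aestronglyMeasurable (by fun_prop)) ?_
    filter_upwards [ae_restrict_mem measurableSet_Ioo] with r hr
    rw [Real.norm_of_nonneg (hnn r hr)]
    refine mul_le_of_le_one_left
      (mul_nonneg (Real.rpow_nonneg (sub_pos.2 hr.2).le _) (Real.rpow_nonneg hr.1.le _)) ?_
    rw [Real.exp_le_one_iff]
    have := sub_pos.2 hr.2
    have : 0 ≤ Λ * (t - r) := by positivity
    linarith
  refine ⟨hint, ?_⟩
  have hB := integrableOn_rpow_Ioo hε0 ht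
  have hG := Real.integral_rpow_mul_exp_neg_mul_Ioi hε0 hΛ
  have hGpos := Real.Gamma_pos_of_pos hε0
  have hGi : IntegrableOn (fun u : ℝ => u ^ (ε - 1) * Real.exp (-(Λ * u))) (Ioi 0) := by
    refine Integrable.of_integral_ne_zero ?_
    rw [hG]; positivity
  have hGi' := integrableOn_comp_sub_Ioo ht (hGi.mono_set Ioo_subset_Ioi_self)
  have hGle : ∫ u in Ioo 0 t, u ^ (ε - 1) * Real.exp (-(Λ * u)) ≤ Λ ^ (-ε) * Real.Gamma ε := by
    rw [Real.rpow_neg hΛ.le, ← Real.inv_rpow hΛ.le, ← one_div, ← hG]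
    refine setIntegral_mono_set hGi ?_ Ioo_subset_Ioi_self.eventuallyLE
    filter_upwards [ae_restrict_mem measurableSet_Ioi] with u hu
    have : (0 : ℝ) < u := hu
    exact mul_nonneg (Real.rpow_nonneg this.le _) (Real.exp_pos _).le
  have hi : IntegrableOn (fun r => Λ ^ (-ε) * (2 / t) * r ^ (ε - 1) +
      (t / 2) ^ (ε - 1) * ((t - r) ^ (ε - 1) * Real.exp (-(Λ * (t - r))))) (Ioo 0 t) :=
    (hB.1.const_mul _).add (hGi'.1.const_mul _)
  have hpt : ∀ r ∈ Ioo 0 t, Real.exp (-(Λ * (t - r))) * ((t - r) ^ (ε - 1) * r ^ (ε - 1)) ≤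
      Λ ^ (-ε) * (2 / t) * r ^ (ε - 1) +
      (t / 2) ^ (ε - 1) * ((t - r) ^ (ε - 1) * Real.exp (-(Λ * (t - r)))) := by
    intro r hr
    have h1 : 0 < r := hr.1
    have h2 : 0 < t - r := sub_pos.2 hr.2
    have hp1 : 0 ≤ Λ ^ (-ε) * (2 / t) * r ^ (ε - 1) := by positivity
    have hp2 : 0 ≤ (t / 2) ^ (ε - 1) * ((t - r) ^ (ε - 1) * Real.exp (-(Λ * (t - r)))) := by
      positivity
    -- For `r ≥ t / 2` the power of `r` is frozen and the exponential leaves a Gamma integral worth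
    -- `Λ ^ (-ε)`. For `r ≤ t / 2` the same gain comes from `exp (-v) ≤ v ^ (-ε)`, the powers of `t
    -- - r` combining to `(t - r) ^ (-1) ≤ 2 / t`.
    rcases le_total (t / 2) r with h | h
    · have h3 : r ^ (ε - 1) ≤ (t / 2) ^ (ε - 1) :=
        Real.rpow_le_rpow_of_nonpos (by positivity) h (by linarith)
      have h5 : 0 ≤ (t - r) ^ (ε - 1) * Real.exp (-(Λ * (t - r))) := by positivity
      nlinarith
    · have h3 := exp_neg_le_rpow (show 0 < Λ * (t - r) by positivity) hε0.le hε
      rw [Real.mul_rpow hΛ.le h2.le] at h3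
      have h4 : (t - r) ^ (-ε) * (t - r) ^ (ε - 1) ≤ 2 / t := by
        rw [← Real.rpow_add h2, show -ε + (ε - 1) = -1 by ring, Real.rpow_neg_one, inv_eq_one_div,
          div_le_div_iff₀ h2 ht]
        linarith
      calc _ ≤ Λ ^ (-ε) * (t - r) ^ (-ε) * ((t - r) ^ (ε - 1) * r ^ (ε - 1)) := by gcongr
        _ = Λ ^ (-ε) * ((t - r) ^ (-ε) * (t - r) ^ (ε - 1)) * r ^ (ε - 1) := by ring
        _ ≤ Λ ^ (-ε) * (2 / t) * r ^ (ε - 1) := by gcongr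
        _ ≤ _ := by linarith
  have h2 : (t / 2) ^ (ε - 1) ≤ 2 * t ^ (ε - 1) := by
    rw [Real.div_rpow ht.le (by norm_num), div_le_iff₀ (by positivity)]
    have h3 : (1 : ℝ) ≤ 2 * 2 ^ (ε - 1) := by
      rw [mul_comm, ← Real.rpow_add_one (by norm_num), sub_add_cancel]
      exact Real.one_le_rpow (by norm_num) hε0.le
    have : 0 ≤ t ^ (ε - 1) := by positivity
    nlinarith
  calc _ ≤ ∫ r in Ioo 0 t, (Λ ^ (-ε) * (2 / t) * r ^ (ε - 1) +
        (t / 2) ^ (ε - 1) * ((t - r) ^ (ε - 1) * Real.exp (-(Λ * (t - r))))) :=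
        setIntegral_mono_on hint hi measurableSet_Ioo hpt
    _ = Λ ^ (-ε) * (2 / t) * (t ^ ε / ε) + (t / 2) ^ (ε - 1) *
        ∫ u in Ioo 0 t, u ^ (ε - 1) * Real.exp (-(Λ * u)) := by
        rw [integral_add (hB.1.const_mul _) (hGi'.1.const_mul _), integral_const_mul,
          integral_const_mul, hB.2, hGi'.2]
    _ ≤ Λ ^ (-ε) * (2 / t) * (t ^ ε / ε) + (2 * t ^ (ε - 1)) * (Λ ^ (-ε) * Real.Gamma ε) := by
        have h3 : 0 ≤ ∫ u in Ioo 0 t, u ^ (ε - 1) * Real.exp (-(Λ * u)) :=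
          setIntegral_nonneg measurableSet_Ioo fun u hu =>
            mul_nonneg (Real.rpow_nonneg hu.1.le _) (Real.exp_pos _).le
        gcongr
    _ = _ := by
        rw [Real.rpow_sub_one ht.ne']; ring

end timeIntegrals

/-! ### Volterra convolution and the Neumann series -/

/-- The kernel bound `|f_t(x,y)| ≤ B e^{γt} t^{a-1} M_t(x-y)`. -/
def KerBound {d : ℕ} (s : Fin d → ℕ) (N : ℕ) (c γ a B : ℝ)
    (f : ℝ → (Fin d → ℝ) → (Fin d → ℝ) → ℂ) : Prop :=
  ∀ t : ℝ, 0 < t → ∀ x y, ‖f t x y‖ ≤ B * Real.exp (γ * t) * t ^ (a - 1) * maj s N c t (x - y)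

/-- Joint measurability of a kernel. -/
def KerMeas {d : ℕ} (f : ℝ → (Fin d → ℝ) → (Fin d → ℝ) → ℂ) : Prop :=
  Measurable fun q : ℝ × (Fin d → ℝ) × (Fin d → ℝ) => f q.1 q.2.1 q.2.2

/-- Composition of two kernels at fixed times. -/
def slice {d : ℕ} (f g : ℝ → (Fin d → ℝ) → (Fin d → ℝ) → ℂ) (τ r : ℝ) (x y : Fin d → ℝ) : ℂ :=
  ∫ z, f τ x z * g r z y

/-- The space-time (Volterra) convolution of two kernels. -/
def volterra {d : ℕ} (f g : ℝ → (Fin d → ℝ) → (Fin d → ℝ) → ℂ) (t : ℝ) (x y : Fin d → ℝ) : ℂ :=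
  ∫ r in Ioo 0 t, slice f g (t - r) r x y

section volterra

variable {d : ℕ} {s : Fin d → ℕ} {N : ℕ} {c γ a b F G : ℝ}
  {f g : ℝ → (Fin d → ℝ) → (Fin d → ℝ) → ℂ}

theorem KerMeas.section_right (hf : KerMeas f) (t : ℝ) (x : Fin d → ℝ) : Measurable (f t x) :=
  hf.comp (by fun_prop : Measurable fun z : Fin d → ℝ => (t, x, z))

theorem KerMeas.section_left (hf : KerMeas f) (t : ℝ) (y : Fin d → ℝ) :
    Measurable fun z => f t z y :=
  hf.comp (by fun_prop : Measurable fun z : Fin d → ℝ => (t, z, y))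

theorem KerMeas.slice (hf : KerMeas f) (hg : KerMeas g) :
    Measurable fun q : ℝ × ℝ × (Fin d → ℝ) × (Fin d → ℝ) =>
      slice f g q.1 q.2.1 q.2.2.1 q.2.2.2 := by
  refine StronglyMeasurable.measurable ?_
  refine StronglyMeasurable.integral_prod_right
    (f := fun (q : ℝ × ℝ × (Fin d → ℝ) × (Fin d → ℝ)) z =>
      f q.1 q.2.2.1 z * g q.2.1 z q.2.2.2) ?_
  refine Measurable.stronglyMeasurable ?_
  simp only [Function.uncurry_def]
  exact (hf.comp (by fun_prop : Measurable fun q : (ℝ × ℝ × (Fin d → ℝ) × (Fin d → ℝ)) ×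
    (Fin d → ℝ) => (q.1.1, q.1.2.2.1, q.2))).mul
    (hg.comp (by fun_prop : Measurable fun q : (ℝ × ℝ × (Fin d → ℝ) × (Fin d → ℝ)) ×
    (Fin d → ℝ) => (q.1.2.1, q.2, q.1.2.2.2)))

theorem KerMeas.slice_time (hf : KerMeas f) (hg : KerMeas g) (t : ℝ) (x y : Fin d → ℝ) :
    Measurable fun r => AnisotropicParabolic.slice f g (t - r) r x y :=
  (hf.slice hg).comp (by fun_prop : Measurable fun r : ℝ => (t - r, r, x, y))

theorem KerMeas.volterra (hf : KerMeas f) (hg : KerMeas g) :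
    KerMeas (AnisotropicParabolic.volterra f g) := by
  unfold KerMeas AnisotropicParabolic.volterra
  -- The domain of integration depends on `t`; an indicator moves this dependence into the
  -- integrand, where joint measurability applies.
  simp_rw [← integral_indicator measurableSet_Ioo]
  refine StronglyMeasurable.measurable ?_
  refine StronglyMeasurable.integral_prod_right
    (f := fun (q : ℝ × (Fin d → ℝ) × (Fin d → ℝ)) r => (Ioo 0 q.1).indicator
      (fun r => AnisotropicParabolic.slice f g (q.1 - r) r q.2.1 q.2.2) r) ?_
  refine Measurable.stronglyMeasurable ?_
  have hS : MeasurableSet {q : (ℝ × (Fin d → ℝ) × (Fin d → ℝ)) × ℝ | q.2 ∈ Ioo 0 q.1.1} :=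
    (measurableSet_lt measurable_const measurable_snd).inter
      (measurableSet_lt measurable_snd (by fun_prop))
  have hm : Measurable fun q : (ℝ × (Fin d → ℝ) × (Fin d → ℝ)) × ℝ =>
      AnisotropicParabolic.slice f g (q.1.1 - q.2) q.2 q.1.2.1 q.1.2.2 :=
    (hf.slice hg).comp (by fun_prop : Measurable fun q : (ℝ × (Fin d → ℝ) × (Fin d → ℝ)) × ℝ =>
      (q.1.1 - q.2, q.2, q.1.2.1, q.1.2.2))
  exact hm.indicator hS

variable (hs : ∀ j, 0 < s j) (hN : ∀ j, s j < N)

include hs hN in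
theorem norm_integral_mul_le_maj (hc : 0 ≤ c) {τ r : ℝ} (hτ : 0 < τ) (hr : 0 < r)
    {x y : Fin d → ℝ} {u v : (Fin d → ℝ) → ℂ} {F G : ℝ} (hu : ∀ z, ‖u z‖ ≤ F * maj s N c τ (x - z))
    (hv : ∀ z, ‖v z‖ ≤ G * maj s N c r (z - y)) :
    ∫ z, ‖u z * v z‖ ≤ F * G * ((8 * Real.pi) ^ d * maj s N c (τ + r) (x - y)) ∧
    ‖∫ z, u z * v z‖ ≤ F * G * ((8 * Real.pi) ^ d * maj s N c (τ + r) (x - y)) := by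
  have hF : 0 ≤ F := by
    have := (norm_nonneg _).trans (hu x)
    exact nonneg_of_mul_nonneg_left this (maj_pos hτ c _)
  have hG : 0 ≤ G := by
    have := (norm_nonneg _).trans (hv x)
    exact nonneg_of_mul_nonneg_left this (maj_pos hr c _)
  have h1 : ∫ z, ‖u z * v z‖ ≤ F * G * ((8 * Real.pi) ^ d * maj s N c (τ + r) (x - y)) := by
    calc ∫ z, ‖u z * v z‖ ≤ ∫ z, F * G * (maj s N c τ (x - z) * maj s N c r (z - y)) := by
          refine integral_mono_of_nonneg (Eventually.of_forall fun z => norm_nonneg _)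
            ((integrable_maj_mul_maj hs hN hc hτ hr x y).const_mul _)
            (Eventually.of_forall fun z => ?_)
          simp only [norm_mul]
          calc _ ≤ (F * maj s N c τ (x - z)) * (G * maj s N c r (z - y)) :=
                mul_le_mul (hu z) (hv z) (norm_nonneg _) (mul_nonneg hF (maj_nonneg hτ c _))
            _ = _ := by ring
      _ ≤ _ := by
          rw [integral_const_mul]
          exact mul_le_mul_of_nonneg_left (integral_maj_mul_maj_le hs hN hc hτ hr x y)
            (mul_nonneg hF hG)
  exact ⟨h1, (norm_integral_le_integral_norm _).trans h1⟩

include hs hN in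
theorem integrable_mul_of_le_maj (hc : 0 ≤ c) {τ r : ℝ} (hτ : 0 < τ) (hr : 0 < r)
    {x y : Fin d → ℝ} {u v : (Fin d → ℝ) → ℂ} {F G : ℝ} (hum : Measurable u) (hvm : Measurable v)
    (hu : ∀ z, ‖u z‖ ≤ F * maj s N c τ (x - z)) (hv : ∀ z, ‖v z‖ ≤ G * maj s N c r (z - y)) :
    Integrable fun z => u z * v z := by
  have hF : 0 ≤ F := by
    have := (norm_nonneg _).trans (hu x)
    exact nonneg_of_mul_nonneg_left this (maj_pos hτ c _)
  refine ((integrable_maj_mul_maj hs hN hc hτ hr x y).const_mul (F * G)).mono'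
    (hum.mul hvm).aestronglyMeasurable (Eventually.of_forall fun z => ?_)
  rw [norm_mul]
  calc _ ≤ (F * maj s N c τ (x - z)) * (G * maj s N c r (z - y)) :=
        mul_le_mul (hu z) (hv z) (norm_nonneg _) (mul_nonneg hF (maj_nonneg hτ c _))
    _ = _ := by ring

include hs hN in
theorem norm_slice_le (hc : 0 ≤ c) (hf : KerBound s N c γ a F f) (hg : KerBound s N c γ b G g)
    {t r : ℝ} (hr : r ∈ Ioo 0 t) (x y : Fin d → ℝ) :
    ‖slice f g (t - r) r x y‖ ≤ F * G * (8 * Real.pi) ^ d * Real.exp (γ * t) *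
      ((t - r) ^ (a - 1) * r ^ (b - 1)) * maj s N c t (x - y) := by
  have h := (norm_integral_mul_le_maj hs hN hc (sub_pos.2 hr.2) hr.1
    (fun z => hf (t - r) (sub_pos.2 hr.2) x z) (fun z => hg r hr.1 z y)).2
  rw [sub_add_cancel] at h
  refine h.trans (le_of_eq ?_)
  have e : Real.exp (γ * t) = Real.exp (γ * (t - r)) * Real.exp (γ * r) := by
    rw [← Real.exp_add]; congr 1; ring
  rw [e]; ring

include hs hN in
theorem integrableOn_slice (hc : 0 ≤ c) (ha0 : 0 < a) (ha : a ≤ 1) (hb0 : 0 < b) (hb : b ≤ 1)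
    (hfm : KerMeas f) (hgm : KerMeas g) (hf : KerBound s N c γ a F f)
    (hg : KerBound s N c γ b G g) {t : ℝ} (ht : 0 < t) (x y : Fin d → ℝ) :
    IntegrableOn (fun r => slice f g (t - r) r x y) (Ioo 0 t) := by
  refine Integrable.mono' (((integrableOn_rpow_mul_rpow ha0 ha hb0 hb ht).1.const_mul
    (F * G * (8 * Real.pi) ^ d * Real.exp (γ * t))).mul_const (maj s N c t (x - y)))
    (hfm.slice_time hgm t x y).aestronglyMeasurable ?_
  filter_upwards [ae_restrict_mem measurableSet_Ioo] with r hr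
  exact norm_slice_le hs hN hc hf hg hr x y

theorem KerBound.nonneg (hf : KerBound s N c γ a F f) : 0 ≤ F := by
  have h := (norm_nonneg _).trans (hf 1 one_pos 0 0)
  have hm : 0 < maj s N c 1 ((0 : Fin d → ℝ) - 0) := maj_pos one_pos c _
  rw [Real.one_rpow, mul_one] at h
  exact nonneg_of_mul_nonneg_left (nonneg_of_mul_nonneg_left h hm) (Real.exp_pos _)

theorem KerBound.mono {γ' F' : ℝ} (hf : KerBound s N c γ a F f) (hγ : γ ≤ γ') (hF : F ≤ F') :
    KerBound s N c γ' a F' f := fun t ht x y => by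
  have hm := maj_nonneg (s := s) (N := N) ht c (x - y)
  have hF' : 0 ≤ F' := hf.nonneg.trans hF
  refine (hf t ht x y).trans ?_
  gcongr

include hs hN in
-- Giving the second factor the faster growth `γ + Λ` leaves `exp (-(Λ * (t - r)))` in the time
-- integral, worth `Λ ^ (-ε)`. The power `t ^ (ε - 1)` and the rate `c` are reproduced, so
-- convolution with `f` acts on a fixed class of kernels with small norm.
theorem norm_volterra_le (hc : 0 ≤ c) {ε Λ : ℝ} (hε0 : 0 < ε) (hε : ε ≤ 1) (hΛ : 0 < Λ)
    (hf : KerBound s N c γ ε F f) (hg : KerBound s N c (γ + Λ) ε G g) :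
    KerBound s N c (γ + Λ) ε
      (F * G * ((8 * Real.pi) ^ d * ((2 / ε + 2 * Real.Gamma ε) * Λ ^ (-ε)))) (volterra f g) := by
  intro t ht x y
  have hm := maj_nonneg (s := s) (N := N) ht c (x - y)
  have hF := hf.nonneg
  have hG := hg.nonneg
  have hπ : 0 ≤ (8 * Real.pi) ^ d := by have := Real.pi_pos; positivity
  have hI := integral_exp_neg_mul_rpow_mul_rpow_le hε0 hε ht hΛ
  set D : ℝ := F * G * (8 * Real.pi) ^ d * Real.exp ((γ + Λ) * t) * maj s N c t (x - y) with hD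
  have hD0 : 0 ≤ D := by positivity
  unfold volterra
  calc _ ≤ ∫ r in Ioo 0 t, D * (Real.exp (-(Λ * (t - r))) *
        ((t - r) ^ (ε - 1) * r ^ (ε - 1))) := by
        refine norm_integral_le_of_norm_le (hI.1.const_mul D) ?_
        filter_upwards [ae_restrict_mem measurableSet_Ioo] with r hr
        have h := (norm_integral_mul_le_maj hs hN hc (sub_pos.2 hr.2) hr.1
          (fun z => hf (t - r) (sub_pos.2 hr.2) x z) (fun z => hg r hr.1 z y)).2
        rw [sub_add_cancel] at h
        refine h.trans (le_of_eq ?_)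
        have e : Real.exp ((γ + Λ) * t) * Real.exp (-(Λ * (t - r))) =
            Real.exp (γ * (t - r)) * Real.exp ((γ + Λ) * r) := by
          rw [← Real.exp_add, ← Real.exp_add]; congr 1; ring
        calc _ = F * G * (8 * Real.pi) ^ d * (Real.exp (γ * (t - r)) * Real.exp ((γ + Λ) * r)) *
              maj s N c t (x - y) * ((t - r) ^ (ε - 1) * r ^ (ε - 1)) := by ring
          _ = _ := by rw [← e, hD]; ring
    _ ≤ D * ((2 / ε + 2 * Real.Gamma ε) * Λ ^ (-ε) * t ^ (ε - 1)) := by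
        rw [integral_const_mul]
        exact mul_le_mul_of_nonneg_left hI.2 hD0
    _ = _ := by rw [hD]; ring

/-- The iterates of a Volterra kernel. -/
def iterKer {d : ℕ} (K : ℝ → (Fin d → ℝ) → (Fin d → ℝ) → ℂ) :
    ℕ → ℝ → (Fin d → ℝ) → (Fin d → ℝ) → ℂ
  | 0 => K
  | n + 1 => volterra K (iterKer K n)

/-- The resolvent (Neumann series) of a Volterra kernel. -/
def resolvent {d : ℕ} (K : ℝ → (Fin d → ℝ) → (Fin d → ℝ) → ℂ) (t : ℝ) (x y : Fin d → ℝ) : ℂ :=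
  ∑' n, iterKer K n t x y

theorem KerMeas.iterKer (hf : KerMeas f) (n : ℕ) : KerMeas (AnisotropicParabolic.iterKer f n) := by
  induction n with
  | zero => exact hf
  | succ n ih => exact hf.volterra ih

theorem KerMeas.resolvent (hf : KerMeas f) : KerMeas (AnisotropicParabolic.resolvent f) := by
  unfold KerMeas AnisotropicParabolic.resolvent
  exact Measurable.tsum fun n => hf.iterKer n

include hs hN in
-- For large `Λ` the Volterra operator contracts by one half in the weighted norm, so the series is
-- geometric with sum `2 * F`, and no factorial decay of the iterates is needed. `Λ` is fixed before
-- the kernel `K`.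
theorem exists_resolvent_bound (hc : 0 ≤ c) {ε : ℝ} (hε0 : 0 < ε) (hε : ε ≤ 1) (F γ : ℝ)
    (hF : 0 ≤ F) : ∃ Λ : ℝ, 0 < Λ ∧ ∀ K : ℝ → (Fin d → ℝ) → (Fin d → ℝ) → ℂ, KerMeas K →
      KerBound s N c γ ε F K →
      KerBound s N c (γ + Λ) ε (2 * F) (resolvent K) ∧
      ∀ t : ℝ, 0 < t → ∀ x y, resolvent K t x y = K t x y + volterra K (resolvent K) t x y := by
  set D : ℝ := F * ((8 * Real.pi) ^ d * (2 / ε + 2 * Real.Gamma ε)) with hD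
  have hGpos := Real.Gamma_pos_of_pos hε0
  have hD0 : 0 ≤ D := by have := Real.pi_pos; positivity
  -- With this value `D * Λ ^ (-ε) = D / (2 * D + 1) ≤ 1 / 2`.
  set Λ : ℝ := (2 * D + 1) ^ (1 / ε) with hΛ
  have hΛ0 : 0 < Λ := by positivity
  have hDΛ : D * Λ ^ (-ε) ≤ 1 / 2 := by
    rw [hΛ, ← Real.rpow_mul (by positivity), show 1 / ε * -ε = -1 by field_simp, Real.rpow_neg_one,
      ← div_eq_mul_inv, div_le_div_iff₀ (by positivity) (by norm_num)]
    linarith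
  refine ⟨Λ, hΛ0, fun K hKm hK => ?_⟩
  have hiter : ∀ n, KerBound s N c (γ + Λ) ε (F * (1 / 2) ^ n) (iterKer K n) := by
    intro n
    induction n with
    | zero =>
      rw [pow_zero, mul_one]
      exact hK.mono (by linarith) le_rfl
    | succ n ih =>
      refine (norm_volterra_le hs hN hc hε0 hε hΛ0 hK ih).mono le_rfl ?_
      calc _ = F * (1 / 2) ^ n * (D * Λ ^ (-ε)) := by rw [hD]; ring
        _ ≤ F * (1 / 2) ^ n * (1 / 2) := mul_le_mul_of_nonneg_left hDΛ (by positivity)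
        _ = _ := by ring
  have hgeo : HasSum (fun n : ℕ => (1 / 2 : ℝ) ^ n) 2 := hasSum_geometric_two
  have hsum : ∀ t : ℝ, 0 < t → ∀ x y, Summable fun n => iterKer K n t x y := fun t ht x y => by
    refine Summable.of_norm_bounded (hgeo.summable.mul_left
      (F * Real.exp ((γ + Λ) * t) * t ^ (ε - 1) * maj s N c t (x - y))) fun n => ?_
    refine (hiter n t ht x y).trans (le_of_eq ?_)
    ring
  have hbound : KerBound s N c (γ + Λ) ε (2 * F) (resolvent K) := by
    intro t ht x y
    refine tsum_of_norm_bounded (hgeo.mul_left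
      (F * Real.exp ((γ + Λ) * t) * t ^ (ε - 1) * maj s N c t (x - y))) (fun n => ?_) |>.trans
      (le_of_eq (by ring))
    refine (hiter n t ht x y).trans (le_of_eq ?_)
    ring
  refine ⟨hbound, fun t ht x y => ?_⟩
  have hK' : KerBound s N c (γ + Λ) ε F K := hK.mono (by linarith) le_rfl
  -- The series is exchanged with the space integral and then with the time integral; geometric
  -- decay makes the integrated norms summable both times.
  have hslice : ∀ r ∈ Ioo 0 t, HasSum (fun n => slice K (iterKer K n) (t - r) r x y)
      (slice K (resolvent K) (t - r) r x y) := by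
    intro r hr
    have hτ := sub_pos.2 hr.2
    have h := hasSum_integral_of_summable_integral_norm
      (μ := (volume : Measure (Fin d → ℝ)))
      (F := fun n z => K (t - r) x z * iterKer K n r z y)
      (fun n => integrable_mul_of_le_maj hs hN hc hτ hr.1 (hKm.section_right _ _)
        ((hKm.iterKer n).section_left _ _) (fun z => hK' (t - r) hτ x z)
        (fun z => hiter n r hr.1 z y)) ?_
    · unfold slice resolvent
      simp_rw [tsum_mul_left] at h
      exact h
    · refine Summable.of_nonneg_of_le (fun n => integral_nonneg fun z => norm_nonneg _)
        (fun n => (norm_integral_mul_le_maj hs hN hc hτ hr.1 (fun z => hK' (t - r) hτ x z)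
        (fun z => hiter n r hr.1 z y)).1) ?_
      refine (hgeo.summable.mul_left ((F * Real.exp ((γ + Λ) * (t - r)) * (t - r) ^ (ε - 1)) *
        (F * Real.exp ((γ + Λ) * r) * r ^ (ε - 1)) *
        ((8 * Real.pi) ^ d * maj s N c (t - r + r) (x - y)))).congr fun n => ?_
      ring
  have hvolt : HasSum (fun n => volterra K (iterKer K n) t x y)
      (volterra K (resolvent K) t x y) := by
    have hI := integrableOn_rpow_mul_rpow hε0 hε hε0 hε ht
    have h := hasSum_integral_of_summable_integral_norm
      (μ := (volume : Measure ℝ).restrict (Ioo 0 t))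
      (F := fun n r => slice K (iterKer K n) (t - r) r x y)
      (fun n => integrableOn_slice hs hN hc hε0 hε hε0 hε hKm (hKm.iterKer n) hK' (hiter n) ht x y)
      ?_
    · have e : ∫ r in Ioo 0 t, ∑' n, slice K (iterKer K n) (t - r) r x y =
          volterra K (resolvent K) t x y :=
        setIntegral_congr_fun measurableSet_Ioo fun r hr => (hslice r hr).tsum_eq
      rw [e] at h
      exact h
    · refine Summable.of_nonneg_of_le (fun n => integral_nonneg fun z => norm_nonneg _)
        (fun n => ?_) (hgeo.summable.mul_left (F * F * (8 * Real.pi) ^ d *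
          Real.exp ((γ + Λ) * t) * (∫ r in Ioo 0 t, (t - r) ^ (ε - 1) * r ^ (ε - 1)) *
          maj s N c t (x - y)))
      calc _ ≤ ∫ r in Ioo 0 t, F * (F * (1 / 2) ^ n) * (8 * Real.pi) ^ d *
            Real.exp ((γ + Λ) * t) * ((t - r) ^ (ε - 1) * r ^ (ε - 1)) * maj s N c t (x - y) := by
            refine integral_mono_of_nonneg (Eventually.of_forall fun r => norm_nonneg _)
              ((hI.1.const_mul _).mul_const _) ?_
            filter_upwards [ae_restrict_mem measurableSet_Ioo] with r hr
            exact norm_slice_le hs hN hc hK' (hiter n) hr x y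
        _ = _ := by
            rw [integral_mul_const, integral_const_mul]; ring
  have h1 := (hsum t ht x y).tsum_eq_zero_add
  unfold resolvent at h1 ⊢
  rw [h1]
  congr 1
  exact hvolt.tsum_eq

end volterra

/-! ### Levi's density -/

/-- The frozen kernel `∂^k Z(t, z, x - z)`, with the coefficients frozen at the second variable. -/
def zker {d : ℕ} (s : Fin d → ℕ) (N : ℕ) (a : (Fin d → ℕ) → (Fin d → ℝ) → ℂ) (k : Fin d → ℕ)
    (t : ℝ) (x z : Fin d → ℝ) : ℂ := frz s N a k t z (x - z)

section levi

variable {d : ℕ} {s : Fin d → ℕ} {N : ℕ} {δ A H α C c γ : ℝ}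
  {a : (Fin d → ℕ) → (Fin d → ℝ) → ℂ}

theorem kerMeas_zker (ha : ∀ l ∈ multiIndices s N, Measurable (a l)) (k : Fin d → ℕ) :
    KerMeas (zker s N a k) := by
  have hm : Measurable fun q : ℝ × (Fin d → ℝ) × (Fin d → ℝ) => (q.1, q.2.2, q.2.1 - q.2.2) := by
    fun_prop
  have h := (measurable_fundKer ha k).comp hm
  exact h

theorem kerMeas_leviKer (ha : ∀ l ∈ multiIndices s N, Measurable (a l)) :
    KerMeas (leviKer s N a) := by
  unfold KerMeas leviKer
  refine Finset.measurable_sum _ fun l hl => Measurable.mul ?_ (kerMeas_zker ha l)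
  exact ((ha l hl).comp (measurable_fst.comp measurable_snd)).sub
    ((ha l hl).comp (measurable_snd.comp measurable_snd))

theorem CoeffAssumptions.measurable (hs : ∀ j, 0 < s j) (hα : 0 < α)
    (ha : CoeffAssumptions s N δ A H α a) : ∀ l ∈ multiIndices s N, Measurable (a l) :=
  fun _ hl => (ha.continuous hs hα ((mem_multiIndices hs).1 hl)).measurable

theorem FrozenBounds.mono {C' γ' : ℝ} (h : FrozenBounds s N α C c γ a) (hC0 : 0 ≤ C) (hC : C ≤ C')
    (hγ : γ ≤ γ') : FrozenBounds s N α C' c γ' a := by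
  have hC0' : 0 ≤ C' := hC0.trans hC
  have key : ∀ t : ℝ, 0 < t → C * Real.exp (γ * t) ≤ C' * Real.exp (γ' * t) := fun t ht => by gcongr
  have hm : ∀ t : ℝ, 0 < t → ∀ x, 0 ≤ maj s N c t x := fun t ht x => maj_nonneg ht c x
  refine ⟨fun k hk x => (h.coeff k hk x).trans hC, fun k hk θ h0 h1 t ht w x =>
    (h.weight k hk θ h0 h1 t ht w x).trans ?_, fun k hk t ht x z =>
    (h.diff k hk t ht x z).trans ?_, fun k hk β h0 h1 t ht w x x' =>
    (h.holder k hk β h0 h1 t ht w x x').trans ?_, fun t ht x z =>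
    (h.levi t ht x z).trans ?_, fun β h0 h1 t ht x x' z =>
    (h.levi_holder β h0 h1 t ht x x' z).trans ?_⟩
  all_goals
    have := key t ht
    have hr : ∀ u : ℝ, 0 ≤ t ^ u := fun u => Real.rpow_nonneg ht.le u
  · exact mul_le_mul_of_nonneg_right (mul_le_mul_of_nonneg_right this (hr _)) (hm t ht _)
  · exact mul_le_mul_of_nonneg_right (mul_le_mul_of_nonneg_right this (hr _)) (hm t ht _)
  · exact mul_le_mul_of_nonneg_right (mul_le_mul_of_nonneg_right
      (mul_le_mul_of_nonneg_right this (hr _)) (Real.rpow_nonneg (snorm_nonneg _) _))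
      (add_nonneg (hm t ht _) (hm t ht _))
  · exact mul_le_mul_of_nonneg_right (mul_le_mul_of_nonneg_right this (hr _)) (hm t ht _)
  · exact mul_le_mul_of_nonneg_right (mul_le_mul_of_nonneg_right
      (mul_le_mul_of_nonneg_right this (hr _)) (Real.rpow_nonneg (snorm_nonneg _) _))
      (add_nonneg (hm t ht _) (hm t ht _))

/-- This is the weight bound with `θ = 0`. The exponent `1 - sdeg s k / N` is zero at degree `N`, so
the direct convolution bounds fail exactly at top order. -/
theorem FrozenBounds.kerBound (h : FrozenBounds s N α C c γ a) {k : Fin d → ℕ}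
    (hk : sdeg s k ≤ 2 * N) : KerBound s N c γ (1 - sdeg s k / N) C (zker s N a k) := by
  intro t ht x y
  have := h.weight k hk 0 le_rfl zero_le_one t ht y (x - y)
  rw [Real.rpow_zero, one_mul, zero_sub] at this
  rw [show (1 - (sdeg s k : ℝ) / N - 1) = -(sdeg s k : ℝ) / N by ring]
  exact this

theorem FrozenBounds.kerBound_levi (h : FrozenBounds s N α C c γ a) :
    KerBound s N c γ (α / N) C (leviKer s N a) := by
  intro t ht x y
  rw [show α / N - 1 = -1 + α / N by ring]
  exact h.levi t ht x y


/-- The Volterra convolution inherits regularity in the first variable from its first factor. -/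
theorem norm_volterra_sub_le {u v F G : ℝ} {f g : ℝ → (Fin d → ℝ) → (Fin d → ℝ) → ℂ}     (hu0 : 0 < u) (hu : u ≤ 1) (hv0 : 0 < v) (hv : v ≤ 1) {x x' : Fin d → ℝ} (hF : 0 ≤ F)
    (hG : 0 ≤ G) {t : ℝ} (ht : 0 < t) {y : Fin d → ℝ}
    (hI : IntegrableOn (fun r => slice f g (t - r) r x y) (Ioo 0 t))
    (hI' : IntegrableOn (fun r => slice f g (t - r) r x' y) (Ioo 0 t))
    (hfg : ∀ r ∈ Ioo 0 t, ‖slice f g (t - r) r x y - slice f g (t - r) r x' y‖ ≤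
      F * G * Real.exp (γ * t) * ((t - r) ^ (u - 1) * r ^ (v - 1)) *
        (maj s N c t (x - y) + maj s N c t (x' - y))) :
    ‖volterra f g t x y - volterra f g t x' y‖ ≤
      F * G * (2 * (1 / u + 1 / v)) * Real.exp (γ * t) * t ^ (u + v - 1) *
        (maj s N c t (x - y) + maj s N c t (x' - y)) := by
  have hm := maj_nonneg (s := s) (N := N) ht c (x - y)
  have hm' := maj_nonneg (s := s) (N := N) ht c (x' - y)
  have hJ := integrableOn_rpow_mul_rpow hu0 hu hv0 hv ht
  unfold volterra
  rw [← integral_sub hI hI']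
  calc _ ≤ ∫ r in Ioo 0 t, F * G * Real.exp (γ * t) * ((t - r) ^ (u - 1) * r ^ (v - 1)) *
        (maj s N c t (x - y) + maj s N c t (x' - y)) := by
        refine norm_integral_le_of_norm_le ((hJ.1.const_mul _).mul_const _) ?_
        filter_upwards [ae_restrict_mem measurableSet_Ioo] with r hr
        exact hfg r hr
    _ = F * G * Real.exp (γ * t) * (∫ r in Ioo 0 t, (t - r) ^ (u - 1) * r ^ (v - 1)) *
        (maj s N c t (x - y) + maj s N c t (x' - y)) := by
        rw [integral_mul_const, integral_const_mul]
    _ ≤ F * G * Real.exp (γ * t) * (2 * (1 / u + 1 / v) * t ^ (u + v - 1)) *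
        (maj s N c t (x - y) + maj s N c t (x' - y)) := by
        gcongr
        exact hJ.2
    _ = _ := by ring

variable (hs : ∀ j, 0 < s j) (hN : ∀ j, s j < N)

include hs hN in
theorem norm_slice_sub_le {u v F G : ℝ} {f g : ℝ → (Fin d → ℝ) → (Fin d → ℝ) → ℂ} (hc : 0 ≤ c)
    {x x' y : Fin d → ℝ} {t r : ℝ} (hr : r ∈ Ioo 0 t)
    (hi : Integrable fun z => f (t - r) x z * g r z y)
    (hi' : Integrable fun z => f (t - r) x' z * g r z y) (hF : 0 ≤ F) (hG : 0 ≤ G)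
    (hf : ∀ z, ‖f (t - r) x z - f (t - r) x' z‖ ≤ F * Real.exp (γ * (t - r)) * (t - r) ^ (u - 1) *
      (maj s N c (t - r) (x - z) + maj s N c (t - r) (x' - z)))
    (hg : KerBound s N c γ v G g) :
    ‖slice f g (t - r) r x y - slice f g (t - r) r x' y‖ ≤
      F * (G * (8 * Real.pi) ^ d) * Real.exp (γ * t) * ((t - r) ^ (u - 1) * r ^ (v - 1)) *
        (maj s N c t (x - y) + maj s N c t (x' - y)) := by
  have hτ := sub_pos.2 hr.2
  have h1 := integrable_maj_mul_maj hs hN hc hτ hr.1 x y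
  have h2 := integrable_maj_mul_maj hs hN hc hτ hr.1 x' y
  have h1' := integral_maj_mul_maj_le hs hN hc hτ hr.1 x y
  have h2' := integral_maj_mul_maj_le hs hN hc hτ hr.1 x' y
  rw [sub_add_cancel] at h1' h2'
  have e : Real.exp (γ * t) = Real.exp (γ * (t - r)) * Real.exp (γ * r) := by
    rw [← Real.exp_add]; congr 1; ring
  have h3 : 0 ≤ (t - r) ^ (u - 1) := Real.rpow_nonneg hτ.le _
  have h4 : 0 ≤ r ^ (v - 1) := Real.rpow_nonneg hr.1.le _
  obtain ⟨D, hD⟩ : ∃ D, D = F * G * Real.exp (γ * t) * ((t - r) ^ (u - 1) * r ^ (v - 1)) := ⟨_, rfl⟩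
  have hD0 : 0 ≤ D := by rw [hD]; positivity
  unfold slice
  rw [← integral_sub hi hi']
  calc _ ≤ ∫ z, D * (maj s N c (t - r) (x - z) * maj s N c r (z - y) +
        maj s N c (t - r) (x' - z) * maj s N c r (z - y)) := by
        refine norm_integral_le_of_norm_le ((h1.add h2).const_mul D) (Eventually.of_forall fun z => ?_)
        rw [← sub_mul, norm_mul]
        refine (mul_le_mul (hf z) (hg r hr.1 z y) (norm_nonneg _)
          ((norm_nonneg _).trans (hf z))).trans (le_of_eq ?_)
        rw [hD, e]; ring
    _ = D * ((∫ z, maj s N c (t - r) (x - z) * maj s N c r (z - y)) +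
        ∫ z, maj s N c (t - r) (x' - z) * maj s N c r (z - y)) := by
        rw [integral_const_mul, integral_add h1 h2]
    _ ≤ D * ((8 * Real.pi) ^ d * maj s N c t (x - y) + (8 * Real.pi) ^ d * maj s N c t (x' - y)) :=
        mul_le_mul_of_nonneg_left (add_le_add h1' h2') hD0
    _ = _ := by rw [hD]; ring

end levi

/-- The density `Φ` of Levi's method: the resolvent of Levi's kernel, with its bounds. -/
structure LeviDensity {d : ℕ} (s : Fin d → ℕ) (N : ℕ) (α θ C c γ : ℝ)
    (a : (Fin d → ℕ) → (Fin d → ℝ) → ℂ) (Φ : ℝ → (Fin d → ℝ) → (Fin d → ℝ) → ℂ) : Prop where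
  frozen : FrozenBounds s N α C c γ a
  meas_coeff : ∀ l ∈ multiIndices s N, Measurable (a l)
  meas : KerMeas Φ
  bound : KerBound s N c γ (α / N) C Φ
  holder : ∀ t : ℝ, 0 < t → ∀ x x' y, ‖Φ t x y - Φ t x' y‖ ≤
    C * Real.exp (γ * t) * t ^ ((α - θ) / N - 1) * snorm s (x - x') ^ θ *
      (maj s N c t (x - y) + maj s N c t (x' - y))
  eqn : ∀ t : ℝ, 0 < t → ∀ x y, Φ t x y = leviKer s N a t x y + volterra (leviKer s N a) Φ t x y

/-- Hölder continuity is read off the equation `Φ = K + K ⋆ Φ`, since regularity in the first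
variable passes through the first factor of a convolution. Integrability in time requires `(α - θ) /
N > 0`, hence the strict inequality `θ < α`. The resolvent itself does not depend on `θ`, which only
indexes the bound. -/
theorem exists_leviDensity {d : ℕ} {s : Fin d → ℕ} {N : ℕ} {δ α θ : ℝ} (hs : ∀ j, 0 < s j)
    (hN : ∀ j, s j < N) (hN0 : 0 < N) (A H : ℝ) (hδ : 0 < δ) (hα0 : 0 < α) (hα1 : α < 1)
    (hθ0 : 0 ≤ θ) (hθ : θ < α) : ∃ C c γ : ℝ, 0 < C ∧ 0 < c ∧ 0 < γ ∧
      ∀ a, CoeffAssumptions s N δ A H α a →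
        LeviDensity s N α θ C c γ a (resolvent (leviKer s N a)) := by
  obtain ⟨C₀, c, γ₀, hC₀, hc, hγ₀, hfr⟩ := exists_frozenBounds (s := s) (N := N) hs hN hN0 A H hδ
    hα0 hα1
  have hN' : (1 : ℝ) ≤ N := by exact_mod_cast hN0
  have hN'' : (0 : ℝ) < N := by linarith
  have hε0 : 0 < α / N := by positivity
  have hε1 : α / N ≤ 1 := (div_le_one hN'').2 (by linarith)
  have hu0 : 0 < (α - θ) / N := div_pos (by linarith) hN''
  have hu1 : (α - θ) / N ≤ 1 := (div_le_one hN'').2 (by linarith)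
  obtain ⟨Λ, hΛ, hres⟩ := exists_resolvent_bound (s := s) hs hN hc.le hε0 hε1 C₀ γ₀ hC₀.le
  have hπ : 0 < (8 * Real.pi) ^ d := by have := Real.pi_pos; positivity
  obtain ⟨M, hM⟩ : ∃ M, M = C₀ * (2 * C₀ * (8 * Real.pi) ^ d) *
    (2 * (1 / ((α - θ) / N) + 1 / (α / N))) := ⟨_, rfl⟩
  have hM0 : 0 < M := by rw [hM]; positivity
  refine ⟨2 * C₀ + M, c, γ₀ + Λ + 1, by positivity, hc, by positivity, fun a ha => ?_⟩
  have hf := hfr a ha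
  have hmeas := ha.measurable hs hα0
  have hKm := kerMeas_leviKer hmeas
  obtain ⟨hb, heq⟩ := hres _ hKm hf.kerBound_levi
  have hf' := hf.mono (γ' := γ₀ + Λ) hC₀.le le_rfl (by linarith)
  refine ⟨hf.mono hC₀.le (by linarith) (by linarith), hmeas, hKm.resolvent,
    hb.mono (by linarith) (by linarith), fun t ht x x' y => ?_, heq⟩
  have hI := fun w => integrableOn_slice hs hN hc.le hε0 hε1 hε0 hε1 hKm hKm.resolvent
    hf'.kerBound_levi hb ht w y
  have hr0 : 0 ≤ snorm s (x - x') ^ θ := Real.rpow_nonneg (snorm_nonneg _) _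
  have hm := maj_nonneg (s := s) (N := N) ht c (x - y)
  have hm' := maj_nonneg (s := s) (N := N) ht c (x' - y)
  have h1 := hf'.levi_holder θ hθ0 hθ.le t ht x x' y
  have h2 := norm_volterra_sub_le (f := leviKer s N a) (g := resolvent (leviKer s N a))
    (F := C₀ * snorm s (x - x') ^ θ) (G := 2 * C₀ * (8 * Real.pi) ^ d) (γ := γ₀ + Λ)
    hu0 hu1 hε0 hε1 (x := x) (x' := x') (by positivity) (by positivity) ht
    (hI x) (hI x') fun r hr => by
      have hint : ∀ w, Integrable fun z => leviKer s N a (t - r) w z *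
          resolvent (leviKer s N a) r z y := fun w =>
        integrable_mul_of_le_maj hs hN hc.le (sub_pos.2 hr.2) hr.1 (hKm.section_right _ _)
          (hKm.resolvent.section_left _ _) (fun z => hf'.kerBound_levi _ (sub_pos.2 hr.2) w z)
          (fun z => hb r hr.1 z y)
      refine norm_slice_sub_le hs hN hc.le hr (hint x) (hint x') (by positivity) (by positivity)
        (fun z => (hf'.levi_holder θ hθ0 hθ.le (t - r) (sub_pos.2 hr.2) x x' z).trans
          (le_of_eq ?_)) hb
      rw [show -1 + (α - θ) / N = (α - θ) / N - 1 by ring]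
      ring
  rw [heq t ht x y, heq t ht x' y, add_sub_add_comm]
  have h3 : t ^ ((α - θ) / N + α / N - 1) ≤ Real.exp t * t ^ ((α - θ) / N - 1) := by
    rw [show (α - θ) / N + α / N - 1 = α / N + ((α - θ) / N - 1) by ring, Real.rpow_add ht]
    gcongr
    exact rpow_le_exp ht hε0.le hε1
  have h4 : Real.exp ((γ₀ + Λ) * t) ≤ Real.exp ((γ₀ + Λ + 1) * t)  :=
    Real.exp_le_exp.2 (mul_le_mul_of_nonneg_right (by linarith) ht.le)
  have h0 : 0 ≤ t ^ ((α - θ) / N - 1) := Real.rpow_nonneg ht.le _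
  have hp : 0 ≤ t ^ ((α - θ) / N - 1) * snorm s (x - x') ^ θ *
      (maj s N c t (x - y) + maj s N c t (x' - y)) := by positivity
  calc _ ≤ C₀ * Real.exp ((γ₀ + Λ) * t) * (t ^ ((α - θ) / N - 1) * snorm s (x - x') ^ θ *
        (maj s N c t (x - y) + maj s N c t (x' - y))) +
        M * Real.exp ((γ₀ + Λ) * t) * t ^ ((α - θ) / N + α / N - 1) * snorm s (x - x') ^ θ *
        (maj s N c t (x - y) + maj s N c t (x' - y)) := by
        refine (norm_add_le _ _).trans (add_le_add (h1.trans (le_of_eq ?_))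
          (h2.trans (le_of_eq ?_)))
        · rw [show -1 + (α - θ) / N = (α - θ) / N - 1 by ring]; ring
        · rw [hM]; ring
    _ ≤ C₀ * Real.exp ((γ₀ + Λ + 1) * t) * (t ^ ((α - θ) / N - 1) * snorm s (x - x') ^ θ *
        (maj s N c t (x - y) + maj s N c t (x' - y))) +
        M * Real.exp ((γ₀ + Λ) * t) * (Real.exp t * t ^ ((α - θ) / N - 1)) *
        snorm s (x - x') ^ θ * (maj s N c t (x - y) + maj s N c t (x' - y)) := by
        gcongr
    _ = (C₀ + M) * Real.exp ((γ₀ + Λ + 1) * t) * (t ^ ((α - θ) / N - 1) *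
        snorm s (x - x') ^ θ * (maj s N c t (x - y) + maj s N c t (x' - y))) := by
        rw [← exp_mul_exp_self (γ₀ + Λ) t]; ring
    _ ≤ (2 * C₀ + M) * Real.exp ((γ₀ + Λ + 1) * t) * (t ^ ((α - θ) / N - 1) *
        snorm s (x - x') ^ θ * (maj s N c t (x - y) + maj s N c t (x' - y))) := by
        gcongr; linarith
    _ = _ := by ring

/-! ### Convolution of singular kernels with the density -/

section singular

variable {d : ℕ} {s : Fin d → ℕ} {N : ℕ} {δ A H α θ C c γ : ℝ}
  {a : (Fin d → ℕ) → (Fin d → ℝ) → ℂ} {Φ : ℝ → (Fin d → ℝ) → (Fin d → ℝ) → ℂ}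

variable (hs : ∀ j, 0 < s j) (hN : ∀ j, s j < N)

include hs hN in
theorem integrable_of_le_maj (hc : 0 ≤ c) {t B : ℝ} (ht : 0 < t) {x : Fin d → ℝ}
    {f : (Fin d → ℝ) → ℂ} (hfm : Measurable f) (hf : ∀ z, ‖f z‖ ≤ B * maj s N c t (x - z)) :
    Integrable f :=
  (((integrable_maj hs hN hc ht).comp_sub_left x).const_mul B).mono' hfm.aestronglyMeasurable
    (Eventually.of_forall hf)

theorem integral_maj_sub_le (hc : 0 ≤ c) {t : ℝ} (ht : 0 < t) (x : Fin d → ℝ) :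
    ∫ z, maj s N c t (x - z) ≤ Real.pi ^ d := by
  rw [integral_sub_left_eq_self (fun z => maj s N c t z) volume x]
  exact integral_maj_le hc ht

include hs hN in
/-- Cancellation: the integral of a derivative of the frozen kernel gains the Hölder exponent. -/
theorem norm_integral_zker_le (hN0 : 0 < N) (hδ : 0 < δ) (hα : 0 < α)
    (ha : CoeffAssumptions s N δ A H α a) (hf : FrozenBounds s N α C c γ a) (hc : 0 ≤ c)
    (hC : 0 ≤ C)
    {k : Fin d → ℕ} (hk : sdeg s k ≤ 2 * N) (hk0 : k ≠ 0) {t : ℝ} (ht : 0 < t) (x : Fin d → ℝ) :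
    ‖∫ z, zker s N a k t x z‖ ≤ C * Real.exp (γ * t) * t ^ ((α - sdeg s k) / N) * Real.pi ^ d := by
  have hp := ha.parabolicSymbol hs x
  have hi : Integrable (fun z => frz s N a k t x (x - z)) :=
    (integrable_fundKer hs hN hN0 hδ (abs_nonneg A) hp k ht).comp_sub_left x
  have h0 : ∫ z, frz s N a k t x (x - z) = 0 := by
    rw [integral_sub_left_eq_self (fun z => frz s N a k t x z) volume x]
    exact integral_fundKer_of_ne_zero hs hN hN0 hδ (abs_nonneg A) hp hk0 ht
  have hi' : Integrable (fun z => zker s N a k t x z) :=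
    integrable_of_le_maj hs hN hc ht
      ((kerMeas_zker (ha.measurable hs hα) k).section_right t x) (fun z => hf.kerBound hk t ht x z)
  -- Frozen at the variable of integration the kernel has no exact cancellation; frozen at `x` it
  -- has mean zero, and the discrepancy of the two freezings gains the exponent `α`.
  have e : ∫ z, zker s N a k t x z = ∫ z, (zker s N a k t x z - frz s N a k t x (x - z)) := by
    rw [integral_sub hi' hi, h0, sub_zero]
  rw [e]
  have hr : 0 ≤ t ^ ((α - sdeg s k) / N) := Real.rpow_nonneg ht.le _
  calc _ ≤ ∫ z, C * Real.exp (γ * t) * t ^ ((α - sdeg s k) / N) * maj s N c t (x - z) :=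
        norm_integral_le_of_norm_le (((integrable_maj hs hN hc ht).comp_sub_left x).const_mul _)
          (Eventually.of_forall fun z => hf.diff k hk t ht x z)
    _ ≤ _ := by
        rw [integral_const_mul]
        exact mul_le_mul_of_nonneg_left (integral_maj_sub_le hc ht x) (by positivity)

include hs hN in
/-- The part of the convolution with the increment of the density. -/
theorem norm_integral_zker_mul_sub_le (hΦ : LeviDensity s N α θ C c γ a Φ) (hc : 0 ≤ c)
    (hC : 0 ≤ C) (hθ0 : 0 ≤ θ) (hθ1 : θ ≤ 1) {k : Fin d → ℕ} (hk : sdeg s k ≤ 2 * N) {t r : ℝ}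
    (hr : r ∈ Ioo 0 t) (htr : t / 2 ≤ r) (x y : Fin d → ℝ) :
    ‖∫ z, zker s N a k (t - r) x z * (Φ r z y - Φ r x y)‖ ≤
      C * C * ((8 * Real.pi) ^ d + Real.pi ^ d * 4 ^ d) * Real.exp (γ * t) *
        ((t - r) ^ ((θ - sdeg s k) / N) * r ^ ((α - θ) / N - 1)) * maj s N c t (x - y) := by
  have hτ := sub_pos.2 hr.2
  have h1 := integrable_maj_mul_maj hs hN hc hτ hr.1 x y
  have h1' := integral_maj_mul_maj_le hs hN hc hτ hr.1 x y
  rw [sub_add_cancel] at h1'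
  have h2 : Integrable fun z => maj s N c (t - r) (x - z) * maj s N c r (x - y) :=
    ((integrable_maj hs hN hc hτ).comp_sub_left x).mul_const _
  have h3 : maj s N c r (x - y) ≤ 4 ^ d * maj s N c t (x - y) :=
    maj_le_of_half hs hN hc hr.1 hr.2.le (by linarith) _
  have hm := maj_nonneg (s := s) (N := N) (hr.1.trans hr.2) c (x - y)
  have hmr := maj_nonneg (s := s) (N := N) hr.1 c (x - y)
  have h2' : ∫ z, maj s N c (t - r) (x - z) * maj s N c r (x - y) ≤
      Real.pi ^ d * (4 ^ d * maj s N c t (x - y)) := by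
    rw [integral_mul_const]
    have hπ := Real.pi_pos
    exact mul_le_mul (integral_maj_sub_le hc hτ x) h3 hmr (by positivity)
  have e : Real.exp (γ * t) = Real.exp (γ * (t - r)) * Real.exp (γ * r) := by
    rw [← Real.exp_add]; congr 1; ring
  have h4 : 0 ≤ (t - r) ^ ((θ - sdeg s k) / N) := Real.rpow_nonneg hτ.le _
  have h5 : 0 ≤ r ^ ((α - θ) / N - 1) := Real.rpow_nonneg hr.1.le _
  obtain ⟨D, hD⟩ : ∃ D, D = C * C * Real.exp (γ * t) *
    ((t - r) ^ ((θ - sdeg s k) / N) * r ^ ((α - θ) / N - 1)) := ⟨_, rfl⟩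
  have hD0 : 0 ≤ D := by rw [hD]; positivity
  calc _ ≤ ∫ z, D * (maj s N c (t - r) (x - z) * maj s N c r (z - y) +
        maj s N c (t - r) (x - z) * maj s N c r (x - y)) := by
        refine norm_integral_le_of_norm_le ((h1.add h2).const_mul D)
          (Eventually.of_forall fun z => ?_)
        rw [norm_mul]
        have hw := hΦ.frozen.weight k hk θ hθ0 hθ1 (t - r) hτ z (x - z)
        have hh := hΦ.holder r hr.1 z x y
        rw [snorm_sub_comm] at hh
        have hmm := add_nonneg (maj_nonneg (s := s) (N := N) hr.1 c (z - y)) hmr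
        calc _ ≤ ‖zker s N a k (t - r) x z‖ * _ := mul_le_mul_of_nonneg_left hh (norm_nonneg _)
          _ = (snorm s (x - z) ^ θ * ‖zker s N a k (t - r) x z‖) * (C * Real.exp (γ * r) *
              r ^ ((α - θ) / N - 1) * (maj s N c r (z - y) + maj s N c r (x - y))) := by ring
          _ ≤ _ := mul_le_mul_of_nonneg_right hw (by positivity)
          _ = _ := by rw [hD, e]; ring
    _ = D * ((∫ z, maj s N c (t - r) (x - z) * maj s N c r (z - y)) +
        ∫ z, maj s N c (t - r) (x - z) * maj s N c r (x - y)) := by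
        rw [integral_const_mul, integral_add h1 h2]
    _ ≤ D * ((8 * Real.pi) ^ d * maj s N c t (x - y) +
        Real.pi ^ d * (4 ^ d * maj s N c t (x - y))) :=
        mul_le_mul_of_nonneg_left (add_le_add h1' h2') hD0
    _ = _ := by rw [hD]; ring

include hs hN in
-- Subtracting and adding the density at `x` pairs its increment with the weight of the kernel and
-- its value with the cancellation of the kernel.
theorem slice_zker_eq (ha : ∀ l ∈ multiIndices s N, Measurable (a l)) (hΦm : KerMeas Φ)
    (hf : FrozenBounds s N α C c γ a) (hΦ : KerBound s N c γ (α / N) C Φ) (hc : 0 ≤ c)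
    {k : Fin d → ℕ} (hk : sdeg s k ≤ 2 * N) {τ r : ℝ} (hτ : 0 < τ) (hr : 0 < r)
    (x y : Fin d → ℝ) :
    slice (zker s N a k) Φ τ r x y = (∫ z, zker s N a k τ x z * (Φ r z y - Φ r x y)) +
      (∫ z, zker s N a k τ x z) * Φ r x y := by
  have hm := (kerMeas_zker ha k).section_right τ x
  have h1 : Integrable fun z => zker s N a k τ x z * Φ r z y :=
    integrable_mul_of_le_maj hs hN hc hτ hr hm (hΦm.section_left r y)
      (fun z => hf.kerBound hk τ hτ x z) (fun z => hΦ r hr z y)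
  have h2 : Integrable fun z => zker s N a k τ x z * Φ r x y :=
    (integrable_of_le_maj hs hN hc hτ hm fun z => hf.kerBound hk τ hτ x z).mul_const _
  simp_rw [mul_sub]
  rw [integral_sub h1 h2, integral_mul_const, sub_add_cancel]
  rfl

include hs hN in
theorem norm_slice_zker_le_late (hN0 : 0 < N) (hδ : 0 < δ) (hα : 0 < α) (hα1 : α ≤ 1)
    (ha : CoeffAssumptions s N δ A H α a) (hΦ : LeviDensity s N α θ C c γ a Φ) (hc : 0 ≤ c)
    (hC : 0 ≤ C) (hθ0 : 0 ≤ θ) (hθ : θ < α) {k : Fin d → ℕ} (hk : sdeg s k ≤ 2 * N)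
    (hk0 : k ≠ 0) {t r : ℝ} (hr : r ∈ Ioo 0 t) (htr : t / 2 ≤ r) (x y : Fin d → ℝ) :
    ‖slice (zker s N a k) Φ (t - r) r x y‖ ≤
      C * C * ((8 * Real.pi) ^ d + 2 * (Real.pi ^ d * 4 ^ d)) * Real.exp ((γ + 1) * t) *
        ((t - r) ^ ((θ - sdeg s k) / N) * r ^ ((α - θ) / N - 1)) * maj s N c t (x - y) := by
  have hτ := sub_pos.2 hr.2
  have ht : 0 < t := hr.1.trans hr.2
  have hN' : (1 : ℝ) ≤ N := by exact_mod_cast hN0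
  have hN'' : (0 : ℝ) < N := by linarith
  have hπ := Real.pi_pos
  have h1 := norm_integral_zker_mul_sub_le hs hN hΦ hc hC hθ0 (hθ.le.trans hα1) hk hr htr x y
  have h2 := norm_integral_zker_le hs hN hN0 hδ hα ha hΦ.frozen hc hC hk hk0 hτ x
  have h3 := hΦ.bound r hr.1 x y
  have h4 : maj s N c r (x - y) ≤ 4 ^ d * maj s N c t (x - y) :=
    maj_le_of_half hs hN hc hr.1 hr.2.le (by linarith) _
  have hm := maj_nonneg (s := s) (N := N) ht c (x - y)
  have h5 : (t - r) ^ ((α - sdeg s k) / N) ≤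
      Real.exp (t - r) * (t - r) ^ ((θ - sdeg s k) / N) := by
    rw [show (α - sdeg s k) / (N : ℝ) = (α - θ) / N + (θ - sdeg s k) / N by ring,
      Real.rpow_add hτ]
    refine mul_le_mul_of_nonneg_right (rpow_le_exp hτ (div_nonneg (by linarith) hN''.le) ?_)
      (Real.rpow_nonneg hτ.le _)
    rw [div_le_one hN'']; linarith
  have h6 : r ^ (α / N - 1) ≤ Real.exp r * r ^ ((α - θ) / N - 1) := by
    rw [show α / (N : ℝ) - 1 = θ / N + ((α - θ) / N - 1) by ring, Real.rpow_add hr.1]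
    refine mul_le_mul_of_nonneg_right (rpow_le_exp hr.1 (div_nonneg hθ0 hN''.le) ?_)
      (Real.rpow_nonneg hr.1.le _)
    rw [div_le_one hN'']; linarith
  have h7 : 0 ≤ (t - r) ^ ((θ - sdeg s k) / N) := Real.rpow_nonneg hτ.le _
  have h8 : 0 ≤ r ^ ((α - θ) / N - 1) := Real.rpow_nonneg hr.1.le _
  have e : Real.exp ((γ + 1) * t) =
      Real.exp (γ * (t - r)) * Real.exp (γ * r) * (Real.exp (t - r) * Real.exp r) := by
    rw [← Real.exp_add, ← Real.exp_add, ← Real.exp_add]; congr 1; ring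
  have h9 : Real.exp (γ * t) ≤ Real.exp ((γ + 1) * t) :=
    Real.exp_le_exp.2 (mul_le_mul_of_nonneg_right (by linarith) ht.le)
  have h2' : ‖∫ z, zker s N a k (t - r) x z‖ ≤ C * Real.exp (γ * (t - r)) *
      (Real.exp (t - r) * (t - r) ^ ((θ - sdeg s k) / N)) * Real.pi ^ d :=
    h2.trans (by gcongr)
  have h3' : ‖Φ r x y‖ ≤ C * Real.exp (γ * r) * (Real.exp r * r ^ ((α - θ) / N - 1)) *
      (4 ^ d * maj s N c t (x - y)) := by
    have := maj_nonneg (s := s) (N := N) hr.1 c (x - y)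
    exact h3.trans (by gcongr)
  rw [slice_zker_eq hs hN hΦ.meas_coeff hΦ.meas hΦ.frozen hΦ.bound hc hk hτ hr.1]
  have h10 : ‖(∫ z, zker s N a k (t - r) x z) * Φ r x y‖ ≤ C * C * (Real.pi ^ d * 4 ^ d) *
      Real.exp ((γ + 1) * t) * ((t - r) ^ ((θ - sdeg s k) / N) * r ^ ((α - θ) / N - 1)) *
      maj s N c t (x - y) := by
    rw [norm_mul]
    refine (mul_le_mul h2' h3' (norm_nonneg _) ((norm_nonneg _).trans h2')).trans (le_of_eq ?_)
    rw [e]; ring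
  refine (norm_add_le _ _).trans ((add_le_add h1 h10).trans ?_)
  calc _ ≤ C * C * ((8 * Real.pi) ^ d + Real.pi ^ d * 4 ^ d) * Real.exp ((γ + 1) * t) *
        ((t - r) ^ ((θ - sdeg s k) / N) * r ^ ((α - θ) / N - 1)) * maj s N c t (x - y) +
        C * C * (Real.pi ^ d * 4 ^ d) *
        Real.exp ((γ + 1) * t) * ((t - r) ^ ((θ - sdeg s k) / N) * r ^ ((α - θ) / N - 1)) *
        maj s N c t (x - y) := by
        gcongr
    _ = _ := by ring

/-- The constant in the bound of the convolution of a frozen kernel with the density. -/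
def sliceConst (d : ℕ) (C : ℝ) : ℝ := C * C * ((8 * Real.pi) ^ d + 2 * (Real.pi ^ d * 4 ^ d))

theorem sliceConst_nonneg (d : ℕ) (hC : 0 ≤ C) : 0 ≤ sliceConst d C := by
  have := Real.pi_pos
  unfold sliceConst; positivity

include hs hN in
-- In the late half `t / 2 ≤ r` cancellation improves the singularity by `θ / N`; in the early half
-- `t - r` is not small and the plain bound suffices. For `k = 0` there is no cancellation, and
-- accordingly no gain is claimed (`θ = 0`).
theorem norm_slice_zker_le (hN0 : 0 < N) (hδ : 0 < δ) (hα : 0 < α) (hα1 : α ≤ 1)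
    (ha : CoeffAssumptions s N δ A H α a) (hΦ : LeviDensity s N α θ C c γ a Φ) (hc : 0 ≤ c)
    (hC : 0 ≤ C) (hθ0 : 0 ≤ θ) (hθ : θ < α) {k : Fin d → ℕ} (hk : sdeg s k ≤ 2 * N)
    (hk0 : k = 0 → θ = 0) {t r : ℝ} (hr : r ∈ Ioo 0 t) (x y : Fin d → ℝ) :
    ‖slice (zker s N a k) Φ (t - r) r x y‖ ≤
      sliceConst d C * Real.exp ((γ + 1) * t) *
        ((t - r) ^ ((θ - sdeg s k) / N) * r ^ ((α - θ) / N - 1)) * maj s N c t (x - y) := by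
  have hτ := sub_pos.2 hr.2
  have ht : 0 < t := hr.1.trans hr.2
  by_cases hcase : t / 2 ≤ r ∧ k ≠ 0
  · exact norm_slice_zker_le_late hs hN hN0 hδ hα hα1 ha hΦ hc hC hθ0 hθ hk hcase.2 hr hcase.1 x y
  have h1 := norm_slice_le hs hN hc (hΦ.frozen.kerBound hk) hΦ.bound hr x y
  have hm := maj_nonneg (s := s) (N := N) ht c (x - y)
  have hπ := Real.pi_pos
  have h7 : 0 ≤ (t - r) ^ ((θ - sdeg s k) / N) := Real.rpow_nonneg hτ.le _
  have h8 : 0 ≤ r ^ ((α - θ) / N - 1) := Real.rpow_nonneg hr.1.le _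
  have h2 : (t - r) ^ (1 - sdeg s k / N - 1 : ℝ) * r ^ (α / N - 1) ≤
      (t - r) ^ ((θ - sdeg s k) / N) * r ^ ((α - θ) / N - 1) := by
    rcases eq_or_ne θ 0 with h0 | h0
    · rw [h0, zero_sub, sub_zero, show 1 - (sdeg s k : ℝ) / N - 1 = -(sdeg s k : ℝ) / N by ring]
    -- With `θ ≠ 0` only the early half remains. There the power `θ / N` may be transferred from `r`
    -- to `t - r`, which brings the plain bound to the form of the late one.
    have hrt : r ≤ t - r := by
      by_contra hlt
      exact hcase ⟨by linarith, fun hk => h0 (hk0 hk)⟩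
    rw [show (1 - sdeg s k / N - 1 : ℝ) = (θ - sdeg s k) / N + -(θ / N) by ring,
      show α / (N : ℝ) - 1 = ((α - θ) / N - 1) + θ / N by ring, Real.rpow_add hτ,
      Real.rpow_add hr.1, Real.rpow_neg hτ.le]
    have h3 : r ^ (θ / N) ≤ (t - r) ^ (θ / N) :=
      Real.rpow_le_rpow hr.1.le hrt (div_nonneg hθ0 (Nat.cast_nonneg N))
    have h4 : 0 < (t - r) ^ (θ / N) := Real.rpow_pos_of_pos hτ _
    calc _ = (t - r) ^ ((θ - sdeg s k) / N) * r ^ ((α - θ) / N - 1) *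
          (((t - r) ^ (θ / N))⁻¹ * r ^ (θ / N)) := by ring
      _ ≤ (t - r) ^ ((θ - sdeg s k) / N) * r ^ ((α - θ) / N - 1) * 1 := by
          refine mul_le_mul_of_nonneg_left ?_ (mul_nonneg h7 h8)
          rw [inv_mul_le_iff₀ h4, mul_one]
          exact h3
      _ = _ := mul_one _
  have h9 : Real.exp (γ * t) ≤ Real.exp ((γ + 1) * t) :=
    Real.exp_le_exp.2 (mul_le_mul_of_nonneg_right (by linarith) ht.le)
  have h10 : C * C * (8 * Real.pi) ^ d ≤ sliceConst d C := by
    unfold sliceConst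
    refine mul_le_mul_of_nonneg_left ?_ (mul_nonneg hC hC)
    have : 0 ≤ 2 * (Real.pi ^ d * 4 ^ d) := by positivity
    linarith
  have := sliceConst_nonneg d hC
  have h11 : 0 ≤ (t - r) ^ (1 - sdeg s k / N - 1 : ℝ) * r ^ (α / N - 1) :=
    mul_nonneg (Real.rpow_nonneg hτ.le _) (Real.rpow_nonneg hr.1.le _)
  refine h1.trans ?_
  gcongr

end singular

/-! ### Continuity and differentiability of singular time integrals -/

section singularIntegrals

theorem integrableOn_sub_rpow {u a t : ℝ} (hu : 0 < u) (hat : a < t) :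
    IntegrableOn (fun r : ℝ => (t - r) ^ (u - 1)) (Ioo a t) ∧
      ∫ r in Ioo a t, (t - r) ^ (u - 1) = (t - a) ^ u / u := by
  have h1 : IntervalIntegrable (fun r : ℝ => r ^ (u - 1)) volume 0 (t - a) :=
    intervalIntegral.intervalIntegrable_rpow' (by linarith)
  have h2 := h1.comp_sub_left t
  rw [sub_zero, sub_sub_cancel] at h2
  refine ⟨(intervalIntegrable_iff_integrableOn_Ioo_of_le hat.le).1 h2.symm, ?_⟩
  rw [← integral_Ioc_eq_integral_Ioo, ← intervalIntegral.integral_of_le hat.le,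
    intervalIntegral.integral_comp_sub_left (fun r => r ^ (u - 1)) t, sub_self,
    integral_rpow (Or.inl (by linarith)), sub_add_cancel, Real.zero_rpow hu.ne', sub_zero]

theorem integrableOn_sub_rpow_right {u r t : ℝ} (hu : 0 < u) (hrt : r < t) :
    IntegrableOn (fun ρ : ℝ => (ρ - r) ^ (u - 1)) (Ioo r t) := by
  have h1 : IntervalIntegrable (fun r : ℝ => r ^ (u - 1)) volume 0 (t - r) :=
    intervalIntegral.intervalIntegrable_rpow' (by linarith)
  have h2 := h1.comp_sub_right r
  rw [zero_add, sub_add_cancel] at h2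
  exact (intervalIntegrable_iff_integrableOn_Ioo_of_le hrt.le).1 h2

theorem integrableOn_of_singular_bound {j : ℝ → ℂ} {t M u v : ℝ} (ht : 0 < t) (hu0 : 0 < u)
    (hu : u ≤ 1) (hv0 : 0 < v) (hv : v ≤ 1) (hm : Measurable j)
    (hb : ∀ r ∈ Ioo 0 t, ‖j r‖ ≤ M * ((t - r) ^ (u - 1) * r ^ (v - 1))) :
    IntegrableOn j (Ioo 0 t) := by
  refine Integrable.mono' ((integrableOn_rpow_mul_rpow hu0 hu hv0 hv ht).1.const_mul M)
    hm.aestronglyMeasurable ?_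
  filter_upwards [ae_restrict_mem measurableSet_Ioo] with r hr
  exact hb r hr

/-- Joint continuity of `(t, x) ↦ ∫₀ᵗ j(t, r, x) dr` for an integrand with integrable
singularities at the end points. -/
theorem continuousAt_setIntegral_Ioo {E : Type*} [TopologicalSpace E] [FirstCountableTopology E]
    {j : ℝ → ℝ → E → ℂ} {t₀ M u v : ℝ} {x₀ : E} (ht₀ : 0 < t₀) (hu0 : 0 < u) (hu : u ≤ 1)
    (hv0 : 0 < v) (hv : v ≤ 1) (hM : 0 ≤ M) (hmeas : ∀ t x, Measurable fun r => j t r x)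
    (hcont : ∀ r ∈ Ioo 0 t₀, ContinuousAt (fun q : ℝ × E => j q.1 r q.2) (t₀, x₀))
    (hb : ∀ᶠ q : ℝ × E in 𝓝 (t₀, x₀), ∀ r ∈ Ioo 0 q.1,
      ‖j q.1 r q.2‖ ≤ M * ((q.1 - r) ^ (u - 1) * r ^ (v - 1))) :
    ContinuousAt (fun q : ℝ × E => ∫ r in Ioo 0 q.1, j q.1 r q.2) (t₀, x₀) := by
  refine continuousAt_of_locally_uniform_approx_of_continuousAt fun W hW => ?_
  obtain ⟨ε, hε, hWε⟩ := Metric.mem_uniformity_dist.1 hW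
  -- The integral is cut off at the fixed time `t₀ - h`, where dominated convergence applies. For
  -- `q.1` in `(t₀ - h / 2, t₀ + h)` the omitted interval is shorter than `2 * h`, so its
  -- contribution is below `ε` by the choice of `h`.
  obtain ⟨h, ⟨hh0, hh1⟩, hhε⟩ : ∃ h ∈ Ioo 0 (t₀ / 2),
      M * ((2 * h) ^ u / u * (t₀ / 2) ^ (v - 1)) < ε := by
    have hc : Continuous fun h : ℝ => M * ((2 * h) ^ u / u * (t₀ / 2) ^ (v - 1)) :=
      continuous_const.mul ((((continuous_const.mul continuous_id).rpow_const
        fun _ => Or.inr hu0.le).div_const _).mul_const _)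
    have h0 := hc.tendsto 0
    rw [mul_zero, Real.zero_rpow hu0.ne', zero_div, zero_mul, mul_zero] at h0
    have h1 := (h0.mono_left nhdsWithin_le_nhds).eventually (gt_mem_nhds hε) |>.and
      (Ioo_mem_nhdsGT (show (0 : ℝ) < t₀ / 2 by positivity))
    obtain ⟨h, h2, h3⟩ := h1.exists
    exact ⟨h, h3, h2⟩
  have hfst : ∀ᶠ q : ℝ × E in 𝓝 (t₀, x₀), q.1 ∈ Ioo (t₀ - h / 2) (t₀ + h) :=
    continuousAt_fst.preimage_mem_nhds
      (Ioo_mem_nhds (show t₀ - h / 2 < t₀ by linarith) (show t₀ < t₀ + h by linarith))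
  refine ⟨_, hb.and hfst, fun q => ∫ r in Ioo 0 (t₀ - h), j q.1 r q.2, ?_, ?_⟩
  · refine continuousAt_of_dominated
      (bound := fun r => M * ((h / 2) ^ (u - 1) * r ^ (v - 1)))
      (Eventually.of_forall fun q => (hmeas _ _).aestronglyMeasurable) ?_
      (((integrableOn_rpow_Ioo hv0 (by linarith)).1.const_mul _).const_mul _) ?_
    · filter_upwards [hb, hfst] with q hq hq1
      filter_upwards [ae_restrict_mem measurableSet_Ioo] with r hr
      refine (hq r ⟨hr.1, by linarith [hr.2, hq1.1]⟩).trans ?_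
      have h3 : (q.1 - r) ^ (u - 1) ≤ (h / 2) ^ (u - 1) :=
        Real.rpow_le_rpow_of_nonpos (by positivity) (by linarith [hr.2, hq1.1]) (by linarith)
      have h4 : 0 ≤ r ^ (v - 1) := Real.rpow_nonneg hr.1.le _
      gcongr
    · filter_upwards [ae_restrict_mem measurableSet_Ioo] with r hr
      exact hcont r ⟨hr.1, by linarith [hr.2]⟩
  · rintro q ⟨hq, hq1⟩
    refine hWε ?_
    have hq0 : 0 < q.1 := by linarith [hq1.1]
    have hlt : t₀ - h < q.1 := by linarith [hq1.1]
    have hi := integrableOn_of_singular_bound hq0 hu0 hu hv0 hv (hmeas q.1 q.2) hq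
    have hU : Ioo 0 q.1 = Ioo 0 (t₀ - h) ∪ Ico (t₀ - h) q.1 :=
      (Ioo_union_Ico_eq_Ioo (by linarith) hlt.le).symm
    have hdisj : Disjoint (Ioo 0 (t₀ - h)) (Ico (t₀ - h) q.1) :=
      Set.disjoint_left.2 fun r h1 h2 => absurd h1.2 (not_lt.2 h2.1)
    have hI := integrableOn_sub_rpow hu0 hlt
    rw [dist_eq_norm]
    simp only
    rw [hU] at hi ⊢
    rw [setIntegral_union hdisj measurableSet_Ico hi.left_of_union hi.right_of_union,
      add_sub_cancel_left, integral_Ico_eq_integral_Ioo]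
    calc _ ≤ ∫ r in Ioo (t₀ - h) q.1, M * ((q.1 - r) ^ (u - 1) * (t₀ / 2) ^ (v - 1)) := by
          refine norm_integral_le_of_norm_le ((hI.1.mul_const _).const_mul _) ?_
          filter_upwards [ae_restrict_mem measurableSet_Ioo] with r hr
          have hr0 : t₀ / 2 ≤ r := by linarith [hr.1]
          refine (hq r ⟨by linarith, hr.2⟩).trans ?_
          have h3 : r ^ (v - 1) ≤ (t₀ / 2) ^ (v - 1) :=
            Real.rpow_le_rpow_of_nonpos (by positivity) hr0 (by linarith)
          have h4 : 0 ≤ (q.1 - r) ^ (u - 1) := Real.rpow_nonneg (by linarith [hr.2]) _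
          gcongr
      _ = M * ((q.1 - (t₀ - h)) ^ u / u * (t₀ / 2) ^ (v - 1)) := by
          rw [integral_const_mul, integral_mul_const, hI.2]
      _ ≤ M * ((2 * h) ^ u / u * (t₀ / 2) ^ (v - 1)) := by
          have h5 : (q.1 - (t₀ - h)) ^ u ≤ (2 * h) ^ u :=
            Real.rpow_le_rpow (by linarith) (by linarith [hq1.2]) hu0.le
          gcongr
      _ < ε := hhε

/-- Integrability on the triangle `r < ρ`, for later use of Fubini. The inner integral is of order
`ρ ^ (u + v - 1)`, whose exponent may have either sign; hence the sum of both end-point values as a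
bound. -/
theorem integrable_indicator_prod {L : ℝ → ℝ → ℂ} {T₁ T₂ M u v : ℝ} (hT₁ : 0 < T₁)
    (hu0 : 0 < u) (hu : u ≤ 1) (hv0 : 0 < v) (hv : v ≤ 1) (hM : 0 ≤ M)
    (hLm : Measurable (Function.uncurry L))
    (hL : ∀ ρ ∈ Ioo T₁ T₂, ∀ r ∈ Ioo 0 ρ, ‖L ρ r‖ ≤ M * ((ρ - r) ^ (u - 1) * r ^ (v - 1))) :
    Integrable (Function.uncurry fun ρ r => (Iio ρ).indicator (L ρ) r)
      ((volume.restrict (Ioo T₁ T₂)).prod (volume.restrict (Ioo 0 T₂))) := by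
  have hm : Measurable (Function.uncurry fun ρ r => (Iio ρ).indicator (L ρ) r) :=
    hLm.indicator (measurableSet_lt measurable_snd measurable_fst)
  have hset : ∀ ρ ∈ Ioo T₁ T₂, Ioo 0 T₂ ∩ Iio ρ = Ioo 0 ρ := fun ρ hρ => by
    rw [Ioo_inter_Iio, min_eq_right hρ.2.le]
  have hpi : ∀ ρ ∈ Ioo T₁ T₂, IntegrableOn (L ρ) (Ioo 0 ρ) := fun ρ hρ =>
    integrableOn_of_singular_bound (hT₁.trans hρ.1) hu0 hu hv0 hv
      (hLm.comp measurable_prodMk_left) (hL ρ hρ)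
  rw [integrable_prod_iff hm.aestronglyMeasurable]
  constructor
  · filter_upwards [ae_restrict_mem measurableSet_Ioo] with ρ hρ
    simp only [Function.uncurry_apply_pair]
    rw [integrable_indicator_iff measurableSet_Iio, IntegrableOn,
      Measure.restrict_restrict measurableSet_Iio, inter_comm, hset ρ hρ]
    exact hpi ρ hρ
  · have hbd : ∀ ρ ∈ Ioo T₁ T₂, ρ ^ (u + v - 1) ≤ T₁ ^ (u + v - 1) + T₂ ^ (u + v - 1) := by
      intro ρ hρ
      have hρ0 := hT₁.trans hρ.1
      have hT₂ := hρ0.trans hρ.2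
      rcases le_total 0 (u + v - 1) with h | h
      · have := Real.rpow_le_rpow hρ0.le hρ.2.le h
        have h' : 0 ≤ T₁ ^ (u + v - 1) := Real.rpow_nonneg hT₁.le _
        linarith
      · have := Real.rpow_le_rpow_of_nonpos hT₁ hρ.1.le h
        have h' : 0 ≤ T₂ ^ (u + v - 1) := Real.rpow_nonneg hT₂.le _
        linarith
    refine Integrable.mono' (g := fun _ => M * (2 * (1 / u + 1 / v) *
      (T₁ ^ (u + v - 1) + T₂ ^ (u + v - 1)))) (integrable_const _)
      hm.aestronglyMeasurable.norm.integral_prod_right' ?_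
    filter_upwards [ae_restrict_mem measurableSet_Ioo] with ρ hρ
    have hρ0 := hT₁.trans hρ.1
    rw [Real.norm_of_nonneg (integral_nonneg fun r => norm_nonneg _)]
    simp only [Function.uncurry_apply_pair, norm_indicator_eq_indicator_norm]
    rw [setIntegral_indicator measurableSet_Iio, hset ρ hρ]
    have hJ := integrableOn_rpow_mul_rpow hu0 hu hv0 hv hρ0
    calc _ ≤ ∫ r in Ioo 0 ρ, M * ((ρ - r) ^ (u - 1) * r ^ (v - 1)) :=
          setIntegral_mono_on (hpi ρ hρ).norm (hJ.1.const_mul M) measurableSet_Ioo (hL ρ hρ)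
      _ ≤ M * (2 * (1 / u + 1 / v) * ρ ^ (u + v - 1)) := by
          rw [integral_const_mul]
          exact mul_le_mul_of_nonneg_left hJ.2 hM
      _ ≤ _ := by
          have := hbd ρ hρ
          gcongr

/-- The fundamental theorem of calculus in the later time, from `max T₁ r` onwards. When `T₁ ≤ r`
the lower boundary term is the initial limit `φ`, the contribution of the diagonal. -/
theorem setIntegral_indicator_eq_sub {j : ℝ → ℂ} {L : ℝ → ℂ} {φ : ℂ} {r T₁ T₂ B u : ℝ}
    (hr : r < T₂) (hT : T₁ < T₂) (hu0 : 0 < u) (hLm : Measurable L)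
    (hL : ∀ ρ ∈ Ioo T₁ T₂, r < ρ → ‖L ρ‖ ≤ B * (ρ - r) ^ (u - 1))
    (hj : ∀ ρ, r < ρ → HasDerivAt j (L ρ) ρ) (hlim : Tendsto j (𝓝[>] r) (𝓝 φ)) :
    ∫ ρ in Ioo T₁ T₂, (Ioi r).indicator L ρ = j T₂ - if r < T₁ then j T₁ else φ := by
  have hlt : max T₁ r < T₂ := max_lt hT hr
  have hset : Ioo T₁ T₂ ∩ Ioi r = Ioo (max T₁ r) T₂ := by
    ext ρ; simp only [mem_inter_iff, mem_Ioo, mem_Ioi, max_lt_iff]; tauto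
  rw [setIntegral_indicator measurableSet_Ioi, hset, ← integral_Ioc_eq_integral_Ioo,
    ← intervalIntegral.integral_of_le hlt.le]
  refine intervalIntegral.integral_eq_sub_of_hasDerivAt_of_tendsto hlt
    (fun ρ hρ => hj ρ ((le_max_right _ _).trans_lt hρ.1)) ?_ ?_ ?_
  · rw [intervalIntegrable_iff_integrableOn_Ioo_of_le hlt.le]
    refine Integrable.mono' (((integrableOn_sub_rpow_right hu0 hr).mono_set
      (Ioo_subset_Ioo_left (le_max_right T₁ r))).const_mul B) hLm.aestronglyMeasurable ?_
    filter_upwards [ae_restrict_mem measurableSet_Ioo] with ρ hρ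
    exact hL ρ ⟨(le_max_left _ _).trans_lt hρ.1, hρ.2⟩ ((le_max_right _ _).trans_lt hρ.1)
  · split_ifs with h
    · rw [max_eq_left h.le]
      exact (hj T₁ h).continuousAt.tendsto.mono_left nhdsWithin_le_nhds
    · rw [max_eq_right (not_lt.1 h)]
      exact hlim
  · exact (hj T₂ hr).continuousAt.tendsto.mono_left nhdsWithin_le_nhds

/-- Increments of `t ↦ ∫₀ᵗ j(t, r) dr`, where `j(·, r)` has derivative `L(·, r)` and initial
value `φ(r)` at time `r`. -/
theorem setIntegral_Ioo_sub_eq {j L : ℝ → ℝ → ℂ} {φ : ℝ → ℂ} {T₁ T₂ M u v : ℝ} (hT₁ : 0 < T₁)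
    (hT : T₁ < T₂) (hu0 : 0 < u) (hu : u ≤ 1) (hv0 : 0 < v) (hv : v ≤ 1) (hM : 0 ≤ M)
    (hLm : Measurable (Function.uncurry L))
    (hL : ∀ ρ ∈ Ioo T₁ T₂, ∀ r ∈ Ioo 0 ρ, ‖L ρ r‖ ≤ M * ((ρ - r) ^ (u - 1) * r ^ (v - 1)))
    (hj : ∀ r, 0 < r → ∀ ρ, r < ρ → HasDerivAt (fun t => j t r) (L ρ r) ρ)
    (hlim : ∀ r, 0 < r → Tendsto (fun t => j t r) (𝓝[>] r) (𝓝 (φ r)))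
    (hji : ∀ t, 0 < t → IntegrableOn (j t) (Ioo 0 t)) (hφ : IntegrableOn φ (Ioo T₁ T₂)) :
    (∫ r in Ioo 0 T₂, j T₂ r) - ∫ r in Ioo 0 T₁, j T₁ r =
      ∫ ρ in T₁..T₂, (φ ρ + ∫ r in Ioo 0 ρ, L ρ r) := by
  have hT₂ := hT₁.trans hT
  have hint := integrable_indicator_prod hT₁ hu0 hu hv0 hv hM hLm hL
  have hset : ∀ ρ ∈ Ioo T₁ T₂, Ioo 0 T₂ ∩ Iio ρ = Ioo 0 ρ := fun ρ hρ => by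
    rw [Ioo_inter_Iio, min_eq_right hρ.2.le]
  have hin : ∀ ρ ∈ Ioo T₁ T₂, ∫ r in Ioo 0 T₂, (Iio ρ).indicator (L ρ) r =
      ∫ r in Ioo 0 ρ, L ρ r := fun ρ hρ => by
    rw [setIntegral_indicator measurableSet_Iio, hset ρ hρ]
  have hLi : IntegrableOn (fun ρ => ∫ r in Ioo 0 ρ, L ρ r) (Ioo T₁ T₂) :=
    IntegrableOn.congr_fun hint.integral_prod_left hin measurableSet_Ioo
  have hsw := integral_integral_swap hint
  rw [setIntegral_congr_fun measurableSet_Ioo hin] at hsw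
  have hout : ∀ r ∈ Ioo 0 T₂, ∫ ρ in Ioo T₁ T₂, (Iio ρ).indicator (L ρ) r =
      j T₂ r - if r < T₁ then j T₁ r else φ r := fun r hr => by
    have h1 := setIntegral_indicator_eq_sub (j := fun t => j t r) (L := fun ρ => L ρ r)
      (φ := φ r) (B := M * r ^ (v - 1)) hr.2 hT hu0 (hLm.comp measurable_prodMk_right)
      (fun ρ hρ hrρ => (hL ρ hρ r ⟨hr.1, hrρ⟩).trans (le_of_eq (by ring))) (hj r hr.1)
      (hlim r hr.1)
    rw [← h1]
    refine setIntegral_congr_fun measurableSet_Ioo fun ρ _ => ?_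
    simp only [indicator, mem_Iio, mem_Ioi]
  rw [setIntegral_congr_fun measurableSet_Ioo hout] at hsw
  have hU : Ioo 0 T₂ = Ioo 0 T₁ ∪ Ico T₁ T₂ := (Ioo_union_Ico_eq_Ioo hT₁ hT.le).symm
  have hdisj : Disjoint (Ioo 0 T₁) (Ico T₁ T₂) :=
    Set.disjoint_left.2 fun r h1 h2 => absurd h1.2 (not_lt.2 h2.1)
  have e1 : EqOn (fun r => j T₁ r) (fun r => if r < T₁ then j T₁ r else φ r) (Ioo 0 T₁) :=
    fun r hr => by simp only [if_pos hr.2]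
  have e2 : EqOn φ (fun r => if r < T₁ then j T₁ r else φ r) (Ico T₁ T₂) :=
    fun r hr => by simp only [if_neg (not_lt.2 hr.1)]
  have hφ' : IntegrableOn φ (Ico T₁ T₂) := (integrableOn_Ico_iff_integrableOn_Ioo (by simp)).2 hφ
  have i1 := (hji T₁ hT₁).congr_fun e1 measurableSet_Ioo
  have i2 := hφ'.congr_fun e2 measurableSet_Ico
  have e3 : ∫ r in Ioo 0 T₂, (if r < T₁ then j T₁ r else φ r) =
      (∫ r in Ioo 0 T₁, j T₁ r) + ∫ r in Ioo T₁ T₂, φ r := by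
    rw [hU, setIntegral_union hdisj measurableSet_Ico i1 i2,
      ← setIntegral_congr_fun measurableSet_Ioo e1, ← setIntegral_congr_fun measurableSet_Ico e2,
      integral_Ico_eq_integral_Ioo]
  have i3 : IntegrableOn (fun r => if r < T₁ then j T₁ r else φ r) (Ioo 0 T₂) := by
    rw [hU]; exact i1.union i2
  rw [integral_sub (hji T₂ hT₂) i3, e3] at hsw
  rw [intervalIntegral.integral_of_le hT.le, integral_Ioc_eq_integral_Ioo, integral_add hφ hLi, hsw]
  ring

/-- The derivative `L` is singular at the moving end point, so the integral is not differentiated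
directly: `setIntegral_Ioo_sub_eq` writes its increments as an integral of `φ + ∫ L`, and the
fundamental theorem of calculus concludes. Only the sum `w` has to be continuous, not its two parts.
-/
theorem hasDerivAt_setIntegral_Ioo {j L : ℝ → ℝ → ℂ} {φ w : ℝ → ℂ} {t M u v : ℝ} (ht : 0 < t)
    (hu0 : 0 < u) (hu : u ≤ 1) (hv0 : 0 < v) (hv : v ≤ 1) (hM : 0 ≤ M)
    (hLm : Measurable (Function.uncurry L))
    (hL : ∀ ρ ∈ Ioo (t / 2) (2 * t), ∀ r ∈ Ioo 0 ρ,
      ‖L ρ r‖ ≤ M * ((ρ - r) ^ (u - 1) * r ^ (v - 1)))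
    (hj : ∀ r, 0 < r → ∀ ρ, r < ρ → HasDerivAt (fun t => j t r) (L ρ r) ρ)
    (hlim : ∀ r, 0 < r → Tendsto (fun t => j t r) (𝓝[>] r) (𝓝 (φ r)))
    (hji : ∀ t, 0 < t → IntegrableOn (j t) (Ioo 0 t))
    (hφ : IntegrableOn φ (Ioo (t / 2) (2 * t)))
    (hw : ∀ ρ, 0 < ρ → φ ρ + ∫ r in Ioo 0 ρ, L ρ r = w ρ) (hwc : ContinuousOn w (Ioi 0)) :
    HasDerivAt (fun t => ∫ r in Ioo 0 t, j t r) (w t) t := by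
  have ht2 : t / 2 < t := by linarith
  have ht2' : t < 2 * t := by linarith
  have hwt : ∀ ρ, 0 < ρ → ContinuousAt w ρ := fun ρ hρ => hwc.continuousAt (Ioi_mem_nhds hρ)
  have hii : IntervalIntegrable w volume (t / 2) t :=
    (hwc.mono fun ρ hρ => by
      rw [uIcc_of_le ht2.le] at hρ
      exact (show 0 < t / 2 by positivity).trans_le hρ.1).intervalIntegrable
  have h1 := intervalIntegral.integral_hasDerivAt_right hii
    (hwc.stronglyMeasurableAtFilter isOpen_Ioi t ht) (hwt t ht)
  refine (h1.const_add (∫ r in Ioo 0 (t / 2), j (t / 2) r)).congr_of_eventuallyEq ?_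
  filter_upwards [Ioo_mem_nhds ht2 ht2'] with T hT
  have h2 := setIntegral_Ioo_sub_eq (T₁ := t / 2) (T₂ := T) (by positivity) hT.1 hu0 hu hv0 hv hM
    hLm (fun ρ hρ => hL ρ ⟨hρ.1, hρ.2.trans hT.2⟩) hj hlim hji
    (hφ.mono_set (Ioo_subset_Ioo_right hT.2.le))
  have h3 : ∫ ρ in t / 2..T, (φ ρ + ∫ r in Ioo 0 ρ, L ρ r) = ∫ ρ in t / 2..T, w ρ :=
    intervalIntegral.integral_congr fun ρ hρ => by
      rw [uIcc_of_le hT.1.le] at hρ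
      exact hw ρ ((show 0 < t / 2 by positivity).trans_le hρ.1)
  rw [h3] at h2
  rw [← h2]
  ring

end singularIntegrals

/-! ### Space derivatives at a positive time lag -/

theorem hasLineDerivAt_integral_of_dominated {E ι : Type*} [AddCommGroup E] [Module ℝ E]
    [MeasurableSpace ι]
    {μ : Measure ι} {F F' : ι → E → ℂ} {v x : E} {bound : ι → ℝ}
    (hFm : ∀ z, AEStronglyMeasurable (fun i => F i z) μ) (hFi : Integrable (fun i => F i x) μ)
    (hF'm : AEStronglyMeasurable (fun i => F' i x) μ)
    (hF' : ∀ᵐ i ∂μ, ∀ z, HasLineDerivAt ℝ (F i) (F' i z) z v)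
    (hb : ∀ᵐ i ∂μ, ∀ z, ‖F' i z‖ ≤ bound i) (hbi : Integrable bound μ) :
    HasLineDerivAt ℝ (fun z => ∫ i, F i z ∂μ) (∫ i, F' i x ∂μ) x v := by
  have h := hasDerivAt_integral_of_dominated_loc_of_deriv_le (𝕜 := ℝ) (μ := μ)
    (F := fun u i => F i (x + u • v)) (F' := fun u i => F' i (x + u • v)) (x₀ := 0)
    (bound := bound) (s := univ) univ_mem (Eventually.of_forall fun u => hFm _)
    (by simpa using hFi) (by simpa using hF'm) (hb.mono fun i hi u _ => hi _) hbi
    (hF'.mono fun i hi u _ => ?_)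
  · have h2 := h.2
    simp only [zero_smul, add_zero] at h2
    exact h2
  · have h3 := hi (x + u • v)
    unfold HasLineDerivAt at h3
    have h5 : HasDerivAt (fun w : ℝ => F i (x + u • v + (w - u) • v)) (F' i (x + u • v)) u := by
      have h6 : HasDerivAt (fun t : ℝ => F i (x + u • v + t • v)) (F' i (x + u • v)) (u - u) := by
        rw [sub_self]; exact h3
      exact h6.comp_sub_const u u
    refine h5.congr_of_eventuallyEq (Eventually.of_forall fun w => ?_)
    simp only
    congr 1
    rw [add_assoc, ← add_smul]
    congr 2
    ring

section spaceRegularity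

variable {d : ℕ} {s : Fin d → ℕ} {N : ℕ} {δ A H α θ C c γ : ℝ}
  {a : (Fin d → ℕ) → (Fin d → ℝ) → ℂ} {Φ : ℝ → (Fin d → ℝ) → (Fin d → ℝ) → ℂ}

variable (hs : ∀ j, 0 < s j) (hN : ∀ j, s j < N) (hN0 : 0 < N) (hδ : 0 < δ)
  (ha : CoeffAssumptions s N δ A H α a)

include hs hN hN0 hδ ha in
theorem hasLineDerivAt_zker (k : Fin d → ℕ) (j : Fin d) {t : ℝ} (ht : 0 < t) (x z : Fin d → ℝ) :
    HasLineDerivAt ℝ (fun x => zker s N a k t x z) (zker s N a (k + Pi.single j 1) t x z) x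
      (Pi.single j 1) := by
  have h := hasLineDerivAt_fundKer hs hN hN0 hδ (abs_nonneg A) (ha.parabolicSymbol hs z) k j ht
    (x - z)
  unfold HasLineDerivAt at h ⊢
  refine h.congr_of_eventuallyEq (Eventually.of_forall fun u => ?_)
  simp only [zker, frz]
  congr 1
  abel

include hs hN hN0 hδ ha in
theorem continuousAt_zker (k : Fin d → ℕ) {t : ℝ} (ht : 0 < t) (x z : Fin d → ℝ) :
    ContinuousAt (fun q : ℝ × (Fin d → ℝ) => zker s N a k q.1 q.2 z) (t, x) := by
  have h := continuousAt_fundKer hs hN hN0 hδ (abs_nonneg A) (ha.parabolicSymbol hs z) k ht (x - z)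
  have hc : Continuous fun q : ℝ × (Fin d → ℝ) => (q.1, q.2 - z) := by fun_prop
  exact ContinuousAt.comp (f := fun q : ℝ × (Fin d → ℝ) => (q.1, q.2 - z)) (x := (t, x)) h
    hc.continuousAt

theorem FrozenBounds.norm_zker_le_rpow (hf : FrozenBounds s N α C c γ a) (hc : 0 ≤ c) (hC : 0 ≤ C)
    {k : Fin d → ℕ} (hk : sdeg s k ≤ 2 * N) {t : ℝ} (ht : 0 < t) (x z : Fin d → ℝ) :
    ‖zker s N a k t x z‖ ≤ C * Real.exp (γ * t) * t ^ (1 - sdeg s k / N - 1 : ℝ) *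
      t ^ (-(scalingSize s : ℝ) / N) := by
  have hr : 0 ≤ t ^ (1 - sdeg s k / N - 1 : ℝ) := Real.rpow_nonneg ht.le _
  refine (hf.kerBound hk t ht x z).trans ?_
  exact mul_le_mul_of_nonneg_left (maj_le_rpow hc ht _) (by positivity)

include hs hN in
theorem KerBound.integrable_left {b B : ℝ} (hΦm : KerMeas Φ) (hΦ : KerBound s N c γ b B Φ)
    (hc : 0 ≤ c) {r : ℝ} (hr : 0 < r) (y : Fin d → ℝ) : Integrable fun z => Φ r z y := by
  refine integrable_of_le_maj hs hN hc hr (x := y) (hΦm.section_left r y)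
    (B := B * Real.exp (γ * r) * r ^ (b - 1)) fun z => ?_
  rw [maj_sub_comm]
  exact hΦ r hr z y

include hs hN in
theorem integrable_zker_mul {b B : ℝ} (hmc : ∀ l ∈ multiIndices s N, Measurable (a l))
    (hf : FrozenBounds s N α C c γ a) (hΦm : KerMeas Φ) (hΦ : KerBound s N c γ b B Φ) (hc : 0 ≤ c)
    {k : Fin d → ℕ} (hk : sdeg s k ≤ 2 * N) {τ r : ℝ} (hτ : 0 < τ) (hr : 0 < r)
    (x y : Fin d → ℝ) : Integrable fun z => zker s N a k τ x z * Φ r z y :=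
  integrable_mul_of_le_maj hs hN hc hτ hr ((kerMeas_zker hmc k).section_right τ x)
    (hΦm.section_left r y) (fun z => hf.kerBound hk τ hτ x z) (fun z => hΦ r hr z y)

include hs hN hN0 hδ ha in
-- At a fixed positive lag the differentiated kernel is bounded uniformly in space, so a multiple of
-- the integrable density dominates.
theorem hasLineDerivAt_slice {b B : ℝ} (hα : 0 < α)
    (hf : FrozenBounds s N α C c γ a) (hΦm : KerMeas Φ) (hΦ : KerBound s N c γ b B Φ) (hc : 0 ≤ c)
    (hC : 0 ≤ C) (k : Fin d → ℕ) (j : Fin d) (hk : sdeg s (k + Pi.single j 1) ≤ 2 * N) {τ r : ℝ}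
    (hτ : 0 < τ) (hr : 0 < r) (x y : Fin d → ℝ) :
    HasLineDerivAt ℝ (fun x => slice (zker s N a k) Φ τ r x y)
      (slice (zker s N a (k + Pi.single j 1)) Φ τ r x y) x (Pi.single j 1) := by
  have hmc := ha.measurable hs hα
  have hk' : sdeg s k ≤ 2 * N := by rw [sdeg_add_single] at hk; omega
  have hi := integrable_zker_mul hs hN hmc hf hΦm hΦ hc hk' hτ hr
  have h1 : ∀ z x, HasLineDerivAt ℝ (fun x => zker s N a k τ x z * Φ r z y)
      (zker s N a (k + Pi.single j 1) τ x z * Φ r z y) x (Pi.single j 1) := fun z x => by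
    have h := hasLineDerivAt_zker hs hN hN0 hδ ha k j hτ x z
    unfold HasLineDerivAt at h ⊢
    exact h.mul_const _
  have h2 : ∀ z x, ‖zker s N a (k + Pi.single j 1) τ x z * Φ r z y‖ ≤ C * Real.exp (γ * τ) *
      τ ^ (1 - sdeg s (k + Pi.single j 1) / N - 1 : ℝ) * τ ^ (-(scalingSize s : ℝ) / N) *
      ‖Φ r z y‖ := fun z x => by
    rw [norm_mul]
    exact mul_le_mul_of_nonneg_right (hf.norm_zker_le_rpow hc hC hk hτ x z) (norm_nonneg _)
  have h3 := (hΦ.integrable_left hs hN hΦm hc hr y).norm.const_mul (C * Real.exp (γ * τ) *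
      τ ^ (1 - sdeg s (k + Pi.single j 1) / N - 1 : ℝ) * τ ^ (-(scalingSize s : ℝ) / N))
  have h4 := hasLineDerivAt_integral_of_dominated (E := Fin d → ℝ) (ι := Fin d → ℝ)
      (μ := (volume : Measure (Fin d → ℝ)))
      (F := fun z x => zker s N a k τ x z * Φ r z y) (x := x)
      (F' := fun z x => zker s N a (k + Pi.single j 1) τ x z * Φ r z y) (v := Pi.single j 1)
      (bound := fun z => C * Real.exp (γ * τ) *
      τ ^ (1 - sdeg s (k + Pi.single j 1) / N - 1 : ℝ) * τ ^ (-(scalingSize s : ℝ) / N) *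
      ‖Φ r z y‖) (fun z => (hi z y).aestronglyMeasurable) (hi x y)
  have h5 := h4 (integrable_zker_mul hs hN hmc hf hΦm hΦ hc hk hτ hr x y).aestronglyMeasurable
  exact h5 (Eventually.of_forall h1) (Eventually.of_forall h2) h3

include hs hN hN0 hδ ha in
theorem continuousAt_slice {b B : ℝ} (hα : 0 < α)
    (hf : FrozenBounds s N α C c γ a) (hΦm : KerMeas Φ) (hΦ : KerBound s N c γ b B Φ) (hc : 0 ≤ c)
    (hC : 0 ≤ C) {k : Fin d → ℕ} (hk : sdeg s k ≤ 2 * N) {t r : ℝ}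
    (hr : r ∈ Ioo 0 t) (x y : Fin d → ℝ) :
    ContinuousAt (fun q : ℝ × (Fin d → ℝ) => slice (zker s N a k) Φ (q.1 - r) r q.2 y) (t, x) := by
  have hmc := ha.measurable hs hα
  have hτ := sub_pos.2 hr.2
  obtain ⟨G, hG⟩ : ∃ G : ℝ → ℝ, G = fun τ => C * Real.exp (γ * τ) *
    τ ^ (1 - sdeg s k / N - 1 : ℝ) * τ ^ (-(scalingSize s : ℝ) / N) := ⟨_, rfl⟩
  have hGc : ContinuousAt (fun q : ℝ × (Fin d → ℝ) => G (q.1 - r)) (t, x) := by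
    rw [hG]
    have h1 : ContinuousAt (fun q : ℝ × (Fin d → ℝ) => q.1 - r) (t, x) := by fun_prop
    have h2 : t - r ≠ 0 := hτ.ne'
    exact ((continuousAt_const.mul (Real.continuous_exp.continuousAt.comp
      (continuousAt_const.mul h1))).mul (h1.rpow_const (Or.inl h2))).mul
      (h1.rpow_const (Or.inl h2))
  have hev : ∀ᶠ q : ℝ × (Fin d → ℝ) in 𝓝 (t, x), r < q.1 :=
    continuousAt_fst.eventually (lt_mem_nhds hr.2)
  unfold slice
  refine continuousAt_of_dominated (bound := fun z => (G (t - r) + 1) * ‖Φ r z y‖)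
    (Eventually.of_forall fun q => (((kerMeas_zker hmc k).section_right _ _).mul
      (hΦm.section_left r y)).aestronglyMeasurable) ?_
    ((hΦ.integrable_left hs hN hΦm hc hr.1 y).norm.const_mul _)
    (Eventually.of_forall fun z => ?_)
  · filter_upwards [hev, hGc.eventually (gt_mem_nhds (lt_add_one (G (t - r))))] with q hq1 hq2
    refine Eventually.of_forall fun z => ?_
    rw [norm_mul]
    refine mul_le_mul_of_nonneg_right (le_trans ?_ hq2.le) (norm_nonneg _)
    rw [hG]
    exact hf.norm_zker_le_rpow hc hC hk (sub_pos.2 hq1) _ z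
  · refine ContinuousAt.mul ?_ continuousAt_const
    have h := continuousAt_zker hs hN hN0 hδ ha k hτ x z
    have hcq : Continuous fun q : ℝ × (Fin d → ℝ) => (q.1 - r, q.2) := by fun_prop
    exact ContinuousAt.comp (f := fun q : ℝ × (Fin d → ℝ) => (q.1 - r, q.2)) (x := (t, x)) h
      hcq.continuousAt

end spaceRegularity


/-! ### The correction term -/

/-- The correction term `V_k = ∂^k Z ⋆ Φ` of Levi's method. -/
abbrev corr {d : ℕ} (s : Fin d → ℕ) (N : ℕ) (a : (Fin d → ℕ) → (Fin d → ℝ) → ℂ)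
    (Φ : ℝ → (Fin d → ℝ) → (Fin d → ℝ) → ℂ) (k : Fin d → ℕ) :
    ℝ → (Fin d → ℝ) → (Fin d → ℝ) → ℂ := volterra (zker s N a k) Φ

section correction

variable {d : ℕ} {s : Fin d → ℕ} {N : ℕ} {δ A H α θ C c γ : ℝ}
  {a : (Fin d → ℕ) → (Fin d → ℝ) → ℂ} {Φ : ℝ → (Fin d → ℝ) → (Fin d → ℝ) → ℂ}

variable (hs : ∀ j, 0 < s j) (hN : ∀ j, s j < N) (hN0 : 0 < N) (hδ : 0 < δ) (hα : 0 < α)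
  (hα1 : α ≤ 1) (ha : CoeffAssumptions s N δ A H α a) (hΦ : LeviDensity s N α θ C c γ a Φ)
  (hc : 0 ≤ c) (hC : 0 ≤ C) (hθ0 : 0 ≤ θ) (hθ : θ < α)

/-- The exponent of the singularity of `∂^k Z ⋆ Φ` at the upper end point. -/
def upperExp {d : ℕ} (s : Fin d → ℕ) (N : ℕ) (θ : ℝ) (k : Fin d → ℕ) : ℝ := 1 + (θ - sdeg s k) / N

include hN0 in
-- The hypothesis is the threshold of integrability at `r = t`; without the gain `θ` the degree `N`
-- itself would be excluded.
theorem upperExp_pos {k : Fin d → ℕ} (h : sdeg s k < N + θ) : 0 < upperExp s N θ k := by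
  have hN' : (0 : ℝ) < N := by exact_mod_cast hN0
  have e : upperExp s N θ k = (N + θ - sdeg s k) / N := by unfold upperExp; field_simp; ring
  rw [e]
  exact div_pos (by linarith) hN'

theorem upperExp_le_one {k : Fin d → ℕ} (h : θ ≤ sdeg s k) : upperExp s N θ k ≤ 1 := by
  unfold upperExp
  have : (θ - sdeg s k) / N ≤ 0 := div_nonpos_of_nonpos_of_nonneg (by linarith) (Nat.cast_nonneg N)
  linarith

include hN0 hα1 hθ0 hθ in
theorem lowerExp_mem : 0 < (α - θ) / N ∧ (α - θ) / N ≤ 1 := by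
  have hN' : (1 : ℝ) ≤ N := by exact_mod_cast hN0
  refine ⟨div_pos (by linarith) (by linarith), ?_⟩
  rw [div_le_one (by linarith)]; linarith

include hs hN hN0 hδ hα hα1 ha hΦ hc hC hθ0 hθ in
theorem norm_slice_zker_le' {k : Fin d → ℕ} (hk : sdeg s k ≤ 2 * N) (hk0 : k = 0 → θ = 0)
    {t r : ℝ} (hr : r ∈ Ioo 0 t) (x y : Fin d → ℝ) :
    ‖slice (zker s N a k) Φ (t - r) r x y‖ ≤
      sliceConst d C * Real.exp ((γ + 1) * t) * maj s N c t (x - y) *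
        ((t - r) ^ (upperExp s N θ k - 1) * r ^ ((α - θ) / N - 1)) := by
  refine (norm_slice_zker_le hs hN hN0 hδ hα hα1 ha hΦ hc hC hθ0 hθ hk hk0 hr x y).trans
    (le_of_eq ?_)
  unfold upperExp
  rw [add_sub_cancel_left]
  ring

theorem measurable_slice_zker (hΦ : LeviDensity s N α θ C c γ a Φ) (k : Fin d → ℕ) (t : ℝ)
    (x y : Fin d → ℝ) : Measurable fun r => slice (zker s N a k) Φ (t - r) r x y :=
  (kerMeas_zker hΦ.meas_coeff k).slice_time hΦ.meas t x y

include hs hN hN0 hδ hα hα1 ha hΦ hc hC hθ0 hθ in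
theorem integrableOn_slice_zker {k : Fin d → ℕ} (hk0 : k = 0 → θ = 0) (hle : θ ≤ sdeg s k)
    (hlt : sdeg s k < N + θ) {t : ℝ} (ht : 0 < t) (x y : Fin d → ℝ) :
    IntegrableOn (fun r => slice (zker s N a k) Φ (t - r) r x y) (Ioo 0 t) := by
  have hk : sdeg s k ≤ 2 * N := by
    have hN' : (1 : ℝ) ≤ N := by exact_mod_cast hN0
    have : (sdeg s k : ℝ) ≤ (2 * N : ℕ) := by push_cast; linarith
    exact_mod_cast this
  have hv := lowerExp_mem hN0 hα1 hθ0 hθ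
  exact integrableOn_of_singular_bound ht (upperExp_pos hN0 hlt) (upperExp_le_one hle) hv.1 hv.2
    (measurable_slice_zker hΦ k t x y) fun r hr =>
      norm_slice_zker_le' hs hN hN0 hδ hα hα1 ha hΦ hc hC hθ0 hθ hk hk0 hr x y

include hs hN hN0 hδ hα hα1 ha hΦ hc hC hθ0 hθ in
-- What the upper singularity gains from `θ` the lower one loses, so `θ` survives only in the
-- constant. The power exceeds that of the frozen kernel by `t ^ (α / N)`, which makes the
-- correction negligible as `t → 0`.
theorem norm_corr_le {k : Fin d → ℕ} (hk0 : k = 0 → θ = 0) (hle : θ ≤ sdeg s k)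
    (hlt : sdeg s k < N + θ) {t : ℝ} (ht : 0 < t) (x y : Fin d → ℝ) :
    ‖corr s N a Φ k t x y‖ ≤
      sliceConst d C * (2 * (1 / upperExp s N θ k + 1 / ((α - θ) / N))) *
        Real.exp ((γ + 1) * t) * t ^ ((α - sdeg s k) / N) * maj s N c t (x - y) := by
  have hk : sdeg s k ≤ 2 * N := by
    have hN' : (1 : ℝ) ≤ N := by exact_mod_cast hN0
    have : (sdeg s k : ℝ) ≤ (2 * N : ℕ) := by push_cast; linarith
    exact_mod_cast this
  have hv := lowerExp_mem hN0 hα1 hθ0 hθ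
  have hJ := integrableOn_rpow_mul_rpow (upperExp_pos hN0 hlt) (upperExp_le_one hle) hv.1 hv.2 ht
  have hm := maj_nonneg (s := s) (N := N) ht c (x - y)
  have hL := sliceConst_nonneg d hC
  unfold corr volterra
  calc _ ≤ ∫ r in Ioo 0 t, sliceConst d C * Real.exp ((γ + 1) * t) * maj s N c t (x - y) *
        ((t - r) ^ (upperExp s N θ k - 1) * r ^ ((α - θ) / N - 1)) := by
        refine norm_integral_le_of_norm_le (hJ.1.const_mul _) ?_
        filter_upwards [ae_restrict_mem measurableSet_Ioo] with r hr
        exact norm_slice_zker_le' hs hN hN0 hδ hα hα1 ha hΦ hc hC hθ0 hθ hk hk0 hr x y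
    _ ≤ sliceConst d C * Real.exp ((γ + 1) * t) * maj s N c t (x - y) *
        (2 * (1 / upperExp s N θ k + 1 / ((α - θ) / N)) *
          t ^ (upperExp s N θ k + (α - θ) / N - 1)) := by
        rw [integral_const_mul]
        exact mul_le_mul_of_nonneg_left hJ.2 (by positivity)
    _ = _ := by
        rw [show upperExp s N θ k + (α - θ) / N - 1 = (α - sdeg s k) / N by unfold upperExp; ring]
        ring

include hs hN hN0 hδ hα hα1 ha hΦ hc hC hθ0 hθ in
theorem hasLineDerivAt_corr {k : Fin d → ℕ} {j : Fin d} (hk0 : k = 0 → θ = 0)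
    (hle : θ ≤ sdeg s k) (hlt : sdeg s (k + Pi.single j 1) < N + θ) {t : ℝ}
    (ht : 0 < t) (x y : Fin d → ℝ) :
    HasLineDerivAt ℝ (fun x => corr s N a Φ k t x y) (corr s N a Φ (k + Pi.single j 1) t x y) x
      (Pi.single j 1) := by
  have hk' : sdeg s (k + Pi.single j 1) ≤ 2 * N := by
    have hN' : (1 : ℝ) ≤ N := by exact_mod_cast hN0
    have : (sdeg s (k + Pi.single j 1) : ℝ) ≤ (2 * N : ℕ) := by push_cast; linarith
    exact_mod_cast this
  have hlt' : sdeg s k < N + θ := by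
    have : (sdeg s k : ℝ) ≤ sdeg s (k + Pi.single j 1) := by
      rw [sdeg_add_single]; push_cast; linarith [Nat.cast_nonneg (α := ℝ) (s j)]
    linarith
  have hle' : θ ≤ sdeg s (k + Pi.single j 1) := by
    rw [sdeg_add_single]; push_cast; linarith [Nat.cast_nonneg (α := ℝ) (s j)]
  have hne : k + Pi.single j 1 = 0 → θ = 0 := fun h => by
    have := congrFun h j; simp at this
  have hv := lowerExp_mem hN0 hα1 hθ0 hθ
  have hJ := integrableOn_rpow_mul_rpow (upperExp_pos hN0 hlt) (upperExp_le_one hle') hv.1 hv.2 ht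
  have hL := sliceConst_nonneg d hC
  have h1 : ∀ r ∈ Ioo 0 t, ∀ z, HasLineDerivAt ℝ (fun x => slice (zker s N a k) Φ (t - r) r x y)
      (slice (zker s N a (k + Pi.single j 1)) Φ (t - r) r z y) z (Pi.single j 1) := fun r hr z =>
    hasLineDerivAt_slice hs hN hN0 hδ ha hα hΦ.frozen hΦ.meas hΦ.bound hc hC k j hk'
      (sub_pos.2 hr.2) hr.1 z y
  have h2 : ∀ r ∈ Ioo 0 t, ∀ z, ‖slice (zker s N a (k + Pi.single j 1)) Φ (t - r) r z y‖ ≤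
      sliceConst d C * Real.exp ((γ + 1) * t) * t ^ (-(scalingSize s : ℝ) / N) *
        ((t - r) ^ (upperExp s N θ (k + Pi.single j 1) - 1) * r ^ ((α - θ) / N - 1)) := by
    intro r hr z
    refine (norm_slice_zker_le' hs hN hN0 hδ hα hα1 ha hΦ hc hC hθ0 hθ hk' hne hr z y).trans ?_
    have h1 := maj_le_rpow (s := s) (N := N) hc ht (z - y)
    have h2 : 0 ≤ (t - r) ^ (upperExp s N θ (k + Pi.single j 1) - 1) * r ^ ((α - θ) / N - 1) :=
      mul_nonneg (Real.rpow_nonneg (sub_pos.2 hr.2).le _) (Real.rpow_nonneg hr.1.le _)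
    gcongr
  have m1 := fun z => (measurable_slice_zker hΦ k t z y).aestronglyMeasurable
    (μ := volume.restrict (Ioo 0 t))
  have m2 := (measurable_slice_zker hΦ (k + Pi.single j 1) t x y).aestronglyMeasurable
    (μ := volume.restrict (Ioo 0 t))
  have m3 := integrableOn_slice_zker hs hN hN0 hδ hα hα1 ha hΦ hc hC hθ0 hθ hk0 hle hlt' ht x y
  have m4 := hJ.1.const_mul (sliceConst d C * Real.exp ((γ + 1) * t) *
    t ^ (-(scalingSize s : ℝ) / N))
  have h3 := hasLineDerivAt_integral_of_dominated (E := Fin d → ℝ) (ι := ℝ)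
    (μ := (volume : Measure ℝ).restrict (Ioo 0 t)) (v := Pi.single j 1) (x := x)
    (F := fun r x => slice (zker s N a k) Φ (t - r) r x y)
    (F' := fun r x => slice (zker s N a (k + Pi.single j 1)) Φ (t - r) r x y)
    (bound := fun r => sliceConst d C * Real.exp ((γ + 1) * t) *
      t ^ (-(scalingSize s : ℝ) / N) * ((t - r) ^ (upperExp s N θ (k + Pi.single j 1) - 1) *
        r ^ ((α - θ) / N - 1)))
  have h4 := h3 m1 m3 m2 ((ae_restrict_mem measurableSet_Ioo).mono h1)
    ((ae_restrict_mem measurableSet_Ioo).mono h2) m4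
  exact h4

include hs hN hN0 hδ hα hα1 ha hΦ hc hC hθ0 hθ in
theorem continuousAt_corr {k : Fin d → ℕ} (hk0 : k = 0 → θ = 0) (hle : θ ≤ sdeg s k)
    (hlt : sdeg s k < N + θ) {t : ℝ} (ht : 0 < t) (x y : Fin d → ℝ) :
    ContinuousAt (fun q : ℝ × (Fin d → ℝ) => corr s N a Φ k q.1 q.2 y) (t, x) := by
  have hk : sdeg s k ≤ 2 * N := by
    have hN' : (1 : ℝ) ≤ N := by exact_mod_cast hN0
    have : (sdeg s k : ℝ) ≤ (2 * N : ℕ) := by push_cast; linarith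
    exact_mod_cast this
  have hv := lowerExp_mem hN0 hα1 hθ0 hθ
  have hL := sliceConst_nonneg d hC
  obtain ⟨G, hG⟩ : ∃ G : ℝ → ℝ, G = fun t => sliceConst d C * Real.exp ((γ + 1) * t) *
    t ^ (-(scalingSize s : ℝ) / N) := ⟨_, rfl⟩
  have hGc : ContinuousAt (fun q : ℝ × (Fin d → ℝ) => G q.1) (t, x) := by
    rw [hG]
    have h1 : ContinuousAt (fun q : ℝ × (Fin d → ℝ) => q.1) (t, x) := continuousAt_fst
    exact (continuousAt_const.mul (Real.continuous_exp.continuousAt.comp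
      (continuousAt_const.mul h1))).mul (h1.rpow_const (Or.inl ht.ne'))
  have hG0 : 0 ≤ G t := by rw [hG]; positivity
  unfold corr volterra
  refine continuousAt_setIntegral_Ioo (M := G t + 1) ht (upperExp_pos hN0 hlt)
    (upperExp_le_one hle) hv.1 hv.2 (by positivity)
    (j := fun t r x => slice (zker s N a k) Φ (t - r) r x y)
    (fun t x => measurable_slice_zker hΦ k t x y)
    (fun r hr => continuousAt_slice hs hN hN0 hδ ha hα hΦ.frozen hΦ.meas hΦ.bound hc hC hk hr x y)
    ?_
  filter_upwards [continuousAt_fst.eventually (lt_mem_nhds ht),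
    hGc.eventually (gt_mem_nhds (lt_add_one (G t)))] with q hq1 hq2 r hr
  refine (norm_slice_zker_le' hs hN hN0 hδ hα hα1 ha hΦ hc hC hθ0 hθ hk hk0 hr q.2 y).trans ?_
  refine mul_le_mul_of_nonneg_right (le_trans ?_ hq2.le)
    (mul_nonneg (Real.rpow_nonneg (sub_pos.2 hr.2).le _) (Real.rpow_nonneg hr.1.le _))
  rw [hG]
  exact mul_le_mul_of_nonneg_left (maj_le_rpow hc hq1 _) (by positivity)

include hs hN hN0 hδ hα hα1 ha hΦ hc hC hθ0 hθ in
-- Two scales are involved: the slice is regular at the scale of the lag `t - r` but decays at the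
-- scale of `t`. The order `β` is paid for entirely at the upper end point, where `θ` becomes `θ -
-- β`.
theorem norm_slice_zker_sub_le {k : Fin d → ℕ} (hk : sdeg s k ≤ N) (hk0 : k = 0 → θ = 0) {β : ℝ}
    (hβ0 : 0 ≤ β) (hβ1 : β ≤ 1) {t r : ℝ} (hr : r ∈ Ioo 0 t) (x x' y : Fin d → ℝ) :
    ‖slice (zker s N a k) Φ (t - r) r x y - slice (zker s N a k) Φ (t - r) r x' y‖ ≤
      ((d + 1) * (3 ^ d * Real.exp (c * d)) * sliceConst d C) * snorm s (x - x') ^ β *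
        Real.exp ((γ + 1) * t) *
        ((t - r) ^ (upperExp s N (θ - β) k - 1) * r ^ ((α - θ) / N - 1)) *
        (maj s N (c * 2⁻¹ ^ N) t (x - y) + maj s N (c * 2⁻¹ ^ N) t (x' - y)) := by
  have hτ := sub_pos.2 hr.2
  have hL := sliceConst_nonneg d hC
  have hkj : ∀ j, sdeg s (k + Pi.single j 1) ≤ 2 * N := fun j => by
    rw [sdeg_add_single]; have := hN j; omega
  have hne : ∀ j, k + Pi.single j 1 = 0 → θ = 0 := fun j h => by
    have := congrFun h j; simp at this
  obtain ⟨B, hB⟩ : ∃ B, B = sliceConst d C * Real.exp ((γ + 1) * t) *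
    ((t - r) ^ ((θ - sdeg s k) / N) * r ^ ((α - θ) / N - 1)) := ⟨_, rfl⟩
  have hB0 : 0 ≤ B := by
    rw [hB]
    exact mul_nonneg (by positivity)
      (mul_nonneg (Real.rpow_nonneg hτ.le _) (Real.rpow_nonneg hr.1.le _))
  have h := holder_of_lineDeriv hs hN (f := fun x => slice (zker s N a k) Φ (t - r) r x y)
    (F := fun j x => slice (zker s N a (k + Pi.single j 1)) Φ (t - r) r x y)
    (fun j z => hasLineDerivAt_slice hs hN hN0 hδ ha hα hΦ.frozen hΦ.meas hΦ.bound hc hC k j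
      (hkj j) hτ hr.1 z y) (c := c) (T := t) (τ := t - r) (B := B) (β := β) hc hτ
    (by linarith [hr.1]) hB0 hβ0 hβ1 (y := y)
    (fun z => by
      rw [hB]
      exact norm_slice_zker_le hs hN hN0 hδ hα hα1 ha hΦ hc hC hθ0 hθ (by omega) hk0 hr z y)
    (fun j z => by
      refine (norm_slice_zker_le hs hN hN0 hδ hα hα1 ha hΦ hc hC hθ0 hθ (hkj j) (hne j) hr
        z y).trans (le_of_eq ?_)
      rw [sdeg_add_single, hB]
      push_cast
      rw [show (θ - (sdeg s k + s j : ℝ)) / N = (θ - sdeg s k) / N + -(s j : ℝ) / N by ring,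
        Real.rpow_add hτ]
      ring) x x'
  refine h.trans (le_of_eq ?_)
  rw [hB, show upperExp s N (θ - β) k - 1 = (θ - sdeg s k) / N + -β / N by unfold upperExp; ring,
    Real.rpow_add hτ]
  ring

include hs hN hN0 hδ hα hα1 ha hΦ hc hC hθ0 hθ in
-- The condition `sdeg s k + β < N + θ` is integrability of the shifted singularity; at top degree
-- it reads `β < θ`, with `θ < α`.
theorem norm_corr_sub_le {k : Fin d → ℕ} (hk : sdeg s k ≤ N) (hk0 : k = 0 → θ = 0) {β : ℝ}
    (hβ0 : 0 ≤ β) (hβ1 : β ≤ 1) (hle : θ ≤ sdeg s k) (hlt : sdeg s k + β < N + θ) {t : ℝ}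
    (ht : 0 < t) (x x' y : Fin d → ℝ) :
    ‖corr s N a Φ k t x y - corr s N a Φ k t x' y‖ ≤
      ((d + 1) * (3 ^ d * Real.exp (c * d)) * sliceConst d C) *
        (2 * (1 / upperExp s N (θ - β) k + 1 / ((α - θ) / N))) * snorm s (x - x') ^ β *
        Real.exp ((γ + 1) * t) * t ^ ((α - (sdeg s k + β)) / N) *
        (maj s N (c * 2⁻¹ ^ N) t (x - y) + maj s N (c * 2⁻¹ ^ N) t (x' - y)) := by
  have hv := lowerExp_mem hN0 hα1 hθ0 hθ
  have hL := sliceConst_nonneg d hC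
  have hr0 : 0 ≤ snorm s (x - x') ^ β := Real.rpow_nonneg (snorm_nonneg _) _
  have hI := integrableOn_slice_zker hs hN hN0 hδ hα hα1 ha hΦ hc hC hθ0 hθ hk0 hle
    (by linarith) ht
  have h := norm_volterra_sub_le (s := s) (N := N) (c := c * 2⁻¹ ^ N) (γ := γ + 1)
    (F := ((d + 1) * (3 ^ d * Real.exp (c * d)) * sliceConst d C) * snorm s (x - x') ^ β) (G := 1)
    (u := upperExp s N (θ - β) k) (v := (α - θ) / N)
    (upperExp_pos hN0 (by linarith)) (upperExp_le_one (by linarith)) hv.1 hv.2 (by positivity)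
    zero_le_one ht (hI x y) (hI x' y) fun r hr => by
      rw [mul_one]
      exact norm_slice_zker_sub_le hs hN hN0 hδ hα hα1 ha hΦ hc hC hθ0 hθ hk hk0 hβ0 hβ1 hr x x' y
  refine h.trans (le_of_eq ?_)
  rw [show upperExp s N (θ - β) k + (α - θ) / N - 1 = (α - (sdeg s k + β)) / N by
    unfold upperExp; ring]
  ring

end correction

/-! ### The frozen kernels as an approximate identity -/

section approximateIdentity

variable {d : ℕ} {s : Fin d → ℕ} {N : ℕ} {δ A H α C c γ : ℝ}
  {a : (Fin d → ℕ) → (Fin d → ℝ) → ℂ}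

variable (hs : ∀ j, 0 < s j) (hN : ∀ j, s j < N) (hN0 : 0 < N) (hδ : 0 < δ) (hα : 0 < α)
  (ha : CoeffAssumptions s N δ A H α a) (hf : FrozenBounds s N α C c γ a) (hc : 0 ≤ c) (hC : 0 ≤ C)

theorem sdeg_zero : sdeg s 0 = 0 := by simp [sdeg]

include hs hN hN0 hδ hα ha hf hc hC in
-- With coefficients frozen at `x` the mass is the exponential of `t` times the zeroth-order
-- coefficient, which tends to one. Freezing at the variable of integration instead costs `t ^ (α /
-- N)`.
theorem tendsto_integral_zker_zero (x : Fin d → ℝ) :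
    Tendsto (fun t => ∫ z, zker s N a 0 t x z) (𝓝[>] 0) (𝓝 1) := by
  have hp := ha.parabolicSymbol hs x
  have hN' : (0 : ℝ) < N := by exact_mod_cast hN0
  have h1 : Tendsto (fun t : ℝ => Complex.exp (t * csymb s N (fun k => a k x) 0)) (𝓝[>] 0)
      (𝓝 1) := by
    have hcont : Continuous fun t : ℝ => Complex.exp (t * csymb s N (fun k => a k x) 0) := by
      fun_prop
    have := hcont.tendsto 0
    simp only [Complex.ofReal_zero, zero_mul, Complex.exp_zero] at this
    exact this.mono_left nhdsWithin_le_nhds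
  have h2 : Tendsto (fun t : ℝ => C * Real.exp (γ * t) * t ^ (α / N) * Real.pi ^ d) (𝓝[>] 0)
      (𝓝 0) := by
    have hcont : Continuous fun t : ℝ => C * Real.exp (γ * t) * t ^ (α / N) * Real.pi ^ d :=
      ((continuous_const.mul (by fun_prop)).mul
        (continuous_id.rpow_const fun _ => Or.inr (by positivity))).mul continuous_const
    have := hcont.tendsto 0
    rw [Real.zero_rpow (by positivity), mul_zero, zero_mul] at this
    exact this.mono_left nhdsWithin_le_nhds
  have h3 : Tendsto (fun t : ℝ => (∫ z, zker s N a 0 t x z) -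
      Complex.exp (t * csymb s N (fun k => a k x) 0)) (𝓝[>] 0) (𝓝 0) := by
    refine squeeze_zero_norm' ?_ h2
    filter_upwards [self_mem_nhdsWithin] with t ht
    have ht : 0 < t := ht
    have hi : Integrable (fun z => frz s N a 0 t x (x - z)) :=
      (integrable_fundKer hs hN hN0 hδ (abs_nonneg A) hp 0 ht).comp_sub_left x
    have h0 : ∫ z, frz s N a 0 t x (x - z) = Complex.exp (t * csymb s N (fun k => a k x) 0) := by
      rw [integral_sub_left_eq_self (fun z => frz s N a 0 t x z) volume x]
      exact integral_fundKer_zero hs hN hN0 hδ (abs_nonneg A) hp ht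
    have hk : sdeg s 0 ≤ 2 * N := by rw [sdeg_zero]; omega
    have hi' : Integrable (fun z => zker s N a 0 t x z) :=
      integrable_of_le_maj hs hN hc ht
        ((kerMeas_zker (ha.measurable hs hα) 0).section_right t x)
        (fun z => hf.kerBound hk t ht x z)
    rw [← h0, ← integral_sub hi' hi]
    calc _ ≤ ∫ z, C * Real.exp (γ * t) * t ^ (α / N) * maj s N c t (x - z) := by
          refine norm_integral_le_of_norm_le
            (((integrable_maj hs hN hc ht).comp_sub_left x).const_mul _)
            (Eventually.of_forall fun z => ?_)
          have := hf.diff 0 hk t ht x z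
          rwa [sdeg_zero, Nat.cast_zero, sub_zero] at this
      _ ≤ _ := by
          rw [integral_const_mul]
          exact mul_le_mul_of_nonneg_left (integral_maj_sub_le hc ht x) (by positivity)
  have := h3.add h1
  simp only [sub_add_cancel, zero_add] at this
  exact this

/-- A bounded function continuous at `x` has there a linear modulus up to `ε`. In this form the
weighted kernel bounds apply directly, without splitting the integral. The threshold `min 1 η`
ensures that powers of a small `snorm` do not increase it. -/
theorem exists_norm_sub_le_add_snorm (hs : ∀ j, 0 < s j) {f : (Fin d → ℝ) → ℂ} {F : ℝ}
    {x : Fin d → ℝ} (hF : ∀ z, ‖f z‖ ≤ F) (hfx : ContinuousAt f x) {ε : ℝ} (hε : 0 < ε) :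
    ∃ B, 0 ≤ B ∧ ∀ z, ‖f z - f x‖ ≤ ε + B * snorm s (x - z) := by
  obtain ⟨η, hη, h⟩ := Metric.continuousAt_iff.1 hfx ε hε
  have hF0 : 0 ≤ F := (norm_nonneg _).trans (hF x)
  have hρ : 0 < min 1 η := lt_min one_pos hη
  refine ⟨2 * F / min 1 η, by positivity, fun z => ?_⟩
  have hsn := snorm_nonneg (s := s) (x - z)
  rcases lt_or_ge (snorm s (x - z)) (min 1 η) with hlt | hge
  · have hd : dist z x < η := by
      rw [dist_comm, dist_pi_lt_iff hη]
      intro j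
      rw [Real.dist_eq]
      have h1 := abs_le_snorm_pow hs (x - z) j
      rw [Pi.sub_apply] at h1
      have h2 : snorm s (x - z) ^ s j ≤ snorm s (x - z) :=
        pow_le_of_le_one hsn (hlt.le.trans (min_le_left _ _)) (hs j).ne'
      exact (h1.trans h2).trans_lt (hlt.trans_le (min_le_right _ _))
    have := h hd
    rw [dist_eq_norm] at this
    have h3 : 0 ≤ 2 * F / min 1 η * snorm s (x - z) := by positivity
    linarith
  · have h1 : ‖f z - f x‖ ≤ 2 * F := (norm_sub_le _ _).trans (by linarith [hF z, hF x])
    have h2 : 2 * F ≤ 2 * F / min 1 η * snorm s (x - z) := by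
      rw [div_mul_eq_mul_div, le_div_iff₀ hρ]
      exact mul_le_mul_of_nonneg_left hge (by linarith)
    linarith

include hs hN hf hc hC in
theorem norm_integral_zker_zero_mul_le {f : (Fin d → ℝ) → ℂ} {ε B t : ℝ} (hN0 : 0 < N) (ht : 0 < t)
    (hε : 0 ≤ ε) (hB : 0 ≤ B) {x : Fin d → ℝ} (hfx : ∀ z, ‖f z‖ ≤ ε + B * snorm s (x - z)) :
    ‖∫ z, zker s N a 0 t x z * f z‖ ≤
      C * Real.exp (γ * t) * (ε + B * t ^ (1 / N : ℝ)) * Real.pi ^ d := by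
  have hk : sdeg s 0 ≤ 2 * N := by rw [sdeg_zero]; omega
  calc _ ≤ ∫ z, C * Real.exp (γ * t) * (ε + B * t ^ (1 / N : ℝ)) * maj s N c t (x - z) := by
        refine norm_integral_le_of_norm_le
            (((integrable_maj hs hN hc ht).comp_sub_left x).const_mul _)
            (Eventually.of_forall fun z => ?_)
        have h0 := hf.weight 0 hk 0 le_rfl zero_le_one t ht z (x - z)
        have h1 := hf.weight 0 hk 1 zero_le_one le_rfl t ht z (x - z)
        rw [sdeg_zero, Nat.cast_zero, sub_zero] at h0 h1
        rw [Real.rpow_zero, zero_div, Real.rpow_zero, one_mul, mul_one] at h0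
        rw [Real.rpow_one] at h1
        rw [norm_mul]
        calc _ ≤ ‖zker s N a 0 t x z‖ * (ε + B * snorm s (x - z)) :=
              mul_le_mul_of_nonneg_left (hfx z) (norm_nonneg _)
          _ = ε * ‖zker s N a 0 t x z‖ + B * (snorm s (x - z) * ‖zker s N a 0 t x z‖) := by ring
          _ ≤ ε * (C * Real.exp (γ * t) * maj s N c t (x - z)) +
              B * (C * Real.exp (γ * t) * t ^ (1 / N : ℝ) * maj s N c t (x - z)) :=
              add_le_add (mul_le_mul_of_nonneg_left h0 hε) (mul_le_mul_of_nonneg_left h1 hB)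
          _ = _ := by ring
    _ ≤ _ := by
        rw [integral_const_mul]
        have : 0 ≤ t ^ (1 / N : ℝ) := Real.rpow_nonneg ht.le _
        exact mul_le_mul_of_nonneg_left (integral_maj_sub_le hc ht x) (by positivity)

include hs hN hN0 hδ hα ha hf hc hC in
/-- The frozen kernels form an approximate identity. -/
theorem tendsto_integral_zker_zero_mul {f : (Fin d → ℝ) → ℂ} {F : ℝ} {x : Fin d → ℝ}
    (hfm : Measurable f) (hF : ∀ z, ‖f z‖ ≤ F) (hfx : ContinuousAt f x) :
    Tendsto (fun t => ∫ z, zker s N a 0 t x z * f z) (𝓝[>] 0) (𝓝 (f x)) := by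
  have hN' : (0 : ℝ) < N := by exact_mod_cast hN0
  have hk : sdeg s 0 ≤ 2 * N := by rw [sdeg_zero]; omega
  have h1 : Tendsto (fun t => ∫ z, zker s N a 0 t x z * (f z - f x)) (𝓝[>] 0) (𝓝 0) := by
    rw [Metric.tendsto_nhds]
    intro ε hε
    have hπ := Real.pi_pos
    obtain ⟨B, hB, h⟩ := exists_norm_sub_le_add_snorm hs hF hfx
      (show 0 < ε / (C * Real.pi ^ d + 1) by positivity)
    have hcont : Continuous fun t : ℝ => C * Real.exp (γ * t) *
        (ε / (C * Real.pi ^ d + 1) + B * t ^ (1 / N : ℝ)) * Real.pi ^ d :=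
      ((continuous_const.mul (by fun_prop)).mul (continuous_const.add (continuous_const.mul
        (continuous_id.rpow_const fun _ => Or.inr (by positivity))))).mul continuous_const
    have h2 := hcont.tendsto 0
    rw [Real.zero_rpow (by positivity), mul_zero, mul_zero, Real.exp_zero, mul_one, add_zero] at h2
    have h3 : C * (ε / (C * Real.pi ^ d + 1)) * Real.pi ^ d < ε := by
      rw [mul_div_assoc', div_mul_eq_mul_div, div_lt_iff₀ (by positivity)]
      nlinarith
    filter_upwards [self_mem_nhdsWithin,
      (h2.mono_left nhdsWithin_le_nhds).eventually (gt_mem_nhds h3)] with t ht hlt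
    rw [dist_zero_right]
    exact (norm_integral_zker_zero_mul_le hs hN hf hc hC hN0 ht (by positivity) hB h).trans_lt hlt
  have h2 := (tendsto_integral_zker_zero hs hN hN0 hδ hα ha hf hc hC x).mul_const (f x)
  have h3 := h1.add h2
  rw [zero_add, one_mul] at h3
  refine h3.congr' ?_
  filter_upwards [self_mem_nhdsWithin] with t ht
  have ht : 0 < t := ht
  have hm := (kerMeas_zker (ha.measurable hs hα) 0).section_right t x
  have hi : Integrable (fun z => zker s N a 0 t x z) :=
    integrable_of_le_maj hs hN hc ht hm (fun z => hf.kerBound hk t ht x z)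
  have hi' : Integrable (fun z => zker s N a 0 t x z * f z) :=
    hi.mul_bdd hfm.aestronglyMeasurable (Eventually.of_forall hF)
  simp_rw [mul_sub]
  rw [integral_sub hi' (hi.mul_const _), integral_mul_const, sub_add_cancel]

end approximateIdentity

/-! ### Time derivative of the correction and the Volterra equation -/

section timeDerivative

variable {d : ℕ} {s : Fin d → ℕ} {N : ℕ} {δ A H α θ C c γ : ℝ}
  {a : (Fin d → ℕ) → (Fin d → ℝ) → ℂ} {Φ : ℝ → (Fin d → ℝ) → (Fin d → ℝ) → ℂ}

/-- For `k = 0` there is no cancellation and the estimates are used with `θ = 0`. -/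
theorem LeviDensity.zero (hΦ : LeviDensity s N α θ C c γ a Φ) : LeviDensity s N α 0 C c γ a Φ := by
  refine ⟨hΦ.frozen, hΦ.meas_coeff, hΦ.meas, hΦ.bound, fun t ht x x' y => ?_, hΦ.eqn⟩
  rw [Real.rpow_zero, mul_one, sub_zero, mul_add]
  exact (norm_sub_le _ _).trans (add_le_add (hΦ.bound t ht x y) (hΦ.bound t ht x' y))

theorem one_le_sdeg (hs : ∀ j, 0 < s j) {k : Fin d → ℕ} (hk : k ≠ 0) : 1 ≤ sdeg s k := by
  obtain ⟨j, hj⟩ := Function.ne_iff.1 hk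
  have h1 : s j * k j ≤ sdeg s k :=
    Finset.single_le_sum (f := fun i => s i * k i) (fun _ _ => Nat.zero_le _) (Finset.mem_univ j)
  have h2 : 0 < s j * k j := Nat.mul_pos (hs j) (Nat.pos_of_ne_zero hj)
  omega

theorem LeviDensity.continuous (hs : ∀ j, 0 < s j) (hθ : 0 < θ) (hc : 0 ≤ c) (hC : 0 ≤ C)
    (hΦ : LeviDensity s N α θ C c γ a Φ) {r : ℝ} (hr : 0 < r) (y : Fin d → ℝ) :
    Continuous fun x => Φ r x y := by
  refine continuous_iff_continuousAt.2 fun x => ?_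
  rw [ContinuousAt, tendsto_iff_norm_sub_tendsto_zero]
  obtain ⟨B, hB⟩ : ∃ B, B = C * Real.exp (γ * r) * r ^ ((α - θ) / N - 1) *
    (r ^ (-(scalingSize s : ℝ) / N) + r ^ (-(scalingSize s : ℝ) / N)) := ⟨_, rfl⟩
  have h1 : Tendsto (fun z => B * snorm s (z - x) ^ θ) (𝓝 x) (𝓝 0) := by
    have h2 : Continuous fun z => B * snorm s (z - x) ^ θ :=
      continuous_const.mul (Continuous.rpow_const (continuous_snorm.comp (by fun_prop))
        fun _ => Or.inr hθ.le)
    have := h2.tendsto x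
    rwa [sub_self, snorm_zero hs, Real.zero_rpow hθ.ne', mul_zero] at this
  refine squeeze_zero (fun z => norm_nonneg _) (fun z => (hΦ.holder r hr z x y).trans ?_) h1
  have h3 : 0 ≤ snorm s (z - x) ^ θ := Real.rpow_nonneg (snorm_nonneg _) _
  have h4 : 0 ≤ r ^ ((α - θ) / N - 1) := Real.rpow_nonneg hr.le _
  calc _ ≤ C * Real.exp (γ * r) * r ^ ((α - θ) / N - 1) * snorm s (z - x) ^ θ *
        (r ^ (-(scalingSize s : ℝ) / N) + r ^ (-(scalingSize s : ℝ) / N)) :=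
        mul_le_mul_of_nonneg_left (add_le_add (maj_le_rpow hc hr _) (maj_le_rpow hc hr _))
          (by positivity)
    _ = _ := by rw [hB]; ring

/-- The time derivative of the convolution of the frozen kernel with the density. -/
def timeDeriv {d : ℕ} (s : Fin d → ℕ) (N : ℕ) (a : (Fin d → ℕ) → (Fin d → ℝ) → ℂ)
    (Φ : ℝ → (Fin d → ℝ) → (Fin d → ℝ) → ℂ) (x y : Fin d → ℝ) (ρ r : ℝ) : ℂ :=
  (∑ l ∈ multiIndices s N, a l x * slice (zker s N a l) Φ (ρ - r) r x y) -
    slice (leviKer s N a) Φ (ρ - r) r x y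

variable (hs : ∀ j, 0 < s j) (hN : ∀ j, s j < N) (hN0 : 0 < N) (hδ : 0 < δ) (hα : 0 < α)
  (ha : CoeffAssumptions s N δ A H α a)

include hs hN hN0 hδ ha in
theorem hasDerivAt_zker_zero {t : ℝ} (ht : 0 < t) (x z : Fin d → ℝ) :
    HasDerivAt (fun t => zker s N a 0 t x z)
      (∑ l ∈ multiIndices s N, a l z * zker s N a l t x z) t := by
  have h := hasDerivAt_fundKer hs hN hN0 hδ (abs_nonneg A) (ha.parabolicSymbol hs z) 0 ht (x - z)
  simp only [zero_add] at h
  exact h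

include hs hN in
-- Changing the coefficients from `z` to `x` under the integral produces exactly Levi's kernel; this
-- is how the Volterra equation meets the differential equation.
theorem slice_levi_eq {b B : ℝ} (hmc : ∀ l ∈ multiIndices s N, Measurable (a l))
    (hf : FrozenBounds s N α C c γ a) (hΦm : KerMeas Φ) (hΦ : KerBound s N c γ b B Φ) (hc : 0 ≤ c)
    {τ r : ℝ} (hτ : 0 < τ) (hr : 0 < r) (x y : Fin d → ℝ) :
    ∫ z, (∑ l ∈ multiIndices s N, a l z * zker s N a l τ x z) * Φ r z y =
      (∑ l ∈ multiIndices s N, a l x * slice (zker s N a l) Φ τ r x y) -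
        slice (leviKer s N a) Φ τ r x y := by
  have hdeg : ∀ l ∈ multiIndices s N, sdeg s l ≤ 2 * N := fun l hl => by
    have := (mem_multiIndices hs).1 hl; omega
  have h1 : ∀ l ∈ multiIndices s N, Integrable fun z => a l x * (zker s N a l τ x z * Φ r z y) :=
    fun l hl => (integrable_zker_mul hs hN hmc hf hΦm hΦ hc (hdeg l hl) hτ hr x y).const_mul _
  have h2 : Integrable fun z => leviKer s N a τ x z * Φ r z y :=
    integrable_mul_of_le_maj hs hN hc hτ hr ((kerMeas_leviKer hmc).section_right τ x)
      (hΦm.section_left r y) (fun z => hf.kerBound_levi τ hτ x z) (fun z => hΦ r hr z y)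
  unfold slice
  simp_rw [← integral_const_mul]
  rw [← integral_finsetSum _ h1, ← integral_sub (integrable_finsetSum _ h1) h2]
  congr 1
  funext z
  simp only [leviKer, zker, Finset.sum_mul]
  rw [← Finset.sum_sub_distrib]
  refine Finset.sum_congr rfl fun l _ => ?_
  ring

include hs hN hN0 hδ hα ha in
theorem hasDerivAt_slice {b B : ℝ} (hf : FrozenBounds s N α C c γ a) (hΦm : KerMeas Φ)
    (hΦ : KerBound s N c γ b B Φ) (hc : 0 ≤ c) (hC : 0 ≤ C) {ρ r : ℝ} (hr : 0 < r) (hρ : r < ρ)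
    (x y : Fin d → ℝ) :
    HasDerivAt (fun t => slice (zker s N a 0) Φ (t - r) r x y) (timeDeriv s N a Φ x y ρ r) ρ := by
  have hmc := ha.measurable hs hα
  have hτ := sub_pos.2 hρ
  have hdeg : ∀ l ∈ multiIndices s N, sdeg s l ≤ 2 * N := fun l hl => by
    have := (mem_multiIndices hs).1 hl; omega
  obtain ⟨G, hG⟩ : ∃ G : ℝ → ℝ, G = fun τ => ∑ l ∈ multiIndices s N, C * (C * Real.exp (γ * τ) *
    τ ^ (1 - sdeg s l / N - 1 : ℝ) * τ ^ (-(scalingSize s : ℝ) / N)) := ⟨_, rfl⟩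
  have hGc : ContinuousAt G (ρ - r) := by
    rw [hG]
    refine tendsto_finsetSum _ fun l _ => ?_
    have h1 : ContinuousAt (fun τ : ℝ => τ) (ρ - r) := continuousAt_id
    exact continuousAt_const.mul (((continuousAt_const.mul (Real.continuous_exp.continuousAt.comp
      (continuousAt_const.mul h1))).mul (h1.rpow_const (Or.inl hτ.ne'))).mul
      (h1.rpow_const (Or.inl hτ.ne')))
  have hS : {τ | 0 < τ ∧ G τ < G (ρ - r) + 1} ∈ 𝓝 (ρ - r) :=
    (lt_mem_nhds hτ).and (hGc.eventually (gt_mem_nhds (lt_add_one _)))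
  have hsum : ∀ τ, 0 < τ → ∀ z, ‖∑ l ∈ multiIndices s N, a l z * zker s N a l τ x z‖ ≤ G τ :=
    fun τ hτ z => by
      rw [hG]
      refine norm_sum_le_of_le _ fun l hl => ?_
      rw [norm_mul]
      exact mul_le_mul (hf.coeff l hl z) (hf.norm_zker_le_rpow hc hC (hdeg l hl) hτ x z)
        (norm_nonneg _) hC
  have hms : ∀ τ, Measurable fun z => ∑ l ∈ multiIndices s N, a l z * zker s N a l τ x z :=
    fun τ => Finset.measurable_sum _ fun l hl =>
      (hmc l hl).mul ((kerMeas_zker hmc l).section_right τ x)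
  have m1 : ∀ τ, AEStronglyMeasurable (fun z => zker s N a 0 τ x z * Φ r z y) volume := fun τ =>
    (((kerMeas_zker hmc 0).section_right τ x).mul (hΦm.section_left r y)).aestronglyMeasurable
  have m2 : Integrable (fun z => zker s N a 0 (ρ - r) x z * Φ r z y) :=
    integrable_zker_mul hs hN hmc hf hΦm hΦ hc (by rw [sdeg_zero]; omega) hτ hr x y
  have m3 : AEStronglyMeasurable (fun z => (∑ l ∈ multiIndices s N, a l z *
      zker s N a l (ρ - r) x z) * Φ r z y) volume :=
    ((hms _).mul (hΦm.section_left r y)).aestronglyMeasurable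
  have m4 : ∀ z, ∀ τ ∈ {τ | 0 < τ ∧ G τ < G (ρ - r) + 1}, ‖(∑ l ∈ multiIndices s N, a l z *
      zker s N a l τ x z) * Φ r z y‖ ≤ (G (ρ - r) + 1) * ‖Φ r z y‖ := fun z τ hτ' => by
    rw [norm_mul]
    exact mul_le_mul_of_nonneg_right ((hsum τ hτ'.1 z).trans hτ'.2.le) (norm_nonneg _)
  have m5 := (hΦ.integrable_left hs hN hΦm hc hr y).norm.const_mul (G (ρ - r) + 1)
  have m6 : ∀ z, ∀ τ ∈ {τ | 0 < τ ∧ G τ < G (ρ - r) + 1}, HasDerivAt (fun τ =>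
      zker s N a 0 τ x z * Φ r z y)
      ((∑ l ∈ multiIndices s N, a l z * zker s N a l τ x z) * Φ r z y) τ := fun z τ hτ' =>
    (hasDerivAt_zker_zero hs hN hN0 hδ ha hτ'.1 x z).mul_const _
  have h := hasDerivAt_integral_of_dominated_loc_of_deriv_le (𝕜 := ℝ) (μ := volume)
    (F := fun τ z => zker s N a 0 τ x z * Φ r z y)
    (F' := fun τ z => (∑ l ∈ multiIndices s N, a l z * zker s N a l τ x z) * Φ r z y)
    (x₀ := ρ - r) (bound := fun z => (G (ρ - r) + 1) * ‖Φ r z y‖) hS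
    (Eventually.of_forall m1) m2 m3 (Eventually.of_forall m4) m5 (Eventually.of_forall m6)
  have h2 := h.2.comp_sub_const ρ r
  rw [slice_levi_eq hs hN hmc hf hΦm hΦ hc hτ hr x y] at h2
  exact h2

end timeDerivative

theorem rpow_le_exp_mul_rpow {t e e' : ℝ} (ht : 0 < t) (h0 : e' ≤ e) (h1 : e ≤ e' + 1) :
    t ^ e ≤ Real.exp t * t ^ e' := by
  have h := rpow_le_exp ht (sub_nonneg.2 h0) (show e - e' ≤ 1 by linarith)
  calc t ^ e = t ^ (e - e') * t ^ e' := by rw [← Real.rpow_add ht, sub_add_cancel]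
    _ ≤ _ := mul_le_mul_of_nonneg_right h (Real.rpow_nonneg ht.le _)

/-- Brings the different singularities in the time derivative to one common pair of exponents, as
required by `hasDerivAt_setIntegral_Ioo`; surpluses of at most one go into the exponential. -/
theorem rpow_mul_rpow_le_exp {ρ r e₁ e₂ e₁' e₂' : ℝ} (hr : r ∈ Ioo 0 ρ) (h1 : e₁' ≤ e₁)
    (h1' : e₁ ≤ e₁' + 1) (h2 : e₂' ≤ e₂) (h2' : e₂ ≤ e₂' + 1) :
    (ρ - r) ^ e₁ * r ^ e₂ ≤ Real.exp ρ * ((ρ - r) ^ e₁' * r ^ e₂') := by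
  have hτ := sub_pos.2 hr.2
  have e : Real.exp ρ = Real.exp (ρ - r) * Real.exp r := by
    rw [← Real.exp_add, sub_add_cancel]
  calc _ ≤ (Real.exp (ρ - r) * (ρ - r) ^ e₁') * (Real.exp r * r ^ e₂') :=
        mul_le_mul (rpow_le_exp_mul_rpow hτ h1 h1') (rpow_le_exp_mul_rpow hr.1 h2 h2')
          (Real.rpow_nonneg hr.1.le _)
          (mul_nonneg (Real.exp_pos _).le (Real.rpow_nonneg hτ.le _))
    _ = _ := by rw [e]; ring

section timeRegularity

variable {d : ℕ} {s : Fin d → ℕ} {N : ℕ} {δ A H α θ C c γ : ℝ}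
  {a : (Fin d → ℕ) → (Fin d → ℝ) → ℂ} {Φ : ℝ → (Fin d → ℝ) → (Fin d → ℝ) → ℂ}

variable (hs : ∀ j, 0 < s j) (hN : ∀ j, s j < N) (hN0 : 0 < N) (hδ : 0 < δ) (hα : 0 < α)
  (hα1 : α ≤ 1) (ha : CoeffAssumptions s N δ A H α a) (hΦ : LeviDensity s N α θ C c γ a Φ)
  (hc : 0 ≤ c) (hC : 0 ≤ C) (hθ0 : 0 < θ) (hθ : θ < α)

include hs hN hN0 hδ hα hα1 ha hΦ hc hC hθ0 hθ

/-- The case `k = 0` uses the density with `θ = 0`. For `k ≠ 0` the degree is at least one, hence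
above `θ`, and at most `N`, hence below `N + θ`, so `θ > 0` is admissible. -/
theorem continuousAt_corr_of_le {k : Fin d → ℕ} (hk : sdeg s k ≤ N) {t : ℝ} (ht : 0 < t)
    (x y : Fin d → ℝ) :
    ContinuousAt (fun q : ℝ × (Fin d → ℝ) => corr s N a Φ k q.1 q.2 y) (t, x) := by
  have hN' : (1 : ℝ) ≤ N := by exact_mod_cast hN0
  have hk' : (sdeg s k : ℝ) ≤ N := by exact_mod_cast hk
  rcases eq_or_ne k 0 with rfl | h
  · exact continuousAt_corr hs hN hN0 hδ hα hα1 ha hΦ.zero hc hC le_rfl hα (fun _ => rfl)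
      (by positivity) (by rw [sdeg_zero]; push_cast; linarith) ht x y
  · have h1 : (1 : ℝ) ≤ sdeg s k := by exact_mod_cast one_le_sdeg hs h
    exact continuousAt_corr hs hN hN0 hδ hα hα1 ha hΦ hc hC hθ0.le hθ (fun h' => absurd h' h)
      (by linarith) (by linarith) ht x y

theorem integrableOn_slice_zker_of_le {k : Fin d → ℕ} (hk : sdeg s k ≤ N) {t : ℝ} (ht : 0 < t)
    (x y : Fin d → ℝ) :
    IntegrableOn (fun r => slice (zker s N a k) Φ (t - r) r x y) (Ioo 0 t) := by
  have hN' : (1 : ℝ) ≤ N := by exact_mod_cast hN0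
  have hk' : (sdeg s k : ℝ) ≤ N := by exact_mod_cast hk
  rcases eq_or_ne k 0 with rfl | h
  · exact integrableOn_slice_zker hs hN hN0 hδ hα hα1 ha hΦ.zero hc hC le_rfl hα (fun _ => rfl)
      (by positivity) (by rw [sdeg_zero]; push_cast; linarith) ht x y
  · have h1 : (1 : ℝ) ≤ sdeg s k := by exact_mod_cast one_le_sdeg hs h
    exact integrableOn_slice_zker hs hN hN0 hδ hα hα1 ha hΦ hc hC hθ0.le hθ
      (fun h' => absurd h' h) (by linarith) (by linarith) ht x y

theorem hasLineDerivAt_corr_of_le {k : Fin d → ℕ} {j : Fin d}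
    (hk : sdeg s (k + Pi.single j 1) ≤ N) {t : ℝ} (ht : 0 < t) (x y : Fin d → ℝ) :
    HasLineDerivAt ℝ (fun x => corr s N a Φ k t x y) (corr s N a Φ (k + Pi.single j 1) t x y) x
      (Pi.single j 1) := by
  rcases eq_or_ne k 0 with rfl | h
  · refine hasLineDerivAt_corr hs hN hN0 hδ hα hα1 ha hΦ.zero hc hC le_rfl hα (fun _ => rfl)
      (by positivity) ?_ ht x y
    rw [sdeg_add_single, sdeg_zero]
    have : (s j : ℝ) < N := by exact_mod_cast hN j
    push_cast; linarith
  · have h1 : (1 : ℝ) ≤ sdeg s k := by exact_mod_cast one_le_sdeg hs h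
    have hk' : (sdeg s (k + Pi.single j 1) : ℝ) ≤ N := by exact_mod_cast hk
    exact hasLineDerivAt_corr hs hN hN0 hδ hα hα1 ha hΦ hc hC hθ0.le hθ (fun h' => absurd h' h)
      (by linarith) (by linarith) ht x y

theorem norm_slice_zker_le_common {k : Fin d → ℕ} (hk : sdeg s k ≤ N) {ρ r : ℝ}
    (hr : r ∈ Ioo 0 ρ) (x y : Fin d → ℝ) :
    ‖slice (zker s N a k) Φ (ρ - r) r x y‖ ≤ sliceConst d C * Real.exp ((γ + 2) * ρ) *
      maj s N c ρ (x - y) * ((ρ - r) ^ (θ / N - 1) * r ^ ((α - θ) / N - 1)) := by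
  have hN' : (1 : ℝ) ≤ N := by exact_mod_cast hN0
  have hN'' : (0 : ℝ) < N := by linarith
  have hk' : (sdeg s k : ℝ) ≤ N := by exact_mod_cast hk
  have hm := maj_nonneg (s := s) (N := N) (hr.1.trans hr.2) c (x - y)
  have hL := sliceConst_nonneg d hC
  have hθN : θ / N ≤ 1 := (div_le_one hN'').2 (by linarith)
  have hθN0 : 0 ≤ θ / N := by positivity
  have e2 : (α - θ) / N = α / N - θ / N := sub_div _ _ _
  have ex : Real.exp ((γ + 2) * ρ) = Real.exp ((γ + 1) * ρ) * Real.exp ρ := by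
    rw [exp_mul_exp_self]; congr 1; ring
  rw [ex]
  rcases eq_or_ne k 0 with rfl | h
  · have h1 := norm_slice_zker_le hs hN hN0 hδ hα hα1 ha hΦ.zero hc hC le_rfl hα (k := 0)
      (by rw [sdeg_zero]; omega) (fun _ => rfl) hr x y
    rw [sdeg_zero, Nat.cast_zero, sub_zero, zero_div, sub_zero] at h1
    refine h1.trans ?_
    have h2 := rpow_mul_rpow_le_exp (e₁ := 0) (e₂ := α / N - 1) (e₁' := θ / N - 1)
      (e₂' := (α - θ) / N - 1) hr (by linarith) (by linarith) (by rw [e2]; linarith)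
      (by rw [e2]; linarith)
    calc _ = sliceConst d C * Real.exp ((γ + 1) * ρ) * maj s N c ρ (x - y) *
          ((ρ - r) ^ (0 : ℝ) * r ^ (α / N - 1)) := by ring
      _ ≤ sliceConst d C * Real.exp ((γ + 1) * ρ) * maj s N c ρ (x - y) * _ :=
          mul_le_mul_of_nonneg_left h2 (by positivity)
      _ = _ := by ring
  · have h1 := norm_slice_zker_le hs hN hN0 hδ hα hα1 ha hΦ hc hC hθ0.le hθ (k := k)
      (by omega) (fun h' => absurd h' h) hr x y
    refine h1.trans ?_
    have e3 : (θ - sdeg s k) / N = θ / N - sdeg s k / N := sub_div _ _ _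
    have h3 : (sdeg s k : ℝ) / N ≤ 1 := (div_le_one hN'').2 hk'
    have h4 : 0 ≤ (sdeg s k : ℝ) / N := by positivity
    have h2 := rpow_mul_rpow_le_exp (e₁ := (θ - sdeg s k) / N) (e₂ := (α - θ) / N - 1)
      (e₁' := θ / N - 1) (e₂' := (α - θ) / N - 1) hr (by rw [e3]; linarith)
      (by rw [e3]; linarith) le_rfl (by linarith)
    calc _ = sliceConst d C * Real.exp ((γ + 1) * ρ) * maj s N c ρ (x - y) *
          ((ρ - r) ^ ((θ - sdeg s k) / N) * r ^ ((α - θ) / N - 1)) := by ring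
      _ ≤ sliceConst d C * Real.exp ((γ + 1) * ρ) * maj s N c ρ (x - y) * _ :=
          mul_le_mul_of_nonneg_left h2 (by positivity)
      _ = _ := by ring

omit hδ hα ha in
theorem norm_slice_levi_le_common {ρ r : ℝ} (hr : r ∈ Ioo 0 ρ) (x y : Fin d → ℝ) :
    ‖slice (leviKer s N a) Φ (ρ - r) r x y‖ ≤ sliceConst d C * Real.exp ((γ + 2) * ρ) *
      maj s N c ρ (x - y) * ((ρ - r) ^ (θ / N - 1) * r ^ ((α - θ) / N - 1)) := by
  have hN' : (1 : ℝ) ≤ N := by exact_mod_cast hN0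
  have hN'' : (0 : ℝ) < N := by linarith
  have hρ := hr.1.trans hr.2
  have hm := maj_nonneg (s := s) (N := N) hρ c (x - y)
  have hπ := Real.pi_pos
  have hθN : θ / N ≤ 1 := (div_le_one hN'').2 (by linarith)
  have hθN0 : 0 ≤ θ / N := by positivity
  have hαN : α / N ≤ 1 := (div_le_one hN'').2 (by linarith)
  have hθα : θ / N ≤ α / N := by gcongr
  have e2 : (α - θ) / N = α / N - θ / N := sub_div _ _ _
  have h1 := norm_slice_le hs hN hc hΦ.frozen.kerBound_levi hΦ.bound hr x y
  have h2 := rpow_mul_rpow_le_exp (e₁ := α / N - 1) (e₂ := α / N - 1)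
      (e₁' := θ / N - 1) (e₂' := (α - θ) / N - 1) hr (by linarith)
      (by linarith) (by rw [e2]; linarith) (by rw [e2]; linarith)
  have h3 : Real.exp (γ * ρ) * Real.exp ρ ≤ Real.exp ((γ + 2) * ρ) := by
    rw [exp_mul_exp_self]
    exact Real.exp_le_exp.2 (mul_le_mul_of_nonneg_right (by linarith) hρ.le)
  have h4 : C * C * (8 * Real.pi) ^ d ≤ sliceConst d C := by
    unfold sliceConst
    refine mul_le_mul_of_nonneg_left ?_ (mul_nonneg hC hC)
    have : 0 ≤ 2 * (Real.pi ^ d * 4 ^ d) := by positivity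
    linarith
  have h5 : 0 ≤ (ρ - r) ^ (θ / N - 1) * r ^ ((α - θ) / N - 1) :=
    mul_nonneg (Real.rpow_nonneg (sub_pos.2 hr.2).le _) (Real.rpow_nonneg hr.1.le _)
  have hL := sliceConst_nonneg d hC
  calc _ ≤ C * C * (8 * Real.pi) ^ d * Real.exp (γ * ρ) * (Real.exp ρ * ((ρ - r) ^ (θ / N - 1) *
        r ^ ((α - θ) / N - 1))) * maj s N c ρ (x - y) :=
        h1.trans (by gcongr)
    _ = C * C * (8 * Real.pi) ^ d * (Real.exp (γ * ρ) * Real.exp ρ) * maj s N c ρ (x - y) *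
        ((ρ - r) ^ (θ / N - 1) * r ^ ((α - θ) / N - 1)) := by ring
    _ ≤ _ := by gcongr

theorem norm_timeDeriv_le {ρ r : ℝ} (hr : r ∈ Ioo 0 ρ) (x y : Fin d → ℝ) :
    ‖timeDeriv s N a Φ x y ρ r‖ ≤ ((multiIndices s N).card * C + 1) * sliceConst d C *
      Real.exp ((γ + 2) * ρ) * maj s N c ρ (x - y) *
        ((ρ - r) ^ (θ / N - 1) * r ^ ((α - θ) / N - 1)) := by
  obtain ⟨D, hD⟩ : ∃ D, D = sliceConst d C * Real.exp ((γ + 2) * ρ) *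
      maj s N c ρ (x - y) * ((ρ - r) ^ (θ / N - 1) * r ^ ((α - θ) / N - 1)) := ⟨_, rfl⟩
  have h1 : ‖∑ l ∈ multiIndices s N, a l x * slice (zker s N a l) Φ (ρ - r) r x y‖ ≤
      ∑ _l ∈ multiIndices s N, C * D := norm_sum_le_of_le _ fun l hl => by
    rw [norm_mul, hD]
    exact mul_le_mul (hΦ.frozen.coeff l hl x) (norm_slice_zker_le_common hs hN hN0 hδ hα hα1 ha hΦ
      hc hC hθ0 hθ ((mem_multiIndices hs).1 hl) hr x y) (norm_nonneg _) hC
  have h2 := norm_slice_levi_le_common hs hN hN0 hα1 hΦ hc hC hθ0 hθ hr x y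
  rw [← hD] at h2
  rw [Finset.sum_const, nsmul_eq_mul] at h1
  unfold timeDeriv
  refine (norm_sub_le _ _).trans ((add_le_add h1 h2).trans (le_of_eq ?_))
  rw [hD]; ring

/-- By `Φ = K + K ⋆ Φ` the term `K ⋆ Φ` cancels. What remains is continuous in `ρ`, as the
differentiation of the time integral needs. -/
theorem integral_timeDeriv {ρ : ℝ} (hρ : 0 < ρ) (x y : Fin d → ℝ) :
    Φ ρ x y + ∫ r in Ioo 0 ρ, timeDeriv s N a Φ x y ρ r =
      leviKer s N a ρ x y + ∑ l ∈ multiIndices s N, a l x * corr s N a Φ l ρ x y := by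
  have hN' : (1 : ℝ) ≤ N := by exact_mod_cast hN0
  have hε0 : 0 < α / N := by positivity
  have hε1 : α / N ≤ 1 := (div_le_one (by linarith)).2 (by linarith)
  have h1 : ∀ l ∈ multiIndices s N, IntegrableOn
      (fun r => a l x * slice (zker s N a l) Φ (ρ - r) r x y) (Ioo 0 ρ) := fun l hl =>
    (integrableOn_slice_zker_of_le hs hN hN0 hδ hα hα1 ha hΦ hc hC hθ0 hθ
      ((mem_multiIndices hs).1 hl) hρ x y).const_mul _
  have h2 := integrableOn_slice hs hN hc hε0 hε1 hε0 hε1 (kerMeas_leviKer hΦ.meas_coeff) hΦ.meas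
    hΦ.frozen.kerBound_levi hΦ.bound hρ x y
  have h3 : ∫ r in Ioo 0 ρ, timeDeriv s N a Φ x y ρ r =
      (∑ l ∈ multiIndices s N, a l x * corr s N a Φ l ρ x y) -
        volterra (leviKer s N a) Φ ρ x y := by
    unfold timeDeriv corr volterra
    rw [integral_sub (integrable_finsetSum _ h1) h2, integral_finsetSum _ h1]
    simp_rw [integral_const_mul]
  rw [h3, hΦ.eqn ρ hρ x y]
  ring

theorem hasDerivAt_corr (hγ : 0 ≤ γ) {t : ℝ} (ht : 0 < t) (x y : Fin d → ℝ) :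
    HasDerivAt (fun t => corr s N a Φ 0 t x y)
      (leviKer s N a t x y + ∑ l ∈ multiIndices s N, a l x * corr s N a Φ l t x y) t := by
  have hN' : (1 : ℝ) ≤ N := by exact_mod_cast hN0
  have hN'' : (0 : ℝ) < N := by linarith
  have hu0 : 0 < θ / N := by positivity
  have hu1 : θ / N ≤ 1 := (div_le_one hN'').2 (by linarith)
  have hv := lowerExp_mem hN0 hα1 hθ0.le hθ
  have hε1 : α / N ≤ 1 := (div_le_one hN'').2 (by linarith)
  have hL := sliceConst_nonneg d hC
  have ht2 : 0 < t / 2 := by positivity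
  have hS : -(scalingSize s : ℝ) / N ≤ 0 := by
    rw [neg_div]
    have : 0 ≤ (scalingSize s : ℝ) / N := by positivity
    linarith
  have hmaj : ∀ ρ ∈ Ioo (t / 2) (2 * t), maj s N c ρ (x - y) ≤
      (t / 2) ^ (-(scalingSize s : ℝ) / N) := fun ρ hρ =>
    (maj_le_rpow hc (ht2.trans hρ.1) _).trans (Real.rpow_le_rpow_of_nonpos ht2 hρ.1.le hS)
  have hLm : Measurable (Function.uncurry (timeDeriv s N a Φ x y)) := by
    have hq : Measurable fun q : ℝ × ℝ => (q.1 - q.2, q.2, x, y) := by fun_prop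
    have hl : ∀ f : ℝ → (Fin d → ℝ) → (Fin d → ℝ) → ℂ, KerMeas f →
        Measurable fun q : ℝ × ℝ => slice f Φ (q.1 - q.2) q.2 x y := fun f hf =>
      (hf.slice hΦ.meas).comp hq
    unfold timeDeriv
    simp only [Function.uncurry_def]
    exact (Finset.measurable_sum _ fun l _ =>
      (hl _ (kerMeas_zker hΦ.meas_coeff l)).const_mul _).sub
      (hl _ (kerMeas_leviKer hΦ.meas_coeff))
  have hb : ∀ ρ ∈ Ioo (t / 2) (2 * t), ∀ r ∈ Ioo 0 ρ, ‖timeDeriv s N a Φ x y ρ r‖ ≤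
      ((multiIndices s N).card * C + 1) * sliceConst d C * Real.exp ((γ + 2) * (2 * t)) *
        (t / 2) ^ (-(scalingSize s : ℝ) / N) *
        ((ρ - r) ^ (θ / N - 1) * r ^ ((α - θ) / N - 1)) := by
    intro ρ hρ r hr
    refine (norm_timeDeriv_le hs hN hN0 hδ hα hα1 ha hΦ hc hC hθ0 hθ hr x y).trans ?_
    have h5 : 0 ≤ (ρ - r) ^ (θ / N - 1) * r ^ ((α - θ) / N - 1) :=
      mul_nonneg (Real.rpow_nonneg (sub_pos.2 hr.2).le _) (Real.rpow_nonneg hr.1.le _)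
    have h6 := hmaj ρ hρ
    have h7 := hρ.2.le
    have h8 := maj_nonneg (s := s) (N := N) (ht2.trans hρ.1) c (x - y)
    gcongr
  have hφ : IntegrableOn (fun ρ => Φ ρ x y) (Ioo (t / 2) (2 * t)) := by
    have hm : Measurable fun ρ => Φ ρ x y :=
      hΦ.meas.comp (by fun_prop : Measurable fun ρ : ℝ => (ρ, x, y))
    refine Integrable.mono' (g := fun _ => C * Real.exp (γ * (2 * t)) * (t / 2) ^ (α / N - 1) *
      (t / 2) ^ (-(scalingSize s : ℝ) / N)) (integrable_const _) hm.aestronglyMeasurable ?_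
    filter_upwards [ae_restrict_mem measurableSet_Ioo] with ρ hρ
    have hρ0 := ht2.trans hρ.1
    refine (hΦ.bound ρ hρ0 x y).trans ?_
    have h6 := hmaj ρ hρ
    have h7 := hρ.2.le
    have h8 : ρ ^ (α / N - 1) ≤ (t / 2) ^ (α / N - 1) :=
      Real.rpow_le_rpow_of_nonpos ht2 hρ.1.le (by linarith)
    have h9 := maj_nonneg (s := s) (N := N) hρ0 c (x - y)
    have h10 : 0 ≤ ρ ^ (α / N - 1) := Real.rpow_nonneg hρ0.le _
    gcongr
  have hwc : ContinuousOn (fun ρ => leviKer s N a ρ x y +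
      ∑ l ∈ multiIndices s N, a l x * corr s N a Φ l ρ x y) (Ioi 0) := by
    intro ρ hρ
    have hρ : 0 < ρ := hρ
    have hpair : ContinuousAt (fun ρ : ℝ => (ρ, x)) ρ := by fun_prop
    refine ContinuousAt.continuousWithinAt (ContinuousAt.add ?_ ?_)
    · unfold leviKer
      refine tendsto_finsetSum _ fun l _ => ContinuousAt.mul continuousAt_const ?_
      exact ContinuousAt.comp (f := fun ρ : ℝ => (ρ, x))
        (continuousAt_zker hs hN hN0 hδ ha l hρ x y) hpair
    · refine tendsto_finsetSum _ fun l hl => ContinuousAt.mul continuousAt_const ?_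
      exact ContinuousAt.comp (f := fun ρ : ℝ => (ρ, x))
        (continuousAt_corr_of_le hs hN hN0 hδ hα hα1 ha hΦ hc hC hθ0 hθ
          ((mem_multiIndices hs).1 hl) hρ x y) hpair
  -- As the lag tends to zero the frozen kernels reproduce `Φ r x y`: the density at time `r` is
  -- bounded in its first variable, and continuous because `θ > 0`.
  have hlim : ∀ r, 0 < r → Tendsto (fun t => slice (zker s N a 0) Φ (t - r) r x y) (𝓝[>] r)
      (𝓝 (Φ r x y)) := by
    intro r hr
    have h1 := tendsto_integral_zker_zero_mul hs hN hN0 hδ hα ha hΦ.frozen hc hC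
      (f := fun z => Φ r z y) (x := x) (hΦ.meas.section_left r y)
      (F := C * Real.exp (γ * r) * r ^ (α / N - 1) * r ^ (-(scalingSize s : ℝ) / N))
      (fun z => (hΦ.bound r hr z y).trans (mul_le_mul_of_nonneg_left (maj_le_rpow hc hr _)
        (mul_nonneg (by positivity) (Real.rpow_nonneg hr.le _))))
      (hΦ.continuous hs hθ0 hc hC hr y).continuousAt
    have h2 : Tendsto (fun t => t - r) (𝓝[>] r) (𝓝[>] 0) := by
      refine tendsto_nhdsWithin_iff.2 ⟨?_, ?_⟩
      · have : Tendsto (fun t => t - r) (𝓝 r) (𝓝 (r - r)) :=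
          (continuous_id.sub continuous_const).tendsto r
        rw [sub_self] at this
        exact this.mono_left nhdsWithin_le_nhds
      · filter_upwards [self_mem_nhdsWithin] with t ht
        exact sub_pos.2 (mem_Ioi.1 ht)
    exact h1.comp h2
  exact hasDerivAt_setIntegral_Ioo (j := fun t r => slice (zker s N a 0) Φ (t - r) r x y)
    (φ := fun ρ => Φ ρ x y) ht hu0 hu1 hv.1 hv.2 (by positivity) hLm hb
    (fun r hr ρ hρ => hasDerivAt_slice hs hN hN0 hδ hα ha hΦ.frozen hΦ.meas hΦ.bound hc hC hr hρ
      x y) hlim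
    (fun t ht => integrableOn_slice_zker_of_le hs hN hN0 hδ hα hα1 ha hΦ hc hC hθ0 hθ
      (by rw [sdeg_zero]; omega) ht x y) hφ
    (fun ρ hρ => integral_timeDeriv hs hN hN0 hδ hα hα1 ha hΦ hc hC hθ0 hθ hρ x y) hwc

end timeRegularity

/-! ### Iterated partial derivatives of a compatible family -/

section mderiv

variable {d : ℕ} {s : Fin d → ℕ} {N : ℕ}

theorem sdeg_add (k l : Fin d → ℕ) : sdeg s (k + l) = sdeg s k + sdeg s l := by
  simp only [sdeg, Pi.add_apply, mul_add, Finset.sum_add_distrib]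

theorem mderiv_zero (f : (Fin d → ℝ) → ℂ) : mderiv 0 f = f := by
  unfold mderiv
  induction List.finRange d with
  | nil => rfl
  | cons j l ih => simp

theorem iterate_pderiv_eq {G : (Fin d → ℕ) → (Fin d → ℝ) → ℂ}
    (hG : ∀ k j, sdeg s (k + Pi.single j 1) ≤ N → ∀ x,
      HasLineDerivAt ℝ (G k) (G (k + Pi.single j 1) x) x (Pi.single j 1))
    (m : Fin d → ℕ) (j : Fin d) (n : ℕ) (h : sdeg s (m + Pi.single j n) ≤ N) :
    (pderiv j)^[n] (G m) = G (m + Pi.single j n) := by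
  induction n with
  | zero => simp
  | succ n ih =>
    have e : m + Pi.single j (n + 1) = m + Pi.single j n + Pi.single j 1 := by
      rw [add_assoc, ← Pi.single_add]
    rw [e] at h ⊢
    rw [Function.iterate_succ_apply', ih (by rw [sdeg_add] at h; omega)]
    funext x
    exact (hG _ j h x).lineDeriv

/-- A family of functions that are each other's partial derivatives consists of the iterated
derivatives of its first member. -/
theorem mderiv_eq {G : (Fin d → ℕ) → (Fin d → ℝ) → ℂ}
    (hG : ∀ k j, sdeg s (k + Pi.single j 1) ≤ N → ∀ x,
      HasLineDerivAt ℝ (G k) (G (k + Pi.single j 1) x) x (Pi.single j 1))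
    {k : Fin d → ℕ} (hk : sdeg s k ≤ N) : mderiv k (G 0) = G k := by
  -- Generalised to arbitrary lists for induction along the fold. The partial sums of the
  -- multi-index only grow, so every intermediate degree stays below `N`.
  have key : ∀ l : List (Fin d), sdeg s (l.map fun j => Pi.single j (k j)).sum ≤ N →
      l.foldr (fun j g => (pderiv j)^[k j] g) (G 0) =
        G (l.map fun j => (Pi.single j (k j) : Fin d → ℕ)).sum := by
    intro l
    induction l with
    | nil => intro _; rfl
    | cons j l ih =>
      intro h
      rw [List.map_cons, List.sum_cons, add_comm] at h ⊢
      rw [List.foldr_cons, ih (by rw [sdeg_add] at h; omega)]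
      exact iterate_pderiv_eq hG _ j (k j) h
  have e : ((List.finRange d).map fun j => (Pi.single j (k j) : Fin d → ℕ)).sum = k := by
    rw [← Fin.sum_univ_def, Finset.univ_sum_single]
  have h := key (List.finRange d) (by rw [e]; exact hk)
  rw [e] at h
  exact h

end mderiv

/-! ### Levi's fundamental solution and its bounds -/

/-- The derivative `∂^k Q` of Levi's fundamental solution. -/
def leviSol {d : ℕ} (s : Fin d → ℕ) (N : ℕ) (a : (Fin d → ℕ) → (Fin d → ℝ) → ℂ)
    (Φ : ℝ → (Fin d → ℝ) → (Fin d → ℝ) → ℂ) (k : Fin d → ℕ) (t : ℝ) (x y : Fin d → ℝ) : ℂ :=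
  zker s N a k t x y + corr s N a Φ k t x y

section bounds

variable {d : ℕ} {s : Fin d → ℕ} {N : ℕ} {δ A H α θ C c γ : ℝ}

variable (hs : ∀ j, 0 < s j) (hN : ∀ j, s j < N) (hN0 : 0 < N) (hδ : 0 < δ) (hα : 0 < α)
  (hα1 : α ≤ 1) (hc : 0 ≤ c) (hC : 0 < C)

include hs hN hN0 hδ hα hα1 hc hC in
theorem exists_norm_leviSol_le_aux (hθ0 : 0 ≤ θ) (hθ : θ < α) {k : Fin d → ℕ}
    (hk0 : k = 0 → θ = 0) (hle : θ ≤ sdeg s k) (hlt : sdeg s k < N + θ) :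
    ∃ B, 0 < B ∧ ∀ a Φ, CoeffAssumptions s N δ A H α a → LeviDensity s N α θ C c γ a Φ →
      ∀ t : ℝ, 0 < t → ∀ x y, ‖corr s N a Φ k t x y‖ ≤
        B * Real.exp ((γ + 1) * t) * t ^ ((α - sdeg s k) / N) * maj s N c t (x - y) ∧
      ‖leviSol s N a Φ k t x y‖ ≤
        B * Real.exp ((γ + 2) * t) * t ^ (-(sdeg s k : ℝ) / N) * maj s N c t (x - y) := by
  have hN' : (1 : ℝ) ≤ N := by exact_mod_cast hN0
  obtain ⟨D, hD⟩ : ∃ D, D = sliceConst d C * (2 * (1 / upperExp s N θ k + 1 / ((α - θ) / N))) :=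
    ⟨_, rfl⟩
  have hu := upperExp_pos hN0 hlt
  have hv := (lowerExp_mem (N := N) hN0 hα1 hθ0 hθ).1
  have hL := sliceConst_nonneg d hC.le
  have hD0 : 0 ≤ D := by rw [hD]; positivity
  refine ⟨C + D, by positivity, fun a Φ ha hΦ t ht x y => ?_⟩
  have hk : sdeg s k ≤ 2 * N := by
    have : (sdeg s k : ℝ) ≤ (2 * N : ℕ) := by push_cast; linarith
    exact_mod_cast this
  have h1 := hΦ.frozen.kerBound hk t ht x y
  have h2 := norm_corr_le hs hN hN0 hδ hα hα1 ha hΦ hc hC.le hθ0 hθ hk0 hle hlt ht x y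
  rw [← hD] at h2
  have hm := maj_nonneg (s := s) (N := N) ht c (x - y)
  rw [show 1 - (sdeg s k : ℝ) / N - 1 = -(sdeg s k : ℝ) / N by ring] at h1
  have h3 : t ^ ((α - sdeg s k) / N) ≤ Real.exp t * t ^ (-(sdeg s k : ℝ) / N) := by
    have e : (α - sdeg s k) / N = α / N + -(sdeg s k : ℝ) / N := by ring
    have h4 : α / N ≤ 1 := (div_le_one (by linarith)).2 (by linarith)
    have h5 : 0 ≤ α / N := by positivity
    exact rpow_le_exp_mul_rpow ht (by rw [e]; linarith) (by rw [e]; linarith)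
  have h4 : 0 ≤ t ^ ((α - sdeg s k) / N) := Real.rpow_nonneg ht.le _
  have h5 : 0 ≤ t ^ (-(sdeg s k : ℝ) / N) := Real.rpow_nonneg ht.le _
  have h6 : Real.exp (γ * t) ≤ Real.exp ((γ + 2) * t) :=
    Real.exp_le_exp.2 (mul_le_mul_of_nonneg_right (by linarith) ht.le)
  have h7 : Real.exp ((γ + 1) * t) * Real.exp t = Real.exp ((γ + 2) * t) := by
    rw [exp_mul_exp_self]; congr 1; ring
  constructor
  · refine h2.trans ?_
    gcongr
    linarith
  · unfold leviSol
    refine (norm_add_le _ _).trans ?_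
    calc _ ≤ C * Real.exp ((γ + 2) * t) * t ^ (-(sdeg s k : ℝ) / N) * maj s N c t (x - y) +
          D * Real.exp ((γ + 1) * t) * (Real.exp t * t ^ (-(sdeg s k : ℝ) / N)) *
          maj s N c t (x - y) := by
          refine add_le_add (h1.trans ?_) (h2.trans ?_)
          · gcongr
          · gcongr
      _ = _ := by rw [← h7]; ring

include hs hN hN0 hδ hα hα1 hc hC in
-- The constant is chosen before the coefficients and the density. As for continuity, `k = 0` is
-- treated with `θ = 0` and the other multi-indices with the given `θ`.
theorem exists_norm_leviSol_le (hθ0 : 0 < θ) (hθ : θ < α) {k : Fin d → ℕ} (hk : sdeg s k ≤ N) :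
    ∃ B, 0 < B ∧ ∀ a Φ, CoeffAssumptions s N δ A H α a → LeviDensity s N α θ C c γ a Φ →
      ∀ t : ℝ, 0 < t → ∀ x y, ‖corr s N a Φ k t x y‖ ≤
        B * Real.exp ((γ + 1) * t) * t ^ ((α - sdeg s k) / N) * maj s N c t (x - y) ∧
      ‖leviSol s N a Φ k t x y‖ ≤
        B * Real.exp ((γ + 2) * t) * t ^ (-(sdeg s k : ℝ) / N) * maj s N c t (x - y) := by
  have hN' : (1 : ℝ) ≤ N := by exact_mod_cast hN0
  have hk' : (sdeg s k : ℝ) ≤ N := by exact_mod_cast hk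
  rcases eq_or_ne k 0 with rfl | h
  · obtain ⟨B, hB, h⟩ := exists_norm_leviSol_le_aux (θ := 0) (A := A) (H := H) (γ := γ) hs hN hN0 hδ
      hα hα1 hc hC le_rfl hα (k := 0) (fun _ => rfl) (by positivity)
      (by rw [sdeg_zero]; push_cast; linarith)
    exact ⟨B, hB, fun a Φ ha hΦ => h a Φ ha hΦ.zero⟩
  · have h1 : (1 : ℝ) ≤ sdeg s k := by exact_mod_cast one_le_sdeg hs h
    exact exists_norm_leviSol_le_aux hs hN hN0 hδ hα hα1 hc hC hθ0.le hθ (fun h' => absurd h' h)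
      (by linarith) (by linarith)

include hs hN hN0 hδ hα hα1 hc hC in
theorem exists_norm_leviSol_sub_le (hθ0 : 0 ≤ θ) (hθ : θ < α) {k : Fin d → ℕ} {β : ℝ}
    (hk : sdeg s k ≤ N) (hk0 : k = 0 → θ = 0) (hβ0 : 0 ≤ β) (hβ1 : β ≤ 1)
    (hle : θ ≤ sdeg s k) (hlt : sdeg s k + β < N + θ) :
    ∃ B, 0 < B ∧ ∀ a Φ, CoeffAssumptions s N δ A H α a → LeviDensity s N α θ C c γ a Φ →
      ∀ t : ℝ, 0 < t → ∀ x x' y, ‖leviSol s N a Φ k t x y - leviSol s N a Φ k t x' y‖ ≤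
        B * Real.exp ((γ + 2) * t) * snorm s (x - x') ^ β * (t ^ ((-(sdeg s k : ℝ) - β) / N) *
        (maj s N (c * 2⁻¹ ^ N) t (x - y) + maj s N (c * 2⁻¹ ^ N) t (x' - y))) := by
  have hN' : (1 : ℝ) ≤ N := by exact_mod_cast hN0
  obtain ⟨D, hD⟩ : ∃ D, D = ((d + 1) * (3 ^ d * Real.exp (c * d)) * sliceConst d C) *
    (2 * (1 / upperExp s N (θ - β) k + 1 / ((α - θ) / N))) := ⟨_, rfl⟩
  have hu : 0 < upperExp s N (θ - β) k := upperExp_pos hN0 (by linarith)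
  have hv := (lowerExp_mem (N := N) hN0 hα1 hθ0 hθ).1
  have hL := sliceConst_nonneg d hC.le
  have hD0 : 0 ≤ D := by rw [hD]; positivity
  refine ⟨C + D, by positivity, fun a Φ ha hΦ t ht x x' y => ?_⟩
  have h1 := hΦ.frozen.holder k hk β hβ0 hβ1 t ht y (x - y) (x' - y)
  rw [sub_sub_sub_cancel_right] at h1
  have h2 := norm_corr_sub_le hs hN hN0 hδ hα hα1 ha hΦ hc hC.le hθ0 hθ hk hk0 hβ0 hβ1 hle hlt ht
    x x' y
  rw [← hD] at h2
  have hc2 : c * 2⁻¹ ^ N ≤ c := mul_le_of_le_one_right hc (pow_le_one₀ (by norm_num) (by norm_num))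
  have hm := maj_mono (s := s) (N := N) hc2 ht (x - y)
  have hm' := maj_mono (s := s) (N := N) hc2 ht (x' - y)
  have hp := maj_nonneg (s := s) (N := N) ht (c * 2⁻¹ ^ N) (x - y)
  have hp' := maj_nonneg (s := s) (N := N) ht (c * 2⁻¹ ^ N) (x' - y)
  have hr0 : 0 ≤ snorm s (x - x') ^ β := Real.rpow_nonneg (snorm_nonneg _) _
  have h3 : t ^ ((α - (sdeg s k + β)) / N) ≤ Real.exp t * t ^ ((-(sdeg s k : ℝ) - β) / N) := by
    have e : (α - (sdeg s k + β)) / N = α / N + (-(sdeg s k : ℝ) - β) / N := by ring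
    have h4 : α / N ≤ 1 := (div_le_one (by linarith)).2 (by linarith)
    have h5 : 0 ≤ α / N := by positivity
    exact rpow_le_exp_mul_rpow ht (by rw [e]; linarith) (by rw [e]; linarith)
  have h5 : 0 ≤ t ^ ((-(sdeg s k : ℝ) - β) / N) := Real.rpow_nonneg ht.le _
  have h6 : Real.exp (γ * t) ≤ Real.exp ((γ + 2) * t) :=
    Real.exp_le_exp.2 (mul_le_mul_of_nonneg_right (by linarith) ht.le)
  have h7 : Real.exp ((γ + 1) * t) * Real.exp t = Real.exp ((γ + 2) * t) := by
    rw [exp_mul_exp_self]; congr 1; ring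
  rw [show (-β - (sdeg s k : ℝ)) / N = (-(sdeg s k : ℝ) - β) / N by ring] at h1
  unfold leviSol
  rw [add_sub_add_comm]
  refine (norm_add_le _ _).trans ?_
  calc _ ≤ C * Real.exp ((γ + 2) * t) * t ^ ((-(sdeg s k : ℝ) - β) / N) * snorm s (x - x') ^ β *
        (maj s N (c * 2⁻¹ ^ N) t (x - y) + maj s N (c * 2⁻¹ ^ N) t (x' - y)) +
        D * snorm s (x - x') ^ β * Real.exp ((γ + 1) * t) *
        (Real.exp t * t ^ ((-(sdeg s k : ℝ) - β) / N)) *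
        (maj s N (c * 2⁻¹ ^ N) t (x - y) + maj s N (c * 2⁻¹ ^ N) t (x' - y)) := by
        refine add_le_add (h1.trans ?_) (h2.trans ?_)
        · have h8 := add_nonneg (maj_nonneg (s := s) (N := N) ht c (x - y))
            (maj_nonneg (s := s) (N := N) ht c (x' - y))
          gcongr
        · gcongr
    _ = _ := by rw [← h7]; ring

end bounds

section solution

variable {d : ℕ} {s : Fin d → ℕ} {N : ℕ} {δ A H α θ C c γ : ℝ}
  {a : (Fin d → ℕ) → (Fin d → ℝ) → ℂ} {Φ : ℝ → (Fin d → ℝ) → (Fin d → ℝ) → ℂ}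

variable (hs : ∀ j, 0 < s j) (hN : ∀ j, s j < N) (hN0 : 0 < N) (hδ : 0 < δ) (hα : 0 < α)
  (hα1 : α ≤ 1) (ha : CoeffAssumptions s N δ A H α a) (hΦ : LeviDensity s N α θ C c γ a Φ)
  (hc : 0 ≤ c) (hC : 0 < C) (hθ0 : 0 < θ) (hθ : θ < α)

include hs hN hN0 hδ hα hα1 ha hΦ hc hC hθ0 hθ

theorem hasLineDerivAt_leviSol {k : Fin d → ℕ} {j : Fin d}
    (hk : sdeg s (k + Pi.single j 1) ≤ N) {t : ℝ} (ht : 0 < t) (x y : Fin d → ℝ) :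
    HasLineDerivAt ℝ (fun x => leviSol s N a Φ k t x y) (leviSol s N a Φ (k + Pi.single j 1) t x y)
      x (Pi.single j 1) := by
  have h1 := hasLineDerivAt_zker hs hN hN0 hδ ha k j ht x y
  have h2 := hasLineDerivAt_corr_of_le hs hN hN0 hδ hα hα1 ha hΦ hc hC.le hθ0 hθ hk ht x y
  unfold HasLineDerivAt at h1 h2 ⊢
  exact h1.add h2

theorem continuousAt_leviSol {k : Fin d → ℕ} (hk : sdeg s k ≤ N) {t : ℝ} (ht : 0 < t)
    (x y : Fin d → ℝ) :
    ContinuousAt (fun q : ℝ × (Fin d → ℝ) => leviSol s N a Φ k q.1 q.2 y) (t, x) :=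
  (continuousAt_zker hs hN hN0 hδ ha k ht x y).add
    (continuousAt_corr_of_le hs hN hN0 hδ hα hα1 ha hΦ hc hC.le hθ0 hθ hk ht x y)

theorem mderiv_leviSol {k : Fin d → ℕ} (hk : sdeg s k ≤ N) {t : ℝ} (ht : 0 < t) (y : Fin d → ℝ) :
    mderiv k (fun x => leviSol s N a Φ 0 t x y) = fun x => leviSol s N a Φ k t x y :=
  mderiv_eq (G := fun k x => leviSol s N a Φ k t x y)
    (fun _ _ h x => hasLineDerivAt_leviSol hs hN hN0 hδ hα hα1 ha hΦ hc hC hθ0 hθ h ht x y) hk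

/-- The frozen kernel solves the equation with coefficients at `y`; adding Levi's kernel, which
comes from the correction, moves them to `x`. -/
theorem hasDerivAt_leviSol (hγ : 0 ≤ γ) {t : ℝ} (ht : 0 < t) (x y : Fin d → ℝ) :
    HasDerivAt (fun t => leviSol s N a Φ 0 t x y)
      (∑ l ∈ multiIndices s N, a l x * leviSol s N a Φ l t x y) t := by
  have h := (hasDerivAt_zker_zero hs hN hN0 hδ ha ht x y).add
    (hasDerivAt_corr hs hN hN0 hδ hα hα1 ha hΦ hc hC.le hθ0 hθ hγ ht x y)
  have e : (∑ l ∈ multiIndices s N, a l x * leviSol s N a Φ l t x y) =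
      (∑ l ∈ multiIndices s N, a l y * zker s N a l t x y) + (leviKer s N a t x y +
        ∑ l ∈ multiIndices s N, a l x * corr s N a Φ l t x y) := by
    unfold leviKer
    rw [← Finset.sum_add_distrib, ← Finset.sum_add_distrib]
    refine Finset.sum_congr rfl fun l _ => ?_
    simp only [leviSol, zker]
    ring
  rw [e]
  exact h

theorem isCs_leviSol {t : ℝ} (ht : 0 < t) (y : Fin d → ℝ) :
    IsCs s N (fun x => leviSol s N a Φ 0 t x y) := by
  have hm := fun {k : Fin d → ℕ} (hk : sdeg s k ≤ N) =>
    mderiv_leviSol hs hN hN0 hδ hα hα1 ha hΦ hc hC hθ0 hθ hk ht y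
  refine ⟨fun k j hk x => ?_, fun k hk => ?_, fun k hk => ?_⟩
  · rw [hm hk, hm (by rw [sdeg_add] at hk; omega)]
    exact hasLineDerivAt_leviSol hs hN hN0 hδ hα hα1 ha hΦ hc hC hθ0 hθ hk ht x y
  · rw [hm hk]
    refine continuous_iff_continuousAt.2 fun x => ?_
    have hpair : ContinuousAt (fun x : Fin d → ℝ => (t, x)) x := by fun_prop
    exact ContinuousAt.comp (f := fun x : Fin d → ℝ => (t, x))
      (continuousAt_leviSol hs hN hN0 hδ hα hα1 ha hΦ hc hC hθ0 hθ hk ht x y) hpair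
  · obtain ⟨B, hB, h⟩ := exists_norm_leviSol_le (A := A) (H := H) (γ := γ) hs hN hN0 hδ hα hα1 hc hC
      hθ0 hθ hk
    refine ⟨B * Real.exp ((γ + 2) * t) * t ^ (-(sdeg s k : ℝ) / N) *
      t ^ (-(scalingSize s : ℝ) / N), fun x => ?_⟩
    rw [hm hk]
    exact (h a Φ ha hΦ t ht x y).2.trans (mul_le_mul_of_nonneg_left (maj_le_rpow hc ht _)
      (by positivity))

theorem contDiffOn_leviSol (hγ : 0 ≤ γ) (x y : Fin d → ℝ) :
    ContDiffOn ℝ 1 (fun t => leviSol s N a Φ 0 t x y) (Ioi 0) := by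
  have hd := fun {t : ℝ} (ht : 0 < t) =>
    hasDerivAt_leviSol hs hN hN0 hδ hα hα1 ha hΦ hc hC hθ0 hθ hγ ht x y
  rw [show (1 : WithTop ℕ∞) = 0 + 1 by rw [zero_add], contDiffOn_succ_iff_deriv_of_isOpen isOpen_Ioi]
  refine ⟨fun t ht => (hd ht).differentiableAt.differentiableWithinAt, by simp, ?_⟩
  rw [contDiffOn_zero]
  have hcont : ContinuousOn (fun t => ∑ l ∈ multiIndices s N, a l x * leviSol s N a Φ l t x y)
      (Ioi 0) := by
    intro t ht
    refine ContinuousAt.continuousWithinAt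
      (tendsto_finsetSum _ fun l hl => ContinuousAt.mul continuousAt_const ?_)
    have hpair : ContinuousAt (fun t : ℝ => (t, x)) t := by fun_prop
    exact ContinuousAt.comp (f := fun t : ℝ => (t, x))
      (continuousAt_leviSol hs hN hN0 hδ hα hα1 ha hΦ hc hC hθ0 hθ ((mem_multiIndices hs).1 hl)
        (mem_Ioi.1 ht) x y) hpair
  exact hcont.congr fun t ht => (hd ht).deriv

theorem integrable_leviSol {t : ℝ} (ht : 0 < t) (x : Fin d → ℝ) :
    Integrable fun y => leviSol s N a Φ 0 t x y := by
  obtain ⟨B, hB, h⟩ := exists_norm_leviSol_le (A := A) (H := H) (γ := γ) hs hN hN0 hδ hα hα1 hc hC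
    hθ0 hθ (k := 0) (by rw [sdeg_zero]; omega)
  have hz := kerMeas_zker hΦ.meas_coeff (0 : Fin d → ℕ)
  exact integrable_of_le_maj hs hN hc ht
    ((hz.section_right t x).add ((hz.volterra hΦ.meas).section_right t x))
    (fun y => (h a Φ ha hΦ t ht x y).2)

theorem tendsto_integral_corr_mul {f : (Fin d → ℝ) → ℂ} {F : ℝ} (hF : ∀ z, ‖f z‖ ≤ F)
    (x : Fin d → ℝ) :
    Tendsto (fun t => ∫ y, corr s N a Φ 0 t x y * f y) (𝓝[>] 0) (𝓝 0) := by
  have hN' : (0 : ℝ) < N := by exact_mod_cast hN0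
  obtain ⟨B, hB, h⟩ := exists_norm_leviSol_le (A := A) (H := H) (γ := γ) hs hN hN0 hδ hα hα1 hc hC
    hθ0 hθ (k := 0) (by rw [sdeg_zero]; omega)
  have hF0 : 0 ≤ F := (norm_nonneg _).trans (hF x)
  have h2 : Tendsto (fun t : ℝ => B * Real.exp ((γ + 1) * t) * t ^ (α / N) * F * Real.pi ^ d)
      (𝓝[>] 0) (𝓝 0) := by
    have hcont : Continuous fun t : ℝ =>
        B * Real.exp ((γ + 1) * t) * t ^ (α / N) * F * Real.pi ^ d :=
      (((continuous_const.mul (by fun_prop)).mul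
        (continuous_id.rpow_const fun _ => Or.inr (by positivity))).mul continuous_const).mul
        continuous_const
    have := hcont.tendsto 0
    rw [Real.zero_rpow (by positivity), mul_zero, zero_mul, zero_mul] at this
    exact this.mono_left nhdsWithin_le_nhds
  refine squeeze_zero_norm' ?_ h2
  filter_upwards [self_mem_nhdsWithin] with t ht
  have ht : 0 < t := ht
  calc _ ≤ ∫ y, B * Real.exp ((γ + 1) * t) * t ^ (α / N) * F * maj s N c t (x - y) := by
        refine norm_integral_le_of_norm_le
          (((integrable_maj hs hN hc ht).comp_sub_left x).const_mul _)
          (Eventually.of_forall fun y => ?_)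
        have h1 := (h a Φ ha hΦ t ht x y).1
        rw [sdeg_zero, Nat.cast_zero, sub_zero] at h1
        rw [norm_mul]
        refine (mul_le_mul h1 (hF y) (norm_nonneg _) ((norm_nonneg _).trans h1)).trans
          (le_of_eq (by ring))
    _ ≤ _ := by
        rw [integral_const_mul]
        exact mul_le_mul_of_nonneg_left (integral_maj_sub_le hc ht x) (by positivity)

theorem tendsto_integral_leviSol_mul (f : BoundedContinuousFunction (Fin d → ℝ) ℂ)
    (x : Fin d → ℝ) :
    Tendsto (fun t => ∫ y, leviSol s N a Φ 0 t x y * f y) (𝓝[>] 0) (𝓝 (f x)) := by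
  have h1 := tendsto_integral_zker_zero_mul hs hN hN0 hδ hα ha hΦ.frozen hc hC.le (f := f)
    (F := ‖f‖) (x := x) f.continuous.measurable f.norm_coe_le_norm f.continuous.continuousAt
  have h2 := tendsto_integral_corr_mul hs hN hN0 hδ hα hα1 ha hΦ hc hC hθ0 hθ f.norm_coe_le_norm x
  have h3 := h1.add h2
  rw [add_zero] at h3
  refine h3.congr' ?_
  filter_upwards [self_mem_nhdsWithin] with t ht
  have ht : 0 < t := ht
  have hi := integrable_leviSol hs hN hN0 hδ hα hα1 ha hΦ hc hC hθ0 hθ ht x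
  have hz : Integrable (fun y => zker s N a 0 t x y) :=
    integrable_of_le_maj hs hN hc ht ((kerMeas_zker hΦ.meas_coeff 0).section_right t x)
      (fun y => hΦ.frozen.kerBound (by rw [sdeg_zero]; omega) t ht x y)
  have hv : Integrable (fun y => corr s N a Φ 0 t x y) := by
    refine (hi.sub hz).congr (Eventually.of_forall fun y => ?_)
    simp only [Pi.sub_apply, leviSol, add_sub_cancel_left]
  have hfm := f.continuous.aestronglyMeasurable (μ := volume)
  rw [← integral_add (hz.mul_bdd hfm (Eventually.of_forall f.norm_coe_le_norm))
    (hv.mul_bdd hfm (Eventually.of_forall f.norm_coe_le_norm))]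
  simp only [leviSol, add_mul]

theorem isFundamentalSolution_leviSol (hγ : 0 ≤ γ) :
    IsFundamentalSolution s N a (leviSol s N a Φ 0) where
  space_regular y t ht := isCs_leviSol hs hN hN0 hδ hα hα1 ha hΦ hc hC hθ0 hθ ht y
  joint_continuous y k hk := by
    refine ContinuousOn.congr (f := fun q : ℝ × (Fin d → ℝ) => leviSol s N a Φ k q.1 q.2 y)
      (fun q hq => (continuousAt_leviSol hs hN hN0 hδ hα hα1 ha hΦ hc hC hθ0 hθ hk hq.1 q.2
        y).continuousWithinAt) fun q hq => ?_
    exact congrFun (mderiv_leviSol hs hN hN0 hδ hα hα1 ha hΦ hc hC hθ0 hθ hk hq.1 y) q.2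
  time_regular y x := contDiffOn_leviSol hs hN hN0 hδ hα hα1 ha hΦ hc hC hθ0 hθ hγ x y
  equation y t ht x := by
    rw [(hasDerivAt_leviSol hs hN hN0 hδ hα hα1 ha hΦ hc hC hθ0 hθ hγ ht x y).deriv, sub_eq_zero]
    refine Finset.sum_congr rfl fun l hl => ?_
    rw [mderiv_leviSol hs hN hN0 hδ hα hα1 ha hΦ hc hC hθ0 hθ ((mem_multiIndices hs).1 hl) ht y]
  integrable t ht x := integrable_leviSol hs hN hN0 hδ hα hα1 ha hΦ hc hC hθ0 hθ ht x
  initial f x := tendsto_integral_leviSol_mul hs hN hN0 hδ hα hα1 ha hΦ hc hC hθ0 hθ f x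

end solution

/-! ### The estimates with constants uniform in the coefficients -/

section estimates

variable {d : ℕ} {s : Fin d → ℕ} {N : ℕ} {δ α : ℝ}

variable (hs : ∀ j, 0 < s j) (hN : ∀ j, s j < N) (hN0 : 0 < N) (A H : ℝ) (hδ : 0 < δ)
  (hα : 0 < α) (hα1 : α < 1)

include hs hN hN0 hδ hα hα1

theorem exists_norm_mderiv_le (k : Fin d → ℕ) (hk : sdeg s k ≤ N) :
    ∃ C c γ : ℝ, 0 < C ∧ 0 < c ∧ 0 < γ ∧ ∀ a, CoeffAssumptions s N δ A H α a →
      ∀ t > 0, ∀ x y,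
        ‖mderiv k (fun x' => leviSol s N a (resolvent (leviKer s N a)) 0 t x' y) x‖ ≤
          C * Real.exp (γ * t) * gaussKernel s N c (-(sdeg s k : ℝ)) t (x - y) := by
  obtain ⟨C, c, γ, hC, hc, hγ, hΦ⟩ := exists_leviDensity (θ := α / 2) hs hN hN0 A H hδ hα hα1
    (by positivity) (by linarith)
  obtain ⟨B, hB, h⟩ := exists_norm_leviSol_le (A := A) (H := H) (γ := γ) (θ := α / 2) hs hN hN0 hδ
    hα hα1.le hc.le hC (by positivity) (by linarith) hk
  refine ⟨B, c, γ + 2, hB, hc, by positivity, fun a ha t ht x y => ?_⟩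
  rw [mderiv_leviSol hs hN hN0 hδ hα hα1.le ha (hΦ a ha) hc.le hC (by positivity) (by linarith)
    hk ht y]
  refine ((h a _ ha (hΦ a ha) t ht x y).2).trans ?_
  rw [mul_assoc]
  exact mul_le_mul_of_nonneg_left (rpow_mul_maj_le_gaussKernel ht _ _) (by positivity)

/-- The time derivative is replaced by `P Q` through the equation, and each power `t ^ (-sdeg s l /
N)` is raised to `t ^ (-1)` at the cost of `exp t`. -/
theorem exists_norm_deriv_le :
    ∃ C c γ : ℝ, 0 < C ∧ 0 < c ∧ 0 < γ ∧ ∀ a, CoeffAssumptions s N δ A H α a →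
      ∀ t > 0, ∀ x y,
        ‖deriv (fun τ => leviSol s N a (resolvent (leviKer s N a)) 0 τ x y) t‖ ≤
          C * Real.exp (γ * t) * gaussKernel s N c (-(N : ℝ)) t (x - y) := by
  have hN' : (0 : ℝ) < N := by exact_mod_cast hN0
  obtain ⟨C, c, γ, hC, hc, hγ, hΦ⟩ := exists_leviDensity (θ := α / 2) hs hN hN0 A H hδ hα hα1
    (by positivity) (by linarith)
  -- A constant for every multi-index, with the dummy value one above degree `N`, so that a choice
  -- function exists on all of them.
  have hB : ∀ l : Fin d → ℕ, ∃ B, 0 < B ∧ (sdeg s l ≤ N → ∀ a Φ,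
      CoeffAssumptions s N δ A H α a → LeviDensity s N α (α / 2) C c γ a Φ →
      ∀ t : ℝ, 0 < t → ∀ x y, ‖leviSol s N a Φ l t x y‖ ≤
        B * Real.exp ((γ + 2) * t) * t ^ (-(sdeg s l : ℝ) / N) * maj s N c t (x - y)) := by
    intro l
    by_cases hl : sdeg s l ≤ N
    · obtain ⟨B, hB, h⟩ := exists_norm_leviSol_le (A := A) (H := H) (γ := γ) (θ := α / 2) hs hN hN0
        hδ hα hα1.le hc.le hC (by positivity) (by linarith) hl
      exact ⟨B, hB, fun _ a Φ ha hΦ t ht x y => (h a Φ ha hΦ t ht x y).2⟩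
    · exact ⟨1, one_pos, fun h => absurd h hl⟩
  choose B hB0 hB using hB
  have hsum : 0 ≤ ∑ l ∈ multiIndices s N, C * B l :=
    Finset.sum_nonneg fun l _ => mul_nonneg hC.le (hB0 l).le
  refine ⟨(∑ l ∈ multiIndices s N, C * B l) + 1, c, γ + 3, by positivity, hc, by positivity,
    fun a ha t ht x y => ?_⟩
  rw [(hasDerivAt_leviSol hs hN hN0 hδ hα hα1.le ha (hΦ a ha) hc.le hC (by positivity)
    (by linarith) hγ.le ht x y).deriv]
  have hm := maj_nonneg (s := s) (N := N) ht c (x - y)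
  have e : Real.exp ((γ + 3) * t) = Real.exp ((γ + 2) * t) * Real.exp t := by
    rw [exp_mul_exp_self]; congr 1; ring
  have h1 : ‖∑ l ∈ multiIndices s N, a l x *
      leviSol s N a (resolvent (leviKer s N a)) l t x y‖ ≤
      ∑ l ∈ multiIndices s N, C * B l *
        (Real.exp ((γ + 3) * t) * (t ^ (-(N : ℝ) / N) * maj s N c t (x - y))) := by
    refine norm_sum_le_of_le _ fun l hl => ?_
    have hl' := (mem_multiIndices hs).1 hl
    have hlN : (sdeg s l : ℝ) ≤ N := by exact_mod_cast hl'
    have h2 : t ^ (-(sdeg s l : ℝ) / N) ≤ Real.exp t * t ^ (-(N : ℝ) / N) := by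
      have h3 : (sdeg s l : ℝ) / N ≤ 1 := (div_le_one hN').2 hlN
      have h4 : 0 ≤ (sdeg s l : ℝ) / N := by positivity
      have e1 : -(N : ℝ) / N = -1 := by rw [neg_div, div_self hN'.ne']
      exact rpow_le_exp_mul_rpow ht (by rw [e1, neg_div]; linarith)
        (by rw [e1, neg_div]; linarith)
    have hBl := (hB0 l).le
    rw [norm_mul]
    calc _ ≤ C * (B l * Real.exp ((γ + 2) * t) * t ^ (-(sdeg s l : ℝ) / N) *
          maj s N c t (x - y)) :=
          mul_le_mul ((hΦ a ha).frozen.coeff l hl x) (hB l hl' a _ ha (hΦ a ha) t ht x y)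
            (norm_nonneg _) hC.le
      _ ≤ C * (B l * Real.exp ((γ + 2) * t) * (Real.exp t * t ^ (-(N : ℝ) / N)) *
          maj s N c t (x - y)) := by gcongr
      _ = _ := by rw [e]; ring
  rw [← Finset.sum_mul] at h1
  have h2 := rpow_mul_maj_le_gaussKernel (s := s) (N := N) (c := c) ht (-(N : ℝ)) (x - y)
  have h3 : 0 ≤ t ^ (-(N : ℝ) / N) * maj s N c t (x - y) :=
    mul_nonneg (Real.rpow_nonneg ht.le _) hm
  calc _ ≤ _ := h1
    _ = (∑ l ∈ multiIndices s N, C * B l) * Real.exp ((γ + 3) * t) *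
        (t ^ (-(N : ℝ) / N) * maj s N c t (x - y)) := by ring
    _ ≤ ((∑ l ∈ multiIndices s N, C * B l) + 1) * Real.exp ((γ + 3) * t) *
        gaussKernel s N c (-(N : ℝ)) t (x - y) := by
        gcongr
        linarith

theorem exists_norm_iteratedDeriv_le (k : Fin d → ℕ) (n : ℕ) (hkn : sdeg s k + N * n ≤ N) :
    ∃ C c γ : ℝ, 0 < C ∧ 0 < c ∧ 0 < γ ∧ ∀ a, CoeffAssumptions s N δ A H α a →
      ∀ t > 0, ∀ x y,
        ‖iteratedDeriv n (fun τ => mderiv k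
          (fun x' => leviSol s N a (resolvent (leviKer s N a)) 0 τ x' y) x) t‖ ≤
          C * Real.exp (γ * t) *
            gaussKernel s N c (-(sdeg s k : ℝ) - (N : ℝ) * n) t (x - y) := by
  -- The constraint on the total degree leaves only `n = 0`, or `n = 1` together with `k = 0`.
  rcases Nat.lt_or_ge n 1 with h | h
  · obtain rfl : n = 0 := by omega
    obtain ⟨C, c, γ, hC, hc, hγ, h⟩ := exists_norm_mderiv_le hs hN hN0 A H hδ hα hα1 k (by omega)
    refine ⟨C, c, γ, hC, hc, hγ, fun a ha t ht x y => ?_⟩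
    rw [iteratedDeriv_zero, Nat.cast_zero, mul_zero, sub_zero]
    exact h a ha t ht x y
  · have h1 : N * 1 ≤ N * n := Nat.mul_le_mul_left N h
    have hn : n = 1 := by
      have h2 : N * n ≤ N * 1 := by omega
      exact le_antisymm (Nat.le_of_mul_le_mul_left h2 hN0) h
    subst hn
    have hk : k = 0 := by
      by_contra hk
      have := one_le_sdeg hs hk
      omega
    subst hk
    obtain ⟨C, c, γ, hC, hc, hγ, h⟩ := exists_norm_deriv_le hs hN hN0 A H hδ hα hα1
    refine ⟨C, c, γ, hC, hc, hγ, fun a ha t ht x y => ?_⟩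
    simp only [iteratedDeriv_one, mderiv_zero, sdeg_zero, Nat.cast_zero, Nat.cast_one, neg_zero,
      zero_sub, mul_one]
    exact h a ha t ht x y

theorem exists_norm_mderiv_sub_le (k : Fin d → ℕ) {β : ℝ} (hk : sdeg s k ≤ N)
    (hβ : β ∈ Ioo (0 : ℝ) 1) (hkβ : sdeg s k = N → β < α) :
    ∃ C c γ : ℝ, 0 < C ∧ 0 < c ∧ 0 < γ ∧ ∀ a, CoeffAssumptions s N δ A H α a →
      ∀ t > 0, ∀ x x' y,
        ‖mderiv k (fun z => leviSol s N a (resolvent (leviKer s N a)) 0 t z y) x -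
          mderiv k (fun z => leviSol s N a (resolvent (leviKer s N a)) 0 t z y) x'‖ ≤
          C * Real.exp (γ * t) * snorm s (x - x') ^ β *
            (gaussKernel s N c (-(sdeg s k : ℝ) - β) t (x - y) +
              gaussKernel s N c (-(sdeg s k : ℝ) - β) t (x' - y)) := by
  -- These bounds, with `α / 2 > 0`, only serve to identify the iterated derivatives. The exponent
  -- of the estimate itself is chosen separately, may vanish, and concerns the same density.
  obtain ⟨C₀, c₀, γ₀, hC₀, hc₀, hγ₀, hΦ₀⟩ := exists_leviDensity (θ := α / 2) hs hN hN0 A H hδ hα hα1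
    (by positivity) (by linarith)
  -- At top degree `θ` must lie strictly between `β` and `α`. Below it the degree is at most `N -
  -- 1`, so `β < 1` leaves room for `θ = 0`, which also covers `k = 0`.
  obtain ⟨θ, hθ0, hθ, hk0, hle, hlt⟩ : ∃ θ, 0 ≤ θ ∧ θ < α ∧ (k = 0 → θ = 0) ∧
      θ ≤ sdeg s k ∧ sdeg s k + β < N + θ := by
    rcases eq_or_ne (sdeg s k) N with h | h
    · have hβα := hkβ h
      have hN' : (1 : ℝ) ≤ N := by exact_mod_cast hN0
      refine ⟨(α + β) / 2, by linarith [hβ.1], by linarith, fun h0 => ?_, ?_, ?_⟩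
      · rw [h0, sdeg_zero] at h; omega
      · rw [h]; linarith
      · rw [h]; linarith
    · have h1 : (sdeg s k : ℝ) + 1 ≤ N := by exact_mod_cast lt_of_le_of_ne hk h
      exact ⟨0, le_rfl, hα, fun _ => rfl, by positivity, by linarith [hβ.2]⟩
  obtain ⟨C, c, γ, hC, hc, hγ, hΦ⟩ := exists_leviDensity (θ := θ) hs hN hN0 A H hδ hα hα1 hθ0 hθ
  obtain ⟨B, hB, h⟩ := exists_norm_leviSol_sub_le (A := A) (H := H) (γ := γ) (θ := θ) hs hN hN0 hδ
    hα hα1.le hc.le hC hθ0 hθ hk hk0 hβ.1.le hβ.2.le hle hlt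
  refine ⟨B, c * 2⁻¹ ^ N, γ + 2, hB, by positivity, by positivity, fun a ha t ht x x' y => ?_⟩
  rw [mderiv_leviSol hs hN hN0 hδ hα hα1.le ha (hΦ₀ a ha) hc₀.le hC₀ (by positivity) (by linarith)
    hk ht y]
  refine (h a _ ha (hΦ a ha) t ht x x' y).trans ?_
  have hr0 : 0 ≤ snorm s (x - x') ^ β := Real.rpow_nonneg (snorm_nonneg _) _
  rw [mul_add (t ^ _)]
  exact mul_le_mul_of_nonneg_left (add_le_add (rpow_mul_maj_le_gaussKernel ht _ _)
    (rpow_mul_maj_le_gaussKernel ht _ _)) (by positivity)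

end estimates

end AnisotropicParabolic

end

/-! ### Choice of the constants and conclusion -/

theorem mainTheorem8 {d : ℕ} (hd : 0 < d) (s : Fin d → ℕ) (hs : ∀ j, 0 < s j)
    (N : ℕ) (hN : ∀ j, s j < N) (δ A H α : ℝ) (hδ : 0 < δ) (hα : α ∈ Set.Ioo (0 : ℝ) 1) :
    ∃ (C c γ : (Fin d → ℕ) → ℕ → ℝ) (C' c' γ' : (Fin d → ℕ) → ℝ → ℝ),
      (∀ k n, 0 < C k n ∧ 0 < c k n ∧ 0 < γ k n) ∧
      (∀ k β, 0 < C' k β ∧ 0 < c' k β ∧ 0 < γ' k β) ∧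
      ∀ a : (Fin d → ℕ) → (Fin d → ℝ) → ℂ, CoeffAssumptions s N δ A H α a →
        ∃ Q : ℝ → (Fin d → ℝ) → (Fin d → ℝ) → ℂ,
          IsFundamentalSolution s N a Q ∧
          (∀ (k : Fin d → ℕ) (n : ℕ), sdeg s k + N * n ≤ N →
            ∀ t > 0, ∀ x y : Fin d → ℝ,
              ‖iteratedDeriv n (fun τ => mderiv k (fun x' => Q τ x' y) x) t‖ ≤
                C k n * Real.exp (γ k n * t) *
                  gaussKernel s N (c k n) (-(sdeg s k : ℝ) - (N : ℝ) * n) t (x - y)) ∧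
          (∀ (k : Fin d → ℕ) (β : ℝ), sdeg s k ≤ N → β ∈ Set.Ioo (0 : ℝ) 1 →
            (sdeg s k = N → β < α) →
            ∀ t > 0, ∀ x x' y : Fin d → ℝ,
              ‖mderiv k (fun z => Q t z y) x - mderiv k (fun z => Q t z y) x'‖ ≤
                C' k β * Real.exp (γ' k β * t) * snorm s (x - x') ^ β *
                  (gaussKernel s N (c' k β) (-(sdeg s k : ℝ) - β) t (x - y) +
                    gaussKernel s N (c' k β) (-(sdeg s k : ℝ) - β) t (x' - y))) := by
  have hN0 : 0 < N := (Nat.zero_le _).trans_lt (hN ⟨0, hd⟩)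
  obtain ⟨hα0, hα1⟩ := hα
  -- The constants must be functions on all indices, fixed before the coefficients. Outside the
  -- admissible range nothing is claimed and the value one is used.
  have hderiv : ∀ (k : Fin d → ℕ) (n : ℕ), ∃ C c γ : ℝ, (0 < C ∧ 0 < c ∧ 0 < γ) ∧
      (sdeg s k + N * n ≤ N → ∀ a, CoeffAssumptions s N δ A H α a → ∀ t > 0, ∀ x y,
        ‖iteratedDeriv n (fun τ => mderiv k
          (fun x' => leviSol s N a (resolvent (leviKer s N a)) 0 τ x' y) x) t‖ ≤
          C * Real.exp (γ * t) *
            gaussKernel s N c (-(sdeg s k : ℝ) - (N : ℝ) * n) t (x - y)) := by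
    intro k n
    by_cases hkn : sdeg s k + N * n ≤ N
    · obtain ⟨C, c, γ, hC, hc, hγ, h⟩ :=
        exists_norm_iteratedDeriv_le hs hN hN0 A H hδ hα0 hα1 k n hkn
      exact ⟨C, c, γ, ⟨hC, hc, hγ⟩, fun _ => h⟩
    · exact ⟨1, 1, 1, ⟨one_pos, one_pos, one_pos⟩, fun h => absurd h hkn⟩
  have hhold : ∀ (k : Fin d → ℕ) (β : ℝ), ∃ C c γ : ℝ, (0 < C ∧ 0 < c ∧ 0 < γ) ∧
      (sdeg s k ≤ N → β ∈ Set.Ioo (0 : ℝ) 1 → (sdeg s k = N → β < α) →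
        ∀ a, CoeffAssumptions s N δ A H α a → ∀ t > 0, ∀ x x' y,
        ‖mderiv k (fun z => leviSol s N a (resolvent (leviKer s N a)) 0 t z y) x -
          mderiv k (fun z => leviSol s N a (resolvent (leviKer s N a)) 0 t z y) x'‖ ≤
          C * Real.exp (γ * t) * snorm s (x - x') ^ β *
            (gaussKernel s N c (-(sdeg s k : ℝ) - β) t (x - y) +
              gaussKernel s N c (-(sdeg s k : ℝ) - β) t (x' - y))) := by
    intro k β
    by_cases hkβ : sdeg s k ≤ N ∧ β ∈ Set.Ioo (0 : ℝ) 1 ∧ (sdeg s k = N → β < α)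
    · obtain ⟨C, c, γ, hC, hc, hγ, h⟩ :=
        exists_norm_mderiv_sub_le hs hN hN0 A H hδ hα0 hα1 k hkβ.1 hkβ.2.1 hkβ.2.2
      exact ⟨C, c, γ, ⟨hC, hc, hγ⟩, fun _ _ _ => h⟩
    · exact ⟨1, 1, 1, ⟨one_pos, one_pos, one_pos⟩, fun h1 h2 h3 => absurd ⟨h1, h2, h3⟩ hkβ⟩
  choose C c γ hpos hderiv using hderiv
  choose C' c' γ' hpos' hhold using hhold
  -- A single `Q` serves all `(k, n)` and `(k, β)`: the resolvent does not depend on the exponent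
  -- `θ`, which varied between the estimates.
  refine ⟨C, c, γ, C', c', γ', hpos, hpos', fun a ha =>
    ⟨leviSol s N a (resolvent (leviKer s N a)) 0, ?_, fun k n hkn => hderiv k n hkn a ha,
      fun k β hk hβ hkβ => hhold k β hk hβ hkβ a ha⟩⟩
  obtain ⟨C₀, c₀, γ₀, hC₀, hc₀, hγ₀, hΦ⟩ := exists_leviDensity (θ := α / 2) hs hN hN0 A H hδ hα0 hα1
    (by positivity) (by linarith)
  exact isFundamentalSolution_leviSol hs hN hN0 hδ hα0 hα1.le ha (hΦ a ha) hc₀.le hC₀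
    (by positivity) (by linarith) hγ₀.le
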